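/- **Notation.** For $h\in(0,1]$, real-valued functions $f$ on $h\mathbb Z$ carry the norm $\|f\|_{L^2(h\mathbb Z)}=(h\sum_{x\in h\mathbb Z}|f(x)|^2)^{1/2}$; $\mathcal F_hf(\xi)=h\sum_{x\in h\mathbb Z} f(x)e^{-ix\xi}$ for $\xi\in[-\frac\pi h,\frac\pi h)$ is the discrete Fourier transform (extended to $L^2$), and all operators below are Fourier multipliers on $[-\frac\pi h,\frac\pi h)$: $\nabla_h$ has symbol $\frac{2i}{h}\sin(\frac{h\xi}{2})$, $\partial_h$ has symbol $i\xi$, $e^{a\partial_h}$ has symbol $e^{ia\xi}$, $S_h^\pm(t)=e^{\mp\frac{t}{h^2}(\nabla_h-\partial_h)}$. With $\langle x\rangle=(1+x^2)^{1/2}$, put $\|f\|_{H^s(h\mathbb Z)}=\|\langle\partial_h\rangle^sf\|_{L^2(h\mathbb Z)}$ and, with $s_h(\xi)=\frac1{h^2}(\xi-\frac2h\sin(\frac{h\xi}2))$ and $\tilde u$ the space-time Fourier transform, $$\|u\|_{X^{s,b}_{h,\pm}}=\Big\{\int_{-\infty}^\infty\int_{-\pi/h}^{\pi/h}\langle\xi\rangle^{2s}\langle\tau\mp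 s_h(\xi)\rangle^{2b}|\tilde u(\tau,\xi)|^2\,d\xi\,d\tau\Big\}^{1/2}.$$ Let $V\in C^5(\mathbb R)$ with $V(0)=V'(0)=0$, $V''(0)=V'''(0)=1$. The *coupled FPU system* is $$u_h^\pm(t)=S_h^\pm(t)u_{h,0}^\pm\mp\frac14\int_0^tS_h^\pm(t-t_1)\nabla_h\Big[\big\{u_h^\pm(t_1)+e^{\pm\frac{2t_1}{h^2}\partial_h}u_h^\mp(t_1)\big\}^2+h^2e^{\pm\frac{t_1}{h^2}\partial_h}\mathcal R(t_1)\Big]dt_1,$$ where $\mathcal R$ is determined by $\frac{2}{h^4}\big(V'(h^2r)-h^2r\big)=r^2+h^2\mathcal R$ with $r(t)=e^{-\frac t{h^2}\partial_h}u_h^+(t)+e^{\frac t{h^2}\partial_h}u_h^-(t)$. The *decoupled FPU system* is $$v_h^\pm(t)=S_h^\pm(t)u_{h,0}^\pm\mp\frac14\int_0^tS_h^\pm(t-t_1)\nabla_h\{v_h^\pm(t_1)\}^2dt_1.$$ **Proposition 6.3 (Uniform bound for coupled and decoupled FPU).** Let $s\ge0$ and $\frac12<b<\frac58$, and assume that $s\le1$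 or that $V(r)=\frac{r^2}2+\frac{r^3}6$ (so that $\mathcal R=0$). Let $R>0$. Then there is $T>0$, independent of $h$ (it may depend on $s,b,V,R$), such that for every non-negative $\theta\in C_c^\infty(\mathbb R)$ vanishing outside $[-2,2]$ there is $C>0$, depending only on $s,b,V,R,T,\theta$, with the following property. For all $h\in(0,1]$ and all real-valued $u_{h,0}^\pm\in L^2(h\mathbb Z)$ with $\sum_\pm\|u_{h,0}^\pm\|_{H^s(h\mathbb Z)}\le R$, the coupled FPU system and the decoupled FPU system with initial data $(u_{h,0}^+,u_{h,0}^-)$ have unique solutions $(u_h^+,u_h^-)$ and $(v_h^+,v_h^-)$ in $C([-2T,2T];L^2(h\mathbb Z))$, and for each sign $$\big\|\theta(\tfrac tT)u_h^\pm(t)\big\|_{X^{s,b}_{h,\pm}}\le C\big(\|u_{h,0}^+\|_{H^s(h\mathbb Z)}+\|u_{h,0}^-\|_{H^s(h\mathbb Z)}\big),\qquad\big\|\theta(\tfrac tT)v_h^\pm(t)\big\|_{X^{s,b}_{h,\pm}}\le C\|u_{h,0}^\pm\|_{H^s(h\mathbb Z)}.$$ -/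

import Mathlib

open Real Set Filter Topology MeasureTheory
open scoped ENNReal ContDiff

noncomputable section

namespace FPU

/-! ### Functions and Fourier analysis on the lattice

A function on the lattice of mesh `h` is represented by its values `f n` at the points `x = h n`,
with `n : ℤ`. The space `L²` of the lattice is `LatticeL2`, with the norm
`(h ∑ |f n|²)^(1/2)`, which for fixed `h` is a multiple of the norm of `ℓ²(ℤ)`. -/

/-- Real-valued square summable functions on the lattice. -/
abbrev LatticeL2 : Type := lp (fun _ : ℤ => ℝ) 2

/-- The Japanese bracket `⟨x⟩ = (1 + |x|²)^(1/2)`. -/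
def bracket (x : ℝ) : ℝ := Real.sqrt (1 + x ^ 2)

/-- The fundamental frequency domain `[-π/h, π/h)`. -/
def freqDomain (h : ℝ) : Set ℝ := Ico (-(π / h)) (π / h)

/-- The inverse discrete Fourier transform
`(1 / 2π) ∫_{-π/h}^{π/h} F(ξ) e^{i x ξ} dξ` at the lattice point `x = h n`. -/
def invDFT (h : ℝ) (F : ℝ → ℂ) (n : ℤ) : ℂ :=
  (1 / (2 * π) : ℝ) *
    ∫ ξ in freqDomain h, F ξ * Complex.exp (Complex.I * (((h * n) * ξ : ℝ) : ℂ))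

/-- `F` is (a representative of) the discrete Fourier transform of the square summable function
`f`: it is square integrable over the frequency domain and its inverse transform is `f`. Such an
`F` exists and is unique up to null sets for each square summable `f`. -/
def IsDFT (h : ℝ) (f : ℤ → ℂ) (F : ℝ → ℂ) : Prop :=
  MemLp F 2 (volume.restrict (freqDomain h)) ∧ ∀ n, invDFT h F n = f n

theorem exists_isDFT {h : ℝ} (hh : 0 < h) {f : ℤ → ℂ} (hf : Memℓp f 2) : ∃ F, IsDFT h f F := by
  have hP : Fact (0 < 2 * π / h) := ⟨by positivity⟩
  have hf' : Memℓp (fun n : ℤ => f (-n)) 2 := by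
    rw [memℓp_gen_iff (by norm_num)] at hf ⊢
    exact (Equiv.neg ℤ).summable_iff.mpr hf
  let g : Lp ℂ 2 (@AddCircle.haarAddCircle (2 * π / h) hP) := fourierBasis.repr.symm ⟨_, hf'⟩
  have hg : ∀ n : ℤ, fourierCoeff (g : AddCircle (2 * π / h) → ℂ) n = f (-n) := fun n => by
    rw [← fourierBasis_repr]
    simp [g]
  have hset : -(π / h) + 2 * π / h = π / h := by ring
  have hmp := AddCircle.measurePreserving_mk (2 * π / h) (-(π / h))
  have hae : volume.restrict (freqDomain h) =
      volume.restrict (Ioc (-(π / h)) (-(π / h) + 2 * π / h)) := by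
    rw [hset]; exact Measure.restrict_congr_set Ico_ae_eq_Ioc
  refine ⟨fun ξ => h * g (ξ : AddCircle (2 * π / h)), ?_, fun n => ?_⟩
  · rw [hae]
    exact (((Lp.memLp g).of_haarAddCircle).comp_measurePreserving hmp).const_mul _
  · have := hg (-n)
    rw [neg_neg, fourierCoeff_eq_intervalIntegral _ _ (-(π / h)),
      intervalIntegral.integral_of_le (by rw [hset]; have : 0 < π / h := by positivity
                                          linarith), ← hae] at this
    rw [← this, invDFT, ← integral_const_mul, ← integral_smul]
    refine integral_congr_ae (Eventually.of_forall fun ξ => ?_)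
    have hc : (h : ℂ) ≠ 0 := by exact_mod_cast hh.ne'
    have hpi : (π : ℂ) ≠ 0 := by exact_mod_cast Real.pi_ne_zero
    have he : (2 * π * Complex.I * ((- -n : ℤ) : ℂ) * ξ / ((2 * π / h : ℝ) : ℂ)) =
        Complex.I * (((h * n) * ξ : ℝ) : ℂ) := by
      push_cast; field_simp
    simp only [fourier_coe_apply, smul_eq_mul, Complex.real_smul, he]
    push_cast
    field_simp

open Classical in
/-- The discrete Fourier transform `(𝓕_h f)(ξ) = h ∑_x f(x) e^{-i x ξ}` on `L²` of the lattice,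
defined up to null sets. -/
def dft (h : ℝ) (f : ℤ → ℂ) : ℝ → ℂ :=
  if H : ∃ F, IsDFT h f F then H.choose else 0

theorem dft_spec {h : ℝ} (hh : 0 < h) {f : ℤ → ℂ} (hf : Memℓp f 2) : IsDFT h f (dft h f) := by
  have H := exists_isDFT hh hf
  rw [dft, dif_pos H]
  exact H.choose_spec

/-- The Fourier multiplier operator with symbol `m` on real-valued lattice functions. For symbols
with `m(-ξ)` conjugate to `m(ξ)`, the only ones used, the inverse transform is already real, so
that taking the real part only changes the type. -/
def multiplier (h : ℝ) (m : ℝ → ℂ) (f : ℤ → ℝ) (n : ℤ) : ℝ :=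
  (invDFT h (fun ξ => m ξ * dft h (fun k => (f k : ℂ)) ξ) n).re

/-- The norm of `L²` of the lattice. -/
def latticeL2Norm (h : ℝ) (f : ℤ → ℝ) : ℝ := Real.sqrt (h * ∑' n, f n ^ 2)

/-- The norm `‖⟨∂_h⟩^s f‖_{L²}` of the Sobolev space `H^s` of the lattice. -/
def sobolevNorm (h s : ℝ) (f : ℤ → ℝ) : ℝ :=
  latticeL2Norm h (multiplier h (fun ξ => ((bracket ξ ^ s : ℝ) : ℂ)) f)

/-! ### The operators of the FPU systems -/

/-- `∇_h`, the multiplier with symbol `(2i/h) sin(hξ/2)`. -/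
def nabla (h : ℝ) : (ℤ → ℝ) → ℤ → ℝ :=
  multiplier h (fun ξ => Complex.I * ((2 / h * Real.sin (h * ξ / 2) : ℝ) : ℂ))

/-- `e^{a ∂_h}`, the multiplier with symbol `e^{i a ξ}` on `[-π/h, π/h)`. -/
def expPartial (h a : ℝ) : (ℤ → ℝ) → ℤ → ℝ :=
  multiplier h (fun ξ => Complex.exp (Complex.I * ((a * ξ : ℝ) : ℂ)))

/-- The linear FPU propagator `S_h^σ(t) = e^{-σ (t/h²) (∇_h - ∂_h)}` for the sign `σ = ±1`. -/
def propagator (h σ t : ℝ) : (ℤ → ℝ) → ℤ → ℝ :=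
  multiplier h (fun ξ => Complex.exp (((-(σ * (t / h ^ 2)) : ℝ) : ℂ) *
    (Complex.I * ((2 / h * Real.sin (h * ξ / 2) : ℝ) : ℂ) - Complex.I * (ξ : ℂ))))

/-- The higher-order remainder `𝓡` at the value `r`, determined by
`(2 / h⁴) (V'(h² r) - h² r) = r² + h² 𝓡`. -/
def remainder (h : ℝ) (V : ℝ → ℝ) (r : ℝ) : ℝ :=
  (2 / h ^ 4 * (deriv V (h ^ 2 * r) - h ^ 2 * r) - r ^ 2) / h ^ 2

/-- The nonlinearity of the equation with sign `σ` in the coupled FPU system at time `t`, where `u`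
is the unknown with that sign and `w` is the other one:
`{u + e^{2σt/h² ∂_h} w}² + h² e^{σt/h² ∂_h} 𝓡`, with `𝓡` evaluated at
`e^{-σt/h² ∂_h} u + e^{σt/h² ∂_h} w`. -/
def coupledNonlinearity (h : ℝ) (V : ℝ → ℝ) (σ t : ℝ) (u w : ℤ → ℝ) (n : ℤ) : ℝ :=
  (u n + expPartial h (2 * σ * t / h ^ 2) w n) ^ 2 +
    h ^ 2 * expPartial h (σ * t / h ^ 2)
      (fun k => remainder h V
        (expPartial h (-(σ * t / h ^ 2)) u k + expPartial h (σ * t / h ^ 2) w k)) n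

/-- The Duhamel formula
`u(t) = S_h^σ(t) f - (σ/4) ∫_0^t S_h^σ(t - t₁) ∇_h N(t₁) dt₁` for `|t| ≤ τ`, at each lattice
point. -/
def Duhamel (h σ τ : ℝ) (f : LatticeL2) (N : ℝ → ℤ → ℝ) (u : ℝ → LatticeL2) : Prop :=
  ∀ t ∈ Icc (-τ) τ, ∀ n : ℤ,
    u t n = propagator h σ t f n -
      σ / 4 * ∫ t₁ in (0 : ℝ)..t, propagator h σ (t - t₁) (nabla h (N t₁)) n

/-- `(u₁, u₂) = (u_h^+, u_h^-)` is a solution in `C([-τ, τ]; L²)` of the coupled FPU system with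
potential `V` and initial data `(f₁, f₂)`. -/
def IsCoupledSolution (h : ℝ) (V : ℝ → ℝ) (τ : ℝ) (f₁ f₂ : LatticeL2) (u₁ u₂ : ℝ → LatticeL2) :
    Prop :=
  ContinuousOn u₁ (Icc (-τ) τ) ∧ ContinuousOn u₂ (Icc (-τ) τ) ∧
  Duhamel h 1 τ f₁ (fun t => coupledNonlinearity h V 1 t (u₁ t) (u₂ t)) u₁ ∧
  Duhamel h (-1) τ f₂ (fun t => coupledNonlinearity h V (-1) t (u₂ t) (u₁ t)) u₂

/-- `v = v_h^σ` is a solution in `C([-τ, τ]; L²)` of the decoupled FPU equation with sign `σ` and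
initial datum `f`. -/
def IsDecoupledSolution (h σ τ : ℝ) (f : LatticeL2) (v : ℝ → LatticeL2) : Prop :=
  ContinuousOn v (Icc (-τ) τ) ∧ Duhamel h σ τ f (fun t n => v t n ^ 2) v

/-! ### Discrete Bourgain spaces -/

/-- `s_h(ξ) = h⁻² (ξ - (2/h) sin(hξ/2))`. -/
def dispersion (h ξ : ℝ) : ℝ := 1 / h ^ 2 * (ξ - 2 / h * Real.sin (h * ξ / 2))

/-- The space-time Fourier transform `h ∑_x ∫ e^{-i t τ} e^{-i x ξ} u(t, x) dt`: first in time at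
each lattice point, then in space. -/
def spaceTimeFT (h : ℝ) (u : ℝ → ℤ → ℝ) (τ : ℝ) : ℝ → ℂ :=
  dft h (fun n => ∫ t : ℝ, Complex.exp (-Complex.I * ((t * τ : ℝ) : ℂ)) * (u t n : ℂ))

/-- The norm of the discrete Bourgain space `X_{h,σ}^{s,b}` for the sign `σ = ±1`, with the value
`∞` off the space:
`{∫ ∫_{-π/h}^{π/h} ⟨ξ⟩^{2s} ⟨τ - σ s_h(ξ)⟩^{2b} |ũ(τ, ξ)|² dξ dτ}^{1/2}`. -/
def bourgainNorm (h σ s b : ℝ) (u : ℝ → ℤ → ℝ) : ℝ≥0∞ :=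
  (∫⁻ τ : ℝ, ∫⁻ ξ in freqDomain h,
    ENNReal.ofReal (bracket ξ ^ (2 * s) * bracket (τ - σ * dispersion h ξ) ^ (2 * b) *
      ‖spaceTimeFT h u τ ξ‖ ^ 2)) ^ (1 / 2 : ℝ)

end FPU

end

/-!
The proof is a contraction argument in the discrete Bourgain spaces, with bounds that do not depend
on the mesh `h`.

**Bilinear estimate.** A function in a Bourgain space is a superposition of waves
`e^{i (t (τ + φ(ξ)) + x ξ)}` with a square integrable density in the weight `⟨ξ⟩^s ⟨τ⟩^b`, where `φ`
is the phase of the propagator. After the shift `e^{2σt/h² ∂_h}` the other component is a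
superposition of the same kind, for the phase with the opposite sign in front of the sine
(`phase`). Hence all products in the nonlinearity are treated at once (`exists_product_density`).
By the Cauchy-Schwarz inequality, the estimate reduces to a bound for
`∫ ⟨τ - Ω(ξ, ξ₁)⟩^{-2b} dξ₁`, where the resonance function `Ω` is, by the addition theorem,
`(E + 4 r cos (h ξ₁ / 2 + a)) / h³` with parameters that depend on `ξ` and on the aliasing number of
the interaction. At its stationary points it is at least `|r|³ / h³` (`resonance_lower_bound`), and
`|sin (h ξ / 2)| ≤ 2 |r|`. The square root singularities at the stationary points and the weight
`⟨τ⟩^{-1/2}` then absorb the square of the symbol of `∇_h` uniformly in `h`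
(`lintegral_resonance_le`, `resonance_kernel_le`).

**Duhamel term.** On the frequency side, the integral in time with a cutoff at scale `T` has an
explicit kernel (`duhamelKernel`), which maps the forcing in the weight `⟨τ⟩^{-1/4}` to the weight
`⟨τ⟩^b` and gains a power of `T` because `b < 5/8` (`exists_duhamel_density`). The remainder `𝓡` is
only a continuous function of time; its Fourier series over `[-π, π]` puts it into the same framework
(`exists_forcing_density`). It is cubic, so that on `H^s` with `s ≤ 1`, where the norm is given by
dyadic differences, `h² 𝓡` is Lipschitz with constant `O(h)`, which compensates for the norm `2 / h`
of `∇_h` (`exists_remainder_lipschitz`).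

**Solutions.** The integral equations are solved in the interaction picture. Only the values of the
solution for `|t| ≤ 2T` enter, so that the contraction argument is set up for densities whose
realised functions are real there (`exists_realised_fixed_point`, `exists_density_solution`). The
coupled and the decoupled system are the cases `κ = 1` and `κ = 0` of one pair of equations. For
fixed `h` these are ordinary differential equations in `L²` with a locally Lipschitz vector field,
and so the solutions are unique (`interaction_unique`). Multiplication with `θ(t / T)` is a
convolution of the density with an integrable kernel, which gives the bounds in the Bourgain norms
(`exists_bourgainNorm_le`).
-/

open Real Set Filter Topology MeasureTheory
open scoped ENNReal ContDiff

noncomputable section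

namespace FPU
/-! ### Fourier analysis on the lattice -/

theorem measurableSet_freqDomain (h : ℝ) : MeasurableSet (freqDomain h) := measurableSet_Ico

instance isFiniteMeasure_freqDomain (h : ℝ) :
    IsFiniteMeasure (volume.restrict (freqDomain h)) :=
  ⟨by simp [freqDomain, Real.volume_Ico]⟩

theorem abs_le_of_mem_freqDomain {h ξ : ℝ} (hξ : ξ ∈ freqDomain h) : |ξ| ≤ π / h :=
  abs_le.mpr ⟨hξ.1, hξ.2.le⟩

theorem restrict_freqDomain (h : ℝ) :
    volume.restrict (freqDomain h) = volume.restrict (Ioc (-(π / h)) (π / h)) :=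
  Measure.restrict_congr_set Ico_ae_eq_Ioc

theorem ae_mem_freqDomain (h : ℝ) :
    ∀ᵐ ξ ∂(volume.restrict (freqDomain h)), ξ ∈ freqDomain h :=
  ae_restrict_mem (measurableSet_freqDomain h)

/-- An integrable function on the frequency domain is determined by its inverse transform: the
trigonometric polynomials are uniformly dense in the continuous periodic functions. -/
theorem ae_eq_zero_of_invDFT_eq_zero {h : ℝ} (hh : 0 < h) {F : ℝ → ℂ}
    (hF : IntegrableOn F (freqDomain h)) (h0 : ∀ n, invDFT h F n = 0) :
    F =ᵐ[volume.restrict (freqDomain h)] 0 := by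
  have hP : Fact (0 < 2 * π / h) := ⟨by positivity⟩
  have hset : -(π / h) + 2 * π / h = π / h := by ring
  have h0' : ∀ n : ℤ, ∫ ξ in freqDomain h,
      (fourier n : C(AddCircle (2 * π / h), ℂ)) (ξ : AddCircle (2 * π / h)) * F ξ = 0 := by
    intro n
    have h1 := h0 n
    rw [invDFT, mul_eq_zero] at h1
    rcases h1 with h1 | h1
    · exact absurd h1 (by norm_cast; positivity)
    rw [← h1]
    refine integral_congr_ae (Eventually.of_forall fun ξ => ?_)
    have hpi : (π : ℂ) ≠ 0 := by exact_mod_cast Real.pi_ne_zero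
    have hc : (h : ℂ) ≠ 0 := by exact_mod_cast hh.ne'
    have he : (2 * π * Complex.I * (n : ℂ) * ξ / ((2 * π / h : ℝ) : ℂ)) =
        Complex.I * (((h * n) * ξ : ℝ) : ℂ) := by
      push_cast; field_simp
    simp only [fourier_coe_apply, he]
    ring
  have hint : ∀ φ : C(AddCircle (2 * π / h), ℂ),
      Integrable (fun ξ : ℝ => φ (ξ : AddCircle (2 * π / h)) * F ξ)
        (volume.restrict (freqDomain h)) := by
    intro φ
    refine Integrable.bdd_mul (c := ‖φ‖) hF ?_ (Eventually.of_forall fun ξ => φ.norm_coe_le_norm _)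
    exact (φ.continuous.comp (AddCircle.continuous_mk' _)).aestronglyMeasurable
  let L : C(AddCircle (2 * π / h), ℂ) →ₗ[ℂ] ℂ :=
    { toFun := fun φ => ∫ ξ in freqDomain h, φ (ξ : AddCircle (2 * π / h)) * F ξ
      map_add' := fun φ ψ => by
        rw [← integral_add (hint φ) (hint ψ)]
        exact integral_congr_ae (Eventually.of_forall fun ξ => by simp [add_mul])
      map_smul' := fun c φ => by
        simp only [ContinuousMap.coe_smul, Pi.smul_apply, smul_eq_mul, RingHom.id_apply, mul_assoc]
        rw [integral_const_mul] }
  let L' : C(AddCircle (2 * π / h), ℂ) →L[ℂ] ℂ :=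
    L.mkContinuous (∫ ξ in freqDomain h, ‖F ξ‖) (fun φ => by
      refine (norm_integral_le_integral_norm _).trans ?_
      refine le_trans ?_ (integral_mul_const ‖φ‖ fun ξ => ‖F ξ‖).le
      refine integral_mono_of_nonneg (Eventually.of_forall fun _ => norm_nonneg _)
        (hF.norm.mul_const _) (Eventually.of_forall fun ξ => ?_)
      simp only [norm_mul]
      rw [mul_comm]
      gcongr
      exact φ.norm_coe_le_norm _)
  have hL : ∀ φ, L' φ = 0 := by
    have hker : (⊤ : Submodule ℂ C(AddCircle (2 * π / h), ℂ)) ≤ L'.toLinearMap.ker := by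
      rw [← span_fourier_closure_eq_top]
      refine Submodule.topologicalClosure_minimal _ ?_ L'.isClosed_ker
      rw [Submodule.span_le]
      rintro _ ⟨n, rfl⟩
      exact h0' n
    intro φ
    exact hker (Submodule.mem_top (x := φ))
  have hU := isOpen_Ioo (a := -(π / h)) (b := π / h) |>.ae_eq_zero_of_integral_contDiff_smul_eq_zero
    (f := F) (μ := volume) ((hF.mono_set Ioo_subset_Ico_self).locallyIntegrableOn) ?_
  · have hr : volume.restrict (freqDomain h) = volume.restrict (Ioo (-(π / h)) (π / h)) :=
      Measure.restrict_congr_set Ioo_ae_eq_Ico.symm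
    rw [hr]
    exact (ae_restrict_iff' measurableSet_Ioo).mpr hU
  intro g hg _ hgs
  have hga : g (-(π / h)) = 0 := by
    by_contra hne
    exact absurd (hgs (subset_tsupport _ (Function.mem_support.mpr hne))).1 (lt_irrefl _)
  have hgb : g (π / h) = 0 := by
    by_contra hne
    exact absurd (hgs (subset_tsupport _ (Function.mem_support.mpr hne))).2 (lt_irrefl _)
  let φ : C(AddCircle (2 * π / h), ℂ) :=
    ⟨AddCircle.liftIco (2 * π / h) (-(π / h)) (fun x => (g x : ℂ)),
      AddCircle.liftIco_continuous (by simp [hset, hga, hgb])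
        (Complex.continuous_ofReal.comp hg.continuous).continuousOn⟩
  have h1 : ∫ ξ in freqDomain h, φ (ξ : AddCircle (2 * π / h)) * F ξ = 0 := hL φ
  rw [← setIntegral_eq_integral_of_forall_compl_eq_zero (s := freqDomain h), ← h1]
  · refine setIntegral_congr_fun (measurableSet_freqDomain h) fun ξ hξ => ?_
    have : φ (ξ : AddCircle (2 * π / h)) = (g ξ : ℂ) :=
      AddCircle.liftIco_coe_apply (f := fun x => (g x : ℂ)) (by rw [hset]; exact hξ)
    simp only [this, Complex.real_smul]
  · intro ξ hξ
    have : g ξ = 0 := by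
      by_contra hne
      exact hξ (Ioo_subset_Ico_self (hgs (subset_tsupport _ (Function.mem_support.mpr hne))))
    simp [this]

theorem integrableOn_mul_exp {h : ℝ} {F : ℝ → ℂ} (hF : IntegrableOn F (freqDomain h)) (n : ℤ) :
    IntegrableOn (fun ξ => F ξ * Complex.exp (Complex.I * (((h * n) * ξ : ℝ) : ℂ)))
      (freqDomain h) := by
  refine Integrable.mul_bdd (c := 1) hF ?_ (Eventually.of_forall fun ξ => ?_)
  · exact (by fun_prop : Continuous _).aestronglyMeasurable
  · rw [mul_comm, Complex.norm_exp_ofReal_mul_I]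

theorem invDFT_congr {h : ℝ} {F G : ℝ → ℂ} (hFG : F =ᵐ[volume.restrict (freqDomain h)] G) (n : ℤ) :
    invDFT h F n = invDFT h G n := by
  rw [invDFT, invDFT]
  congr 1
  refine integral_congr_ae (hFG.mono fun ξ hξ => ?_)
  simp only [hξ]

theorem invDFT_add {h : ℝ} {F G : ℝ → ℂ} (hF : IntegrableOn F (freqDomain h))
    (hG : IntegrableOn G (freqDomain h)) (n : ℤ) :
    invDFT h (fun ξ => F ξ + G ξ) n = invDFT h F n + invDFT h G n := by
  simp only [invDFT, add_mul]
  rw [integral_add (integrableOn_mul_exp hF n) (integrableOn_mul_exp hG n), mul_add]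

theorem invDFT_sub {h : ℝ} {F G : ℝ → ℂ} (hF : IntegrableOn F (freqDomain h))
    (hG : IntegrableOn G (freqDomain h)) (n : ℤ) :
    invDFT h (fun ξ => F ξ - G ξ) n = invDFT h F n - invDFT h G n := by
  simp only [invDFT, sub_mul]
  rw [integral_sub (integrableOn_mul_exp hF n) (integrableOn_mul_exp hG n), mul_sub]

theorem invDFT_const_mul {h : ℝ} (c : ℂ) (F : ℝ → ℂ) (n : ℤ) :
    invDFT h (fun ξ => c * F ξ) n = c * invDFT h F n := by
  simp only [invDFT, mul_assoc]
  rw [integral_const_mul]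
  ring

theorem ae_eq_of_invDFT_eq {h : ℝ} (hh : 0 < h) {F G : ℝ → ℂ}
    (hF : IntegrableOn F (freqDomain h)) (hG : IntegrableOn G (freqDomain h))
    (hFG : ∀ n, invDFT h F n = invDFT h G n) :
    F =ᵐ[volume.restrict (freqDomain h)] G := by
  have := ae_eq_zero_of_invDFT_eq_zero hh (hF.sub hG) (fun n => by
    have := invDFT_sub hF hG n
    rw [hFG n, sub_self] at this
    exact this)
  filter_upwards [this] with ξ hξ
  exact sub_eq_zero.mp hξ

theorem IsDFT.integrableOn {h : ℝ} {f : ℤ → ℂ} {F : ℝ → ℂ} (hF : IsDFT h f F) :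
    IntegrableOn F (freqDomain h) :=
  hF.1.integrable (by norm_num)

/-- Parseval's identity for the inverse discrete Fourier transform. -/
theorem hasSum_norm_sq_invDFT {h : ℝ} (hh : 0 < h) {F : ℝ → ℂ}
    (hF : MemLp F 2 (volume.restrict (freqDomain h))) :
    HasSum (fun n => ‖invDFT h F n‖ ^ 2)
      ((2 * π * h)⁻¹ * ∫ ξ in freqDomain h, ‖F ξ‖ ^ 2) := by
  have hlt : -(π / h) < π / h := by
    have : 0 < π / h := by positivity
    linarith
  have hs := hasSum_sq_fourierCoeffOn hlt (f := F) (by rwa [← restrict_freqDomain])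
  have key : ∀ n : ℤ, fourierCoeffOn hlt F (-n) = h * invDFT h F n := by
    intro n
    rw [fourierCoeffOn_eq_integral, intervalIntegral.integral_of_le hlt.le, ← restrict_freqDomain,
      invDFT]
    have hset : π / h - -(π / h) = 2 * π / h := by ring
    have hpi : (π : ℂ) ≠ 0 := by exact_mod_cast Real.pi_ne_zero
    have hc : (h : ℂ) ≠ 0 := by exact_mod_cast hh.ne'
    rw [hset, ← mul_assoc, Complex.real_smul]
    congr 1
    · push_cast; field_simp
    · refine integral_congr_ae (Eventually.of_forall fun ξ => ?_)
      have he : (2 * π * Complex.I * ((- -n : ℤ) : ℂ) * ξ / ((2 * π / h : ℝ) : ℂ)) =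
          Complex.I * (((h * n) * ξ : ℝ) : ℂ) := by
        push_cast; field_simp
      simp only [fourier_coe_apply, smul_eq_mul, he]
      ring
  have hs2 := ((Equiv.neg ℤ).hasSum_iff.mpr hs).mul_left (h ^ 2)⁻¹
  rw [intervalIntegral.integral_of_le hlt.le, ← restrict_freqDomain, smul_eq_mul, ← mul_assoc] at hs2
  have e1 : (fun n => ‖invDFT h F n‖ ^ 2) = fun i => (h ^ 2)⁻¹ *
      ((fun i => ‖fourierCoeffOn hlt F i‖ ^ 2) ∘ (Equiv.neg ℤ)) i := by
    funext n
    simp only [Function.comp_apply, Equiv.neg_apply, key, norm_mul, Complex.norm_real,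
      Real.norm_eq_abs, abs_of_pos hh]
    field_simp
  have e2 : (2 * π * h)⁻¹ = (h ^ 2)⁻¹ * (π / h - -(π / h))⁻¹ := by
    have : π / h - -(π / h) = 2 * π / h := by ring
    rw [this]; field_simp
  rw [e1, e2]
  exact hs2

theorem memℓp_invDFT {h : ℝ} (hh : 0 < h) {F : ℝ → ℂ}
    (hF : MemLp F 2 (volume.restrict (freqDomain h))) : Memℓp (invDFT h F) 2 := by
  rw [memℓp_gen_iff (by norm_num)]
  simpa using (hasSum_norm_sq_invDFT hh hF).summable

theorem IsDFT.ae_eq {h : ℝ} (hh : 0 < h) {f : ℤ → ℂ} {F G : ℝ → ℂ} (hF : IsDFT h f F)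
    (hG : IntegrableOn G (freqDomain h)) (hfG : ∀ n, invDFT h G n = f n) :
    F =ᵐ[volume.restrict (freqDomain h)] G :=
  ae_eq_of_invDFT_eq hh hF.integrableOn hG fun n => by rw [hF.2, hfG]

theorem IsDFT.congr {h : ℝ} {f : ℤ → ℂ} {F G : ℝ → ℂ} (hF : IsDFT h f F)
    (hFG : F =ᵐ[volume.restrict (freqDomain h)] G) : IsDFT h f G :=
  ⟨(memLp_congr_ae hFG).mp hF.1, fun n => by rw [← hF.2 n, invDFT_congr hFG]⟩

/-- For square summable `f`, an integrable function with inverse transform `f` is the discrete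
Fourier transform of `f`, and so square integrable. -/
theorem isDFT_of_integrableOn {h : ℝ} (hh : 0 < h) {f : ℤ → ℂ} {F : ℝ → ℂ} (hf : Memℓp f 2)
    (hF : IntegrableOn F (freqDomain h)) (hfF : ∀ n, invDFT h F n = f n) : IsDFT h f F :=
  (dft_spec hh hf).congr ((dft_spec hh hf).ae_eq hh hF hfF)

theorem IsDFT.dft_ae_eq {h : ℝ} (hh : 0 < h) {f : ℤ → ℂ} {F : ℝ → ℂ} (hF : IsDFT h f F) :
    dft h f =ᵐ[volume.restrict (freqDomain h)] F := by
  have hf : Memℓp f 2 := by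
    have := memℓp_invDFT hh hF.1
    rwa [funext hF.2] at this
  exact (dft_spec hh hf).ae_eq hh hF.integrableOn hF.2

theorem IsDFT.add {h : ℝ} {f g : ℤ → ℂ} {F G : ℝ → ℂ} (hF : IsDFT h f F) (hG : IsDFT h g G) :
    IsDFT h (fun n => f n + g n) (fun ξ => F ξ + G ξ) :=
  ⟨hF.1.add hG.1, fun n => by rw [invDFT_add hF.integrableOn hG.integrableOn, hF.2, hG.2]⟩

theorem IsDFT.sub {h : ℝ} {f g : ℤ → ℂ} {F G : ℝ → ℂ} (hF : IsDFT h f F) (hG : IsDFT h g G) :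
    IsDFT h (fun n => f n - g n) (fun ξ => F ξ - G ξ) :=
  ⟨hF.1.sub hG.1, fun n => by rw [invDFT_sub hF.integrableOn hG.integrableOn, hF.2, hG.2]⟩

theorem IsDFT.const_mul {h : ℝ} {f : ℤ → ℂ} {F : ℝ → ℂ} (c : ℂ) (hF : IsDFT h f F) :
    IsDFT h (fun n => c * f n) (fun ξ => c * F ξ) :=
  ⟨hF.1.const_mul c, fun n => by rw [invDFT_const_mul, hF.2]⟩

/-! ### Fourier multipliers on real lattice functions -/

theorem LatticeL2.memℓp_ofReal (f : LatticeL2) : Memℓp (fun n => (f n : ℂ)) 2 := by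
  have := lp.memℓp f
  rw [memℓp_gen_iff (by norm_num)] at this ⊢
  simpa using this

/-- Reflection of the frequency domain in the origin preserves Lebesgue measure, the missing end
point being a null set. -/
theorem measurePreserving_neg_freqDomain (h : ℝ) :
    MeasurePreserving (fun ξ : ℝ => -ξ) (volume.restrict (freqDomain h))
      (volume.restrict (freqDomain h)) := by
  have := (Measure.measurePreserving_neg (volume : Measure ℝ)).restrict_preimage
    (measurableSet_freqDomain h)
  have hs : (Neg.neg ⁻¹' freqDomain h) = Ioc (-(π / h)) (π / h) := by
    ext x; simp only [freqDomain, mem_preimage, mem_Ico, mem_Ioc]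
    constructor <;> rintro ⟨h1, h2⟩ <;> constructor <;> linarith
  rw [hs, ← restrict_freqDomain] at this
  exact this

theorem invDFT_conj_neg (h : ℝ) (F : ℝ → ℂ) (n : ℤ) :
    invDFT h (fun ξ => starRingEnd ℂ (F (-ξ))) n = starRingEnd ℂ (invDFT h F n) := by
  rw [invDFT, invDFT, map_mul, Complex.conj_ofReal, ← integral_conj]
  congr 1
  rw [← (measurePreserving_neg_freqDomain h).integral_comp (MeasurableEquiv.neg ℝ).measurableEmbedding]
  refine integral_congr_ae (Eventually.of_forall fun ξ => ?_)
  simp only [map_mul, ← Complex.exp_conj, Complex.conj_ofReal, Complex.conj_I]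
  congr 2
  · rw [neg_neg]
  · rw [mul_neg, Complex.ofReal_neg]
    ring

/-- The transform of a real function is conjugate symmetric. -/
theorem IsDFT.conj_neg {h : ℝ} (hh : 0 < h) {f : ℤ → ℝ} {F : ℝ → ℂ}
    (hF : IsDFT h (fun n => (f n : ℂ)) F) :
    (fun ξ => starRingEnd ℂ (F (-ξ))) =ᵐ[volume.restrict (freqDomain h)] F := by
  have hm := hF.1.comp_measurePreserving (measurePreserving_neg_freqDomain h)
  have hm' : MemLp (fun ξ => starRingEnd ℂ (F (-ξ))) 2 (volume.restrict (freqDomain h)) :=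
    MemLp.of_le hm (Complex.continuous_conj.comp_aestronglyMeasurable hm.1)
      (Eventually.of_forall fun ξ => by simp)
  refine (hF.ae_eq hh (hm'.integrable (by norm_num)) fun n => ?_).symm
  rw [invDFT_conj_neg, hF.2, Complex.conj_ofReal]

/-- A symbol of a bounded Fourier multiplier that maps real functions to real functions. -/
structure RealSymbol (h : ℝ) where
  /-- the symbol, as a function of the frequency -/
  toFun : ℝ → ℂ
  measurable' : Measurable toFun
  bounded' : ∃ C : ℝ, 0 ≤ C ∧ ∀ ξ ∈ freqDomain h, ‖toFun ξ‖ ≤ C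
  conj_neg' : ∀ ξ, toFun (-ξ) = starRingEnd ℂ (toFun ξ)

instance (h : ℝ) : CoeFun (RealSymbol h) (fun _ => ℝ → ℂ) := ⟨RealSymbol.toFun⟩

theorem RealSymbol.memLp {h : ℝ} (m : RealSymbol h) {F : ℝ → ℂ}
    (hF : MemLp F 2 (volume.restrict (freqDomain h))) :
    MemLp (fun ξ => m ξ * F ξ) 2 (volume.restrict (freqDomain h)) := by
  obtain ⟨C, hC, hb⟩ := m.bounded'
  refine MemLp.of_le_mul (c := C) hF (m.measurable'.aestronglyMeasurable.mul hF.1) ?_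
  filter_upwards [ae_mem_freqDomain h] with ξ hξ
  rw [norm_mul]
  gcongr
  exact hb ξ hξ

/-- A multiplier acts on the transform by multiplication with its symbol. In particular the value
of the inverse transform is real. -/
theorem IsDFT.multiplier {h : ℝ} (hh : 0 < h) (m : RealSymbol h) {f : ℤ → ℝ} {F : ℝ → ℂ}
    (hF : IsDFT h (fun n => (f n : ℂ)) F) :
    IsDFT h (fun n => (multiplier h m f n : ℂ)) (fun ξ => m ξ * F ξ) := by
  refine ⟨m.memLp hF.1, fun n => ?_⟩
  have h1 : invDFT h (fun ξ => m ξ * dft h (fun k => (f k : ℂ)) ξ) n =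
      invDFT h (fun ξ => m ξ * F ξ) n := by
    refine invDFT_congr ?_ n
    filter_upwards [hF.dft_ae_eq hh] with ξ hξ
    rw [hξ]
  have h2 : starRingEnd ℂ (invDFT h (fun ξ => m ξ * F ξ) n) = invDFT h (fun ξ => m ξ * F ξ) n := by
    rw [← invDFT_conj_neg]
    refine invDFT_congr ?_ n
    filter_upwards [hF.conj_neg hh] with ξ hξ
    rw [map_mul, hξ, m.conj_neg', Complex.conj_conj]
  simp only [FPU.multiplier]
  rw [h1]
  exact (Complex.conj_eq_iff_re.mp h2).symm

theorem IsDFT.memℓp {h : ℝ} (hh : 0 < h) {f : ℤ → ℝ} {F : ℝ → ℂ}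
    (hF : IsDFT h (fun n => (f n : ℂ)) F) : Memℓp f 2 := by
  have := memℓp_invDFT hh hF.1
  rw [funext hF.2, memℓp_gen_iff (by norm_num)] at this
  rw [memℓp_gen_iff (by norm_num)]
  simpa using this

theorem LatticeL2.isDFT {h : ℝ} (hh : 0 < h) (f : LatticeL2) :
    IsDFT h (fun n => (f n : ℂ)) (dft h (fun n => (f n : ℂ))) :=
  dft_spec hh f.memℓp_ofReal

theorem LatticeL2.norm_sq (f : LatticeL2) : ‖f‖ ^ 2 = ∑' n, f n ^ 2 := by
  have := lp.norm_rpow_eq_tsum (p := 2) (by norm_num) f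
  simpa using this

theorem LatticeL2.hasSum_sq (f : LatticeL2) : HasSum (fun n => f n ^ 2) (‖f‖ ^ 2) := by
  rw [f.norm_sq]
  have := lp.memℓp f
  rw [memℓp_gen_iff (by norm_num)] at this
  exact Summable.hasSum (by simpa using this)

theorem LatticeL2.abs_apply_le (f : LatticeL2) (n : ℤ) : |f n| ≤ ‖f‖ := by
  simpa using lp.norm_apply_le_norm (p := 2) (by norm_num) f n

/-- Parseval's identity for real lattice functions. -/
theorem IsDFT.norm_sq_eq {h : ℝ} (hh : 0 < h) {f : LatticeL2} {F : ℝ → ℂ}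
    (hF : IsDFT h (fun n => (f n : ℂ)) F) :
    h * ‖f‖ ^ 2 = (2 * π)⁻¹ * ∫ ξ in freqDomain h, ‖F ξ‖ ^ 2 := by
  have h1 := (hasSum_norm_sq_invDFT hh hF.1).unique (by
    have := f.hasSum_sq
    convert this using 2 with n
    rw [hF.2]; simp)
  rw [← h1]
  field_simp

/-- The Fourier multiplier with a real symbol, as a linear map on square summable functions. -/
def mulLin {h : ℝ} (hh : 0 < h) (m : RealSymbol h) : LatticeL2 →ₗ[ℝ] LatticeL2 where
  toFun f := ⟨multiplier h m f, ((f.isDFT hh).multiplier hh m).memℓp hh⟩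
  map_add' f g := by
    ext n
    have h1 := ((f.isDFT hh).multiplier hh m).add ((g.isDFT hh).multiplier hh m)
    have h2 : IsDFT h (fun n => ((f + g : LatticeL2) n : ℂ)) _ :=
      (by simpa using (f.isDFT hh).add (g.isDFT hh))
    have h3 := (h2.multiplier hh m).2 n
    have h4 := h1.2 n
    simp only [mul_add] at h3
    rw [h3] at h4
    change multiplier h m (f + g : LatticeL2) n = multiplier h m f n + multiplier h m g n
    exact Complex.ofReal_injective (by push_cast; exact h4)
  map_smul' c f := by
    ext n
    have h1 := ((f.isDFT hh).multiplier hh m).const_mul c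
    have h2 : IsDFT h (fun n => ((c • f : LatticeL2) n : ℂ)) _ :=
      (by simpa using (f.isDFT hh).const_mul c)
    have h3 := (h2.multiplier hh m).2 n
    have h4 := h1.2 n
    simp only [mul_left_comm _ (c : ℂ)] at h3
    rw [h3] at h4
    change multiplier h m (c • f : LatticeL2) n = c * multiplier h m f n
    exact Complex.ofReal_injective (by push_cast; exact h4)
/-! ### The Japanese bracket and oscillatory sublevel integrals -/

theorem bracket_sq (x : ℝ) : bracket x ^ 2 = 1 + x ^ 2 := Real.sq_sqrt (by positivity)

theorem one_le_bracket (x : ℝ) : 1 ≤ bracket x := by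
  rw [bracket, Real.one_le_sqrt]; nlinarith [sq_nonneg x]

theorem bracket_pos (x : ℝ) : 0 < bracket x := zero_lt_one.trans_le (one_le_bracket x)

theorem abs_le_bracket (x : ℝ) : |x| ≤ bracket x := by
  rw [bracket]; exact Real.abs_le_sqrt (by linarith)

theorem continuous_bracket : Continuous bracket := by unfold bracket; fun_prop

@[fun_prop]
theorem measurable_bracket : Measurable bracket := continuous_bracket.measurable

theorem bracket_neg (x : ℝ) : bracket (-x) = bracket x := by simp [bracket]

/-- The bracket is Lipschitz with constant one. -/
theorem bracket_le_add (x y : ℝ) : bracket x ≤ bracket y + |x - y| := by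
  have hy := bracket_pos y
  rw [bracket]
  refine Real.sqrt_le_iff.mpr ⟨by positivity, ?_⟩
  have h1 : y * (x - y) ≤ bracket y * |x - y| :=
    (le_abs_self _).trans (by rw [abs_mul]; gcongr; exact abs_le_bracket y)
  nlinarith [bracket_sq y, sq_abs (x - y)]

theorem bracket_sub_le_add (x y : ℝ) : bracket (x - y) ≤ bracket x + bracket y := by
  have := bracket_le_add (x - y) x
  rw [sub_sub_cancel_left, abs_neg] at this
  linarith [abs_le_bracket y]

theorem bracket_le_mul {x y z : ℝ} (h : |z| ≤ |x| + |y|) :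
    bracket z ≤ 2 * (bracket x * bracket y) := by
  have hx := bracket_pos x
  have hy := bracket_pos y
  rw [bracket]
  refine Real.sqrt_le_iff.mpr ⟨by positivity, ?_⟩
  have h1 : z ^ 2 ≤ (|x| + |y|) ^ 2 := sq_le_sq' (by linarith [neg_abs_le z]) (by
    linarith [le_abs_self z])
  rw [mul_pow, mul_pow, bracket_sq, bracket_sq]
  nlinarith [sq_nonneg (|x| - |y|), sq_abs x, sq_abs y, sq_nonneg (x * y)]

theorem bracket_rpow_le_mul {s : ℝ} (hs : 0 ≤ s) {x y z : ℝ} (h : |z| ≤ |x| + |y|) :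
    bracket z ^ s ≤ 2 ^ s * (bracket x ^ s * bracket y ^ s) := by
  rw [← Real.mul_rpow (bracket_pos x).le (bracket_pos y).le,
    ← Real.mul_rpow (by norm_num) (mul_pos (bracket_pos x) (bracket_pos y)).le]
  exact Real.rpow_le_rpow (bracket_pos z).le (bracket_le_mul h) hs

theorem integrable_bracket_rpow {c : ℝ} (hc : 1 < c) :
    Integrable (fun x : ℝ => bracket x ^ (-c)) := by
  have := integrable_rpow_neg_one_add_norm_sq (E := ℝ) (μ := volume) (r := c) (by simpa using hc)
  refine this.congr (Eventually.of_forall fun x => ?_)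
  simp only [Real.norm_eq_abs, sq_abs]
  rw [bracket, Real.sqrt_eq_rpow, ← Real.rpow_mul (by positivity)]
  congr 1; ring

/-- The integral of `⟨x⟩^{-c}` over the line. -/
def bracketMass (c : ℝ) : ℝ := ∫ x, bracket x ^ (-c)

theorem bracketMass_nonneg (c : ℝ) : 0 ≤ bracketMass c :=
  integral_nonneg fun x => Real.rpow_nonneg (bracket_pos x).le _

theorem lintegral_bracket_rpow {c : ℝ} (hc : 1 < c) :
    ∫⁻ x, ENNReal.ofReal (bracket x ^ (-c)) = ENNReal.ofReal (bracketMass c) :=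
  (ofReal_integral_eq_lintegral_ofReal (integrable_bracket_rpow hc)
    (Eventually.of_forall fun x => Real.rpow_nonneg (bracket_pos x).le _)).symm

/-- One of the two factors is always at most `(⟨x - y⟩ / 2)^{-c}`. -/
theorem lintegral_bracket_sub_mul_le {c : ℝ} (hc : 1 < c) (x y : ℝ) :
    ∫⁻ τ, ENNReal.ofReal (bracket (τ - x) ^ (-c) * bracket (τ - y) ^ (-c)) ≤
      ENNReal.ofReal (2 ^ c * (2 * bracketMass c) * bracket (x - y) ^ (-c)) := by
  have hpt : ∀ τ, bracket (τ - x) ^ (-c) * bracket (τ - y) ^ (-c) ≤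
      (2 ^ c * bracket (x - y) ^ (-c)) * (bracket (τ - x) ^ (-c) + bracket (τ - y) ^ (-c)) := by
    have aux : ∀ u v : ℝ, 1 ≤ v → u ≤ v → bracket (x - y) ≤ u + v → 0 < u →
        u ^ (-c) * v ^ (-c) ≤ (2 ^ c * bracket (x - y) ^ (-c)) * (u ^ (-c) + v ^ (-c)) := by
      intro u v hv huv hb hu
      have h1 : v ^ (-c) ≤ 2 ^ c * bracket (x - y) ^ (-c) := by
        have h2 : bracket (x - y) / 2 ≤ v := by linarith
        have h3 := Real.rpow_le_rpow_of_nonpos (by have := bracket_pos (x - y); positivity) h2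
          (by linarith : -c ≤ 0)
        rwa [Real.div_rpow (bracket_pos _).le (by norm_num), Real.rpow_neg (by norm_num : (0:ℝ) ≤ 2),
          div_inv_eq_mul, mul_comm] at h3
      have h4 : 0 ≤ u ^ (-c) := by positivity
      have h5 : 0 ≤ v ^ (-c) := by positivity
      have h6 : 0 ≤ 2 ^ c * bracket (x - y) ^ (-c) := h5.trans h1
      nlinarith [mul_le_mul_of_nonneg_left h1 h4, mul_nonneg h6 h5]
    intro τ
    have hb : bracket (x - y) ≤ bracket (τ - x) + bracket (τ - y) := by
      have := bracket_sub_le_add (τ - y) (τ - x)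
      rw [show τ - y - (τ - x) = x - y by ring] at this
      linarith
    rcases le_total (bracket (τ - x)) (bracket (τ - y)) with hle | hle
    · exact aux _ _ (one_le_bracket _) hle hb (bracket_pos _)
    · rw [mul_comm, add_comm (bracket (τ - x) ^ (-c))]
      exact aux _ _ (one_le_bracket _) hle (by linarith) (bracket_pos _)
  have hnn : ∀ z, 0 ≤ bracket z ^ (-c) := fun z => Real.rpow_nonneg (bracket_pos z).le _
  calc ∫⁻ τ, ENNReal.ofReal (bracket (τ - x) ^ (-c) * bracket (τ - y) ^ (-c))
      ≤ ∫⁻ τ, ENNReal.ofReal (2 ^ c * bracket (x - y) ^ (-c)) *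
          (ENNReal.ofReal (bracket (τ - x) ^ (-c)) + ENNReal.ofReal (bracket (τ - y) ^ (-c))) := by
        refine lintegral_mono fun τ => ?_
        rw [← ENNReal.ofReal_add (hnn _) (hnn _), ← ENNReal.ofReal_mul (by have := hnn (x - y); positivity)]
        exact ENNReal.ofReal_le_ofReal (hpt τ)
    _ = ENNReal.ofReal (2 ^ c * bracket (x - y) ^ (-c)) *
          (ENNReal.ofReal (bracketMass c) + ENNReal.ofReal (bracketMass c)) := by
        rw [lintegral_const_mul _ (by fun_prop), lintegral_add_left (by fun_prop),
          lintegral_sub_right_eq_self (fun τ => ENNReal.ofReal (bracket τ ^ (-c))),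
          lintegral_sub_right_eq_self (fun τ => ENNReal.ofReal (bracket τ ^ (-c))),
          lintegral_bracket_rpow hc]
    _ = _ := by
        rw [← ENNReal.ofReal_add (bracketMass_nonneg c) (bracketMass_nonneg c),
          ← ENNReal.ofReal_mul (by have := hnn (x - y); positivity)]
        congr 1; ring

theorem lintegral_inv_sqrt_abs_le {r : ℝ} (hr : 0 < r) :
    ∫⁻ y in Ioo (-r) r, ENNReal.ofReal (√|y|)⁻¹ ≤ ENNReal.ofReal (4 * √r) := by
  have hpos : ∫⁻ y in Ioc 0 r, ENNReal.ofReal (√|y|)⁻¹ = ENNReal.ofReal (2 * √r) := by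
    have hint : IntervalIntegrable (fun y : ℝ => y ^ (-(1 / 2) : ℝ)) volume 0 r :=
      intervalIntegral.intervalIntegrable_rpow' (by norm_num)
    have h1 := integral_rpow (a := 0) (b := r) (r := -(1 / 2)) (Or.inl (by norm_num))
    rw [intervalIntegral.integral_of_le hr.le] at h1
    have h2 : ∫⁻ y in Ioc 0 r, ENNReal.ofReal (√|y|)⁻¹ =
        ∫⁻ y in Ioc 0 r, ENNReal.ofReal (y ^ (-(1 / 2) : ℝ)) := by
      refine setLIntegral_congr_fun measurableSet_Ioc fun y hy => ?_
      rw [abs_of_pos hy.1, Real.sqrt_eq_rpow, Real.rpow_neg hy.1.le]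
    rw [h2, ← ofReal_integral_eq_lintegral_ofReal
      ((intervalIntegrable_iff_integrableOn_Ioc_of_le hr.le).mp hint), h1]
    · congr 1
      rw [Real.sqrt_eq_rpow]
      norm_num
      ring
    · filter_upwards [ae_restrict_mem measurableSet_Ioc] with y hy
      exact Real.rpow_nonneg hy.1.le _
  have hneg : ∫⁻ y in Ico (-r) 0, ENNReal.ofReal (√|y|)⁻¹ = ENNReal.ofReal (2 * √r) := by
    rw [← hpos, ← (Measure.measurePreserving_neg (volume : Measure ℝ)).setLIntegral_comp_preimage
      measurableSet_Ico (by fun_prop)]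
    simp only [abs_neg]
    congr 2
    ext x; simp only [mem_preimage, mem_Ico, mem_Ioc]; constructor <;> rintro ⟨_, _⟩ <;> constructor <;> linarith
  calc ∫⁻ y in Ioo (-r) r, ENNReal.ofReal (√|y|)⁻¹
      ≤ ∫⁻ y in Ico (-r) 0 ∪ Icc 0 r, ENNReal.ofReal (√|y|)⁻¹ := by
        refine lintegral_mono_set fun y hy => ?_
        rcases lt_or_ge y 0 with h | h
        · exact Or.inl ⟨hy.1.le, h⟩
        · exact Or.inr ⟨h, hy.2.le⟩
    _ ≤ _ := lintegral_union_le _ _ _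
    _ = _ := by
        rw [hneg, setLIntegral_congr (Ioc_ae_eq_Icc (a := (0:ℝ)) (b := r)).symm, hpos,
          ← ENNReal.ofReal_add (by positivity) (by positivity)]
        congr 1; ring

/-- The weight decays faster than the inverse square root, which is split at distance `⟨d⟩ / 4` from
its singularity. -/
theorem lintegral_bracket_mul_inv_sqrt_le {c : ℝ} (hc : 1 < c) (d : ℝ) :
    ∫⁻ x, ENNReal.ofReal (bracket x ^ (-c) * (√|x - d|)⁻¹) ≤
      ENNReal.ofReal ((2 * bracketMass c + 4) * (√(bracket d))⁻¹) := by
  have hd := bracket_pos d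
  have hnn : ∀ z, 0 ≤ bracket z ^ (-c) := fun z => Real.rpow_nonneg (bracket_pos z).le _
  set r := bracket d / 4 with hr
  have hr0 : 0 < r := by positivity
  have hs4 : √r = √(bracket d) / 2 := by
    rw [hr, Real.sqrt_div hd.le, show (4:ℝ) = 2 ^ 2 by norm_num, Real.sqrt_sq (by norm_num)]
  have hsd : 0 < √(bracket d) := Real.sqrt_pos.mpr hd
  have hpt : ∀ x, ENNReal.ofReal (bracket x ^ (-c) * (√|x - d|)⁻¹) ≤
      ENNReal.ofReal (2 * (√(bracket d))⁻¹) * ENNReal.ofReal (bracket x ^ (-c)) +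
      ENNReal.ofReal (2 * (bracket d)⁻¹) *
        (Ioo (-r) r).indicator (fun y => ENNReal.ofReal (√|y|)⁻¹) (x - d) := by
    intro x
    by_cases hx : x - d ∈ Ioo (-r) r
    · refine le_trans ?_ le_add_self
      rw [indicator_of_mem hx, ← ENNReal.ofReal_mul (by positivity)]
      refine ENNReal.ofReal_le_ofReal (mul_le_mul_of_nonneg_right ?_ (by positivity))
      have h1 : bracket d / 2 ≤ bracket x := by
        have := bracket_le_add d x
        have h2 : |d - x| < r := by rw [abs_sub_comm]; exact abs_lt.mpr hx
        linarith
      calc bracket x ^ (-c) ≤ bracket x ^ (-1 : ℝ) :=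
            Real.rpow_le_rpow_of_exponent_le (one_le_bracket x) (by linarith)
        _ = (bracket x)⁻¹ := Real.rpow_neg_one _
        _ ≤ (bracket d / 2)⁻¹ := by gcongr
        _ = _ := by rw [inv_div]; ring
    · refine le_trans ?_ le_self_add
      rw [← ENNReal.ofReal_mul (by positivity), mul_comm]
      refine ENNReal.ofReal_le_ofReal (mul_le_mul_of_nonneg_right ?_ (hnn x))
      have h1 : r ≤ |x - d| := by
        by_contra hlt
        exact hx (abs_lt.mp (not_le.mp hlt))
      calc (√|x - d|)⁻¹ ≤ (√r)⁻¹ := by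
            have := Real.sqrt_pos.mpr hr0
            gcongr
        _ = _ := by rw [hs4, inv_div]; ring
  refine (lintegral_mono hpt).trans ?_
  rw [lintegral_add_left (by fun_prop), lintegral_const_mul _ (by fun_prop), lintegral_bracket_rpow hc,
    lintegral_const_mul' _ _ ENNReal.ofReal_ne_top,
    lintegral_sub_right_eq_self ((Ioo (-r) r).indicator (fun y => ENNReal.ofReal (√|y|)⁻¹)),
    lintegral_indicator measurableSet_Ioo]
  have hm := bracketMass_nonneg c
  calc _ ≤ ENNReal.ofReal (2 * (√(bracket d))⁻¹) * ENNReal.ofReal (bracketMass c) +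
        ENNReal.ofReal (2 * (bracket d)⁻¹) * ENNReal.ofReal (4 * √r) := by
        gcongr
        exact lintegral_inv_sqrt_abs_le hr0
    _ = _ := by
        rw [← ENNReal.ofReal_mul (by positivity), ← ENNReal.ofReal_mul (by positivity),
          ← ENNReal.ofReal_add (by positivity) (by positivity), hs4]
        congr 1
        have : bracket d = √(bracket d) ^ 2 := (Real.sq_sqrt hd.le).symm
        rw [show (bracket d)⁻¹ = (√(bracket d))⁻¹ ^ 2 by rw [inv_pow, ← this]]
        field_simp

/-- One half of the level set integral of `M cos z`: the stationary points `z = 0` and `z = π`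
contribute the two terms on the right. The substitution `μ = M cos z` turns the integral into one
with the weight `(M² - μ²)^(-1/2)`. -/
theorem lintegral_bracket_cos_le_aux {c : ℝ} (hc : 1 < c) {M : ℝ} (hM : 0 < M) (l : ℝ) :
    ∫⁻ z in Ioo 0 π, ENNReal.ofReal (bracket (l + M * Real.cos z) ^ (-c)) ≤
      ENNReal.ofReal ((2 * bracketMass c + 4) * (√M)⁻¹ *
        ((√(bracket (l + M)))⁻¹ + (√(bracket (l - M)))⁻¹)) := by
  have hnn : ∀ z, 0 ≤ bracket z ^ (-c) := fun z => Real.rpow_nonneg (bracket_pos z).le _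
  have hm := bracketMass_nonneg c
  let g : ℝ → ℝ≥0∞ := fun μ => ENNReal.ofReal (bracket (l + μ) ^ (-c) * (√(M ^ 2 - μ ^ 2))⁻¹)
  have hsub := lintegral_image_eq_lintegral_abs_deriv_mul (s := Ioo 0 π)
    (f := fun z => M * Real.cos z) (f' := fun z => M * -Real.sin z) measurableSet_Ioo
    (fun z _ => ((Real.hasDerivAt_cos z).const_mul M).hasDerivWithinAt)
    (fun x hx y hy hxy => Real.injOn_cos ⟨hx.1.le, hx.2.le⟩ ⟨hy.1.le, hy.2.le⟩
      (mul_left_cancel₀ hM.ne' hxy)) g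
  have h1 : ∫⁻ z in Ioo 0 π, ENNReal.ofReal (bracket (l + M * Real.cos z) ^ (-c)) =
      ∫⁻ z in Ioo 0 π, ENNReal.ofReal |M * -Real.sin z| * g (M * Real.cos z) := by
    refine setLIntegral_congr_fun measurableSet_Ioo fun z hz => ?_
    have hs : 0 < Real.sin z := Real.sin_pos_of_pos_of_lt_pi hz.1 hz.2
    have h2 : M ^ 2 - (M * Real.cos z) ^ 2 = (M * Real.sin z) ^ 2 := by
      have := Real.sin_sq_add_cos_sq z
      linear_combination (-M ^ 2) * this
    simp only [g]
    rw [h2, Real.sqrt_sq (by positivity), ← ENNReal.ofReal_mul (abs_nonneg _), mul_neg, abs_neg,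
      abs_of_pos (by positivity)]
    congr 1
    field_simp
  rw [h1, ← hsub]
  have hpt : ∀ μ ∈ Icc (-M) M, g μ ≤ ENNReal.ofReal (√M)⁻¹ *
      (ENNReal.ofReal (bracket (l + μ) ^ (-c) * (√|l + μ - (l + M)|)⁻¹) +
        ENNReal.ofReal (bracket (l + μ) ^ (-c) * (√|l + μ - (l - M)|)⁻¹)) := by
    intro μ hμ
    have h0 := hnn (l + μ)
    rw [← ENNReal.ofReal_add (by positivity) (by positivity), ← ENNReal.ofReal_mul (by positivity),
      ← mul_add, mul_left_comm]
    refine ENNReal.ofReal_le_ofReal (mul_le_mul_of_nonneg_left ?_ (hnn _))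
    have ha : |l + μ - (l + M)| = M - μ := by
      rw [show l + μ - (l + M) = -(M - μ) by ring, abs_neg, abs_of_nonneg (by linarith [hμ.2])]
    have hb : |l + μ - (l - M)| = M + μ := by
      rw [show l + μ - (l - M) = M + μ by ring, abs_of_nonneg (by linarith [hμ.1])]
    rw [ha, hb, show M ^ 2 - μ ^ 2 = (M - μ) * (M + μ) by ring,
      Real.sqrt_mul (by linarith [hμ.2]), mul_inv, mul_add]
    have h3 : 0 < √M := Real.sqrt_pos.mpr hM
    rcases le_total 0 μ with h | h
    · have h4 : (√(M + μ))⁻¹ ≤ (√M)⁻¹ := by gcongr; linarith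
      have h5 : 0 ≤ (√M)⁻¹ * (√(M + μ))⁻¹ := by positivity
      have h6 : 0 ≤ (√(M - μ))⁻¹ := by positivity
      nlinarith [mul_le_mul_of_nonneg_left h4 h6]
    · have h4 : (√(M - μ))⁻¹ ≤ (√M)⁻¹ := by gcongr; linarith
      have h5 : 0 ≤ (√M)⁻¹ * (√(M - μ))⁻¹ := by positivity
      have h6 : 0 ≤ (√(M + μ))⁻¹ := by positivity
      nlinarith [mul_le_mul_of_nonneg_left h4 h6]
  have hmeas : ∀ d : ℝ, Measurable fun x => ENNReal.ofReal (bracket x ^ (-c) * (√|x - d|)⁻¹) := by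
    intro d; fun_prop
  calc ∫⁻ μ in (fun z => M * Real.cos z) '' Ioo 0 π, g μ
      ≤ ∫⁻ μ in (fun z => M * Real.cos z) '' Ioo 0 π, ENNReal.ofReal (√M)⁻¹ *
      (ENNReal.ofReal (bracket (l + μ) ^ (-c) * (√|l + μ - (l + M)|)⁻¹) +
        ENNReal.ofReal (bracket (l + μ) ^ (-c) * (√|l + μ - (l - M)|)⁻¹)) := by
        have hsub' : (fun z => M * Real.cos z) '' Ioo 0 π ⊆ Icc (-M) M := by
          rintro _ ⟨z, _, rfl⟩
          have h1 := Real.neg_one_le_cos z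
          have h2 := Real.cos_le_one z
          constructor <;> nlinarith
        refine setLIntegral_mono ?_ fun μ hμ => hpt μ (hsub' hμ)
        fun_prop
    _ ≤ ∫⁻ μ, ENNReal.ofReal (√M)⁻¹ *
      (ENNReal.ofReal (bracket (l + μ) ^ (-c) * (√|l + μ - (l + M)|)⁻¹) +
        ENNReal.ofReal (bracket (l + μ) ^ (-c) * (√|l + μ - (l - M)|)⁻¹)) :=
        setLIntegral_le_lintegral _ _
    _ ≤ ENNReal.ofReal (√M)⁻¹ * (ENNReal.ofReal ((2 * bracketMass c + 4) * (√(bracket (l + M)))⁻¹) +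
          ENNReal.ofReal ((2 * bracketMass c + 4) * (√(bracket (l - M)))⁻¹)) := by
        rw [lintegral_const_mul _ (by fun_prop), lintegral_add_left (by fun_prop)]
        rw [lintegral_add_left_eq_self
            (fun x => ENNReal.ofReal (bracket x ^ (-c) * (√|x - (l + M)|)⁻¹)),
          lintegral_add_left_eq_self
            (fun x => ENNReal.ofReal (bracket x ^ (-c) * (√|x - (l - M)|)⁻¹))]
        gcongr <;> exact lintegral_bracket_mul_inv_sqrt_le hc _
    _ = _ := by
        rw [← ENNReal.ofReal_add (by positivity) (by positivity), ← ENNReal.ofReal_mul (by positivity)]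
        congr 1; ring

theorem lintegral_bracket_cos_le {c : ℝ} (hc : 1 < c) {M : ℝ} (hM : M ≠ 0) (l : ℝ) :
    ∫⁻ z in Ioo 0 π, ENNReal.ofReal (bracket (l + M * Real.cos z) ^ (-c)) ≤
      ENNReal.ofReal ((2 * bracketMass c + 4) * (√|M|)⁻¹ *
        ((√(bracket (l + M)))⁻¹ + (√(bracket (l - M)))⁻¹)) := by
  rcases lt_or_gt_of_ne hM with h | h
  · have := lintegral_bracket_cos_le_aux hc (neg_pos.mpr h) (-l)
    rw [abs_of_neg h]
    convert this using 4 with z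
    · rw [← bracket_neg]; congr 2; ring
    · rw [← bracket_neg]; congr 3; ring_nf
    · rw [← bracket_neg]; congr 3; ring_nf
  · rw [abs_of_pos h]
    exact lintegral_bracket_cos_le_aux hc h l

/-- The level set integral over an arbitrary interval of length `π`. -/
theorem lintegral_bracket_cos_Ico_le {c : ℝ} (hc : 1 < c) {M : ℝ} (hM : M ≠ 0) (l α : ℝ) :
    ∫⁻ z in Ico α (α + π), ENNReal.ofReal (bracket (l + M * Real.cos z) ^ (-c)) ≤
      ENNReal.ofReal (2 * (2 * bracketMass c + 4) * (√|M|)⁻¹ *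
        ((√(bracket (l + M)))⁻¹ + (√(bracket (l - M)))⁻¹)) := by
  have hm := bracketMass_nonneg c
  have key : ∀ k : ℤ, ∫⁻ z in Ico (k * π) (k * π + π),
      ENNReal.ofReal (bracket (l + M * Real.cos z) ^ (-c)) ≤
      ENNReal.ofReal ((2 * bracketMass c + 4) * (√|M|)⁻¹ *
        ((√(bracket (l + M)))⁻¹ + (√(bracket (l - M)))⁻¹)) := by
    intro k
    have hmp := measurePreserving_add_right (volume : Measure ℝ) (k * π)
    have hpre : (fun z : ℝ => z + k * π) ⁻¹' Ico (k * π) (k * π + π) = Ico 0 π := by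
      ext z; simp only [mem_preimage, mem_Ico]
      constructor <;> rintro ⟨_, _⟩ <;> constructor <;> linarith
    rw [← hmp.setLIntegral_comp_preimage measurableSet_Ico (by fun_prop), hpre,
      setLIntegral_congr Ioo_ae_eq_Ico.symm]
    have hcos : ∀ z : ℝ, Real.cos (z + k * π) = (-1) ^ k * Real.cos z :=
      fun z => Real.cos_add_int_mul_pi z k
    simp only [hcos]
    rcases Int.even_or_odd k with hk | hk
    · simp only [hk.neg_one_zpow, one_mul]
      exact lintegral_bracket_cos_le hc hM l
    · simp only [hk.neg_one_zpow, neg_one_mul, mul_neg, ← neg_mul]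
      have := lintegral_bracket_cos_le hc (neg_ne_zero.mpr hM) l
      rwa [abs_neg, sub_neg_eq_add, ← sub_eq_add_neg, add_comm (√(bracket (l - M)))⁻¹] at this
  set k := ⌊α / π⌋
  have h1 : (k : ℝ) * π ≤ α := by
    have := Int.floor_le (α / π)
    rwa [le_div_iff₀ pi_pos] at this
  have h2 : α < (k : ℝ) * π + π := by
    have := Int.lt_floor_add_one (α / π)
    rw [div_lt_iff₀ pi_pos] at this
    linarith
  -- the interval is covered by two of the intervals `[k π, (k + 1) π)`
  calc _ ≤ ∫⁻ z in Ico (k * π) (k * π + π) ∪ Ico ((k + 1 : ℤ) * π) ((k + 1 : ℤ) * π + π),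
        ENNReal.ofReal (bracket (l + M * Real.cos z) ^ (-c)) := by
        refine lintegral_mono_set fun z hz => ?_
        push_cast
        rcases lt_or_ge z (k * π + π) with h | h
        · exact Or.inl ⟨h1.trans hz.1, h⟩
        · exact Or.inr ⟨by linarith, by linarith [hz.2]⟩
    _ ≤ _ := lintegral_union_le _ _ _
    _ ≤ _ := add_le_add (key k) (key (k + 1))
    _ = _ := by
        rw [← ENNReal.ofReal_add (by positivity) (by positivity)]
        congr 1; ring

/-- The bound behind the bilinear estimate, for a phase `(E + 4 r cos) / h³` whose values at its
stationary points are bounded below by `|r|³ / h³`. -/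
theorem lintegral_resonance_le {c : ℝ} (hc : 1 < c) {h : ℝ} (hh : 0 < h) {S r E : ℝ}
    (hS : |S| ≤ 2 * |r|) (hp : |r| ^ 3 ≤ |E + 4 * r|) (hm : |r| ^ 3 ≤ |E - 4 * r|) (τ a : ℝ) :
    ENNReal.ofReal ((2 / h * S) ^ 2 * (√(bracket τ))⁻¹) *
      ∫⁻ ξ in freqDomain h,
        ENNReal.ofReal (bracket (τ - (E + 4 * r * Real.cos (h * ξ / 2 + a)) / h ^ 3) ^ (-c)) ≤
      ENNReal.ofReal (256 * (2 * bracketMass c + 4)) := by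
  have hB := bracketMass_nonneg c
  rcases eq_or_ne r 0 with rfl | hr
  · have : S = 0 := by simpa using hS
    simp [this]
  have hr' : 0 < |r| := abs_pos.mpr hr
  set g : ℝ → ℝ≥0∞ := fun z =>
    ENNReal.ofReal (bracket (τ - E / h ^ 3 + (-(4 * r / h ^ 3)) * Real.cos z) ^ (-c)) with hg
  have hM : -(4 * r / h ^ 3) ≠ 0 := by
    have := hh.ne'
    simp [hr, this]
  -- the substitution `z = h ξ / 2 + a` maps the frequency domain to an interval of length `π`
  have hsub := lintegral_image_eq_lintegral_abs_deriv_mul (s := freqDomain h)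
    (f := fun ξ => h * ξ / 2 + a) (f' := fun _ => h / 2) (measurableSet_freqDomain h)
    (fun ξ _ => by
      have := (((hasDerivAt_id ξ).const_mul h).div_const 2).add_const a
      simpa using this.hasDerivWithinAt)
    (fun x _ y _ hxy => by
      simp only [add_left_inj] at hxy
      have := hh.ne'
      field_simp at hxy
      exact hxy) g
  have himg : (fun ξ => h * ξ / 2 + a) '' freqDomain h ⊆ Ico (a - π / 2) (a - π / 2 + π) := by
    rintro _ ⟨ξ, hξ, rfl⟩
    have h1 : -π ≤ h * ξ := by
      have := hξ.1; rw [← neg_div, div_le_iff₀ hh] at this; linarith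
    have h2 : h * ξ < π := by
      have := hξ.2; rw [lt_div_iff₀ hh] at this; linarith
    constructor <;> simp only <;> linarith
  have h1 : ∫⁻ ξ in freqDomain h,
        ENNReal.ofReal (bracket (τ - (E + 4 * r * Real.cos (h * ξ / 2 + a)) / h ^ 3) ^ (-c)) =
      ENNReal.ofReal (2 / h) * ∫⁻ z in (fun ξ => h * ξ / 2 + a) '' freqDomain h, g z := by
    rw [hsub, abs_of_pos (by positivity), lintegral_const_mul' _ _ ENNReal.ofReal_ne_top, ← mul_assoc,
      ← ENNReal.ofReal_mul (by positivity), show 2 / h * (h / 2) = 1 by field_simp,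
      ENNReal.ofReal_one, one_mul]
    refine lintegral_congr fun ξ => ?_
    simp only [hg]
    congr 3
    ring
  have h2 : ∫⁻ z in (fun ξ => h * ξ / 2 + a) '' freqDomain h, g z ≤ _ :=
    (lintegral_mono_set himg).trans (lintegral_bracket_cos_Ico_le hc hM (τ - E / h ^ 3) _)
  rw [h1]
  refine (mul_le_mul_right (mul_le_mul_right h2 _) _).trans ?_
  rw [← ENNReal.ofReal_mul (by positivity), ← ENNReal.ofReal_mul (by positivity)]
  refine ENNReal.ofReal_le_ofReal ?_
  -- either `τ` or the modulation at the stationary point is large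
  have hDbound : ∀ D : ℝ, |r| ^ 3 ≤ |D| →
      (√(bracket τ))⁻¹ * (√(bracket (τ - D / h ^ 3)))⁻¹ ≤ (√(|r| ^ 3 / (2 * h ^ 3)))⁻¹ := by
    intro D hD
    rw [← mul_inv, ← Real.sqrt_mul (bracket_pos _).le]
    have h3 : |r| ^ 3 / (2 * h ^ 3) ≤ bracket τ * bracket (τ - D / h ^ 3) := by
      have h4 : |D / h ^ 3| ≤ bracket τ + bracket (τ - D / h ^ 3) := by
        have := bracket_sub_le_add τ (τ - D / h ^ 3)
        rw [sub_sub_cancel] at this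
        exact (abs_le_bracket _).trans this
      rw [abs_div, abs_of_pos (by positivity : 0 < h ^ 3)] at h4
      have h5 : |r| ^ 3 / (2 * h ^ 3) ≤ |D| / h ^ 3 / 2 := by
        rw [div_div, mul_comm (h ^ 3)]
        gcongr
      nlinarith [one_le_bracket τ, one_le_bracket (τ - D / h ^ 3)]
    have h6 : 0 < √(|r| ^ 3 / (2 * h ^ 3)) := Real.sqrt_pos.mpr (by positivity)
    gcongr
  have e1 : τ - E / h ^ 3 + -(4 * r / h ^ 3) = τ - (E + 4 * r) / h ^ 3 := by ring
  have e2 : τ - E / h ^ 3 - -(4 * r / h ^ 3) = τ - (E - 4 * r) / h ^ 3 := by ring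
  have e3 : |-(4 * r / h ^ 3)| = 4 * |r| / h ^ 3 := by
    rw [abs_neg, abs_div, abs_mul, abs_of_pos (by positivity : 0 < h ^ 3)]; norm_num
  rw [e1, e2, e3]
  have hS2 : (2 / h * S) ^ 2 ≤ 16 * r ^ 2 / h ^ 2 := by
    have : S ^ 2 ≤ 4 * r ^ 2 := by
      rw [← sq_abs S, ← sq_abs r]
      nlinarith [abs_nonneg S]
    rw [mul_pow, div_pow, div_mul_eq_mul_div]
    refine div_le_div_of_nonneg_right ?_ (by positivity)
    linarith
  have hprod : (√(4 * |r| / h ^ 3))⁻¹ * (√(|r| ^ 3 / (2 * h ^ 3)))⁻¹ ≤ h ^ 3 / r ^ 2 := by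
    rw [← mul_inv, ← Real.sqrt_mul (by positivity), ← inv_div (r ^ 2)]
    have : r ^ 2 / h ^ 3 ≤ √(4 * |r| / h ^ 3 * (|r| ^ 3 / (2 * h ^ 3))) := by
      refine Real.le_sqrt_of_sq_le ?_
      have : 4 * |r| / h ^ 3 * (|r| ^ 3 / (2 * h ^ 3)) = 2 * (r ^ 2 / h ^ 3) ^ 2 := by
        rw [← sq_abs r]; field_simp; ring
      rw [this]
      nlinarith [sq_nonneg (r ^ 2 / h ^ 3)]
    exact inv_anti₀ (by positivity) this
  set K := 2 * bracketMass c + 4 with hK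
  have hK0 : 0 ≤ K := by positivity
  set p := (√(bracket τ))⁻¹
  set q₁ := (√(bracket (τ - (E + 4 * r) / h ^ 3)))⁻¹
  set q₂ := (√(bracket (τ - (E - 4 * r) / h ^ 3)))⁻¹
  set M' := (√(4 * |r| / h ^ 3))⁻¹
  set N' := (√(|r| ^ 3 / (2 * h ^ 3)))⁻¹
  have hp0 : 0 ≤ p := by positivity
  have hq1 : 0 ≤ q₁ := by positivity
  have hq2 : 0 ≤ q₂ := by positivity
  have hM0 : 0 ≤ M' := by positivity
  have hN0 : 0 ≤ N' := by positivity
  calc (2 / h * S) ^ 2 * p * (2 / h * (2 * K * M' * (q₁ + q₂)))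
      = (2 / h * S) ^ 2 * (4 / h * K) * M' * (p * q₁ + p * q₂) := by ring
    _ ≤ (16 * r ^ 2 / h ^ 2) * (4 / h * K) * M' * (N' + N') := by
        gcongr
        · exact hDbound _ hp
        · exact hDbound _ hm
    _ = 128 * K * (r ^ 2 / h ^ 3) * (M' * N') := by ring
    _ ≤ 128 * K * (r ^ 2 / h ^ 3) * (h ^ 3 / r ^ 2) := by gcongr
    _ = 128 * K := by field_simp
    _ ≤ 256 * K := by linarith

/-! ### Resonances of the FPU phases -/

/-- The representative in `[-π/h, π/h)` of a frequency modulo `2π/h`. -/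
def wrap (h x : ℝ) : ℝ := x - 2 * π / h * ⌊(x + π / h) / (2 * π / h)⌋

@[fun_prop]
theorem measurable_wrap (h : ℝ) : Measurable (wrap h) := by unfold wrap; fun_prop

theorem wrap_sub_eq {h : ℝ} (hh : 0 < h) {ξ ξ₁ : ℝ} (hξ : ξ ∈ freqDomain h)
    (hξ₁ : ξ₁ ∈ freqDomain h) :
    ∃ k : ℤ, (k = -1 ∨ k = 0 ∨ k = 1) ∧ wrap h (ξ - ξ₁) = ξ - ξ₁ + 2 * π / h * k := by
  have hp : 0 < 2 * π / h := by positivity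
  have h3 : 2 * π / h = π / h + π / h := by ring
  have hb1 := hξ.1
  have hb2 := hξ.2
  have hb3 := hξ₁.1
  have hb4 := hξ₁.2
  have h1 : -1 ≤ ⌊(ξ - ξ₁ + π / h) / (2 * π / h)⌋ := by
    rw [Int.le_floor, le_div_iff₀ hp]; push_cast; nlinarith
  have h2 : ⌊(ξ - ξ₁ + π / h) / (2 * π / h)⌋ < 2 := by
    rw [Int.floor_lt, div_lt_iff₀ hp]; push_cast; nlinarith
  refine ⟨-⌊(ξ - ξ₁ + π / h) / (2 * π / h)⌋, by omega, ?_⟩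
  rw [wrap]; push_cast; ring

theorem abs_le_abs_add_abs_wrap {h : ℝ} (hh : 0 < h) {ξ ξ₁ : ℝ} (hξ : ξ ∈ freqDomain h)
    (hξ₁ : ξ₁ ∈ freqDomain h) : |ξ| ≤ |ξ₁| + |wrap h (ξ - ξ₁)| := by
  obtain ⟨k, hk, he⟩ := wrap_sub_eq hh hξ hξ₁
  have hb1 := hξ.1
  have hb2 := hξ.2
  have h3 : 2 * π / h = π / h + π / h := by ring
  have h4 := le_abs_self ξ₁
  have h5 := neg_abs_le ξ₁
  have h6 := le_abs_self (wrap h (ξ - ξ₁))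
  have h7 := neg_abs_le (wrap h (ξ - ξ₁))
  rcases hk with rfl | rfl | rfl <;> push_cast at he <;> rw [abs_le] <;> constructor <;> nlinarith

/-- The phase `σ (ξ/h² - ε (2/h³) sin (hξ/2))`. For `ε = 1` it is the one of the propagator with
sign `σ`, for `ε = -1` it is the one of the other component after the shift to the frame of the
component with sign `σ`. -/
def phase (h σ ε ξ : ℝ) : ℝ := σ * (ξ / h ^ 2 - ε * (2 / h ^ 3 * Real.sin (h * ξ / 2)))

@[fun_prop]
theorem measurable_phase (h σ ε : ℝ) : Measurable (phase h σ ε) := by unfold phase; fun_prop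

theorem phase_one {h : ℝ} (hh : 0 < h) (σ ξ : ℝ) : phase h σ 1 ξ = σ * dispersion h ξ := by
  rw [phase, dispersion]; field_simp

theorem phase_neg (h σ ε ξ : ℝ) : phase h σ ε (-ξ) = -phase h σ ε ξ := by
  have : h * -ξ / 2 = -(h * ξ / 2) := by ring
  rw [phase, phase, this, Real.sin_neg]; ring

/-- The resonance function of the interaction of two waves with frequencies `ξ₁` and
`ξ - ξ₁` modulo `2π/h`. -/
def resonance (h σ ε₁ ε₂ ξ ξ₁ : ℝ) : ℝ :=
  phase h σ ε₁ ξ₁ + phase h σ ε₂ (wrap h (ξ - ξ₁)) - phase h σ 1 ξ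

theorem measurable_resonance (h σ ε₁ ε₂ : ℝ) :
    Measurable (fun p : ℝ × ℝ => resonance h σ ε₁ ε₂ p.1 p.2) := by
  unfold resonance
  have := measurable_phase h σ
  fun_prop

/-- The maximum of the left hand side is `3√3`, attained at `v = 1/2`. -/
theorem four_mul_one_add_le {u v : ℝ} (huv : u ^ 2 + v ^ 2 = 1) :
    4 * u * (1 + v) ≤ 5.25 := by
  have h1 : (u * (1 + v)) ^ 2 ≤ 27 / 16 := by
    have : (u * (1 + v)) ^ 2 = (1 - v) * (1 + v) ^ 3 := by
      rw [mul_pow, show u ^ 2 = 1 - v ^ 2 by linarith]; ring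
    rw [this]
    nlinarith [mul_nonneg (sq_nonneg (v - 1 / 2)) (add_nonneg (sq_nonneg (v + 3 / 2)) zero_le_one),
      sq_nonneg (v - 1 / 2)]
  nlinarith

/-- The lower bound for the resonance function at its stationary points. Without aliasing (`k = 0`)
it is the cubic bound known from the Korteweg-de Vries equation; aliased interactions are far from
resonant because `2π` exceeds the maximum `3√3` of `4 sin p (1 + cos p)`. -/
theorem resonance_lower_bound {u v w : ℝ} (huv : u ^ 2 + v ^ 2 = 1) {k : ℤ}
    (hk : k = -1 ∨ k = 0 ∨ k = 1) (hw : |w| = |u| * |v|) (hw0 : k = 0 → w = u * v) :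
    |u| ^ 3 ≤ |2 * π * k + 4 * w + 4 * u| ∧ |u| ^ 3 ≤ |2 * π * k + 4 * w - 4 * u| := by
  have hu1 : |u| ≤ 1 := by rw [abs_le]; constructor <;> nlinarith
  have hv1 : |v| ≤ 1 := by rw [abs_le]; constructor <;> nlinarith
  have huv' : |u| ^ 2 + |v| ^ 2 = 1 := by simpa using huv
  have hu0 := abs_nonneg u
  have hv0 := abs_nonneg v
  by_cases hk0 : k = 0
  · subst hk0
    have aux : ∀ z : ℝ, 1 - |v| ≤ |z| → |u| ^ 3 ≤ |4 * (u * z)| := by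
      intro z hz
      rw [abs_mul, abs_mul, abs_of_pos (by norm_num : (0:ℝ) < 4)]
      have h1 : |u| ^ 2 ≤ 2 * (1 - |v|) := by nlinarith
      have h2 : |u| ^ 2 ≤ 4 * |z| := by nlinarith
      nlinarith
    rw [hw0 rfl]
    constructor
    · have h1 := aux (v + 1) (by
        have := abs_sub_abs_le_abs_sub 1 (-v)
        rw [abs_one, abs_neg, sub_neg_eq_add, add_comm 1 v] at this; exact this)
      convert h1 using 2; push_cast; ring
    · have h1 := aux (v - 1) (by
        have := abs_sub_abs_le_abs_sub 1 v
        rw [abs_one, abs_sub_comm 1 v] at this; exact this)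
      convert h1 using 2; push_cast; ring
  · have h1 := four_mul_one_add_le huv'
    have h2 : |u| ^ 3 ≤ 1 := pow_le_one₀ hu0 hu1
    have h3 := pi_gt_d2
    have h4 : |4 * w| ≤ 4 * |u| * |v| := by
      rw [abs_mul, hw, abs_of_pos (by norm_num : (0:ℝ) < 4)]; linarith
    have h5 := abs_le.mp h4
    have h6 : |4 * u| = 4 * |u| := by rw [abs_mul, abs_of_pos (by norm_num : (0:ℝ) < 4)]
    have h7 := abs_le.mp h6.le
    rcases hk with rfl | rfl | rfl
    · push_cast
      constructor <;> rw [le_abs] <;> right <;> linarith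
    · exact absurd rfl hk0
    · push_cast
      constructor <;> rw [le_abs] <;> left <;> linarith

theorem sin_two_mul_sub_int {p : ℝ} {k : ℤ} (hk : k = -1 ∨ k = 0 ∨ k = 1) :
    |Real.sin (2 * p - π * k)| = 2 * (|Real.sin p| * |Real.cos p|) ∧
      (k = 0 → Real.sin (2 * p - π * k) = 2 * (Real.sin p * Real.cos p)) := by
  have h0 : Real.sin (2 * p) = 2 * (Real.sin p * Real.cos p) := by rw [Real.sin_two_mul]; ring
  have habs : |Real.sin (2 * p)| = 2 * (|Real.sin p| * |Real.cos p|) := by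
    rw [h0, abs_mul, abs_mul, abs_of_pos (by norm_num : (0:ℝ) < 2)]
  refine ⟨?_, fun hk0 => by rw [hk0]; simpa using h0⟩
  rcases hk with rfl | rfl | rfl
  · have : 2 * p - π * ((-1 : ℤ) : ℝ) = 2 * p + π := by push_cast; ring
    rw [this, Real.sin_add_pi, abs_neg, habs]
  · simpa using habs
  · have : 2 * p - π * ((1 : ℤ) : ℝ) = 2 * p - π := by push_cast; ring
    rw [this, Real.sin_sub_pi, abs_neg, habs]

/-- For interactions with aliasing number `k` the resonance function is `(E + 4 r cos) / h³` with
parameters to which `lintegral_resonance_le` applies. -/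
theorem resonance_eq {h : ℝ} (hh : 0 < h) {σ ε₁ ε₂ : ℝ} (hσ : σ = 1 ∨ σ = -1)
    (hε₁ : ε₁ = 1 ∨ ε₁ = -1) (hε₂ : ε₂ = 1 ∨ ε₂ = -1) (ξ : ℝ) {k : ℤ}
    (hk : k = -1 ∨ k = 0 ∨ k = 1) :
    ∃ E r a : ℝ, |Real.sin (h * ξ / 2)| ≤ 2 * |r| ∧ |r| ^ 3 ≤ |E + 4 * r| ∧ |r| ^ 3 ≤ |E - 4 * r| ∧
      ∀ ξ₁, wrap h (ξ - ξ₁) = ξ - ξ₁ + 2 * π / h * k →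
        resonance h σ ε₁ ε₂ ξ ξ₁ = (E + 4 * r * Real.cos (h * ξ₁ / 2 + a)) / h ^ 3 := by
  -- the mean of the half-phases `h ξ₁ / 2` and `h ξ₂ / 2` of the two interacting waves
  set p := (h * ξ / 2 + π * k) / 2 with hp
  have ha : h * ξ / 2 = 2 * p - π * k := by rw [hp]; ring
  obtain ⟨hs1, hs2⟩ := sin_two_mul_sub_int (p := p) hk
  rw [← ha] at hs1 hs2
  have hsc := Real.sin_sq_add_cos_sq p
  have hsgn : ∀ u E : ℝ, |u| ^ 3 ≤ |E + 4 * u| ∧ |u| ^ 3 ≤ |E - 4 * u| → ∀ δ : ℝ, δ = 1 ∨ δ = -1 →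
      |(-(σ * δ)) * u| ^ 3 ≤ |σ * E + 4 * ((-(σ * δ)) * u)| ∧
      |(-(σ * δ)) * u| ^ 3 ≤ |σ * E - 4 * ((-(σ * δ)) * u)| := by
    rintro u E ⟨h1, h2⟩ δ hδ
    have e1 : |-(1 * E) + 4 * u| = |E - 4 * u| := by rw [← abs_neg]; ring_nf
    have e2 : |-(1 * E) - 4 * u| = |E + 4 * u| := by rw [← abs_neg]; ring_nf
    rcases hσ with rfl | rfl <;> rcases hδ with rfl | rfl <;>
      simp only [mul_one, one_mul, mul_neg, neg_mul, neg_neg, abs_neg, sub_neg_eq_add] at * <;>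
      simp only [← sub_eq_add_neg, *, and_self]
  have habs : ∀ δ u : ℝ, δ = 1 ∨ δ = -1 → |(-(σ * δ)) * u| = |u| := by
    intro δ u hδ
    rcases hσ with rfl | rfl <;> rcases hδ with rfl | rfl <;> simp
  have hc1 := Real.abs_cos_le_one p
  have hs1' := Real.abs_sin_le_one p
  have hcomm : ∀ ξ₁, wrap h (ξ - ξ₁) = ξ - ξ₁ + 2 * π / h * k →
      resonance h σ ε₁ ε₂ ξ ξ₁ = σ * ((2 * π * k + 2 * Real.sin (h * ξ / 2)) -
        2 * (ε₁ * Real.sin (h * ξ₁ / 2) + ε₂ * Real.sin (2 * p - h * ξ₁ / 2))) / h ^ 3 := by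
    intro ξ₁ h1
    have h2 : h * (ξ - ξ₁ + 2 * π / h * k) / 2 = 2 * p - h * ξ₁ / 2 := by
      rw [hp]; field_simp; ring
    rw [resonance, h1, phase, phase, phase, h2]
    field_simp
    ring
  -- the sum of two sines, with amplitude `sin p`, or their difference, with amplitude `cos p`
  by_cases hε : ε₁ = ε₂
  · obtain ⟨b1, b2⟩ := resonance_lower_bound hsc hk (w := Real.sin (h * ξ / 2) / 2)
      (by rw [abs_div, hs1]; norm_num) (fun h0 => by rw [hs2 h0]; ring)
    obtain ⟨c1, c2⟩ := hsgn _ _ ⟨b1, b2⟩ ε₁ hε₁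
    refine ⟨σ * (2 * π * k + 4 * (Real.sin (h * ξ / 2) / 2)), -(σ * ε₁) * Real.sin p, -p, ?_, c1, c2,
      fun ξ₁ h1 => ?_⟩
    · rw [habs _ _ hε₁, hs1]
      nlinarith [abs_nonneg (Real.sin p)]
    · rw [hcomm ξ₁ h1, ← hε]
      have : Real.sin (h * ξ₁ / 2) + Real.sin (2 * p - h * ξ₁ / 2) =
          2 * Real.sin p * Real.cos (h * ξ₁ / 2 + -p) := by
        have e1 : h * ξ₁ / 2 = p + (h * ξ₁ / 2 + -p) := by ring
        have e2 : 2 * p - h * ξ₁ / 2 = p - (h * ξ₁ / 2 + -p) := by ring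
        rw [e2]
        conv_lhs => rw [e1]
        rw [Real.sin_add, Real.sin_sub]; ring_nf
      rw [← mul_add, this]
      ring
  · have hε' : ε₂ = -ε₁ := by
      rcases hε₁ with rfl | rfl <;> rcases hε₂ with rfl | rfl <;> simp_all
    obtain ⟨b1, b2⟩ := resonance_lower_bound (u := Real.cos p) (v := Real.sin p)
      (by rw [add_comm]; exact hsc) hk (w := Real.sin (h * ξ / 2) / 2)
      (by rw [abs_div, hs1]; norm_num; ring) (fun h0 => by rw [hs2 h0]; ring)
    obtain ⟨c1, c2⟩ := hsgn _ _ ⟨b1, b2⟩ ε₁ hε₁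
    refine ⟨σ * (2 * π * k + 4 * (Real.sin (h * ξ / 2) / 2)), -(σ * ε₁) * Real.cos p, -p - π / 2, ?_,
      c1, c2, fun ξ₁ h1 => ?_⟩
    · rw [habs _ _ hε₁, hs1]
      nlinarith [abs_nonneg (Real.cos p)]
    · rw [hcomm ξ₁ h1, hε']
      have : Real.sin (h * ξ₁ / 2) - Real.sin (2 * p - h * ξ₁ / 2) =
          2 * Real.cos p * Real.cos (h * ξ₁ / 2 + (-p - π / 2)) := by
        have e0 : h * ξ₁ / 2 + (-p - π / 2) = h * ξ₁ / 2 + -p - π / 2 := by ring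
        have e1 : h * ξ₁ / 2 = p + (h * ξ₁ / 2 + -p) := by ring
        have e2 : 2 * p - h * ξ₁ / 2 = p - (h * ξ₁ / 2 + -p) := by ring
        rw [e0, Real.cos_sub_pi_div_two, e2]
        conv_lhs => rw [e1]
        rw [Real.sin_add, Real.sin_sub]; ring_nf
      have e3 : ε₁ * Real.sin (h * ξ₁ / 2) + -ε₁ * Real.sin (2 * p - h * ξ₁ / 2) =
        ε₁ * (Real.sin (h * ξ₁ / 2) - Real.sin (2 * p - h * ξ₁ / 2)) := by ring
      rw [e3, this]
      ring

/-- The kernel bound of the bilinear estimate, uniformly in the mesh `h`. -/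
theorem resonance_kernel_le {c : ℝ} (hc : 1 < c) {h : ℝ} (hh : 0 < h) {σ ε₁ ε₂ : ℝ}
    (hσ : σ = 1 ∨ σ = -1) (hε₁ : ε₁ = 1 ∨ ε₁ = -1) (hε₂ : ε₂ = 1 ∨ ε₂ = -1) {ξ : ℝ}
    (hξ : ξ ∈ freqDomain h) (τ : ℝ) :
    ENNReal.ofReal ((2 / h * Real.sin (h * ξ / 2)) ^ 2 * (√(bracket τ))⁻¹) *
      ∫⁻ ξ₁ in freqDomain h, ENNReal.ofReal (bracket (τ - resonance h σ ε₁ ε₂ ξ ξ₁) ^ (-c)) ≤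
      ENNReal.ofReal (768 * (2 * bracketMass c + 4)) := by
  have hB := bracketMass_nonneg c
  obtain ⟨E₁, r₁, a₁, hS₁, hp₁, hm₁, he₁⟩ := resonance_eq hh hσ hε₁ hε₂ ξ (k := -1) (by simp)
  obtain ⟨E₂, r₂, a₂, hS₂, hp₂, hm₂, he₂⟩ := resonance_eq hh hσ hε₁ hε₂ ξ (k := 0) (by simp)
  obtain ⟨E₃, r₃, a₃, hS₃, hp₃, hm₃, he₃⟩ := resonance_eq hh hσ hε₁ hε₂ ξ (k := 1) (by simp)
  let f : ℝ → ℝ → ℝ → ℝ → ℝ≥0∞ := fun E r a ξ₁ =>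
    ENNReal.ofReal (bracket (τ - (E + 4 * r * Real.cos (h * ξ₁ / 2 + a)) / h ^ 3) ^ (-c))
  have hf : ∀ E r a, Measurable (f E r a) := fun E r a => by simp only [f]; fun_prop
  have hle : ∫⁻ ξ₁ in freqDomain h, ENNReal.ofReal (bracket (τ - resonance h σ ε₁ ε₂ ξ ξ₁) ^ (-c)) ≤
      ∫⁻ ξ₁ in freqDomain h, (f E₁ r₁ a₁ ξ₁ + f E₂ r₂ a₂ ξ₁ + f E₃ r₃ a₃ ξ₁) := by
    refine setLIntegral_mono (by fun_prop) fun ξ₁ hξ₁ => ?_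
    obtain ⟨k, hk, hw⟩ := wrap_sub_eq hh hξ hξ₁
    rcases hk with rfl | rfl | rfl
    · rw [he₁ ξ₁ hw]; exact le_self_add.trans le_self_add
    · rw [he₂ ξ₁ hw]; exact le_add_self.trans le_self_add
    · rw [he₃ ξ₁ hw]; exact le_add_self
  refine (mul_le_mul_right hle _).trans ?_
  rw [lintegral_add_left (by fun_prop), lintegral_add_left (by fun_prop), mul_add, mul_add]
  refine (add_le_add (add_le_add (lintegral_resonance_le hc hh hS₁ hp₁ hm₁ τ a₁)
    (lintegral_resonance_le hc hh hS₂ hp₂ hm₂ τ a₂))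
    (lintegral_resonance_le hc hh hS₃ hp₃ hm₃ τ a₃)).trans ?_
  rw [← ENNReal.ofReal_add (by positivity) (by positivity),
    ← ENNReal.ofReal_add (by positivity) (by positivity)]
  refine ENNReal.ofReal_le_ofReal (le_of_eq ?_)
  ring
/-! ### Densities of space-time functions and the bilinear estimate -/

/-- Lebesgue measure on the space-time frequencies `(ξ, τ)` with `ξ ∈ [-π/h, π/h)`. -/
def specMeasure (h : ℝ) : Measure (ℝ × ℝ) := (volume.restrict (freqDomain h)).prod volume

instance (h : ℝ) : SFinite (specMeasure h) := by unfold specMeasure; infer_instance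

/-- The inverse weight `⟨ξ⟩^{-s} ⟨τ⟩^{-b}` of the Bourgain space. -/
def invWeight (s b : ℝ) (p : ℝ × ℝ) : ℝ := bracket p.1 ^ (-s) * bracket p.2 ^ (-b)

theorem invWeight_pos (s b : ℝ) (p : ℝ × ℝ) : 0 < invWeight s b p :=
  mul_pos (Real.rpow_pos_of_pos (bracket_pos _) _) (Real.rpow_pos_of_pos (bracket_pos _) _)

@[fun_prop]
theorem measurable_invWeight (s b : ℝ) : Measurable (invWeight s b) := by
  unfold invWeight; fun_prop

/-- The plane wave `e^{i (t (τ + φ(ξ)) + h n ξ)}`. -/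
def planeWave (h : ℝ) (φ : ℝ → ℝ) (t : ℝ) (n : ℤ) (p : ℝ × ℝ) : ℂ :=
  Complex.exp (Complex.I * ((t * (p.2 + φ p.1) + h * n * p.1 : ℝ) : ℂ))

theorem norm_planeWave (h : ℝ) (φ : ℝ → ℝ) (t : ℝ) (n : ℤ) (p : ℝ × ℝ) :
    ‖planeWave h φ t n p‖ = 1 := by
  rw [planeWave, mul_comm, Complex.norm_exp_ofReal_mul_I]

theorem measurable_planeWave (h : ℝ) {φ : ℝ → ℝ} (hφ : Measurable φ) (t : ℝ) (n : ℤ) :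
    Measurable (planeWave h φ t n) := by
  unfold planeWave; fun_prop

/-- The lattice function at time `t` that is the superposition with density `W` of the waves
`e^{i (t (τ + φ(ξ)) + x ξ)}`. Thus `W` is the space-time Fourier transform, up to a constant, in the
frame moving along the characteristic surface `τ = φ(ξ)`. -/
def syn (h : ℝ) (φ : ℝ → ℝ) (W : ℝ × ℝ → ℂ) (t : ℝ) (n : ℤ) : ℂ :=
  ((1 / (2 * π) : ℝ) : ℂ) * ∫ p, planeWave h φ t n p * W p ∂specMeasure h

/-- The transform in `τ` of the density `W`, a function of the frequency at the time `t`. -/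
def profile (W : ℝ × ℝ → ℂ) (t ξ : ℝ) : ℂ :=
  ∫ τ : ℝ, Complex.exp (Complex.I * ((t * τ : ℝ) : ℂ)) * W (ξ, τ)

/-- The square of the norm in `L²` of a density. -/
def energy (h : ℝ) (A : ℝ × ℝ → ℂ) : ℝ≥0∞ := ∫⁻ p, ‖A p‖ₑ ^ 2 ∂specMeasure h

theorem sq_lintegral_mul_le {α : Type*} [MeasurableSpace α] {μ : Measure α} {f g : α → ℝ≥0∞}
    (hf : AEMeasurable f μ) (hg : AEMeasurable g μ) :
    (∫⁻ x, f x * g x ∂μ) ^ 2 ≤ (∫⁻ x, f x ^ 2 ∂μ) * ∫⁻ x, g x ^ 2 ∂μ := by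
  have := ENNReal.lintegral_mul_le_Lp_mul_Lq μ (p := 2) (q := 2)
    (by constructor <;> norm_num) hf hg
  simp only [Pi.mul_apply, ENNReal.rpow_ofNat] at this
  calc _ ≤ ((∫⁻ x, f x ^ 2 ∂μ) ^ (1 / 2 : ℝ) * (∫⁻ x, g x ^ 2 ∂μ) ^ (1 / 2 : ℝ)) ^ 2 := by gcongr
    _ = _ := by
      rw [mul_pow, ← ENNReal.rpow_natCast, ← ENNReal.rpow_mul, ← ENNReal.rpow_natCast,
        ← ENNReal.rpow_mul]
      norm_num

theorem energy_lt_top {h : ℝ} {A : ℝ × ℝ → ℂ} (hA : MemLp A 2 (specMeasure h)) :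
    energy h A < ⊤ := by
  have := hA.eLpNorm_lt_top
  rw [eLpNorm_lt_top_iff_lintegral_rpow_enorm_lt_top (by norm_num) (by norm_num)] at this
  simpa [energy] using this

theorem memLp_of_energy_lt_top {h : ℝ} {A : ℝ × ℝ → ℂ}
    (hA : AEStronglyMeasurable A (specMeasure h)) (hE : energy h A < ⊤) :
    MemLp A 2 (specMeasure h) := by
  refine ⟨hA, ?_⟩
  rw [eLpNorm_lt_top_iff_lintegral_rpow_enorm_lt_top (by norm_num) (by norm_num)]
  simpa [energy] using hE

theorem bracket_rpow_neg_le_one {s : ℝ} (hs : 0 ≤ s) (x : ℝ) : bracket x ^ (-s) ≤ 1 :=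
  Real.rpow_le_one_of_one_le_of_nonpos (one_le_bracket x) (by linarith)

theorem rpow_neg_sq {x : ℝ} (hx : 0 < x) (b : ℝ) : (x ^ (-b)) ^ 2 = x ^ (-(2 * b)) := by
  rw [← Real.rpow_natCast, ← Real.rpow_mul hx.le]
  congr 1; push_cast; ring

theorem memLp_invWeight (h : ℝ) {s b : ℝ} (hs : 0 ≤ s) (hb : 1 / 2 < b) :
    MemLp (fun p => (invWeight s b p : ℂ)) 2 (specMeasure h) := by
  refine memLp_of_energy_lt_top (by fun_prop) ?_
  have hle : energy h (fun p => (invWeight s b p : ℂ)) ≤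
      ∫⁻ p : ℝ × ℝ, 1 * ENNReal.ofReal (bracket p.2 ^ (-(2 * b))) ∂specMeasure h := by
    refine lintegral_mono fun p => ?_
    simp only [one_mul, ← ofReal_norm, Complex.norm_real, Real.norm_eq_abs,
      abs_of_pos (invWeight_pos s b p)]
    rw [← ENNReal.ofReal_pow (invWeight_pos s b p).le, ← rpow_neg_sq (bracket_pos _), invWeight]
    refine ENNReal.ofReal_le_ofReal ?_
    have h1 := bracket_rpow_neg_le_one hs p.1
    have h2 : 0 ≤ bracket p.1 ^ (-s) := Real.rpow_nonneg (bracket_pos _).le _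
    have h3 : 0 ≤ bracket p.2 ^ (-b) := Real.rpow_nonneg (bracket_pos _).le _
    gcongr
    exact mul_le_of_le_one_left h3 h1
  refine hle.trans_lt ?_
  have hprod := lintegral_prod_mul (μ := volume.restrict (freqDomain h)) (ν := volume)
    (f := fun _ : ℝ => (1 : ℝ≥0∞)) (g := fun τ : ℝ => ENNReal.ofReal (bracket τ ^ (-(2 * b))))
    (by fun_prop) (by fun_prop)
  rw [lintegral_bracket_rpow (by linarith)] at hprod
  rw [specMeasure, hprod]
  refine ENNReal.mul_lt_top ?_ ENNReal.ofReal_lt_top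
  simp only [lintegral_one]
  exact measure_lt_top _ _

theorem integrable_invWeight_mul {h s b : ℝ} (hs : 0 ≤ s) (hb : 1 / 2 < b) {A : ℝ × ℝ → ℂ}
    (hA : MemLp A 2 (specMeasure h)) :
    Integrable (fun p => (invWeight s b p : ℂ) * A p) (specMeasure h) :=
  (memLp_invWeight h hs hb).integrable_mul hA

theorem integrable_planeWave_mul {h : ℝ} {φ : ℝ → ℝ} (hφ : Measurable φ) {W : ℝ × ℝ → ℂ}
    (hW : Integrable W (specMeasure h)) (t : ℝ) (n : ℤ) :
    Integrable (fun p => planeWave h φ t n p * W p) (specMeasure h) :=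
  hW.bdd_mul (c := 1) (measurable_planeWave h hφ t n).aestronglyMeasurable
    (Eventually.of_forall fun p => (norm_planeWave h φ t n p).le)

theorem integrable_exp_mul {h : ℝ} {φ : ℝ → ℝ} (hφ : Measurable φ) {W : ℝ × ℝ → ℂ}
    (hW : Integrable W (specMeasure h)) (t : ℝ) :
    Integrable (fun p : ℝ × ℝ => Complex.exp (Complex.I * ((t * φ p.1 : ℝ) : ℂ)) *
      (Complex.exp (Complex.I * ((t * p.2 : ℝ) : ℂ)) * W p)) (specMeasure h) := by
  refine (hW.bdd_mul (c := 1) ?_ (Eventually.of_forall fun p => ?_)).bdd_mul (c := 1) ?_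
    (Eventually.of_forall fun p => ?_)
  · exact (by fun_prop : Measurable _).aestronglyMeasurable
  · rw [mul_comm, Complex.norm_exp_ofReal_mul_I]
  · exact (by fun_prop : Measurable _).aestronglyMeasurable
  · rw [mul_comm, Complex.norm_exp_ofReal_mul_I]

theorem integrableOn_exp_mul_profile {h : ℝ} {φ : ℝ → ℝ} (hφ : Measurable φ) {W : ℝ × ℝ → ℂ}
    (hW : Integrable W (specMeasure h)) (t : ℝ) :
    IntegrableOn (fun ξ => Complex.exp (Complex.I * ((t * φ ξ : ℝ) : ℂ)) * profile W t ξ)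
      (freqDomain h) := by
  have := (integrable_exp_mul hφ hW t).integral_prod_left
  simp only [integral_const_mul] at this
  exact this

theorem syn_eq_invDFT {h : ℝ} {φ : ℝ → ℝ} (hφ : Measurable φ) {W : ℝ × ℝ → ℂ}
    (hW : Integrable W (specMeasure h)) (t : ℝ) (n : ℤ) :
    syn h φ W t n =
      invDFT h (fun ξ => Complex.exp (Complex.I * ((t * φ ξ : ℝ) : ℂ)) * profile W t ξ) n := by
  rw [syn, invDFT, specMeasure, integral_prod _ (integrable_planeWave_mul hφ hW t n)]
  congr 1
  refine integral_congr_ae (Eventually.of_forall fun ξ => ?_)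
  simp only [profile]
  rw [mul_right_comm, ← integral_const_mul]
  refine integral_congr_ae (Eventually.of_forall fun τ => ?_)
  simp only [planeWave]
  rw [← mul_assoc, ← Complex.exp_add, ← Complex.exp_add]
  congr 2
  push_cast; ring

theorem syn_congr {h : ℝ} {φ : ℝ → ℝ} {W W' : ℝ × ℝ → ℂ} (hW : W =ᵐ[specMeasure h] W') (t : ℝ)
    (n : ℤ) : syn h φ W t n = syn h φ W' t n := by
  rw [syn, syn]
  congr 1
  exact integral_congr_ae (hW.mono fun p hp => by simp only [hp])

theorem syn_add {h : ℝ} {φ : ℝ → ℝ} (hφ : Measurable φ) {W W' : ℝ × ℝ → ℂ}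
    (hW : Integrable W (specMeasure h)) (hW' : Integrable W' (specMeasure h)) (t : ℝ) (n : ℤ) :
    syn h φ (fun p => W p + W' p) t n = syn h φ W t n + syn h φ W' t n := by
  simp only [syn, mul_add]
  rw [integral_add (integrable_planeWave_mul hφ hW t n) (integrable_planeWave_mul hφ hW' t n),
    mul_add]

/-- Translations modulo `2π/h` preserve Lebesgue measure on the frequency domain. -/
theorem measurePreserving_wrap {h : ℝ} (hh : 0 < h) (ξ₁ : ℝ) :
    MeasurePreserving (fun ξ => wrap h (ξ - ξ₁)) (volume.restrict (freqDomain h))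
      (volume.restrict (freqDomain h)) := by
  have hp : 0 < 2 * π / h := by positivity
  have hmeas : Measurable (fun ξ => wrap h (ξ - ξ₁)) := by fun_prop
  refine ⟨hmeas, ?_⟩
  have hset : ∀ a : ℝ, a - π / h + 2 * π / h = a + π / h := fun a => by ring
  have hper : ∀ x : ℝ, ∀ k : ℤ, wrap h (x + k * (2 * π / h)) = wrap h x := by
    intro x k
    have : (x + k * (2 * π / h) + π / h) / (2 * π / h) = (x + π / h) / (2 * π / h) + k := by
      field_simp; ring
    rw [wrap, wrap, this, Int.floor_add_intCast]
    push_cast; ring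
  have hid : ∀ x ∈ freqDomain h, wrap h x = x := by
    intro x hx
    have h1 : ⌊(x + π / h) / (2 * π / h)⌋ = 0 := by
      rw [Int.floor_eq_zero_iff]
      refine ⟨div_nonneg (by linarith [hx.1]) hp.le, ?_⟩
      rw [div_lt_one hp]
      have : 2 * π / h = π / h + π / h := by ring
      linarith [hx.2]
    rw [wrap, h1]; simp
  ext S hS
  rw [Measure.map_apply hmeas hS]
  have e1 : ∀ T : Set ℝ, MeasurableSet T → (volume.restrict (freqDomain h)) T =
      ∫⁻ ξ in Ioc (-(π / h)) (π / h), T.indicator 1 ξ := by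
    intro T hT
    rw [restrict_freqDomain, lintegral_indicator_one hT]
  rw [e1 _ (hmeas hS), e1 _ hS]
  have hmp := measurePreserving_sub_right (volume : Measure ℝ) ξ₁
  have hpre : (fun ξ => ξ - ξ₁) ⁻¹' Ioc (-ξ₁ - π / h) (-ξ₁ + π / h) = Ioc (-(π / h)) (π / h) := by
    ext x; simp only [mem_preimage, mem_Ioc]
    constructor <;> rintro ⟨_, _⟩ <;> constructor <;> linarith
  have h1 := hmp.setLIntegral_comp_preimage (s := Ioc (-ξ₁ - π / h) (-ξ₁ + π / h))
    measurableSet_Ioc (f := fun x => (S.indicator 1 (wrap h x) : ℝ≥0∞))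
    ((measurable_one.indicator hS).comp (measurable_wrap h))
  rw [hpre] at h1
  have h2 := (isAddFundamentalDomain_Ioc hp (-ξ₁ - π / h)).setLIntegral_eq
    (isAddFundamentalDomain_Ioc hp (-(π / h))) (fun x => (S.indicator 1 (wrap h x) : ℝ≥0∞))
    (by
      rintro ⟨_, k, rfl⟩ x
      have : (⟨(fun x => x • (2 * π / h)) k, ⟨k, rfl⟩⟩ : AddSubgroup.zmultiples (2 * π / h)) +ᵥ x =
          x + k * (2 * π / h) := by
        rw [AddSubgroup.vadd_def]; simp [add_comm]
      rw [this, hper])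
  rw [hset, show -(π / h) + 2 * π / h = π / h by ring] at h2
  have h3 : (fun ξ => (((fun ξ => wrap h (ξ - ξ₁)) ⁻¹' S).indicator 1 ξ : ℝ≥0∞)) =
      fun ξ => (S.indicator 1 (wrap h (ξ - ξ₁)) : ℝ≥0∞) := by
    funext ξ
    by_cases hx : wrap h (ξ - ξ₁) ∈ S
    · have hx' : ξ ∈ (fun ξ => wrap h (ξ - ξ₁)) ⁻¹' S := hx
      rw [indicator_of_mem hx, indicator_of_mem hx']; rfl
    · have hx' : ξ ∉ (fun ξ => wrap h (ξ - ξ₁)) ⁻¹' S := hx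
      rw [indicator_of_notMem hx, indicator_of_notMem hx']
  rw [h3, h1, h2, ← restrict_freqDomain]
  refine setLIntegral_congr_fun (measurableSet_freqDomain h) fun x hx => ?_
  simp only [hid x hx]

/-- The frequencies of the second wave in an interaction: `p` is the output, `p₁` the first
wave. -/
def secondFreq (h σ ε₁ ε₂ : ℝ) (p p₁ : ℝ × ℝ) : ℝ × ℝ :=
  (wrap h (p.1 - p₁.1), p.2 - p₁.2 - resonance h σ ε₁ ε₂ p.1 p₁.1)

theorem measurable_secondFreq (h σ ε₁ ε₂ : ℝ) :
    Measurable (fun q : (ℝ × ℝ) × (ℝ × ℝ) => secondFreq h σ ε₁ ε₂ q.1 q.2) := by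
  have := (measurable_resonance h σ ε₁ ε₂).comp
    ((measurable_fst.comp measurable_fst).prodMk (measurable_fst.comp measurable_snd) :
      Measurable (fun q : (ℝ × ℝ) × (ℝ × ℝ) => (q.1.1, q.2.1)))
  refine Measurable.prodMk (by fun_prop) ?_
  exact Measurable.sub (by fun_prop) this

/-- The change of variables from the frequencies of output and first wave to those of the two
waves preserves the measure. -/
theorem measurePreserving_interaction {h : ℝ} (hh : 0 < h) (σ ε₁ ε₂ : ℝ) :
    MeasurePreserving (fun q : (ℝ × ℝ) × (ℝ × ℝ) => (q.2, secondFreq h σ ε₁ ε₂ q.1 q.2))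
      ((specMeasure h).prod (specMeasure h)) ((specMeasure h).prod (specMeasure h)) := by
  have hsec : ∀ p₁ : ℝ × ℝ, MeasurePreserving (fun p => secondFreq h σ ε₁ ε₂ p p₁)
      (specMeasure h) (specMeasure h) := by
    intro p₁
    refine (measurePreserving_wrap hh p₁.1).skew_product
      (g := fun ξ τ => τ - p₁.2 - resonance h σ ε₁ ε₂ ξ p₁.1) ?_ (Eventually.of_forall fun ξ => ?_)
    · have := (measurable_resonance h σ ε₁ ε₂).comp
        (measurable_fst.prodMk measurable_const : Measurable (fun q : ℝ × ℝ => (q.1, p₁.1)))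
      exact Measurable.sub (by fun_prop) this
    · have := (measurePreserving_sub_right (volume : Measure ℝ)
        (p₁.2 + resonance h σ ε₁ ε₂ ξ p₁.1)).map_eq
      simpa only [← sub_sub] using this
  have h1 := (MeasurePreserving.id (specMeasure h)).skew_product
    (g := fun p₁ p => secondFreq h σ ε₁ ε₂ p p₁)
    ((measurable_secondFreq h σ ε₁ ε₂).comp measurable_swap)
    (Eventually.of_forall fun p₁ => (hsec p₁).map_eq)
  exact h1.comp Measure.measurePreserving_swap

/-- The frequency `secondFreq` is the one for which the product of the waves is the output wave; on the
lattice, frequencies count only modulo `2π/h`. -/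
theorem planeWave_mul_planeWave {h : ℝ} (hh : 0 < h) (σ ε₁ ε₂ t : ℝ) (n : ℤ) (p p₁ : ℝ × ℝ) :
    planeWave h (phase h σ ε₁) t n p₁ *
      planeWave h (phase h σ ε₂) t n (secondFreq h σ ε₁ ε₂ p p₁) =
      planeWave h (phase h σ 1) t n p := by
  have hexp : Complex.exp (Complex.I * ((h * n * (2 * π / h *
      ⌊(p.1 - p₁.1 + π / h) / (2 * π / h)⌋) : ℝ) : ℂ)) = 1 := by
    set k := ⌊(p.1 - p₁.1 + π / h) / (2 * π / h)⌋
    have : Complex.I * ((h * n * (2 * π / h * k) : ℝ) : ℂ) = ((n * k : ℤ) : ℂ) * (2 * π * Complex.I) := by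
      have hc : (h : ℂ) ≠ 0 := by exact_mod_cast hh.ne'
      push_cast; field_simp
    rw [this, Complex.exp_int_mul_two_pi_mul_I]
  rw [planeWave, planeWave, planeWave, ← Complex.exp_add]
  rw [← mul_one (Complex.exp _), ← hexp, ← Complex.exp_add]
  congr 1
  simp only [secondFreq, resonance]
  have : h * n * wrap h (p.1 - p₁.1) = h * n * (p.1 - p₁.1) -
      h * n * (2 * π / h * ⌊(p.1 - p₁.1 + π / h) / (2 * π / h)⌋) := by
    rw [wrap]; ring
  rw [this]
  push_cast; ring

/-- The constant in the bilinear estimate. -/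
def bilinearConst (s b : ℝ) : ℝ :=
  (2 ^ s) ^ 2 * (2 ^ (2 * b) * (2 * bracketMass (2 * b))) * (768 * (2 * bracketMass (2 * b) + 4))

theorem bilinearConst_nonneg (s b : ℝ) : 0 ≤ bilinearConst s b := by
  have := bracketMass_nonneg (2 * b)
  unfold bilinearConst; positivity

/-- The pointwise Cauchy-Schwarz step of the bilinear estimate. -/
theorem bilinear_pointwise_le {h : ℝ} (hh : 0 < h) {s b : ℝ} (hs : 0 ≤ s) (hb : 1 / 2 < b)
    {σ ε₁ ε₂ : ℝ} (hσ : σ = 1 ∨ σ = -1) (hε₁ : ε₁ = 1 ∨ ε₁ = -1) (hε₂ : ε₂ = 1 ∨ ε₂ = -1)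
    {p : ℝ × ℝ} (hp : p.1 ∈ freqDomain h) {G : ℝ × ℝ → ℝ≥0∞} (hG : AEMeasurable G (specMeasure h)) :
    ENNReal.ofReal ((2 / h * Real.sin (h * p.1 / 2)) ^ 2 * bracket p.1 ^ (2 * s) *
        (√(bracket p.2))⁻¹) *
      (∫⁻ p₁, ENNReal.ofReal (invWeight s b p₁ * invWeight s b (secondFreq h σ ε₁ ε₂ p p₁)) *
        G p₁ ∂specMeasure h) ^ 2 ≤
    ENNReal.ofReal (bilinearConst s b) * ∫⁻ p₁, G p₁ ^ 2 ∂specMeasure h := by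
  have hB := bracketMass_nonneg (2 * b)
  have hbp : ∀ (x y : ℝ), 0 < bracket x ^ y := fun x y => Real.rpow_pos_of_pos (bracket_pos x) y
  have hae : ∀ᵐ p₁ ∂specMeasure h, p₁.1 ∈ freqDomain h :=
    (Measure.quasiMeasurePreserving_fst).ae (ae_mem_freqDomain h)
  set K : ℝ × ℝ → ℝ≥0∞ := fun p₁ => ENNReal.ofReal (bracket p₁.2 ^ (-b) *
    bracket (p₁.2 - (p.2 - resonance h σ ε₁ ε₂ p.1 p₁.1)) ^ (-b)) with hK
  have hres : Measurable (fun ξ => resonance h σ ε₁ ε₂ p.1 ξ) :=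
    (measurable_resonance h σ ε₁ ε₂).comp
      (measurable_const.prodMk measurable_id : Measurable (fun ξ : ℝ => (p.1, ξ)))
  have hKm : Measurable K := by
    have := hres.comp (measurable_fst : Measurable (Prod.fst : ℝ × ℝ → ℝ))
    simp only [Function.comp_def] at this
    fun_prop
  -- the weights in `ξ`: one of the two factors has a frequency of at least half the size
  have hinner : ∫⁻ p₁, ENNReal.ofReal (invWeight s b p₁ *
        invWeight s b (secondFreq h σ ε₁ ε₂ p p₁)) * G p₁ ∂specMeasure h ≤
      ENNReal.ofReal (2 ^ s * bracket p.1 ^ (-s)) * ∫⁻ p₁, K p₁ * G p₁ ∂specMeasure h := by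
    rw [← lintegral_const_mul' _ _ ENNReal.ofReal_ne_top]
    refine lintegral_mono_ae (hae.mono fun p₁ hp₁ => ?_)
    rw [← mul_assoc, hK, ← ENNReal.ofReal_mul (by have := hbp p.1 (-s); positivity)]
    refine mul_le_mul_left (ENNReal.ofReal_le_ofReal ?_) _
    simp only [invWeight, secondFreq]
    have h1 := bracket_rpow_le_mul hs (abs_le_abs_add_abs_wrap hh hp hp₁)
    have h2 : bracket p₁.1 ^ (-s) * bracket (wrap h (p.1 - p₁.1)) ^ (-s) ≤
        2 ^ s * bracket p.1 ^ (-s) := by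
      rw [Real.rpow_neg (bracket_pos _).le, Real.rpow_neg (bracket_pos _).le,
        Real.rpow_neg (bracket_pos _).le, ← mul_inv, ← div_eq_mul_inv, ← inv_div]
      have := hbp p.1 s
      refine inv_anti₀ (by positivity) ?_
      rw [div_le_iff₀ (by positivity), mul_comm]
      exact h1
    have h3 : p.2 - p₁.2 - resonance h σ ε₁ ε₂ p.1 p₁.1 =
        -(p₁.2 - (p.2 - resonance h σ ε₁ ε₂ p.1 p₁.1)) := by ring
    rw [h3, bracket_neg]
    have h4 := hbp p₁.2 (-b)
    have h5 := hbp (p₁.2 - (p.2 - resonance h σ ε₁ ε₂ p.1 p₁.1)) (-b)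
    calc _ = (bracket p₁.1 ^ (-s) * bracket (wrap h (p.1 - p₁.1)) ^ (-s)) * (bracket p₁.2 ^ (-b) *
          bracket (p₁.2 - (p.2 - resonance h σ ε₁ ε₂ p.1 p₁.1)) ^ (-b)) :=
          mul_mul_mul_comm _ _ _ _
      _ ≤ _ := mul_le_mul_of_nonneg_right h2 (by positivity)
  -- the integral in the modulation of the first wave
  have hKsq : ∫⁻ p₁, K p₁ ^ 2 ∂specMeasure h ≤
      ENNReal.ofReal (2 ^ (2 * b) * (2 * bracketMass (2 * b))) *
      ∫⁻ ξ₁ in freqDomain h,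
        ENNReal.ofReal (bracket (p.2 - resonance h σ ε₁ ε₂ p.1 ξ₁) ^ (-(2 * b))) := by
    rw [specMeasure, lintegral_prod _ (by fun_prop), ← lintegral_const_mul' _ _ ENNReal.ofReal_ne_top]
    refine lintegral_mono fun ξ₁ => ?_
    rw [← ENNReal.ofReal_mul (by positivity)]
    have := lintegral_bracket_sub_mul_le (c := 2 * b) (by linarith) 0
      (p.2 - resonance h σ ε₁ ε₂ p.1 ξ₁)
    rw [zero_sub, bracket_neg] at this
    refine le_trans (le_of_eq (lintegral_congr fun τ₁ => ?_)) this
    rw [hK, sub_zero]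
    have h4 := hbp τ₁ (-b)
    have h5 := hbp (τ₁ - (p.2 - resonance h σ ε₁ ε₂ p.1 ξ₁)) (-b)
    rw [← ENNReal.ofReal_pow (by positivity), mul_pow, rpow_neg_sq (bracket_pos _),
      rpow_neg_sq (bracket_pos _)]
  have hker := resonance_kernel_le (c := 2 * b) (by linarith) hh hσ hε₁ hε₂ hp p.2
  have hpow : bracket p.1 ^ (2 * s) * (2 ^ s * bracket p.1 ^ (-s)) ^ 2 = (2 ^ s) ^ 2 := by
    rw [mul_pow, rpow_neg_sq (bracket_pos _), mul_left_comm, ← Real.rpow_add (bracket_pos _)]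
    simp
  calc _ ≤ ENNReal.ofReal ((2 / h * Real.sin (h * p.1 / 2)) ^ 2 * bracket p.1 ^ (2 * s) *
        (√(bracket p.2))⁻¹) * ((ENNReal.ofReal (2 ^ s * bracket p.1 ^ (-s))) ^ 2 *
          ((ENNReal.ofReal (2 ^ (2 * b) * (2 * bracketMass (2 * b))) *
      ∫⁻ ξ₁ in freqDomain h,
        ENNReal.ofReal (bracket (p.2 - resonance h σ ε₁ ε₂ p.1 ξ₁) ^ (-(2 * b)))) *
          ∫⁻ p₁, G p₁ ^ 2 ∂specMeasure h)) := by
        gcongr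
        refine (pow_le_pow_left' hinner 2).trans ?_
        rw [mul_pow]
        gcongr
        exact (sq_lintegral_mul_le hKm.aemeasurable hG).trans (by gcongr)
    _ = ENNReal.ofReal (2 ^ s) ^ 2 * ENNReal.ofReal (2 ^ (2 * b) * (2 * bracketMass (2 * b))) *
        (ENNReal.ofReal ((2 / h * Real.sin (h * p.1 / 2)) ^ 2 * (√(bracket p.2))⁻¹) *
      ∫⁻ ξ₁ in freqDomain h,
        ENNReal.ofReal (bracket (p.2 - resonance h σ ε₁ ε₂ p.1 ξ₁) ^ (-(2 * b)))) *
          ∫⁻ p₁, G p₁ ^ 2 ∂specMeasure h := by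
        rw [← ENNReal.ofReal_pow (by have := hbp p.1 (-s); positivity), ← ENNReal.ofReal_pow (by positivity),
          ← hpow, ENNReal.ofReal_mul (p := bracket p.1 ^ (2 * s)) (hbp _ _).le,
          mul_right_comm ((2 / h * Real.sin (h * p.1 / 2)) ^ 2),
          ENNReal.ofReal_mul (q := bracket p.1 ^ (2 * s)) (by positivity)]
        ring
    _ ≤ ENNReal.ofReal (2 ^ s) ^ 2 * ENNReal.ofReal (2 ^ (2 * b) * (2 * bracketMass (2 * b))) *
        ENNReal.ofReal (768 * (2 * bracketMass (2 * b) + 4)) *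
          ∫⁻ p₁, G p₁ ^ 2 ∂specMeasure h := by gcongr
    _ = _ := by
        rw [← ENNReal.ofReal_pow (by positivity), ← ENNReal.ofReal_mul (by positivity),
          ← ENNReal.ofReal_mul (by positivity), bilinearConst]

/-- The **bilinear estimate**: the product of two superpositions of waves is again one, and after
multiplication with the symbol of `∇_h` its density is controlled in the weight `⟨τ⟩^{-1/4}`,
uniformly in the mesh. -/
theorem exists_product_density {h : ℝ} (hh : 0 < h) {s b : ℝ} (hs : 0 ≤ s) (hb : 1 / 2 < b)
    {σ ε₁ ε₂ : ℝ} (hσ : σ = 1 ∨ σ = -1) (hε₁ : ε₁ = 1 ∨ ε₁ = -1) (hε₂ : ε₂ = 1 ∨ ε₂ = -1)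
    {A B : ℝ × ℝ → ℂ} (hA : MemLp A 2 (specMeasure h)) (hB : MemLp B 2 (specMeasure h)) :
    ∃ Q : ℝ × ℝ → ℂ, Integrable Q (specMeasure h) ∧
      ∫⁻ p, ENNReal.ofReal ((2 / h * Real.sin (h * p.1 / 2)) ^ 2 * bracket p.1 ^ (2 * s) *
        (√(bracket p.2))⁻¹) * ‖Q p‖ₑ ^ 2 ∂specMeasure h ≤
          ENNReal.ofReal (bilinearConst s b) * (energy h A * energy h B) ∧
      ∀ t n, syn h (phase h σ ε₁) (fun p => invWeight s b p * A p) t n *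
        syn h (phase h σ ε₂) (fun p => invWeight s b p * B p) t n = syn h (phase h σ 1) Q t n := by
  set WA : ℝ × ℝ → ℂ := fun p => invWeight s b p * A p with hWA
  set WB : ℝ × ℝ → ℂ := fun p => invWeight s b p * B p with hWB
  have hWAi : Integrable WA (specMeasure h) := integrable_invWeight_mul hs hb hA
  have hWBi : Integrable WB (specMeasure h) := integrable_invWeight_mul hs hb hB
  have hΘ := measurePreserving_interaction hh σ ε₁ ε₂
  have hF : Integrable (fun q : (ℝ × ℝ) × (ℝ × ℝ) => WA q.2 * WB (secondFreq h σ ε₁ ε₂ q.1 q.2))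
      ((specMeasure h).prod (specMeasure h)) :=
    hΘ.integrable_comp_of_integrable (hWAi.mul_prod hWBi)
  have hG : AEMeasurable (fun q : (ℝ × ℝ) × (ℝ × ℝ) =>
      ‖A q.2‖ₑ * ‖B (secondFreq h σ ε₁ ε₂ q.1 q.2)‖ₑ) ((specMeasure h).prod (specMeasure h)) := by
    have h1 := (hA.1.comp_fst (ν := specMeasure h)).comp_measurePreserving hΘ
    have h2 := (hB.1.comp_snd (μ := specMeasure h)).comp_measurePreserving hΘ
    exact h1.enorm.mul h2.enorm
  have hpi : ‖((1 / (2 * π) : ℝ) : ℂ)‖ₑ ≤ 1 := by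
    rw [← ofReal_norm, Complex.norm_real, Real.norm_eq_abs, abs_of_pos (by positivity),
      ENNReal.ofReal_le_one, div_le_one (by positivity)]
    linarith [pi_gt_three]
  refine ⟨fun p => ((1 / (2 * π) : ℝ) : ℂ) *
    ∫ p₁, WA p₁ * WB (secondFreq h σ ε₁ ε₂ p p₁) ∂specMeasure h,
    hF.integral_prod_left.const_mul _, ?_, fun t n => ?_⟩
  · have hGs : ∀ᵐ p ∂specMeasure h, AEMeasurable (fun p₁ =>
        ‖A p₁‖ₑ * ‖B (secondFreq h σ ε₁ ε₂ p p₁)‖ₑ) (specMeasure h) := by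
      have := (hG.aestronglyMeasurable).prodMk_left
      exact this.mono fun p hp => hp.aemeasurable
    have hae : ∀ᵐ p ∂specMeasure h, p.1 ∈ freqDomain h :=
      (Measure.quasiMeasurePreserving_fst).ae (ae_mem_freqDomain h)
    calc _ ≤ ∫⁻ p, ENNReal.ofReal (bilinearConst s b) *
          ∫⁻ p₁, (‖A p₁‖ₑ * ‖B (secondFreq h σ ε₁ ε₂ p p₁)‖ₑ) ^ 2 ∂specMeasure h ∂specMeasure h := by
          refine lintegral_mono_ae ?_
          filter_upwards [hGs, hae] with p hp1 hp2
          refine le_trans ?_ (bilinear_pointwise_le hh hs hb hσ hε₁ hε₂ hp2 hp1)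
          gcongr
          rw [enorm_mul]
          refine (mul_le_of_le_one_left' hpi).trans ((enorm_integral_le_lintegral_enorm _).trans
            (le_of_eq (lintegral_congr fun p₁ => ?_)))
          simp only [hWA, hWB, enorm_mul]
          have e : ∀ q, ‖(invWeight s b q : ℂ)‖ₑ = ENNReal.ofReal (invWeight s b q) := fun q => by
            rw [← ofReal_norm, Complex.norm_real, Real.norm_eq_abs, abs_of_pos (invWeight_pos s b q)]
          rw [e, e, ENNReal.ofReal_mul (invWeight_pos s b _).le]
          ring
      _ = ENNReal.ofReal (bilinearConst s b) * ∫⁻ q : (ℝ × ℝ) × (ℝ × ℝ),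
          (‖A q.2‖ₑ * ‖B (secondFreq h σ ε₁ ε₂ q.1 q.2)‖ₑ) ^ 2
            ∂((specMeasure h).prod (specMeasure h)) := by
          rw [lintegral_const_mul' _ _ ENNReal.ofReal_ne_top, lintegral_prod _ (hG.pow_const 2)]
      _ = ENNReal.ofReal (bilinearConst s b) * ∫⁻ q : (ℝ × ℝ) × (ℝ × ℝ),
          ‖A q.1‖ₑ ^ 2 * ‖B q.2‖ₑ ^ 2 ∂((specMeasure h).prod (specMeasure h)) := by
          congr 1
          have h3 : AEMeasurable (fun q : (ℝ × ℝ) × (ℝ × ℝ) => ‖A q.1‖ₑ ^ 2 * ‖B q.2‖ₑ ^ 2)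
              ((specMeasure h).prod (specMeasure h)) :=
            (hA.1.comp_fst.enorm.pow_const 2).mul (hB.1.comp_snd.enorm.pow_const 2)
          nth_rw 2 [← hΘ.map_eq]
          rw [lintegral_map' (by rwa [hΘ.map_eq]) hΘ.measurable.aemeasurable]
          simp only [mul_pow]
      _ = _ := by
          rw [lintegral_prod_mul (hA.1.enorm.pow_const 2) (hB.1.enorm.pow_const 2)]
          rfl
  · have hφ := measurable_phase h σ
    have h1 := integrable_planeWave_mul (hφ ε₁) hWAi t n
    have h2 := integrable_planeWave_mul (hφ ε₂) hWBi t n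
    simp only [syn]
    have h3 : (∫ p, planeWave h (phase h σ ε₁) t n p * WA p ∂specMeasure h) *
        (∫ p, planeWave h (phase h σ ε₂) t n p * WB p ∂specMeasure h) =
        ∫ q : (ℝ × ℝ) × (ℝ × ℝ), planeWave h (phase h σ 1) t n q.1 *
          (WA q.2 * WB (secondFreq h σ ε₁ ε₂ q.1 q.2)) ∂((specMeasure h).prod (specMeasure h)) := by
      rw [← integral_prod_mul, ← hΘ.map_eq, integral_map hΘ.measurable.aemeasurable
        (by rw [hΘ.map_eq]; exact (h1.mul_prod h2).1), hΘ.map_eq]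
      refine integral_congr_ae (Eventually.of_forall fun q => ?_)
      simp only [← planeWave_mul_planeWave hh σ ε₁ ε₂ t n q.1 q.2]
      ring
    have h4 : Integrable (fun q : (ℝ × ℝ) × (ℝ × ℝ) => planeWave h (phase h σ 1) t n q.1 *
          (WA q.2 * WB (secondFreq h σ ε₁ ε₂ q.1 q.2))) ((specMeasure h).prod (specMeasure h)) :=
      hF.bdd_mul (c := 1) ((measurable_planeWave h (hφ 1) t n).comp measurable_fst).aestronglyMeasurable
        (Eventually.of_forall fun q => (norm_planeWave h _ t n q.1).le)
    rw [mul_mul_mul_comm, h3, integral_prod _ h4]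
    simp only [integral_const_mul]
    rw [mul_assoc, ← integral_const_mul]
    congr 1
    refine integral_congr_ae (Eventually.of_forall fun p => ?_)
    simp only
    ring
/-! ### Time cutoffs and the Duhamel operator -/

/-- `ψ` is the Fourier transform `(1 / 2π) ∫ e^{-i t x} η(t) dt` of the time cutoff `η`, together
with the properties that hold for smooth compactly supported `η`. -/
structure IsCutoffTransform (η : ℝ → ℝ) (ψ : ℝ → ℂ) : Prop where
  contDiff : ContDiff ℝ 1 ψ
  decay : ∃ C : ℝ, 0 ≤ C ∧ ∀ x, ‖ψ x‖ ≤ C * bracket x ^ (-4 : ℝ) ∧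
    ‖deriv ψ x‖ ≤ C * bracket x ^ (-4 : ℝ)
  synthesis : ∀ t : ℝ, ∫ x : ℝ, Complex.exp (Complex.I * ((t * x : ℝ) : ℂ)) * ψ x = η t
  synthesis_deriv : ∀ t : ℝ, ∫ x : ℝ, Complex.exp (Complex.I * ((t * x : ℝ) : ℂ)) * deriv ψ x =
    -(Complex.I * t * η t)
  analysis : ∀ x : ℝ, ∫ t : ℝ, Complex.exp (-Complex.I * ((t * x : ℝ) : ℂ)) * (η t : ℂ) =
    2 * π * ψ x

open scoped SchwartzMap FourierTransform in
theorem exists_isCutoffTransform {η : ℝ → ℝ} (hη : ContDiff ℝ ∞ η) (hc : HasCompactSupport η) :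
    ∃ ψ : ℝ → ℂ, IsCutoffTransform η ψ := by
  have hc' : HasCompactSupport (fun x : ℝ => (η (2 * π * x) : ℂ)) := by
    have h1 : HasCompactSupport (fun x : ℝ => η (2 * π * x)) :=
      hc.comp_homeomorph (Homeomorph.mulLeft₀ (2 * π) (by positivity))
    exact h1.comp_left (g := Complex.ofReal) (by simp)
  have hs' : ContDiff ℝ ∞ (fun x : ℝ => (η (2 * π * x) : ℂ)) :=
    Complex.ofRealCLM.contDiff.comp (hη.comp (by fun_prop))
  let g : 𝓢(ℝ, ℂ) := hc'.toSchwartzMap hs'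
  have hg : ∀ x, g x = (η (2 * π * x) : ℂ) := fun x => rfl
  let ψ : 𝓢(ℝ, ℂ) := 𝓕 g
  have hdec : ∀ F : 𝓢(ℝ, ℂ), ∃ C : ℝ, 0 ≤ C ∧ ∀ x, ‖F x‖ ≤ C * bracket x ^ (-4 : ℝ) := by
    intro F
    obtain ⟨C0, h0, hC0⟩ := F.decay 0 0
    obtain ⟨C4, h4, hC4⟩ := F.decay 4 0
    refine ⟨2 * (C0 + C4), by positivity, fun x => ?_⟩
    have e0 := hC0 x
    have e4 := hC4 x
    simp only [norm_iteratedFDeriv_zero, pow_zero, one_mul, Real.norm_eq_abs] at e0 e4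
    have hb : bracket x ^ (-4 : ℝ) = (bracket x ^ 4)⁻¹ := by
      rw [Real.rpow_neg (bracket_pos x).le]; norm_cast
    rw [hb, ← div_eq_mul_inv, le_div_iff₀ (pow_pos (bracket_pos x) 4)]
    have hb4 : bracket x ^ 4 ≤ 2 * (1 + |x| ^ 4) := by
      have : bracket x ^ 4 = (1 + x ^ 2) ^ 2 := by rw [← bracket_sq]; ring
      rw [this, ← sq_abs x]
      nlinarith [sq_nonneg (|x| ^ 2 - 1)]
    calc ‖F x‖ * bracket x ^ 4 ≤ ‖F x‖ * (2 * (1 + |x| ^ 4)) := by gcongr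
      _ = 2 * (‖F x‖ + |x| ^ 4 * ‖F x‖) := by ring
      _ ≤ _ := by gcongr
  have hinv : ∀ x : ℝ, 𝓕⁻ (ψ : ℝ → ℂ) x = (η (2 * π * x) : ℂ) := by
    intro x
    have : 𝓕⁻ ψ = g := FourierTransform.fourierInv_fourier_eq g
    rw [← SchwartzMap.fourierInv_coe, this, hg]
  have hsyn : ∀ (f : ℝ → ℂ) (t : ℝ), ∫ x : ℝ, Complex.exp (Complex.I * ((t * x : ℝ) : ℂ)) * f x =
      𝓕⁻ f (t / (2 * π)) := by
    intro f t
    rw [Real.fourierInv_eq']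
    refine integral_congr_ae (Eventually.of_forall fun x => ?_)
    have hpi : (π : ℂ) ≠ 0 := by exact_mod_cast Real.pi_ne_zero
    have hre : (2 * π * inner ℝ x (t / (2 * π)) : ℝ) = t * x := by
      have : inner ℝ x (t / (2 * π)) = t / (2 * π) * x := rfl
      rw [this]
      field_simp
    simp only [smul_eq_mul, hre]
    rw [mul_comm Complex.I]
  obtain ⟨C1, h1, hC1⟩ := hdec ψ
  obtain ⟨C2, h2, hC2⟩ := hdec (SchwartzMap.derivCLM ℝ ℂ ψ)
  refine ⟨ψ, ψ.smooth 1, ⟨C1 + C2, by positivity, fun x => ⟨?_, ?_⟩⟩, fun t => ?_, fun t => ?_,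
    fun x => ?_⟩
  · exact (hC1 x).trans (mul_le_mul_of_nonneg_right (by linarith)
      (Real.rpow_nonneg (bracket_pos x).le _))
  · exact (hC2 x).trans (mul_le_mul_of_nonneg_right (by linarith)
      (Real.rpow_nonneg (bracket_pos x).le _))
  · rw [hsyn, hinv]
    congr 2
    field_simp
  · have hd := Real.fourier_deriv ψ.integrable ψ.differentiable
      ((SchwartzMap.derivCLM ℝ ℂ ψ).integrable)
    rw [hsyn, Real.fourierInv_eq_fourier_neg, hd]
    simp only
    rw [← Real.fourierInv_eq_fourier_neg, hinv, mul_div_cancel₀ _ (by positivity : (2 * π : ℝ) ≠ 0)]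
    have hpi : (π : ℂ) ≠ 0 := by exact_mod_cast Real.pi_ne_zero
    push_cast
    rw [smul_eq_mul]
    field_simp
  · have hf : ψ x = 𝓕 (g : ℝ → ℂ) x := by rw [← SchwartzMap.fourier_coe]
    rw [hf, Real.fourier_eq']
    have hcv := Measure.integral_comp_mul_left
      (fun t : ℝ => Complex.exp (-Complex.I * ((t * x : ℝ) : ℂ)) * (η t : ℂ)) (2 * π)
    have hpi : (π : ℂ) ≠ 0 := by exact_mod_cast Real.pi_ne_zero
    rw [abs_of_pos (by positivity : 0 < (2 * π)⁻¹), Complex.real_smul] at hcv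
    have : ∫ v : ℝ, Complex.exp (((-2 * π * inner ℝ v x : ℝ) : ℂ) * Complex.I) • g v =
        ∫ t : ℝ, Complex.exp (-Complex.I * ((2 * π * t * x : ℝ) : ℂ)) * (η (2 * π * t) : ℂ) := by
      refine integral_congr_ae (Eventually.of_forall fun t => ?_)
      have : inner ℝ t x = x * t := rfl
      simp only [hg, smul_eq_mul, this]
      congr 2
      push_cast; ring
    rw [this, hcv, ← mul_assoc]
    have : 2 * (π : ℂ) * (((2 * π)⁻¹ : ℝ) : ℂ) = 1 := by push_cast; field_simp
    rw [this, one_mul]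

theorem IsCutoffTransform.continuous_deriv {η : ℝ → ℝ} {ψ : ℝ → ℂ} (h : IsCutoffTransform η ψ) :
    Continuous (deriv ψ) := h.contDiff.continuous_deriv le_rfl

theorem IsCutoffTransform.integrable_deriv {η : ℝ → ℝ} {ψ : ℝ → ℂ} (h : IsCutoffTransform η ψ) :
    Integrable (deriv ψ) := by
  obtain ⟨C, hC, hd⟩ := h.decay
  refine ((integrable_bracket_rpow (c := 4) (by norm_num)).const_mul C).mono'
    h.continuous_deriv.aestronglyMeasurable (Eventually.of_forall fun x => (hd x).2)

/-- The integral `∫_0^t e^{i w t₁} dt₁`. -/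
def expPrimitive (w t : ℝ) : ℂ := ∫ t₁ in (0 : ℝ)..t, Complex.exp (Complex.I * ((t₁ * w : ℝ) : ℂ))

/-- The transform in `t` of `∫_0^t e^{i w t₁} dt₁` after localisation to the time scale `T`, written
as an average in order to treat all frequencies `w` alike. -/
def duhamelKernel (ψ : ℝ → ℂ) (T w x : ℝ) : ℂ :=
  Complex.I * T ^ 2 * ∫ r in (0 : ℝ)..1, deriv ψ (T * (x - r * w))

theorem continuous_duhamelKernel {η : ℝ → ℝ} {ψ : ℝ → ℂ} (hψ : IsCutoffTransform η ψ) (T : ℝ) :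
    Continuous (fun q : ℝ × ℝ => duhamelKernel ψ T q.1 q.2) := by
  have := hψ.continuous_deriv
  refine continuous_const.mul ?_
  refine intervalIntegral.continuous_parametric_intervalIntegral_of_continuous'
    (f := fun (q : ℝ × ℝ) r => deriv ψ (T * (q.2 - r * q.1))) ?_ 0 1
  fun_prop

/-- As long as the cutoff is `1`, the kernel reproduces `∫_0^t e^{i w t₁} dt₁`. -/
theorem integral_exp_mul_duhamelKernel {η : ℝ → ℝ} {ψ : ℝ → ℂ} (hψ : IsCutoffTransform η ψ)
    {T : ℝ} (hT : 0 < T) {t : ℝ} (ht : η (t / T) = 1) (w : ℝ) :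
    ∫ x : ℝ, Complex.exp (Complex.I * ((t * x : ℝ) : ℂ)) * duhamelKernel ψ T w x =
      expPrimitive w t := by
  have hcd := hψ.continuous_deriv
  have hsub : ∀ r : ℝ, ∫ x : ℝ, Complex.exp (Complex.I * ((t * x : ℝ) : ℂ)) *
      deriv ψ (T * (x - r * w)) =
      Complex.exp (Complex.I * ((t * (r * w) : ℝ) : ℂ)) * (-(Complex.I * t) / T ^ 2) := by
    intro r
    have h1 := hψ.synthesis_deriv (t / T)
    have h2 := Measure.integral_comp_mul_left
      (fun y : ℝ => Complex.exp (Complex.I * ((t / T * y : ℝ) : ℂ)) * deriv ψ y) T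
    rw [h1, ht, abs_of_pos (inv_pos.mpr hT)] at h2
    have h3 := integral_sub_right_eq_self (μ := volume)
      (fun y : ℝ => Complex.exp (Complex.I * ((t / T * (T * y) : ℝ) : ℂ)) * deriv ψ (T * y)) (r * w)
    rw [h2] at h3
    have hTc : (T : ℂ) ≠ 0 := by exact_mod_cast hT.ne'
    have h4 : -(Complex.I * t) / T ^ 2 =
        T⁻¹ • -(Complex.I * ((t / T : ℝ) : ℂ) * ((1 : ℝ) : ℂ)) := by
      rw [Complex.real_smul]; push_cast; field_simp
    rw [h4, ← h3, ← integral_const_mul]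
    refine integral_congr_ae (Eventually.of_forall fun x => ?_)
    simp only
    rw [← mul_assoc, ← Complex.exp_add]
    congr 2
    push_cast
    field_simp
    ring
  have hint : Integrable (fun q : ℝ × ℝ => Complex.exp (Complex.I * ((t * q.2 : ℝ) : ℂ)) *
      deriv ψ (T * (q.2 - q.1 * w))) ((volume.restrict (Ioc 0 1)).prod volume) := by
    rw [integrable_prod_iff (by fun_prop : Continuous _).aestronglyMeasurable]
    have hn : ∀ r x : ℝ, ‖Complex.exp (Complex.I * ((t * x : ℝ) : ℂ)) *
        deriv ψ (T * (x - r * w))‖ = ‖deriv ψ (T * (x - r * w))‖ := by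
      intro r x
      rw [norm_mul, mul_comm Complex.I, Complex.norm_exp_ofReal_mul_I, one_mul]
    have hi : ∀ r : ℝ, Integrable (fun x : ℝ => deriv ψ (T * (x - r * w))) := fun r =>
      ((hψ.integrable_deriv.comp_mul_left' hT.ne').comp_sub_right (r * w))
    refine ⟨Eventually.of_forall fun r => ?_, ?_⟩
    · refine ((hi r).norm).mono' (by fun_prop : Continuous _).aestronglyMeasurable
        (Eventually.of_forall fun x => (hn r x).le)
    · simp only [hn]
      have : ∀ r : ℝ, ∫ x : ℝ, ‖deriv ψ (T * (x - r * w))‖ = ∫ x : ℝ, ‖deriv ψ (T * x)‖ :=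
        fun r => integral_sub_right_eq_self (μ := volume) (fun y : ℝ => ‖deriv ψ (T * y)‖) (r * w)
      simp only [this]
      exact integrable_const _
  simp only [duhamelKernel, mul_left_comm _ (Complex.I * (T : ℂ) ^ 2)]
  rw [integral_const_mul]
  have hin : ∀ x : ℝ, Complex.exp (Complex.I * ((t * x : ℝ) : ℂ)) *
      ∫ r in (0 : ℝ)..1, deriv ψ (T * (x - r * w)) = ∫ r in Ioc (0 : ℝ) 1,
        Complex.exp (Complex.I * ((t * x : ℝ) : ℂ)) * deriv ψ (T * (x - r * w)) := fun x => by
    rw [intervalIntegral.integral_of_le zero_le_one, integral_const_mul]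
  simp only [hin]
  rw [← integral_integral_swap hint]
  simp only [hsub]
  rw [← intervalIntegral.integral_of_le zero_le_one, intervalIntegral.integral_mul_const,
    expPrimitive]
  have hsc : t • ∫ r in (0 : ℝ)..1, Complex.exp (Complex.I * ((t * r * w : ℝ) : ℂ)) =
      ∫ t₁ in (0 : ℝ)..t, Complex.exp (Complex.I * ((t₁ * w : ℝ) : ℂ)) := by
    have := intervalIntegral.smul_integral_comp_mul_left (a := 0) (b := 1)
      (fun y : ℝ => Complex.exp (Complex.I * ((y * w : ℝ) : ℂ))) t
    simpa using this
  rw [← hsc, Complex.real_smul]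
  have hTc : (T : ℂ) ≠ 0 := by exact_mod_cast hT.ne'
  have hI : Complex.I * Complex.I = -1 := Complex.I_mul_I
  simp only [← mul_assoc t]
  generalize ∫ r in (0 : ℝ)..1, Complex.exp (Complex.I * ((t * r * w : ℝ) : ℂ)) = J
  field_simp
  linear_combination (-(t : ℂ) * J) * hI

/-- The pointwise bound of the Duhamel kernel: a gain of a power of `T` over a kernel that is
bounded from `⟨w⟩^{-1/4}`-weighted `L²` to `L²`. The exponent `17/32` is slightly above `1/2`, so that
`⟨x⟩^{-17/32}` is square integrable; the powers of `T` that remain are at least `1/16` for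
`b < 5/8`. -/
theorem exists_duhamelKernel_bound {η : ℝ → ℝ} {ψ : ℝ → ℂ} (hψ : IsCutoffTransform η ψ) {b : ℝ}
    (hb : 1 / 2 < b) (hb' : b < 5 / 8) :
    ∃ C : ℝ, 0 ≤ C ∧ ∀ T : ℝ, 0 < T → T ≤ 1 → ∀ w x : ℝ,
      bracket x ^ b * ‖duhamelKernel ψ T w x‖ ≤ C * T ^ (1 / 16 : ℝ) * (bracket w ^ (-(1 / 4) : ℝ) *
        (T * bracket (T * (x - w)) ^ (-3 : ℝ) +
          bracket w ^ (-(17 / 32) : ℝ) * bracket x ^ (-(17 / 32) : ℝ))) := by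
  obtain ⟨C, hC, hd⟩ := hψ.decay
  refine ⟨32 * C, by positivity, fun T hT hT1 w x => ?_⟩
  have hbp : ∀ (x y : ℝ), 0 < bracket x ^ y := fun x y => Real.rpow_pos_of_pos (bracket_pos x) y
  have hTp : ∀ y : ℝ, 0 < T ^ y := fun y => Real.rpow_pos_of_pos hT y
  have hTle : ∀ {y z : ℝ}, z ≤ y → T ^ y ≤ T ^ z := fun h =>
    Real.rpow_le_rpow_of_exponent_ge hT hT1 h
  have hnorm : ‖duhamelKernel ψ T w x‖ =
      T ^ 2 * ‖∫ r in (0 : ℝ)..1, deriv ψ (T * (x - r * w))‖ := by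
    rw [duhamelKernel, norm_mul, norm_mul, Complex.norm_I, one_mul, norm_pow, Complex.norm_real,
      Real.norm_eq_abs, abs_of_pos hT]
  -- the decay in `x` at the scale `1 / T`, traded for powers of `T`
  have htail : bracket (T * x) ^ (-4 : ℝ) * bracket x ^ b ≤
      T ^ (-(b + 17 / 32)) * bracket x ^ (-(17 / 32) : ℝ) := by
    have h1 : T * bracket x ≤ bracket (T * x) := by
      rw [bracket, bracket]
      refine Real.le_sqrt_of_sq_le ?_
      rw [mul_pow, Real.sq_sqrt (by positivity)]
      nlinarith
    have h2 : bracket (T * x) ^ (-4 : ℝ) ≤ bracket (T * x) ^ (-(b + 17 / 32)) :=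
      Real.rpow_le_rpow_of_exponent_le (one_le_bracket _) (by linarith)
    have h3 : bracket (T * x) ^ (-(b + 17 / 32)) ≤ (T * bracket x) ^ (-(b + 17 / 32)) :=
      Real.rpow_le_rpow_of_nonpos (mul_pos hT (bracket_pos x)) h1 (by linarith)
    have h4 : bracket x ^ (-(17 / 32) : ℝ) = bracket x ^ (-(b + 17 / 32)) * bracket x ^ b := by
      rw [← Real.rpow_add (bracket_pos x)]; congr 1; ring
    rw [h4, ← mul_assoc, ← Real.mul_rpow hT.le (bracket_pos x).le]
    exact mul_le_mul_of_nonneg_right (h2.trans h3) (hbp x b).le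
  set u := bracket w ^ (-(1 / 4) : ℝ) with hu
  set z := bracket (T * (x - w)) ^ (-3 : ℝ) with hz
  set y := bracket w ^ (-(17 / 32) : ℝ) with hy
  set v := bracket x ^ (-(17 / 32) : ℝ) with hv
  have hu0 : 0 < u := hbp _ _
  have hz0 : 0 < z := hbp _ _
  have hy0 : 0 < y := hbp _ _
  have hv0 : 0 < v := hbp _ _
  have huy : bracket w ^ (-(25 / 32) : ℝ) = u * y := by
    rw [hu, hy, ← Real.rpow_add (bracket_pos w)]; norm_num
  -- the derivative of `ψ` is used for `|w| ≤ 1 / T`, and a difference quotient for larger `w`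
  rcases le_or_gt (|w| * T) 1 with hwT | hwT
  · have h1 : ∀ r ∈ uIoc (0 : ℝ) 1, ‖deriv ψ (T * (x - r * w))‖ ≤
        C * (16 * bracket (T * x) ^ (-4 : ℝ)) := by
      intro r hr
      rw [uIoc_of_le zero_le_one] at hr
      refine ((hd _).2).trans (mul_le_mul_of_nonneg_left ?_ hC)
      have h2 : bracket (T * x) ≤ 2 * bracket (T * (x - r * w)) := by
        have e := bracket_le_add (T * x) (T * (x - r * w))
        have e1 : |T * x - T * (x - r * w)| ≤ 1 := by
          rw [show T * x - T * (x - r * w) = r * (w * T) by ring, abs_mul, abs_mul, abs_of_pos hT,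
            abs_of_pos hr.1]
          exact mul_le_one₀ hr.2 (by positivity) hwT
        linarith [one_le_bracket (T * (x - r * w))]
      have h3 : (2 * bracket (T * (x - r * w))) ^ (-4 : ℝ) ≤ bracket (T * x) ^ (-4 : ℝ) :=
        Real.rpow_le_rpow_of_nonpos (bracket_pos _) h2 (by norm_num)
      rw [Real.mul_rpow (by norm_num) (bracket_pos _).le] at h3
      have h4 : (2 : ℝ) ^ (-4 : ℝ) = 1 / 16 := by
        rw [Real.rpow_neg (by norm_num)]; norm_num
      rw [h4] at h3
      linarith
    have h5 := intervalIntegral.norm_integral_le_of_norm_le_const h1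
    rw [sub_zero, abs_one, mul_one] at h5
    have h6 : 1 ≤ 2 * T ^ (-(25 / 32) : ℝ) * (u * y) := by
      have e1 : bracket w ≤ 2 * T⁻¹ := by
        have := bracket_le_add w 0
        have e2 : |w| ≤ T⁻¹ := by rw [← one_div, le_div_iff₀ hT]; exact hwT
        have e3 : 1 ≤ T⁻¹ := (one_le_inv₀ hT).mpr hT1
        have e4 : bracket 0 = 1 := by simp [bracket]
        rw [sub_zero, e4] at this
        linarith
      have e5 : bracket w ^ (25 / 32 : ℝ) ≤ (2 * T⁻¹) ^ (25 / 32 : ℝ) :=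
        Real.rpow_le_rpow (bracket_pos w).le e1 (by norm_num)
      rw [Real.mul_rpow (by norm_num) (inv_pos.mpr hT).le, Real.inv_rpow hT.le,
        ← Real.rpow_neg hT.le] at e5
      have e6 : (2 : ℝ) ^ (25 / 32 : ℝ) ≤ 2 := by
        conv_rhs => rw [← Real.rpow_one 2]
        exact Real.rpow_le_rpow_of_exponent_le (by norm_num) (by norm_num)
      have e7 : bracket w ^ (25 / 32 : ℝ) * (u * y) = 1 := by
        rw [← huy, ← Real.rpow_add (bracket_pos w)]; norm_num
      rw [← e7]
      refine mul_le_mul_of_nonneg_right (e5.trans ?_) (by positivity)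
      exact mul_le_mul_of_nonneg_right e6 (hTp _).le
    calc bracket x ^ b * ‖duhamelKernel ψ T w x‖
        ≤ bracket x ^ b * (T ^ 2 * (C * (16 * bracket (T * x) ^ (-4 : ℝ)))) := by
          rw [hnorm]
          have := hbp x b
          gcongr
      _ = 16 * C * T ^ (2 : ℝ) * (bracket (T * x) ^ (-4 : ℝ) * bracket x ^ b) := by
          rw [Real.rpow_ofNat]; ring
      _ ≤ 16 * C * T ^ (2 : ℝ) * (T ^ (-(b + 17 / 32)) * v) := by
          have := hTp 2
          gcongr
      _ = 16 * C * T ^ (2 - (b + 17 / 32)) * v * 1 := by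
          rw [sub_eq_add_neg, Real.rpow_add hT]; ring
      _ ≤ 16 * C * T ^ (2 - (b + 17 / 32)) * v * (2 * T ^ (-(25 / 32) : ℝ) * (u * y)) := by
          have := hTp (2 - (b + 17 / 32))
          gcongr
      _ = 32 * C * T ^ (2 - (b + 17 / 32) + -(25 / 32)) * (u * (y * v)) := by
          rw [Real.rpow_add hT]; ring
      _ ≤ 32 * C * T ^ (1 / 16 : ℝ) * (u * (T * z + y * v)) := by
          have h7 : T ^ (2 - (b + 17 / 32) + -(25 / 32)) ≤ T ^ (1 / 16 : ℝ) :=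
            hTle (by linarith)
          have := hTp (1 / 16)
          gcongr
          linarith [mul_pos hT hz0]
  · have hw0 : w ≠ 0 := by rintro rfl; simp at hwT; linarith
    have hwpos : 0 < |w| := abs_pos.mpr hw0
    have hw1 : T⁻¹ ≤ |w| := by
      rw [← one_div, div_le_iff₀ hT]; exact hwT.le
    have hw2 : 1 ≤ |w| := ((one_le_inv₀ hT).mpr hT1).trans hw1
    have h1 : ∫ r in (0 : ℝ)..1, deriv ψ (T * (x - r * w)) =
        ((-(T * w))⁻¹ : ℝ) • (ψ (T * (x - w)) - ψ (T * x)) := by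
      have hder : ∀ r ∈ uIcc (0 : ℝ) 1, HasDerivAt (fun r : ℝ => ψ (T * (x - r * w)))
          ((-(T * w)) • deriv ψ (T * (x - r * w))) r := by
        intro r _
        have e1 : HasDerivAt (fun r : ℝ => T * (x - r * w)) (-(T * w)) r := by
          have := (((hasDerivAt_id r).mul_const w).const_sub x).const_mul T
          simpa using this
        exact (hψ.contDiff.differentiable one_ne_zero _).hasDerivAt.scomp r e1
      have hcd := hψ.continuous_deriv
      have e2 := intervalIntegral.integral_eq_sub_of_hasDerivAt hder
        (Continuous.intervalIntegrable (by fun_prop) _ _)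
      rw [intervalIntegral.integral_smul] at e2
      simp only [one_mul, zero_mul, sub_zero] at e2
      rw [← e2, smul_smul, inv_mul_cancel₀ (neg_ne_zero.mpr (mul_ne_zero hT.ne' hw0)), one_smul]
    have h2 : ‖duhamelKernel ψ T w x‖ ≤ T * |w|⁻¹ * (C * bracket (T * (x - w)) ^ (-4 : ℝ) +
        C * bracket (T * x) ^ (-4 : ℝ)) := by
      rw [hnorm, h1, norm_smul, Real.norm_eq_abs, abs_inv, abs_neg, abs_mul, abs_of_pos hT]
      calc _ = T * |w|⁻¹ * ‖ψ (T * (x - w)) - ψ (T * x)‖ := by field_simp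
        _ ≤ _ := by
          refine mul_le_mul_of_nonneg_left ?_ (by positivity)
          exact (norm_sub_le _ _).trans (add_le_add (hd _).1 (hd _).1)
    have hwb : |w|⁻¹ ≤ 2 * bracket w ^ (-1 : ℝ) := by
      rw [Real.rpow_neg_one, ← div_eq_mul_inv, le_div_iff₀ (bracket_pos w), inv_mul_le_iff₀ hwpos]
      have := bracket_le_add w 0
      have e4 : bracket 0 = 1 := by simp [bracket]
      rw [sub_zero, e4] at this
      linarith
    have hTb : ∀ c : ℝ, 0 ≤ c → bracket w ^ (-c) ≤ T ^ c := by
      intro c hc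
      have e1 : bracket w ^ (-c) ≤ (T⁻¹) ^ (-c) :=
        Real.rpow_le_rpow_of_nonpos (inv_pos.mpr hT) (hw1.trans (abs_le_bracket w)) (by linarith)
      rwa [Real.inv_rpow hT.le, ← Real.rpow_neg hT.le, neg_neg] at e1
    -- near the diagonal, the weight in `x` is comparable with that in `w`
    have hA : bracket w ^ (-1 : ℝ) * bracket (T * (x - w)) ^ (-4 : ℝ) * bracket x ^ b ≤
        4 * T ^ (1 / 16 : ℝ) * (u * z) := by
      have e1 : bracket x ≤ 4 * (bracket w * bracket (T * (x - w))) := by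
        have f1 := bracket_le_add x 0
        have e4 : bracket 0 = 1 := by simp [bracket]
        rw [sub_zero, e4] at f1
        have f2 : |x| ≤ |w| * (1 + |T * (x - w)|) := by
          have g1 : |x| ≤ |w| + |x - w| := by
            have := abs_add_le w (x - w); rwa [add_sub_cancel] at this
          have g2 : |x - w| ≤ |w| * |T * (x - w)| := by
            rw [abs_mul, abs_of_pos hT, ← mul_assoc]
            exact le_mul_of_one_le_left (abs_nonneg _) hwT.le
          linarith
        have f3 := abs_le_bracket w
        have f4 := abs_le_bracket (T * (x - w))
        have f5 := one_le_bracket w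
        have f6 := one_le_bracket (T * (x - w))
        have f7 : |w| * (1 + |T * (x - w)|) ≤ bracket w * (2 * bracket (T * (x - w))) := by
          have := abs_nonneg (T * (x - w))
          gcongr
          linarith
        nlinarith
      have e2 : bracket x ^ b ≤ 4 * (bracket w ^ b * bracket (T * (x - w)) ^ (1 : ℝ)) := by
        have f1 : bracket x ^ b ≤ (4 * (bracket w * bracket (T * (x - w)))) ^ b :=
          Real.rpow_le_rpow (bracket_pos x).le e1 (by linarith)
        rw [Real.mul_rpow (by norm_num) (mul_pos (bracket_pos _) (bracket_pos _)).le,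
          Real.mul_rpow (bracket_pos _).le (bracket_pos _).le] at f1
        refine f1.trans ?_
        have f2 : (4 : ℝ) ^ b ≤ 4 := by
          conv_rhs => rw [← Real.rpow_one 4]
          exact Real.rpow_le_rpow_of_exponent_le (by norm_num) (by linarith)
        have f3 : bracket (T * (x - w)) ^ b ≤ bracket (T * (x - w)) ^ (1 : ℝ) :=
          Real.rpow_le_rpow_of_exponent_le (one_le_bracket _) (by linarith)
        have := hbp w b
        have := hbp (T * (x - w)) b
        gcongr
      have e3 : bracket w ^ (-1 : ℝ) * bracket w ^ b = u * bracket w ^ (-(3 / 4 - b)) := by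
        rw [hu, ← Real.rpow_add (bracket_pos w), ← Real.rpow_add (bracket_pos w)]; congr 1; ring
      have e4 : bracket (T * (x - w)) ^ (-4 : ℝ) * bracket (T * (x - w)) ^ (1 : ℝ) = z := by
        rw [hz, ← Real.rpow_add (bracket_pos _)]; norm_num
      calc _ ≤ bracket w ^ (-1 : ℝ) * bracket (T * (x - w)) ^ (-4 : ℝ) *
            (4 * (bracket w ^ b * bracket (T * (x - w)) ^ (1 : ℝ))) :=
            mul_le_mul_of_nonneg_left e2 (mul_pos (hbp _ _) (hbp _ _)).le
        _ = 4 * (bracket w ^ (-1 : ℝ) * bracket w ^ b) *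
            (bracket (T * (x - w)) ^ (-4 : ℝ) * bracket (T * (x - w)) ^ (1 : ℝ)) := by ring
        _ = 4 * bracket w ^ (-(3 / 4 - b)) * (u * z) := by rw [e3, e4]; ring
        _ ≤ 4 * T ^ (1 / 16 : ℝ) * (u * z) := by
          have := (hTb (3 / 4 - b) (by linarith)).trans (hTle (z := 1 / 16) (by linarith))
          gcongr
    have hB : T * bracket w ^ (-1 : ℝ) * bracket (T * x) ^ (-4 : ℝ) * bracket x ^ b ≤
        T ^ (1 / 16 : ℝ) * (u * (y * v)) := by
      have e1 : bracket w ^ (-1 : ℝ) = bracket w ^ (-(7 / 32) : ℝ) * (u * y) := by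
        rw [← huy, ← Real.rpow_add (bracket_pos w)]; norm_num
      have e2 := hTb (7 / 32) (by norm_num)
      calc _ = T * bracket w ^ (-1 : ℝ) * (bracket (T * x) ^ (-4 : ℝ) * bracket x ^ b) := by ring
        _ ≤ T * bracket w ^ (-1 : ℝ) * (T ^ (-(b + 17 / 32)) * v) :=
            mul_le_mul_of_nonneg_left htail (mul_pos hT (hbp _ _)).le
        _ ≤ T ^ (1 : ℝ) * (T ^ (7 / 32 : ℝ) * (u * y)) * (T ^ (-(b + 17 / 32)) * v) := by
            rw [e1, Real.rpow_one]
            have := hTp (-(b + 17 / 32))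
            gcongr
        _ = T ^ (1 + 7 / 32 + -(b + 17 / 32)) * (u * (y * v)) := by
            rw [Real.rpow_add hT, Real.rpow_add hT]; ring
        _ ≤ _ := by
            have := hTle (y := 1 + 7 / 32 + -(b + 17 / 32)) (z := 1 / 16) (by linarith)
            gcongr
    have hxb := hbp x b
    have h3 := hbp (T * (x - w)) (-4)
    have h4 := hbp (T * x) (-4)
    calc bracket x ^ b * ‖duhamelKernel ψ T w x‖
        ≤ bracket x ^ b * (T * (2 * bracket w ^ (-1 : ℝ)) *
          (C * bracket (T * (x - w)) ^ (-4 : ℝ) + C * bracket (T * x) ^ (-4 : ℝ))) := by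
          refine mul_le_mul_of_nonneg_left (h2.trans ?_) hxb.le
          gcongr
      _ = 2 * C * (T * (bracket w ^ (-1 : ℝ) * bracket (T * (x - w)) ^ (-4 : ℝ) * bracket x ^ b) +
          T * bracket w ^ (-1 : ℝ) * bracket (T * x) ^ (-4 : ℝ) * bracket x ^ b) := by ring
      _ ≤ 2 * C * (T * (4 * T ^ (1 / 16 : ℝ) * (u * z)) + T ^ (1 / 16 : ℝ) * (u * (y * v))) := by
          gcongr
      _ ≤ 32 * C * T ^ (1 / 16 : ℝ) * (u * (T * z + y * v)) := by
          have h8 : 0 ≤ C * T ^ (1 / 16 : ℝ) * (u * (T * z)) := by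
            have := hTp (1 / 16); positivity
          have h9 : 0 ≤ C * T ^ (1 / 16 : ℝ) * (u * (y * v)) := by
            have := hTp (1 / 16); positivity
          linarith
theorem sq_lintegral_mul_le_weighted {α : Type*} [MeasurableSpace α] {μ : Measure α}
    {f g : α → ℝ≥0∞} (hf : AEMeasurable f μ) (hg : AEMeasurable g μ) :
    (∫⁻ x, f x * g x ∂μ) ^ 2 ≤ (∫⁻ x, f x ^ 2 * g x ∂μ) * ∫⁻ x, g x ∂μ := by
  have hsq : ∀ y : ℝ≥0∞, y ^ (1 / 2 : ℝ) * y ^ (1 / 2 : ℝ) = y := fun y => by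
    rw [← ENNReal.rpow_add_of_nonneg _ _ (by norm_num) (by norm_num)]; norm_num
  have := sq_lintegral_mul_le (hf.mul (hg.pow_const (1 / 2 : ℝ))) (hg.pow_const (1 / 2 : ℝ))
  simp only [Pi.mul_apply] at this
  calc _ = (∫⁻ x, f x * g x ^ (1 / 2 : ℝ) * g x ^ (1 / 2 : ℝ) ∂μ) ^ 2 := by
        simp only [mul_assoc, hsq]
    _ ≤ _ := this
    _ = _ := by simp only [mul_pow, sq (_ ^ (1 / 2 : ℝ)), hsq]

theorem ennreal_add_sq_le (x y : ℝ≥0∞) : (x + y) ^ 2 ≤ 2 * (x ^ 2 + y ^ 2) := by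
  have := ENNReal.rpow_add_le_mul_rpow_add_rpow x y (p := 2) (by norm_num)
  norm_num at this
  exact this

theorem lintegral_bracket_mul_sub {c : ℝ} (hc : 1 < c) {T : ℝ} (hT : 0 < T) (w : ℝ) :
    ∫⁻ x, ENNReal.ofReal (T * bracket (T * (x - w)) ^ (-c)) = ENNReal.ofReal (bracketMass c) := by
  rw [lintegral_sub_right_eq_self (fun x => ENNReal.ofReal (T * bracket (T * x) ^ (-c))) w,
    ← ofReal_integral_eq_lintegral_ofReal
      (((integrable_bracket_rpow hc).comp_mul_left' hT.ne').const_mul T)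
      (Eventually.of_forall fun x => mul_nonneg hT.le (Real.rpow_nonneg (bracket_pos _).le _)),
    integral_const_mul, Measure.integral_comp_mul_left (fun x => bracket x ^ (-c)) T,
    abs_of_pos (inv_pos.mpr hT), smul_eq_mul, mul_inv_cancel_left₀ hT.ne']
  rfl

/-- The frequencies `w`, distributed according to `ν`, are spread at least as thinly as those of
Lebesgue measure. The main examples are Lebesgue measure itself and the integers. -/
structure IsSpread {α : Type*} [MeasurableSpace α] (ν : Measure α) (w : α → ℝ) (M : ℝ) : Prop where
  measurable : Measurable w
  nonneg : 0 ≤ M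
  bound : ∀ T : ℝ, 0 < T → T ≤ 1 → ∀ x : ℝ,
    ∫⁻ a, ENNReal.ofReal (T * bracket (T * (x - w a)) ^ (-(17 / 16) : ℝ)) ∂ν ≤ ENNReal.ofReal M

theorem isSpread_volume : IsSpread (volume : Measure ℝ) (fun τ => τ) (bracketMass (17 / 16)) where
  measurable := measurable_id
  nonneg := bracketMass_nonneg _
  bound T hT _ x := by
    rw [← lintegral_bracket_mul_sub (c := 17 / 16) (by norm_num) hT x]
    refine (lintegral_congr fun a => ?_).le
    rw [← bracket_neg, ← mul_neg, neg_sub]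

theorem isSpread_int :
    IsSpread (Measure.count : Measure ℤ) (fun k => -(k : ℝ))
      ((2 * √2) ^ (17 / 16 : ℝ) * bracketMass (17 / 16)) where
  measurable := measurable_from_top
  nonneg := mul_nonneg (by positivity) (bracketMass_nonneg _)
  bound T hT hT1 x := by
    set c : ℝ := (2 * √2) ^ (17 / 16 : ℝ) with hc
    -- each term is at most a multiple of the integral over the unit interval that follows it
    have hcell : ∀ k : ℤ, ENNReal.ofReal (T * bracket (T * (x - -(k : ℝ))) ^ (-(17 / 16) : ℝ)) ≤
        ∫⁻ y in Ioc (k : ℝ) (k + 1), ENNReal.ofReal c *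
          ENNReal.ofReal (T * bracket (T * (y - -x)) ^ (-(17 / 16) : ℝ)) := by
      intro k
      have hvol : (volume (Ioc (k : ℝ) (k + 1))) = 1 := by simp
      calc _ = ∫⁻ y in Ioc (k : ℝ) (k + 1),
            ENNReal.ofReal (T * bracket (T * (x - -(k : ℝ))) ^ (-(17 / 16) : ℝ)) := by
            rw [lintegral_const]; simp [hvol]
        _ ≤ _ := by
          refine setLIntegral_mono' measurableSet_Ioc fun y hy => ?_
          rw [← ENNReal.ofReal_mul (by positivity)]
          refine ENNReal.ofReal_le_ofReal ?_
          have h1 : bracket (T * (y - -x)) ≤ 2 * (√2 * bracket (T * (x - -(k : ℝ)))) := by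
            have e : √2 = bracket 1 := by rw [bracket]; norm_num
            rw [e]
            refine bracket_le_mul ?_
            have e2 : T * (y - -x) = T * (y - k) + T * (x - -(k : ℝ)) := by ring
            rw [e2]
            refine (abs_add_le _ _).trans (add_le_add ?_ le_rfl)
            rw [abs_one, abs_mul, abs_of_pos hT, abs_of_pos (by linarith [hy.1])]
            exact mul_le_one₀ hT1 (by linarith [hy.1]) (by linarith [hy.2])
          have h2 := Real.rpow_le_rpow_of_nonpos (bracket_pos _) h1
            (by norm_num : (-(17 / 16) : ℝ) ≤ 0)
          rw [← mul_assoc, Real.mul_rpow (by positivity) (bracket_pos _).le,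
            Real.rpow_neg (by positivity), ← hc, inv_mul_le_iff₀ (by positivity)] at h2
          rw [mul_left_comm]
          gcongr
    rw [lintegral_count]
    calc _ ≤ ∑' k : ℤ, ∫⁻ y in Ioc (k : ℝ) (k + 1), ENNReal.ofReal c *
          ENNReal.ofReal (T * bracket (T * (y - -x)) ^ (-(17 / 16) : ℝ)) :=
          ENNReal.tsum_le_tsum hcell
      _ = ∫⁻ y, ENNReal.ofReal c *
          ENNReal.ofReal (T * bracket (T * (y - -x)) ^ (-(17 / 16) : ℝ)) := by
          rw [← lintegral_iUnion (fun k => measurableSet_Ioc) (pairwise_disjoint_Ioc_intCast ℝ),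
            iUnion_Ioc_intCast, Measure.restrict_univ]
      _ = _ := by
          rw [lintegral_const_mul' _ _ ENNReal.ofReal_ne_top,
            lintegral_bracket_mul_sub (by norm_num) hT, ← ENNReal.ofReal_mul (by positivity)]
      _ ≤ _ := le_rfl

/-- The Duhamel kernel maps the weighted `L²` of the forcing frequencies to `L²` with a gain of a
power of `T`. -/
theorem exists_duhamelKernel_schur {η : ℝ → ℝ} {ψ : ℝ → ℂ} (hψ : IsCutoffTransform η ψ) {b : ℝ}
    (hb : 1 / 2 < b) (hb' : b < 5 / 8) :
    ∃ C : ℝ, 0 ≤ C ∧ ∀ T : ℝ, 0 < T → T ≤ 1 → ∀ {α : Type} [MeasurableSpace α] (ν : Measure α)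
      [SFinite ν] (w : α → ℝ) (M : ℝ), IsSpread ν w M → ∀ f : α → ℝ≥0∞, Measurable f →
      ∫⁻ x, (∫⁻ a, f a * ENNReal.ofReal (bracket x ^ b * ‖duhamelKernel ψ T (w a) x‖) ∂ν) ^ 2 ≤
        ENNReal.ofReal (C * T ^ (1 / 8 : ℝ) * M) *
          ∫⁻ a, ENNReal.ofReal (√(bracket (w a)))⁻¹ * f a ^ 2 ∂ν := by
  obtain ⟨C, hC, hk⟩ := exists_duhamelKernel_bound hψ hb hb'
  have hB3 := bracketMass_nonneg 3
  have hB1 := bracketMass_nonneg (17 / 16)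
  refine ⟨C ^ 2 * (2 * (bracketMass 3 + bracketMass (17 / 16))), by positivity,
    fun T hT hT1 α _ ν _ w M hM f hf => ?_⟩
  have hw := hM.measurable
  have hM0 := hM.nonneg
  have hbp : ∀ (x y : ℝ), 0 < bracket x ^ y := fun x y => Real.rpow_pos_of_pos (bracket_pos x) y
  set F : α → ℝ≥0∞ := fun a => f a * ENNReal.ofReal (bracket (w a) ^ (-(1 / 4) : ℝ)) with hF
  have hFm : Measurable F := by fun_prop
  have hFsq : ∀ a, F a ^ 2 = ENNReal.ofReal (√(bracket (w a)))⁻¹ * f a ^ 2 := by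
    intro a
    rw [hF]
    simp only
    rw [mul_pow, ← ENNReal.ofReal_pow (hbp _ _).le, rpow_neg_sq (bracket_pos _), mul_comm,
      Real.sqrt_eq_rpow, ← Real.rpow_neg (bracket_pos _).le]
    norm_num
  set g1 : ℝ → α → ℝ≥0∞ := fun x a => ENNReal.ofReal (T * bracket (T * (x - w a)) ^ (-3 : ℝ))
    with hg1
  set y : α → ℝ≥0∞ := fun a => ENNReal.ofReal (bracket (w a) ^ (-(17 / 32) : ℝ)) with hy
  set v : ℝ → ℝ≥0∞ := fun x => ENNReal.ofReal (bracket x ^ (-(17 / 32) : ℝ)) with hv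
  set I1 : ℝ → ℝ≥0∞ := fun x => ∫⁻ a, F a * g1 x a ∂ν with hI1
  set I2 : ℝ≥0∞ := ∫⁻ a, F a * y a ∂ν with hI2
  set S : ℝ≥0∞ := ∫⁻ a, F a ^ 2 ∂ν with hS
  have hg1m : Measurable (Function.uncurry g1) := by
    have := hw.comp (measurable_snd : Measurable (Prod.snd : ℝ × α → α))
    simp only [Function.comp_def] at this
    rw [hg1]; unfold Function.uncurry; fun_prop
  have hstep : ∀ x, ∫⁻ a, f a * ENNReal.ofReal (bracket x ^ b * ‖duhamelKernel ψ T (w a) x‖) ∂ν ≤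
      ENNReal.ofReal (C * T ^ (1 / 16 : ℝ)) * (I1 x + I2 * v x) := by
    intro x
    have e1 : I1 x + I2 * v x = ∫⁻ a, (F a * g1 x a + F a * y a * v x) ∂ν := by
      have e0 : Measurable (fun a => F a * g1 x a) := hFm.mul hg1m.of_uncurry_left
      rw [lintegral_add_left e0, lintegral_mul_const' _ _ ENNReal.ofReal_ne_top]
    rw [e1, ← lintegral_const_mul' _ _ ENNReal.ofReal_ne_top]
    refine lintegral_mono fun a => ?_
    calc _ ≤ f a * ENNReal.ofReal (C * T ^ (1 / 16 : ℝ) * (bracket (w a) ^ (-(1 / 4) : ℝ) *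
        (T * bracket (T * (x - w a)) ^ (-3 : ℝ) +
          bracket (w a) ^ (-(17 / 32) : ℝ) * bracket x ^ (-(17 / 32) : ℝ)))) :=
          mul_le_mul_right (ENNReal.ofReal_le_ofReal (hk T hT hT1 (w a) x)) _
      _ = _ := by
          have h1 := hbp (w a) (-(1 / 4))
          have h2 := hbp (T * (x - w a)) (-3)
          have h3 := hbp (w a) (-(17 / 32))
          have h4 := hbp x (-(17 / 32))
          rw [ENNReal.ofReal_mul (p := C * T ^ (1 / 16 : ℝ)) (by positivity),
            ENNReal.ofReal_mul (p := bracket (w a) ^ (-(1 / 4) : ℝ)) h1.le,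
            ENNReal.ofReal_add (by positivity) (by positivity), ENNReal.ofReal_mul h3.le]
          simp only [hF, hg1, hy, hv]
          ring
  have hI1sq : ∫⁻ x, I1 x ^ 2 ≤ ENNReal.ofReal (bracketMass 3 * M) * S := by
    have e1 : ∀ x, I1 x ^ 2 ≤ ENNReal.ofReal M * ∫⁻ a, F a ^ 2 * g1 x a ∂ν := by
      intro x
      refine (sq_lintegral_mul_le_weighted hFm.aemeasurable
        hg1m.of_uncurry_left.aemeasurable).trans ?_
      rw [mul_comm]
      refine mul_le_mul_left ((lintegral_mono fun a => ENNReal.ofReal_le_ofReal ?_).trans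
        (hM.bound T hT hT1 x)) _
      exact mul_le_mul_of_nonneg_left
        (Real.rpow_le_rpow_of_exponent_le (one_le_bracket _) (by norm_num)) hT.le
    calc _ ≤ ∫⁻ x, ENNReal.ofReal M * ∫⁻ a, F a ^ 2 * g1 x a ∂ν := lintegral_mono e1
      _ = ENNReal.ofReal M * ∫⁻ a, (∫⁻ x, F a ^ 2 * g1 x a) ∂ν := by
          rw [lintegral_const_mul' _ _ ENNReal.ofReal_ne_top, lintegral_lintegral_swap]
          exact (((hFm.comp measurable_snd).pow_const 2).mul hg1m).aemeasurable
      _ = ENNReal.ofReal M * ∫⁻ a, F a ^ 2 * ENNReal.ofReal (bracketMass 3) ∂ν := by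
          congr 1
          refine lintegral_congr fun a => ?_
          rw [lintegral_const_mul _ hg1m.of_uncurry_right, hg1]
          simp only
          rw [lintegral_bracket_mul_sub (by norm_num) hT]
      _ = _ := by
          rw [lintegral_mul_const' _ _ ENNReal.ofReal_ne_top, ENNReal.ofReal_mul hB3]
          ring
  have hI2sq : ∫⁻ x, (I2 * v x) ^ 2 ≤ ENNReal.ofReal (bracketMass (17 / 16) * M) * S := by
    have e1 : I2 ^ 2 ≤ S * ENNReal.ofReal M := by
      refine (sq_lintegral_mul_le hFm.aemeasurable (by fun_prop)).trans (mul_le_mul_right ?_ _)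
      refine le_trans (lintegral_mono fun a => ?_) (hM.bound 1 one_pos le_rfl 0)
      rw [hy]
      simp only [one_mul, zero_sub, bracket_neg]
      rw [← ENNReal.ofReal_pow (hbp _ _).le, rpow_neg_sq (bracket_pos _)]
      norm_num
    have e2 : ∫⁻ x, v x ^ 2 = ENNReal.ofReal (bracketMass (17 / 16)) := by
      rw [← lintegral_bracket_rpow (by norm_num)]
      refine lintegral_congr fun x => ?_
      rw [hv]
      simp only
      rw [← ENNReal.ofReal_pow (hbp _ _).le, rpow_neg_sq (bracket_pos _)]
      norm_num
    simp only [mul_pow]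
    rw [lintegral_const_mul _ (by fun_prop), e2, ENNReal.ofReal_mul hB1]
    calc _ ≤ S * ENNReal.ofReal M * ENNReal.ofReal (bracketMass (17 / 16)) := by gcongr
      _ = _ := by ring
  have hI1m : Measurable I1 := by
    exact ((hFm.comp measurable_snd).mul hg1m).lintegral_prod_right
  calc _ ≤ ∫⁻ x, ENNReal.ofReal (C * T ^ (1 / 16 : ℝ)) ^ 2 * (2 * (I1 x ^ 2 + (I2 * v x) ^ 2)) := by
        refine lintegral_mono fun x => ?_
        refine (pow_le_pow_left' (hstep x) 2).trans ?_
        rw [mul_pow]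
        exact mul_le_mul_right (ennreal_add_sq_le _ _) _
    _ = ENNReal.ofReal (C * T ^ (1 / 16 : ℝ)) ^ 2 *
        (2 * ((∫⁻ x, I1 x ^ 2) + ∫⁻ x, (I2 * v x) ^ 2)) := by
        rw [lintegral_const_mul' _ _ (by finiteness), lintegral_const_mul' _ _ (by finiteness),
          lintegral_add_left (hI1m.pow_const 2)]
    _ ≤ ENNReal.ofReal (C * T ^ (1 / 16 : ℝ)) ^ 2 *
        (2 * (ENNReal.ofReal (bracketMass 3 * M) * S +
          ENNReal.ofReal (bracketMass (17 / 16) * M) * S)) := by gcongr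
    _ = ENNReal.ofReal (C ^ 2 * (2 * (bracketMass 3 + bracketMass (17 / 16))) *
          T ^ (1 / 8 : ℝ) * M) * S := by
        have e2 : (2 : ℝ≥0∞) = ENNReal.ofReal 2 := by norm_num
        have e3 : (T ^ (1 / 16 : ℝ)) ^ 2 = T ^ (1 / 8 : ℝ) := by
          rw [← Real.rpow_natCast, ← Real.rpow_mul hT.le]; norm_num
        rw [← add_mul, ← ENNReal.ofReal_add (by positivity) (by positivity), e2,
          ← mul_assoc, ← mul_assoc, ← ENNReal.ofReal_pow (by positivity),
          ← ENNReal.ofReal_mul (by positivity), ← ENNReal.ofReal_mul (by positivity), mul_pow, e3]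
        congr 2
        ring
    _ = _ := by rw [hS]; simp only [hFsq]
/-- The lattice function `(1 / 2π) ∫ e^{i h n ξ} (∫_0^t e^{i w(a) t₁} dt₁) Q(ξ, a)`: the integral in
time, over `[0, t]`, of the superposition with density `Q` of waves with the frequencies `ξ` in space
and `w` in time. -/
def integratedSyn (h : ℝ) {α : Type} [MeasurableSpace α] (ν : Measure α) (w : α → ℝ)
    (Q : ℝ × α → ℂ) (t : ℝ) (n : ℤ) : ℂ :=
  ((1 / (2 * π) : ℝ) : ℂ) * ∫ p, Complex.exp (Complex.I * ((h * n * p.1 : ℝ) : ℂ)) *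
    (expPrimitive (w p.2) t * Q p) ∂((volume.restrict (freqDomain h)).prod ν)

theorem bracket_rpow_two_mul (s x : ℝ) : bracket x ^ (2 * s) = (bracket x ^ s) ^ 2 := by
  rw [← Real.rpow_natCast, ← Real.rpow_mul (bracket_pos _).le]
  congr 1; push_cast; ring

theorem enorm_ofReal_of_nonneg {x : ℝ} (hx : 0 ≤ x) : ‖(x : ℂ)‖ₑ = ENNReal.ofReal x := by
  rw [← ofReal_norm, Complex.norm_real, Real.norm_eq_abs, abs_of_nonneg hx]

theorem lintegral_invWeight_sq_lt_top (h : ℝ) {s b : ℝ} (hs : 0 ≤ s) (hb : 1 / 2 < b) :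
    ∫⁻ p, ENNReal.ofReal (invWeight s b p) ^ 2 ∂specMeasure h < ⊤ := by
  have := energy_lt_top (memLp_invWeight h hs hb)
  simpa only [energy, enorm_ofReal_of_nonneg (invWeight_pos s b _).le] using this

/-- The **Duhamel estimate**: the integral in time of a forcing with density `Q` has, for times of
order `T`, a density in the Bourgain space, and a power of `T` is gained. -/
theorem exists_duhamel_density {η : ℝ → ℝ} {ψ : ℝ → ℂ} (hψ : IsCutoffTransform η ψ) {b : ℝ}
    (hb : 1 / 2 < b) (hb' : b < 5 / 8) :
    ∃ C : ℝ, 0 ≤ C ∧ ∀ T : ℝ, 0 < T → T ≤ 1 → ∀ (h s : ℝ), 0 ≤ s →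
      ∀ {α : Type} [MeasurableSpace α] (ν : Measure α) [SFinite ν] (w : α → ℝ) (M : ℝ),
      IsSpread ν w M → ∀ Q : ℝ × α → ℂ, StronglyMeasurable Q → ∀ K : ℝ≥0∞, K < ⊤ →
      ∫⁻ p, ENNReal.ofReal (bracket p.1 ^ (2 * s) * (√(bracket (w p.2)))⁻¹) * ‖Q p‖ₑ ^ 2
        ∂((volume.restrict (freqDomain h)).prod ν) ≤ K →
      ∃ A : ℝ × ℝ → ℂ, MemLp A 2 (specMeasure h) ∧
        energy h A ≤ ENNReal.ofReal (C * T ^ (1 / 8 : ℝ) * M) * K ∧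
        ∀ t : ℝ, η (t / T) = 1 → ∀ n : ℤ,
          syn h (fun _ => 0) (fun p => invWeight s b p * A p) t n = integratedSyn h ν w Q t n := by
  obtain ⟨C, hC, hS⟩ := exists_duhamelKernel_schur hψ hb hb'
  refine ⟨C, hC, ?_⟩
  intro T hT hT1 h s hs α _ ν _ w M hM Q hQ K hK hQK
  have hbp : ∀ (x y : ℝ), 0 < bracket x ^ y := fun x y => Real.rpow_pos_of_pos (bracket_pos x) y
  have hw := hM.measurable
  set μ := volume.restrict (freqDomain h) with hμ
  have hkm : Measurable (fun q : (ℝ × ℝ) × α => duhamelKernel ψ T (w q.2) q.1.2) := by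
    have e1 : Measurable (fun q : (ℝ × ℝ) × α => w q.2) := hw.comp measurable_snd
    have e2 : Measurable (fun q : (ℝ × ℝ) × α => (w q.2, q.1.2)) :=
      e1.prodMk (measurable_snd.comp measurable_fst)
    have e3 : Measurable (fun q : ℝ × ℝ => duhamelKernel ψ T q.1 q.2) :=
      (continuous_duhamelKernel hψ T).measurable
    have e4 := e3.comp e2
    simpa only [Function.comp_def] using e4
  let G : (ℝ × ℝ) × α → ℂ := fun q => Q (q.1.1, q.2) * duhamelKernel ψ T (w q.2) q.1.2
  have hG : G = fun q => Q (q.1.1, q.2) * duhamelKernel ψ T (w q.2) q.1.2 := rfl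
  have hGm : StronglyMeasurable G := by
    have e1 : StronglyMeasurable (fun q : (ℝ × ℝ) × α => Q (q.1.1, q.2)) :=
      hQ.comp_measurable ((measurable_fst.comp measurable_fst).prodMk measurable_snd)
    exact e1.mul hkm.stronglyMeasurable
  have hQm : Measurable (fun p => ‖Q p‖ₑ) := hQ.measurable.enorm
  set B : ℝ × ℝ → ℝ≥0∞ := fun p => ∫⁻ a, (ENNReal.ofReal (bracket p.1 ^ s) * ‖Q (p.1, a)‖ₑ) *
    ENNReal.ofReal (bracket p.2 ^ b * ‖duhamelKernel ψ T (w a) p.2‖) ∂ν with hB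
  have hBm : Measurable B := by
    have e1 : Measurable fun q : (ℝ × ℝ) × α => ENNReal.ofReal (bracket q.1.1 ^ s) := by fun_prop
    have e2 : Measurable fun q : (ℝ × ℝ) × α => ‖Q (q.1.1, q.2)‖ₑ :=
      hQm.comp ((measurable_fst.comp measurable_fst).prodMk measurable_snd)
    have e3 : Measurable fun q : (ℝ × ℝ) × α => bracket q.1.2 ^ b := by fun_prop
    exact ((e1.mul e2).mul
      (ENNReal.measurable_ofReal.comp (e3.mul hkm.norm))).lintegral_prod_right'
  have hBsq : ∫⁻ p, B p ^ 2 ∂specMeasure h ≤ ENNReal.ofReal (C * T ^ (1 / 8 : ℝ) * M) * K := by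
    calc _ = ∫⁻ ξ, ∫⁻ x, B (ξ, x) ^ 2 ∂volume ∂μ := by
          rw [specMeasure, lintegral_prod _ (hBm.pow_const 2).aemeasurable]
      _ ≤ ∫⁻ ξ, ENNReal.ofReal (C * T ^ (1 / 8 : ℝ) * M) *
          ∫⁻ a, ENNReal.ofReal (√(bracket (w a)))⁻¹ *
            (ENNReal.ofReal (bracket ξ ^ s) * ‖Q (ξ, a)‖ₑ) ^ 2 ∂ν ∂μ := by
          refine lintegral_mono fun ξ => ?_
          exact hS T hT hT1 ν w M hM _ ((hQm.comp measurable_prodMk_left).const_mul _)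
      _ = ENNReal.ofReal (C * T ^ (1 / 8 : ℝ) * M) *
          ∫⁻ p, ENNReal.ofReal (bracket p.1 ^ (2 * s) * (√(bracket (w p.2)))⁻¹) * ‖Q p‖ₑ ^ 2
            ∂(μ.prod ν) := by
          have hwm := hw.comp (measurable_snd : Measurable (Prod.snd : ℝ × α → α))
          simp only [Function.comp_def] at hwm
          rw [lintegral_const_mul' _ _ ENNReal.ofReal_ne_top,
            lintegral_prod _ (by fun_prop)]
          congr 1
          refine lintegral_congr fun ξ => lintegral_congr fun a => ?_
          simp only
          rw [bracket_rpow_two_mul, ENNReal.ofReal_mul (sq_nonneg _), ENNReal.ofReal_pow (hbp _ _).le]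
          ring
      _ ≤ _ := mul_le_mul_right hQK _
  have hBfin : ∫⁻ p, B p ^ 2 ∂specMeasure h < ⊤ :=
    hBsq.trans_lt (ENNReal.mul_lt_top ENNReal.ofReal_lt_top hK)
  set A : ℝ × ℝ → ℂ := fun p => ((bracket p.1 ^ s * bracket p.2 ^ b : ℝ) : ℂ) * ∫ a, G (p, a) ∂ν
    with hA
  have hAm : StronglyMeasurable A := by
    have e1 : Measurable (fun p : ℝ × ℝ => ((bracket p.1 ^ s * bracket p.2 ^ b : ℝ) : ℂ)) := by
      fun_prop
    exact e1.stronglyMeasurable.mul hGm.integral_prod_right'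
  have hAB : ∀ p, ‖A p‖ₑ ≤ B p := by
    intro p
    have h1 := (mul_pos (hbp p.1 s) (hbp p.2 b)).le
    calc _ ≤ ENNReal.ofReal (bracket p.1 ^ s * bracket p.2 ^ b) * ∫⁻ a, ‖G (p, a)‖ₑ ∂ν := by
          rw [hA]
          simp only
          rw [enorm_mul, enorm_ofReal_of_nonneg h1]
          exact mul_le_mul_right (enorm_integral_le_lintegral_enorm _) _
      _ = _ := by
          rw [← lintegral_const_mul' _ _ ENNReal.ofReal_ne_top, hB]
          refine lintegral_congr fun a => ?_
          rw [hG]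
          simp only
          rw [enorm_mul, ENNReal.ofReal_mul (hbp _ _).le, ENNReal.ofReal_mul (hbp _ _).le,
            ofReal_norm]
          ring
  have hAE : energy h A ≤ ∫⁻ p, B p ^ 2 ∂specMeasure h :=
    lintegral_mono fun p => pow_le_pow_left' (hAB p) 2
  have hcancel : ∀ p : ℝ × ℝ, invWeight s b p * (bracket p.1 ^ s * bracket p.2 ^ b) = 1 := by
    intro p
    rw [invWeight, Real.rpow_neg (bracket_pos _).le, Real.rpow_neg (bracket_pos _).le]
    have := hbp p.1 s
    have := hbp p.2 b
    field_simp
  -- all integrals below converge absolutely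
  have hGi : Integrable G ((specMeasure h).prod ν) := by
    refine ⟨hGm.aestronglyMeasurable, ?_⟩
    rw [hasFiniteIntegral_iff_enorm, lintegral_prod _ hGm.enorm.aemeasurable]
    have h1 : ∀ p, ∫⁻ a, ‖G (p, a)‖ₑ ∂ν = ENNReal.ofReal (invWeight s b p) * B p := by
      intro p
      rw [hB, ← lintegral_const_mul' _ _ ENNReal.ofReal_ne_top]
      refine lintegral_congr fun a => ?_
      have h2 : ENNReal.ofReal (invWeight s b p) *
          (ENNReal.ofReal (bracket p.1 ^ s) * ENNReal.ofReal (bracket p.2 ^ b)) = 1 := by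
        rw [← ENNReal.ofReal_mul (hbp _ _).le, ← ENNReal.ofReal_mul (invWeight_pos s b p).le,
          hcancel, ENNReal.ofReal_one]
      rw [hG]
      simp only
      rw [enorm_mul, ENNReal.ofReal_mul (hbp _ _).le, ofReal_norm]
      calc _ = 1 * (‖Q (p.1, a)‖ₑ * ‖duhamelKernel ψ T (w a) p.2‖ₑ) := by rw [one_mul]
        _ = _ := by rw [← h2]; ring
    simp only [h1]
    have h3 := sq_lintegral_mul_le (μ := specMeasure h)
      (f := fun p => ENNReal.ofReal (invWeight s b p)) (g := B) (by fun_prop) hBm.aemeasurable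
    have h4 := h3.trans_lt (ENNReal.mul_lt_top (lintegral_invWeight_sq_lt_top h hs hb) hBfin)
    by_contra h5
    rw [not_lt, top_le_iff] at h5
    rw [h5] at h4
    simp at h4
  refine ⟨A, memLp_of_energy_lt_top hAm.aestronglyMeasurable (hAE.trans_lt hBfin),
    hAE.trans hBsq, fun t ht n => ?_⟩
  rw [syn, integratedSyn]
  congr 1
  have hpw : Integrable (fun q : (ℝ × ℝ) × α => planeWave h (fun _ => 0) t n q.1 * G q)
      ((specMeasure h).prod ν) :=
    hGi.bdd_mul (c := 1)
      ((measurable_planeWave h measurable_const t n).comp measurable_fst).aestronglyMeasurable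
      (Eventually.of_forall fun q => (norm_planeWave h _ t n q.1).le)
  have hmp : MeasurePreserving (fun q : (ℝ × α) × ℝ => ((q.1.1, q.2), q.1.2))
      ((μ.prod ν).prod volume) ((specMeasure h).prod ν) := by
    have h1 := measurePreserving_prodAssoc μ ν (volume : Measure ℝ)
    have h2 := (MeasurePreserving.id μ).prod
      (Measure.measurePreserving_swap (μ := ν) (ν := (volume : Measure ℝ)))
    have h3 := (measurePreserving_prodAssoc μ (volume : Measure ℝ) ν).symm
      MeasurableEquiv.prodAssoc
    exact h3.comp (h2.comp h1)
  have h1 : ∫ p, planeWave h (fun _ => 0) t n p * (invWeight s b p * A p) ∂specMeasure h =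
      ∫ q, planeWave h (fun _ => 0) t n q.1 * G q ∂((specMeasure h).prod ν) := by
    rw [integral_prod _ hpw]
    refine integral_congr_ae (Eventually.of_forall fun p => ?_)
    simp only
    rw [integral_const_mul, hA]
    simp only
    rw [← mul_assoc (invWeight s b p : ℂ), ← Complex.ofReal_mul, hcancel, Complex.ofReal_one,
      one_mul]
  have h2 : ∫ q, planeWave h (fun _ => 0) t n q.1 * G q ∂((specMeasure h).prod ν) =
      ∫ q : (ℝ × α) × ℝ, planeWave h (fun _ => 0) t n (q.1.1, q.2) * G ((q.1.1, q.2), q.1.2)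
        ∂((μ.prod ν).prod volume) := by
    rw [← hmp.map_eq, integral_map hmp.measurable.aemeasurable (by rw [hmp.map_eq]; exact hpw.1)]
  have hpw' : Integrable (fun q : (ℝ × α) × ℝ => planeWave h (fun _ => 0) t n (q.1.1, q.2) *
      G ((q.1.1, q.2), q.1.2)) ((μ.prod ν).prod volume) := hmp.integrable_comp_of_integrable hpw
  rw [h1, h2, integral_prod _ hpw']
  refine integral_congr_ae (Eventually.of_forall fun p => ?_)
  simp only
  rw [← integral_exp_mul_duhamelKernel hψ hT ht, ← integral_mul_const, ← integral_const_mul]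
  refine integral_congr_ae (Eventually.of_forall fun x => ?_)
  simp only [hG, planeWave, add_zero, Prod.mk.eta]
  have : Complex.exp (Complex.I * ((t * x + h * n * p.1 : ℝ) : ℂ)) =
      Complex.exp (Complex.I * ((h * n * p.1 : ℝ) : ℂ)) *
        Complex.exp (Complex.I * ((t * x : ℝ) : ℂ)) := by
    rw [← Complex.exp_add]; congr 1; push_cast; ring
  rw [this]
  ring
/-! ### Fourier multipliers on the space of square summable functions -/

/-- A pointwise bound for the transforms gives a bound for the norms. -/
theorem norm_le_of_isDFT {h : ℝ} (hh : 0 < h) {f g : LatticeL2} {F G : ℝ → ℂ}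
    (hF : IsDFT h (fun n => (f n : ℂ)) F) (hG : IsDFT h (fun n => (g n : ℂ)) G) {C : ℝ}
    (hC : 0 ≤ C) (hle : ∀ᵐ ξ ∂volume.restrict (freqDomain h), ‖G ξ‖ ≤ C * ‖F ξ‖) :
    ‖g‖ ≤ C * ‖f‖ := by
  have h1 := hG.norm_sq_eq hh
  have h2 := hF.norm_sq_eq hh
  have h3 : h * ‖g‖ ^ 2 ≤ h * (C * ‖f‖) ^ 2 := by
    rw [h1, mul_pow, mul_left_comm h, h2, mul_left_comm, ← integral_const_mul (C ^ 2)]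
    refine mul_le_mul_of_nonneg_left ?_ (by positivity : (0 : ℝ) ≤ (2 * π)⁻¹)
    have hi := ((memLp_two_iff_integrable_sq_norm hF.1.1).mp hF.1).const_mul (C ^ 2)
    refine integral_mono_of_nonneg (Eventually.of_forall fun _ => sq_nonneg _) hi ?_
    filter_upwards [hle] with ξ hξ
    rw [← mul_pow]
    gcongr
  exact (sq_le_sq₀ (norm_nonneg _) (by positivity)).mp (le_of_mul_le_mul_left h3 hh)

theorem mulLin_isDFT {h : ℝ} (hh : 0 < h) (m : RealSymbol h) {f : LatticeL2} {F : ℝ → ℂ}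
    (hF : IsDFT h (fun n => (f n : ℂ)) F) :
    IsDFT h (fun n => (mulLin hh m f n : ℂ)) (fun ξ => m ξ * F ξ) := hF.multiplier hh m

theorem mulLin_norm_le {h : ℝ} (hh : 0 < h) (m : RealSymbol h) {C : ℝ} (hC : 0 ≤ C)
    (hm : ∀ ξ ∈ freqDomain h, ‖m ξ‖ ≤ C) (f : LatticeL2) : ‖mulLin hh m f‖ ≤ C * ‖f‖ := by
  refine norm_le_of_isDFT hh (f.isDFT hh) (mulLin_isDFT hh m (f.isDFT hh)) hC ?_
  filter_upwards [ae_mem_freqDomain h] with ξ hξ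
  rw [norm_mul]
  exact mul_le_mul_of_nonneg_right (hm ξ hξ) (norm_nonneg _)

theorem norm_mulLin_sub_le {h : ℝ} (hh : 0 < h) (m m' : RealSymbol h) {C : ℝ} (hC : 0 ≤ C)
    (hm : ∀ ξ ∈ freqDomain h, ‖m ξ - m' ξ‖ ≤ C) (f : LatticeL2) :
    ‖mulLin hh m f - mulLin hh m' f‖ ≤ C * ‖f‖ := by
  have h1 := (mulLin_isDFT hh m (f.isDFT hh)).sub (mulLin_isDFT hh m' (f.isDFT hh))
  refine norm_le_of_isDFT hh (g := mulLin hh m f - mulLin hh m' f) (f.isDFT hh)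
    (by simpa using h1) hC ?_
  filter_upwards [ae_mem_freqDomain h] with ξ hξ
  rw [← sub_mul, norm_mul]
  exact mul_le_mul_of_nonneg_right (hm ξ hξ) (norm_nonneg _)

theorem ext_of_isDFT {h : ℝ} {f g : LatticeL2} {F G : ℝ → ℂ}
    (hF : IsDFT h (fun n => (f n : ℂ)) F) (hG : IsDFT h (fun n => (g n : ℂ)) G)
    (hFG : F =ᵐ[volume.restrict (freqDomain h)] G) : f = g := by
  ext n
  have h1 := hF.2 n
  rw [invDFT_congr hFG, hG.2 n] at h1
  exact (Complex.ofReal_injective h1).symm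

theorem mulLin_mulLin {h : ℝ} (hh : 0 < h) {m m' m'' : RealSymbol h}
    (hm : ∀ ξ, m ξ * m' ξ = m'' ξ) (f : LatticeL2) :
    mulLin hh m (mulLin hh m' f) = mulLin hh m'' f :=
  ext_of_isDFT (mulLin_isDFT hh m (mulLin_isDFT hh m' (f.isDFT hh)))
    (mulLin_isDFT hh m'' (f.isDFT hh)) (Eventually.of_forall fun ξ => by
      simp only [← mul_assoc, hm])

theorem mulLin_comm {h : ℝ} (hh : 0 < h) (m m' : RealSymbol h) (f : LatticeL2) :
    mulLin hh m (mulLin hh m' f) = mulLin hh m' (mulLin hh m f) :=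
  ext_of_isDFT (mulLin_isDFT hh m (mulLin_isDFT hh m' (f.isDFT hh)))
    (mulLin_isDFT hh m' (mulLin_isDFT hh m (f.isDFT hh))) (Eventually.of_forall fun ξ => by
      simp only [mul_left_comm])

/-- The Fourier multiplier with a real symbol, as a bounded operator. -/
def mulCLM {h : ℝ} (hh : 0 < h) (m : RealSymbol h) : LatticeL2 →L[ℝ] LatticeL2 :=
  (mulLin hh m).mkContinuousOfExistsBound
    (m.bounded'.imp fun _ hC f => mulLin_norm_le hh m hC.1 hC.2 f)

theorem mulCLM_apply {h : ℝ} (hh : 0 < h) (m : RealSymbol h) (f : LatticeL2) :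
    mulCLM hh m f = mulLin hh m f := rfl

/-- The symbol `(2i/h) sin(hξ/2)` of `∇_h`. -/
def nablaSymbol (h : ℝ) : RealSymbol h where
  toFun ξ := Complex.I * ((2 / h * Real.sin (h * ξ / 2) : ℝ) : ℂ)
  measurable' := by fun_prop
  bounded' := ⟨|2 / h|, abs_nonneg _, fun ξ _ => by
    rw [norm_mul, Complex.norm_I, one_mul, Complex.norm_real, Real.norm_eq_abs, abs_mul]
    exact mul_le_of_le_one_right (abs_nonneg _) (Real.abs_sin_le_one _)⟩
  conj_neg' ξ := by
    rw [map_mul, Complex.conj_I, Complex.conj_ofReal, mul_neg, neg_div, Real.sin_neg]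
    push_cast; ring

/-- The symbol `⟨ξ⟩^s`. -/
def bracketSymbol (h s : ℝ) : RealSymbol h where
  toFun ξ := ((bracket ξ ^ s : ℝ) : ℂ)
  measurable' := by fun_prop
  bounded' := by
    obtain ⟨C, hC⟩ := (isCompact_Icc (a := -(π / h)) (b := π / h)).exists_bound_of_continuousOn
      (f := fun ξ : ℝ => bracket ξ ^ s)
      (continuous_bracket.rpow_const fun x => Or.inl (bracket_pos x).ne').continuousOn
    refine ⟨max C 0, le_max_right _ _, fun ξ hξ => ?_⟩
    rw [Complex.norm_real]
    exact (hC ξ ⟨hξ.1, hξ.2.le⟩).trans (le_max_left _ _)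
  conj_neg' ξ := by rw [bracket_neg, Complex.conj_ofReal]

/-- The symbol `e^{i t φ(ξ)}` of the unitary group generated by an odd phase function `φ`. -/
def waveSymbol (h : ℝ) {φ : ℝ → ℝ} (hφ : Measurable φ) (hodd : ∀ ξ, φ (-ξ) = -φ ξ) (t : ℝ) :
    RealSymbol h where
  toFun ξ := Complex.exp (Complex.I * ((t * φ ξ : ℝ) : ℂ))
  measurable' := by fun_prop
  bounded' := ⟨1, zero_le_one, fun ξ _ => by rw [mul_comm, Complex.norm_exp_ofReal_mul_I]⟩
  conj_neg' ξ := by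
    rw [← Complex.exp_conj, map_mul, Complex.conj_I, Complex.conj_ofReal, hodd]
    congr 1; push_cast; ring

theorem waveSymbol_apply {h : ℝ} {φ : ℝ → ℝ} (hφ : Measurable φ) (hodd : ∀ ξ, φ (-ξ) = -φ ξ)
    (t ξ : ℝ) : waveSymbol h hφ hodd t ξ = Complex.exp (Complex.I * ((t * φ ξ : ℝ) : ℂ)) := rfl

theorem norm_waveSymbol {h : ℝ} {φ : ℝ → ℝ} (hφ : Measurable φ) (hodd : ∀ ξ, φ (-ξ) = -φ ξ)
    (t ξ : ℝ) : ‖waveSymbol h hφ hodd t ξ‖ = 1 := by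
  rw [waveSymbol_apply, mul_comm, Complex.norm_exp_ofReal_mul_I]

theorem norm_exp_sub_exp_le (x y : ℝ) :
    ‖Complex.exp (Complex.I * (x : ℂ)) - Complex.exp (Complex.I * (y : ℂ))‖ ≤ |x - y| := by
  have h1 : Complex.exp (Complex.I * (x : ℂ)) - Complex.exp (Complex.I * (y : ℂ)) =
      Complex.exp (Complex.I * (y : ℂ)) * (Complex.exp (Complex.I * ((x - y : ℝ) : ℂ)) - 1) := by
    rw [mul_sub, ← Complex.exp_add, mul_one]
    congr 2; push_cast; ring
  rw [h1, norm_mul, mul_comm Complex.I (y : ℂ), Complex.norm_exp_ofReal_mul_I, one_mul]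
  have := Real.norm_exp_I_mul_ofReal_sub_one_le (x := x - y)
  simpa using this

/-- The unitary group generated by an odd phase function. -/
def flow {h : ℝ} (hh : 0 < h) {φ : ℝ → ℝ} (hφ : Measurable φ) (hodd : ∀ ξ, φ (-ξ) = -φ ξ)
    (t : ℝ) : LatticeL2 →L[ℝ] LatticeL2 := mulCLM hh (waveSymbol h hφ hodd t)

section Flow

variable {h : ℝ} (hh : 0 < h) {φ : ℝ → ℝ} (hφ : Measurable φ) (hodd : ∀ ξ, φ (-ξ) = -φ ξ)

theorem flow_isDFT (t : ℝ) {f : LatticeL2} {F : ℝ → ℂ} (hF : IsDFT h (fun n => (f n : ℂ)) F) :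
    IsDFT h (fun n => (flow hh hφ hodd t f n : ℂ))
      (fun ξ => Complex.exp (Complex.I * ((t * φ ξ : ℝ) : ℂ)) * F ξ) := mulLin_isDFT hh _ hF

theorem flow_flow (t t' : ℝ) (f : LatticeL2) :
    flow hh hφ hodd t (flow hh hφ hodd t' f) = flow hh hφ hodd (t + t') f :=
  mulLin_mulLin hh (fun ξ => by
    rw [waveSymbol_apply, waveSymbol_apply, waveSymbol_apply, ← Complex.exp_add]
    congr 1; push_cast; ring) f

theorem flow_zero (f : LatticeL2) : flow hh hφ hodd 0 f = f := by
  refine ext_of_isDFT (flow_isDFT hh hφ hodd 0 (f.isDFT hh)) (f.isDFT hh)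
    (Eventually.of_forall fun ξ => ?_)
  simp

theorem norm_flow (t : ℝ) (f : LatticeL2) : ‖flow hh hφ hodd t f‖ = ‖f‖ := by
  have hle : ∀ (t : ℝ) (f : LatticeL2), ‖flow hh hφ hodd t f‖ ≤ ‖f‖ := fun t f => by
    have := mulLin_norm_le hh (waveSymbol h hφ hodd t) zero_le_one
      (fun ξ _ => (norm_waveSymbol hφ hodd t ξ).le) f
    rwa [one_mul] at this
  refine le_antisymm (hle t f) ?_
  have := hle (-t) (flow hh hφ hodd t f)
  rwa [flow_flow, neg_add_cancel, flow_zero] at this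

theorem flow_mulLin (t : ℝ) (m : RealSymbol h) (f : LatticeL2) :
    flow hh hφ hodd t (mulLin hh m f) = mulLin hh m (flow hh hφ hodd t f) := mulLin_comm hh _ m f

/-- The group is continuous in the operator norm, since the phase is bounded on the frequency
domain. -/
theorem continuous_flow {c : ℝ} (hc : ∀ ξ ∈ freqDomain h, |φ ξ| ≤ c) :
    Continuous (fun t => flow hh hφ hodd t) := by
  have hc0 : 0 ≤ max c 0 := le_max_right _ _
  refine (LipschitzWith.of_dist_le_mul (K := (max c 0).toNNReal) fun t t' => ?_).continuous
  rw [dist_eq_norm, Real.coe_toNNReal _ hc0]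
  refine ContinuousLinearMap.opNorm_le_bound _ (by positivity) fun f => ?_
  refine norm_mulLin_sub_le hh _ _ (by positivity) (fun ξ hξ => ?_) f
  rw [waveSymbol_apply, waveSymbol_apply]
  refine (norm_exp_sub_exp_le _ _).trans ?_
  rw [← sub_mul, abs_mul, mul_comm, Real.dist_eq]
  exact mul_le_mul_of_nonneg_right ((hc ξ hξ).trans (le_max_left _ _)) (abs_nonneg _)

theorem continuous_flow_apply {c : ℝ} (hc : ∀ ξ ∈ freqDomain h, |φ ξ| ≤ c) {t : ℝ → ℝ}
    (ht : Continuous t) {f : ℝ → LatticeL2} (hf : Continuous f) :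
    Continuous (fun x => flow hh hφ hodd (t x) (f x)) :=
  ((continuous_flow hh hφ hodd hc).comp ht).clm_apply hf

end Flow

theorem phase_bounded (h σ ε : ℝ) : ∃ c, ∀ ξ ∈ freqDomain h, |phase h σ ε ξ| ≤ c := by
  obtain ⟨C, hC⟩ := (isCompact_Icc (a := -(π / h)) (b := π / h)).exists_bound_of_continuousOn
    (f := phase h σ ε) (by unfold phase; fun_prop)
  exact ⟨C, fun ξ hξ => hC ξ ⟨hξ.1, hξ.2.le⟩⟩

/-- The Sobolev norm as a multiple of the norm of a multiplier. -/
theorem sobolevNorm_eq {h : ℝ} (hh : 0 < h) (s : ℝ) (f : LatticeL2) :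
    sobolevNorm h s f = √h * ‖mulLin hh (bracketSymbol h s) f‖ := by
  have h1 : ‖mulLin hh (bracketSymbol h s) f‖ ^ 2 = ∑' n, (mulLin hh (bracketSymbol h s) f n) ^ 2 :=
    LatticeL2.norm_sq _
  rw [sobolevNorm, latticeL2Norm, ← Real.sqrt_sq (norm_nonneg (mulLin hh (bracketSymbol h s) f)), h1,
    ← Real.sqrt_mul hh.le]
  rfl

theorem sobolevNorm_nonneg (h s : ℝ) (f : ℤ → ℝ) : 0 ≤ sobolevNorm h s f := Real.sqrt_nonneg _

theorem sobolevNorm_sq_eq_integral {h : ℝ} (hh : 0 < h) (s : ℝ) {f : LatticeL2} {F : ℝ → ℂ}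
    (hF : IsDFT h (fun n => (f n : ℂ)) F) :
    sobolevNorm h s f ^ 2 =
      (2 * π)⁻¹ * ∫ ξ in freqDomain h, bracket ξ ^ (2 * s) * ‖F ξ‖ ^ 2 := by
  rw [sobolevNorm_eq hh, mul_pow, Real.sq_sqrt hh.le,
    (mulLin_isDFT hh (bracketSymbol h s) hF).norm_sq_eq hh]
  congr 1
  refine integral_congr_ae (Eventually.of_forall fun ξ => ?_)
  have h1 := bracket_rpow_two_mul s ξ
  have h2 : (bracketSymbol h s ξ : ℂ) = ((bracket ξ ^ s : ℝ) : ℂ) := rfl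
  simp only [norm_mul, mul_pow, h1, h2, Complex.norm_real, Real.norm_eq_abs, sq_abs]

theorem sobolevNorm_sq_eq_lintegral {h : ℝ} (hh : 0 < h) (s : ℝ) {f : LatticeL2} {F : ℝ → ℂ}
    (hF : IsDFT h (fun n => (f n : ℂ)) F) :
    ∫⁻ ξ in freqDomain h, ENNReal.ofReal (bracket ξ ^ (2 * s)) * ‖F ξ‖ₑ ^ 2 =
      ENNReal.ofReal (2 * π * sobolevNorm h s f ^ 2) := by
  rw [sobolevNorm_sq_eq_integral hh s hF, ← mul_assoc, mul_inv_cancel₀ (by positivity), one_mul,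
    ofReal_integral_eq_lintegral_ofReal]
  · refine lintegral_congr fun ξ => ?_
    rw [ENNReal.ofReal_mul (Real.rpow_nonneg (bracket_pos _).le _),
      ENNReal.ofReal_pow (norm_nonneg _), ofReal_norm]
  · have h2 := (memLp_two_iff_integrable_sq_norm
      (mulLin_isDFT hh (bracketSymbol h s) hF).1.1).mp (mulLin_isDFT hh (bracketSymbol h s) hF).1
    refine h2.congr (Eventually.of_forall fun ξ => ?_)
    have h1 := bracket_rpow_two_mul s ξ
    have h2 : (bracketSymbol h s ξ : ℂ) = ((bracket ξ ^ s : ℝ) : ℂ) := rfl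
    simp only [norm_mul, mul_pow, h1, h2, Complex.norm_real, Real.norm_eq_abs, sq_abs]
  · exact Eventually.of_forall fun ξ =>
      mul_nonneg (Real.rpow_nonneg (bracket_pos _).le _) (sq_nonneg _)

/-- The evolution with constant profile: a time-independent function has, on the support of the
cutoff, a density in the Bourgain space. -/
theorem exists_const_density {η : ℝ → ℝ} {ψ : ℝ → ℂ} (hψ : IsCutoffTransform η ψ) {b : ℝ}
    (hb' : b < 5 / 8) :
    ∃ C : ℝ, 0 ≤ C ∧ ∀ (h s : ℝ), 0 < h → ∀ f : LatticeL2,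
      ∃ A : ℝ × ℝ → ℂ, MemLp A 2 (specMeasure h) ∧
        energy h A ≤ ENNReal.ofReal (C * sobolevNorm h s f ^ 2) ∧
        ∀ t : ℝ, η t = 1 → ∀ n : ℤ,
          syn h (fun _ => 0) (fun p => invWeight s b p * A p) t n = f n := by
  obtain ⟨C, hC, hd⟩ := hψ.decay
  have hB := bracketMass_nonneg 2
  refine ⟨2 * π * (C ^ 2 * bracketMass 2), by positivity, ?_⟩
  intro h s hh f
  have hbp : ∀ (x y : ℝ), 0 < bracket x ^ y := fun x y => Real.rpow_pos_of_pos (bracket_pos x) y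
  have hF := f.isDFT hh
  set F := dft h (fun n => (f n : ℂ)) with hFdef
  have hψm : Measurable ψ := hψ.contDiff.continuous.measurable
  let A : ℝ × ℝ → ℂ := fun p => (((bracket p.1 ^ s : ℝ) : ℂ) * F p.1) *
    (((bracket p.2 ^ b : ℝ) : ℂ) * ψ p.2)
  have hAm : AEStronglyMeasurable A (specMeasure h) := by
    have e1 : AEStronglyMeasurable (fun p : ℝ × ℝ => F p.1) (specMeasure h) := hF.1.1.comp_fst
    have e2 : Measurable (fun p : ℝ × ℝ => ((bracket p.1 ^ s : ℝ) : ℂ)) := by fun_prop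
    have e3 : Measurable (fun p : ℝ × ℝ => ((bracket p.2 ^ b : ℝ) : ℂ) * ψ p.2) := by fun_prop
    exact (e2.aestronglyMeasurable.mul e1).mul e3.aestronglyMeasurable
  have hψ2 : ∫⁻ x, (ENNReal.ofReal (bracket x ^ b) * ‖ψ x‖ₑ) ^ 2 ≤
      ENNReal.ofReal (C ^ 2 * bracketMass 2) := by
    rw [ENNReal.ofReal_mul (by positivity), ← lintegral_bracket_rpow (c := 2) (by norm_num),
      ← lintegral_const_mul' _ _ ENNReal.ofReal_ne_top]
    refine lintegral_mono fun x => ?_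
    rw [← ofReal_norm, ← ENNReal.ofReal_mul (hbp _ _).le, ← ENNReal.ofReal_pow
      (mul_nonneg (hbp _ _).le (norm_nonneg _)), ← ENNReal.ofReal_mul (by positivity)]
    refine ENNReal.ofReal_le_ofReal ?_
    have e1 : bracket x ^ b * ‖ψ x‖ ≤ C * bracket x ^ (-1 : ℝ) := by
      calc _ ≤ bracket x ^ b * (C * bracket x ^ (-4 : ℝ)) :=
            mul_le_mul_of_nonneg_left (hd x).1 (hbp _ _).le
        _ = C * bracket x ^ (b + -4) := by rw [Real.rpow_add (bracket_pos _)]; ring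
        _ ≤ _ := mul_le_mul_of_nonneg_left (Real.rpow_le_rpow_of_exponent_le (one_le_bracket _)
            (by linarith)) hC
    calc _ ≤ (C * bracket x ^ (-1 : ℝ)) ^ 2 :=
          pow_le_pow_left₀ (mul_nonneg (hbp _ _).le (norm_nonneg _)) e1 2
      _ = _ := by rw [mul_pow, rpow_neg_sq (bracket_pos _)]; norm_num
  have hE : energy h A ≤ ENNReal.ofReal (2 * π * (C ^ 2 * bracketMass 2) * sobolevNorm h s f ^ 2) := by
    have e1 : ∀ p, ‖A p‖ₑ ^ 2 = (ENNReal.ofReal (bracket p.1 ^ (2 * s)) * ‖F p.1‖ₑ ^ 2) *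
        (ENNReal.ofReal (bracket p.2 ^ b) * ‖ψ p.2‖ₑ) ^ 2 := by
      intro p
      have h1 := bracket_rpow_two_mul s p.1
      rw [h1, ENNReal.ofReal_pow (hbp _ _).le]
      simp only [A, enorm_mul, enorm_ofReal_of_nonneg (hbp _ _).le]
      ring
    rw [energy, specMeasure]
    simp only [e1]
    rw [lintegral_prod_mul (μ := volume.restrict (freqDomain h)) (ν := volume)
      (f := fun ξ => ENNReal.ofReal (bracket ξ ^ (2 * s)) * ‖F ξ‖ₑ ^ 2)
      (g := fun x => (ENNReal.ofReal (bracket x ^ b) * ‖ψ x‖ₑ) ^ 2)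
      (by have := hF.1.1.enorm; fun_prop) (by fun_prop), sobolevNorm_sq_eq_lintegral hh s hF]
    refine (mul_le_mul_right hψ2 _).trans_eq ?_
    rw [← ENNReal.ofReal_mul (by positivity)]
    congr 1; ring
  refine ⟨A, memLp_of_energy_lt_top hAm (hE.trans_lt ENNReal.ofReal_lt_top), hE, fun t ht n => ?_⟩
  have h0 : (f n : ℂ) = invDFT h F n := (hF.2 n).symm
  rw [syn, h0, invDFT]
  congr 1
  have e1 : ∀ p : ℝ × ℝ, planeWave h (fun _ => 0) t n p * (invWeight s b p * A p) =
      (F p.1 * Complex.exp (Complex.I * (((h * n) * p.1 : ℝ) : ℂ))) *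
        (Complex.exp (Complex.I * ((t * p.2 : ℝ) : ℂ)) * ψ p.2) := by
    intro p
    have h1 : (invWeight s b p : ℂ) * (((bracket p.1 ^ s : ℝ) : ℂ) * ((bracket p.2 ^ b : ℝ) : ℂ)) =
        1 := by
      rw [← Complex.ofReal_mul, ← Complex.ofReal_mul, invWeight, Real.rpow_neg (bracket_pos _).le,
        Real.rpow_neg (bracket_pos _).le]
      have := hbp p.1 s
      have := hbp p.2 b
      rw [← Complex.ofReal_one]
      congr 1
      field_simp
    have h2 : planeWave h (fun _ => 0) t n p = Complex.exp (Complex.I * (((h * n) * p.1 : ℝ) : ℂ)) *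
        Complex.exp (Complex.I * ((t * p.2 : ℝ) : ℂ)) := by
      rw [planeWave, ← Complex.exp_add]
      congr 1; push_cast; ring
    rw [h2]
    simp only [A]
    linear_combination (Complex.exp (Complex.I * (((h * n) * p.1 : ℝ) : ℂ)) *
      Complex.exp (Complex.I * ((t * p.2 : ℝ) : ℂ)) * F p.1 * ψ p.2) * h1
  simp only [e1]
  rw [specMeasure, integral_prod_mul
    (f := fun ξ => F ξ * Complex.exp (Complex.I * (((h * n) * ξ : ℝ) : ℂ)))
    (g := fun τ => Complex.exp (Complex.I * ((t * τ : ℝ) : ℂ)) * ψ τ), hψ.synthesis, ht,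
    Complex.ofReal_one, mul_one]
/-! ### Forcing terms that are only continuous in time -/

theorem mul_conj_eq_polarization (x y : ℂ) :
    x * starRingEnd ℂ y = (((‖x + y‖ ^ 2 - ‖x - y‖ ^ 2) / 4 : ℝ) : ℂ) +
      Complex.I * (((‖x + Complex.I * y‖ ^ 2 - ‖x - Complex.I * y‖ ^ 2) / 4 : ℝ) : ℂ) := by
  simp only [← Complex.normSq_eq_norm_sq, Complex.normSq_apply]
  refine Complex.ext ?_ ?_ <;> simp <;> ring

/-- The polarised form of Parseval's identity. -/
theorem hasSum_invDFT_mul_conj {h : ℝ} (hh : 0 < h) {F G : ℝ → ℂ}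
    (hF : MemLp F 2 (volume.restrict (freqDomain h)))
    (hG : MemLp G 2 (volume.restrict (freqDomain h))) :
    HasSum (fun n => invDFT h F n * starRingEnd ℂ (invDFT h G n))
      (((2 * π * h)⁻¹ : ℝ) * ∫ ξ in freqDomain h, F ξ * starRingEnd ℂ (G ξ)) := by
  have hIG := hG.const_mul Complex.I
  have hFi := hF.integrable (q := 2) (by norm_num)
  have hGi := hG.integrable (q := 2) (by norm_num)
  have hIGi := hIG.integrable (q := 2) (by norm_num)
  have key : ∀ {G : ℝ → ℂ}, MemLp G 2 (volume.restrict (freqDomain h)) →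
      HasSum (fun n => (‖invDFT h F n + invDFT h G n‖ ^ 2 - ‖invDFT h F n - invDFT h G n‖ ^ 2) / 4)
        ((2 * π * h)⁻¹ * ∫ ξ in freqDomain h, (‖F ξ + G ξ‖ ^ 2 - ‖F ξ - G ξ‖ ^ 2) / 4) := by
    intro G hG
    have hGi := hG.integrable (q := 2) (by norm_num)
    have h1 := hasSum_norm_sq_invDFT hh (hF.add hG)
    have h2 := hasSum_norm_sq_invDFT hh (hF.sub hG)
    have i1 := (memLp_two_iff_integrable_sq_norm (hF.add hG).1).mp (hF.add hG)
    have i2 := (memLp_two_iff_integrable_sq_norm (hF.sub hG).1).mp (hF.sub hG)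
    have h3 := (h1.sub h2).div_const 4
    have e1 : ∀ n, invDFT h (F + G) n = invDFT h F n + invDFT h G n := invDFT_add hFi hGi
    have e2 : ∀ n, invDFT h (F - G) n = invDFT h F n - invDFT h G n := invDFT_sub hFi hGi
    simp only [Pi.add_apply, Pi.sub_apply, e1, e2] at i1 i2 h3
    rw [integral_div, integral_sub i1 i2, mul_div_assoc', mul_sub]
    exact h3
  have h1 := key hG
  have h2 := key hIG
  simp only [invDFT_const_mul] at h2
  have h3 := (Complex.hasSum_ofReal.mpr h1).add ((Complex.hasSum_ofReal.mpr h2).mul_left Complex.I)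
  simp only [← mul_conj_eq_polarization] at h3
  convert h3 using 1
  rw [Complex.ofReal_mul, Complex.ofReal_mul, mul_left_comm Complex.I, ← mul_add,
    ← integral_complex_ofReal, ← integral_complex_ofReal]
  congr 1
  rw [← integral_const_mul Complex.I, ← integral_add]
  · simp only [← mul_conj_eq_polarization]
  · refine Integrable.ofReal (Integrable.div_const (Integrable.sub ?_ ?_) 4)
    · exact (memLp_two_iff_integrable_sq_norm (hF.add hG).1).mp (hF.add hG)
    · exact (memLp_two_iff_integrable_sq_norm (hF.sub hG).1).mp (hF.sub hG)
  · refine (Integrable.ofReal (Integrable.div_const (Integrable.sub ?_ ?_) 4)).const_mul _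
    · exact (memLp_two_iff_integrable_sq_norm (hF.add hIG).1).mp (hF.add hIG)
    · exact (memLp_two_iff_integrable_sq_norm (hF.sub hIG).1).mp (hF.sub hIG)

theorem tsum_enorm_sq_invDFT {h : ℝ} (hh : 0 < h) {F : ℝ → ℂ}
    (hF : MemLp F 2 (volume.restrict (freqDomain h))) :
    ∑' n, ‖invDFT h F n‖ₑ ^ 2 =
      ENNReal.ofReal (2 * π * h)⁻¹ * ∫⁻ ξ in freqDomain h, ‖F ξ‖ₑ ^ 2 := by
  have h1 := hasSum_norm_sq_invDFT hh hF
  have hi := (memLp_two_iff_integrable_sq_norm hF.1).mp hF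
  have h2 : ∫⁻ ξ in freqDomain h, ‖F ξ‖ₑ ^ 2 = ENNReal.ofReal (∫ ξ in freqDomain h, ‖F ξ‖ ^ 2) := by
    rw [ofReal_integral_eq_lintegral_ofReal hi (Eventually.of_forall fun _ => sq_nonneg _)]
    refine lintegral_congr fun ξ => ?_
    rw [ENNReal.ofReal_pow (norm_nonneg _), ofReal_norm]
  rw [h2, ← ENNReal.ofReal_mul (by positivity), ← h1.tsum_eq,
    ENNReal.ofReal_tsum_of_nonneg (fun _ => sq_nonneg _) h1.summable]
  refine tsum_congr fun n => ?_
  rw [ENNReal.ofReal_pow (norm_nonneg _), ofReal_norm]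

/-- The signed indicator of the interval between `0` and `t`, the integral against which is the
integral from `0` to `t`. -/
def timeWindow (t : ℝ) (x : ℝ) : ℂ := (Ioc 0 t).indicator 1 x - (Ioc t 0).indicator 1 x

theorem conj_timeWindow (t x : ℝ) : starRingEnd ℂ (timeWindow t x) = timeWindow t x := by
  rw [timeWindow, map_sub]
  congr 1
  · by_cases hx : x ∈ Ioc 0 t
    · rw [indicator_of_mem hx]; simp
    · rw [indicator_of_notMem hx]; simp
  · by_cases hx : x ∈ Ioc t 0
    · rw [indicator_of_mem hx]; simp
    · rw [indicator_of_notMem hx]; simp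

theorem memLp_timeWindow (t : ℝ) : MemLp (timeWindow t) 2 (volume.restrict (freqDomain 1)) := by
  have h1 : ∀ a b : ℝ, MemLp ((Ioc a b).indicator (1 : ℝ → ℂ)) 2
      (volume.restrict (freqDomain 1)) := fun a b =>
    memLp_indicator_const 2 measurableSet_Ioc (1 : ℂ) (Or.inr (measure_ne_top _ _))
  exact (h1 0 t).sub (h1 t 0)

theorem integral_mul_timeWindow {t : ℝ} (ht : |t| < π) {f : ℝ → ℂ}
    (hf : IntegrableOn f (freqDomain 1)) :
    ∫ x in freqDomain 1, f x * timeWindow t x = ∫ x in (0 : ℝ)..t, f x := by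
  have hpos := Real.pi_pos
  rw [abs_lt] at ht
  have hsub : ∀ a b : ℝ, -π < a → b < π → Ioc a b ⊆ freqDomain 1 := fun a b ha hb x hx => by
    rw [freqDomain, div_one]
    exact ⟨by linarith [hx.1], by linarith [hx.2]⟩
  have h1 : ∀ a b : ℝ, -π < a → b < π →
      ∫ x in freqDomain 1, f x * (Ioc a b).indicator 1 x = ∫ x in Ioc a b, f x := by
    intro a b ha hb
    have : (fun x => f x * (Ioc a b).indicator 1 x) = (Ioc a b).indicator f := by
      funext x
      by_cases hx : x ∈ Ioc a b
      · simp [hx]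
      · simp [hx]
    rw [this, setIntegral_indicator measurableSet_Ioc, inter_eq_self_of_subset_right (hsub a b ha hb)]
  have h2 : ∀ a b : ℝ, Integrable (fun x => f x * (Ioc a b).indicator 1 x)
      (volume.restrict (freqDomain 1)) := by
    intro a b
    have : (fun x => f x * (Ioc a b).indicator 1 x) = (Ioc a b).indicator f := by
      funext x
      by_cases hx : x ∈ Ioc a b
      · simp [hx]
      · simp [hx]
    rw [this]
    exact hf.indicator measurableSet_Ioc
  simp only [timeWindow, mul_sub]
  rw [integral_sub (h2 0 t) (h2 t 0), h1 0 t (by linarith) ht.2, h1 t 0 ht.1 (by linarith)]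
  rfl

theorem conj_invDFT_timeWindow {t : ℝ} (ht : |t| < π) (k : ℤ) :
    starRingEnd ℂ (invDFT 1 (timeWindow t) k) =
      ((1 / (2 * π) : ℝ) : ℂ) * expPrimitive (-(k : ℝ)) t := by
  rw [← invDFT_conj_neg, invDFT, expPrimitive, ← integral_mul_timeWindow ht]
  · congr 1
    have hmp := measurePreserving_neg_freqDomain 1
    have hcv := hmp.integral_comp (MeasurableEquiv.neg ℝ).measurableEmbedding
      (fun x => Complex.exp (Complex.I * ((x * -(k : ℝ) : ℝ) : ℂ)) * timeWindow t x)
    rw [← hcv]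
    refine integral_congr_ae (Eventually.of_forall fun x => ?_)
    simp only [conj_timeWindow]
    rw [mul_comm]
    congr 3
    push_cast; ring
  · refine Measure.integrableOn_of_bounded (M := 1) (measure_ne_top_of_subset subset_rfl
      (by rw [freqDomain]; simp)) (by fun_prop : Continuous _).aestronglyMeasurable
      (Eventually.of_forall fun x => ?_)
    rw [mul_comm, Complex.norm_exp_ofReal_mul_I]

/-- The cosine coefficients in time of a function with values in the square summable functions. -/
def cosCoeff (q : ℝ → LatticeL2) (k : ℤ) : LatticeL2 :=
  (2 * π)⁻¹ • ∫ t in freqDomain 1, Real.cos (k * t) • q t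

/-- The sine coefficients in time of a function with values in the square summable functions. -/
def sinCoeff (q : ℝ → LatticeL2) (k : ℤ) : LatticeL2 :=
  (2 * π)⁻¹ • ∫ t in freqDomain 1, Real.sin (k * t) • q t

theorem integrableOn_freqDomain_of_continuous {E : Type*} [NormedAddCommGroup E] {q : ℝ → E}
    (hq : Continuous q) (h : ℝ) : IntegrableOn q (freqDomain h) :=
  (hq.continuousOn.integrableOn_compact isCompact_Icc).mono_set Ico_subset_Icc_self

theorem map_cosCoeff (L : LatticeL2 →L[ℝ] LatticeL2) {q : ℝ → LatticeL2} (hq : Continuous q)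
    (k : ℤ) : L (cosCoeff q k) = cosCoeff (fun t => L (q t)) k := by
  rw [cosCoeff, map_smul, ← L.integral_comp_comm
    (integrableOn_freqDomain_of_continuous (by fun_prop) 1)]
  simp only [map_smul]
  rfl

theorem map_sinCoeff (L : LatticeL2 →L[ℝ] LatticeL2) {q : ℝ → LatticeL2} (hq : Continuous q)
    (k : ℤ) : L (sinCoeff q k) = sinCoeff (fun t => L (q t)) k := by
  rw [sinCoeff, map_smul, ← L.integral_comp_comm
    (integrableOn_freqDomain_of_continuous (by fun_prop) 1)]
  simp only [map_smul]
  rfl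

/-- Evaluation at a lattice point. -/
def evalAt (n : ℤ) : LatticeL2 →L[ℝ] ℝ := lp.evalCLM ℝ (fun _ : ℤ => ℝ) 2 n

theorem evalAt_apply (n : ℤ) (f : LatticeL2) : evalAt n f = f n := rfl

theorem cosCoeff_add_sinCoeff {q : ℝ → LatticeL2} (hq : Continuous q) (k n : ℤ) :
    (cosCoeff q k n : ℂ) + Complex.I * (sinCoeff q k n : ℂ) =
      invDFT 1 (fun t => (q t n : ℂ)) k := by
  have hqn : Continuous fun t => q t n := (evalAt n).continuous.comp hq
  have h1 : cosCoeff q k n = (2 * π)⁻¹ * ∫ t in freqDomain 1, Real.cos (k * t) * q t n := by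
    rw [← evalAt_apply, cosCoeff, map_smul, ← (evalAt n).integral_comp_comm
      (integrableOn_freqDomain_of_continuous (by fun_prop) 1)]
    simp only [map_smul, smul_eq_mul, evalAt_apply]
  have h2 : sinCoeff q k n = (2 * π)⁻¹ * ∫ t in freqDomain 1, Real.sin (k * t) * q t n := by
    rw [← evalAt_apply, sinCoeff, map_smul, ← (evalAt n).integral_comp_comm
      (integrableOn_freqDomain_of_continuous (by fun_prop) 1)]
    simp only [map_smul, smul_eq_mul, evalAt_apply]
  rw [h1, h2, invDFT, Complex.ofReal_mul, Complex.ofReal_mul, ← integral_complex_ofReal,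
    ← integral_complex_ofReal, mul_left_comm Complex.I, ← mul_add, ← integral_const_mul,
    ← integral_add, one_div]
  · congr 1
    refine integral_congr_ae (Eventually.of_forall fun t => ?_)
    simp only
    rw [mul_comm Complex.I (((1 * k * t : ℝ) : ℂ)), Complex.exp_mul_I, ← Complex.ofReal_cos,
      ← Complex.ofReal_sin, one_mul]
    push_cast; ring
  · exact integrableOn_freqDomain_of_continuous (by fun_prop) 1
  · exact integrableOn_freqDomain_of_continuous (by fun_prop) 1

/-- A forcing that is continuous in time with values in `H^s` has, in integrated form, a density
over the integer time frequencies, namely its Fourier series in time. -/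
theorem exists_forcing_density {h : ℝ} (hh : 0 < h) {s : ℝ} (hs : 0 ≤ s) {q : ℝ → LatticeL2}
    (hq : Continuous q) {P : ℝ} (hP : ∀ t, sobolevNorm h s (q t) ≤ P) :
    ∃ Q : ℝ × ℤ → ℂ, StronglyMeasurable Q ∧
      ∫⁻ p : ℝ × ℤ, ENNReal.ofReal (bracket p.1 ^ (2 * s) * (√(bracket (-(p.2 : ℝ))))⁻¹) * ‖Q p‖ₑ ^ 2
        ∂((volume.restrict (freqDomain h)).prod Measure.count) ≤ ENNReal.ofReal (2 * π * P ^ 2) ∧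
      ∀ t : ℝ, |t| < π → ∀ n : ℤ,
        integratedSyn h Measure.count (fun k : ℤ => -(k : ℝ)) Q t n =
          ((∫ t₁ in (0 : ℝ)..t, q t₁) n : ℝ) := by
  set μ := volume.restrict (freqDomain h) with hμ
  have hbp : ∀ (x y : ℝ), 0 < bracket x ^ y := fun x y => Real.rpow_pos_of_pos (bracket_pos x) y
  have hC0 : ∀ k, IsDFT h (fun n => invDFT 1 (fun t => (q t n : ℂ)) k)
      (fun ξ => dft h (fun n => (cosCoeff q k n : ℂ)) ξ +
        Complex.I * dft h (fun n => (sinCoeff q k n : ℂ)) ξ) := fun k => by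
    have := ((cosCoeff q k).isDFT hh).add (((sinCoeff q k).isDFT hh).const_mul Complex.I)
    simpa only [cosCoeff_add_sinCoeff hq] using this
  set p : ℝ → LatticeL2 := fun t => mulCLM hh (bracketSymbol h s) (q t) with hp
  have hpc : Continuous p := (mulCLM hh (bracketSymbol h s)).continuous.comp hq
  have hCs : ∀ k, IsDFT h (fun n => invDFT 1 (fun t => (p t n : ℂ)) k)
      (fun ξ => ((bracket ξ ^ s : ℝ) : ℂ) * (dft h (fun n => (cosCoeff q k n : ℂ)) ξ +
        Complex.I * dft h (fun n => (sinCoeff q k n : ℂ)) ξ)) := fun k => by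
    have h1 := (mulLin_isDFT hh (bracketSymbol h s) ((cosCoeff q k).isDFT hh)).add
      ((mulLin_isDFT hh (bracketSymbol h s) ((sinCoeff q k).isDFT hh)).const_mul Complex.I)
    simp only [← mulCLM_apply, map_cosCoeff _ hq, map_sinCoeff _ hq] at h1
    have h2 := fun n => cosCoeff_add_sinCoeff hpc k n
    simp only [hp] at h2
    simp only [h2] at h1
    refine h1.congr (Eventually.of_forall fun ξ => ?_)
    have : (bracketSymbol h s ξ : ℂ) = ((bracket ξ ^ s : ℝ) : ℂ) := rfl
    simp only [this]
    ring
  -- measurable representatives of the coefficients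
  let C : ℤ → ℝ → ℂ := fun k => (hC0 k).1.1.mk _
  have hCm : ∀ k, StronglyMeasurable (C k) := fun k => (hC0 k).1.1.stronglyMeasurable_mk
  have hCae : ∀ k, _ =ᵐ[μ] C k := fun k => (hC0 k).1.1.ae_eq_mk
  have hC : ∀ k, IsDFT h (fun n => invDFT 1 (fun t => (q t n : ℂ)) k) (C k) := fun k =>
    (hC0 k).congr (hCae k)
  have hC' : ∀ k, IsDFT h (fun n => invDFT 1 (fun t => (p t n : ℂ)) k)
      (fun ξ => ((bracket ξ ^ s : ℝ) : ℂ) * C k ξ) := fun k =>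
    (hCs k).congr ((hCae k).mono fun ξ hξ => by simp only [← hξ])
  let Q : ℝ × ℤ → ℂ := fun x => C x.2 x.1
  have hQm : StronglyMeasurable Q :=
    (measurable_from_prod_countable_left fun k => (hCm k).measurable).stronglyMeasurable
  have hQE : ∫⁻ x, ENNReal.ofReal (bracket x.1 ^ (2 * s)) * ‖Q x‖ₑ ^ 2 ∂(μ.prod Measure.count) ≤
      ENNReal.ofReal (2 * π * P ^ 2) := by
    have e1 : ∀ k, ∫⁻ ξ, ENNReal.ofReal (bracket ξ ^ (2 * s)) * ‖C k ξ‖ₑ ^ 2 ∂μ =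
        ENNReal.ofReal (2 * π * h) * ∑' n, ‖invDFT 1 (fun t => (p t n : ℂ)) k‖ₑ ^ 2 := by
      intro k
      have f1 := tsum_enorm_sq_invDFT hh (hC' k).1
      simp only [(hC' k).2] at f1
      rw [f1, ← mul_assoc, ← ENNReal.ofReal_mul (by positivity), mul_inv_cancel₀ (by positivity),
        ENNReal.ofReal_one, one_mul]
      refine lintegral_congr fun ξ => ?_
      rw [enorm_mul, mul_pow, enorm_ofReal_of_nonneg (hbp _ _).le, bracket_rpow_two_mul,
        ENNReal.ofReal_pow (hbp _ _).le]
    have hpn : ∀ n, Continuous fun t => p t n := fun n => (evalAt n).continuous.comp hpc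
    have e2 : ∀ n, ∑' k, ‖invDFT 1 (fun t => (p t n : ℂ)) k‖ₑ ^ 2 =
        ENNReal.ofReal (2 * π)⁻¹ * ∫⁻ t in freqDomain 1, ‖(p t n : ℂ)‖ₑ ^ 2 := by
      intro n
      have f0 : Continuous fun t => (p t n : ℂ) := Complex.continuous_ofReal.comp (hpn n)
      have f1 : MemLp (fun t => (p t n : ℂ)) 2 (volume.restrict (freqDomain 1)) := by
        refine (memLp_two_iff_integrable_sq_norm f0.aestronglyMeasurable).mpr ?_
        exact integrableOn_freqDomain_of_continuous (by fun_prop) 1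
      have := tsum_enorm_sq_invDFT one_pos f1
      rwa [mul_one] at this
    calc _ = ∑' k, ∫⁻ ξ, ENNReal.ofReal (bracket ξ ^ (2 * s)) * ‖C k ξ‖ₑ ^ 2 ∂μ := by
          have := hQm.measurable.enorm
          rw [lintegral_prod_symm _ (by fun_prop), lintegral_count]
      _ = ENNReal.ofReal (2 * π * h) * ∑' n, ∑' k, ‖invDFT 1 (fun t => (p t n : ℂ)) k‖ₑ ^ 2 := by
          simp only [e1]
          rw [ENNReal.tsum_mul_left, ENNReal.tsum_comm]
      _ = ENNReal.ofReal h * ∑' n, ∫⁻ t in freqDomain 1, ‖(p t n : ℂ)‖ₑ ^ 2 := by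
          simp only [e2]
          rw [ENNReal.tsum_mul_left, ← mul_assoc, ← ENNReal.ofReal_mul (by positivity)]
          congr 2
          field_simp
      _ = ∫⁻ t in freqDomain 1, ENNReal.ofReal h * ∑' n, ‖(p t n : ℂ)‖ₑ ^ 2 := by
          rw [lintegral_const_mul' _ _ ENNReal.ofReal_ne_top, lintegral_tsum]
          intro n
          have := (hpn n).measurable
          fun_prop
      _ ≤ ∫⁻ t in freqDomain 1, ENNReal.ofReal (P ^ 2) := by
          refine lintegral_mono fun t => ?_
          have f1 : ∑' n, ‖(p t n : ℂ)‖ₑ ^ 2 = ENNReal.ofReal (‖p t‖ ^ 2) := by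
            rw [LatticeL2.norm_sq, ENNReal.ofReal_tsum_of_nonneg (fun _ => sq_nonneg _)
              (p t).hasSum_sq.summable]
            refine tsum_congr fun n => ?_
            rw [← ofReal_norm, Complex.norm_real, ← ENNReal.ofReal_pow (norm_nonneg _),
              Real.norm_eq_abs, sq_abs]
          rw [f1, ← ENNReal.ofReal_mul hh.le]
          refine ENNReal.ofReal_le_ofReal ?_
          have f2 := hP t
          rw [sobolevNorm_eq hh] at f2
          have f3 : h * ‖p t‖ ^ 2 = (√h * ‖mulLin hh (bracketSymbol h s) (q t)‖) ^ 2 := by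
            rw [mul_pow, Real.sq_sqrt hh.le]; rfl
          rw [f3]
          exact pow_le_pow_left₀ (by positivity) f2 2
      _ = _ := by
          rw [setLIntegral_const, freqDomain, Real.volume_Ico, ← ENNReal.ofReal_mul (by positivity)]
          congr 1; ring
  refine ⟨Q, hQm, (lintegral_mono fun x => ?_).trans hQE, fun t ht n => ?_⟩
  · refine mul_le_mul_left (ENNReal.ofReal_le_ofReal ?_) _
    refine mul_le_of_le_one_right (hbp _ _).le (inv_le_one_of_one_le₀ ?_)
    rw [Real.one_le_sqrt]
    exact one_le_bracket _
  · have hqn : Continuous fun t => (q t n : ℂ) :=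
      Complex.continuous_ofReal.comp ((evalAt n).continuous.comp hq)
    have hF2 : MemLp (fun t => (q t n : ℂ)) 2 (volume.restrict (freqDomain 1)) := by
      refine (memLp_two_iff_integrable_sq_norm hqn.aestronglyMeasurable).mpr ?_
      exact integrableOn_freqDomain_of_continuous (by fun_prop) 1
    have hsum := hasSum_invDFT_mul_conj one_pos hF2 (memLp_timeWindow t)
    simp only [conj_timeWindow, conj_invDFT_timeWindow ht] at hsum
    rw [integral_mul_timeWindow ht (integrableOn_freqDomain_of_continuous hqn 1)] at hsum
    have hval : ((∫ t₁ in (0 : ℝ)..t, q t₁) n : ℝ) = ∫ t₁ in (0 : ℝ)..t, q t₁ n := by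
      rw [← evalAt_apply, ← (evalAt n).intervalIntegral_comp_comm (hq.intervalIntegrable _ _)]
      rfl
    rw [hval, ← intervalIntegral.integral_ofReal]
    -- the superposition converges absolutely, by the Cauchy-Schwarz inequality
    have hEm : Measurable (fun x : ℝ × ℤ => expPrimitive (-(x.2 : ℝ)) t) :=
      (measurable_from_top (f := fun k : ℤ => expPrimitive (-(k : ℝ)) t)).comp measurable_snd
    have hE2 : ∫⁻ x : ℝ × ℤ, ‖expPrimitive (-(x.2 : ℝ)) t‖ₑ ^ 2 ∂(μ.prod Measure.count) < ⊤ := by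
      rw [lintegral_prod _ (hEm.enorm.pow_const 2).aemeasurable]
      simp only [lintegral_count, lintegral_const]
      refine ENNReal.mul_lt_top ?_ (measure_lt_top _ _)
      have f1 := tsum_enorm_sq_invDFT one_pos (memLp_timeWindow t)
      have f2 : ∀ k : ℤ, ‖expPrimitive (-(k : ℝ)) t‖ₑ ^ 2 =
          ENNReal.ofReal (2 * π) ^ 2 * ‖invDFT 1 (timeWindow t) k‖ₑ ^ 2 := by
        intro k
        have g1 := conj_invDFT_timeWindow ht k
        have g2 : expPrimitive (-(k : ℝ)) t =
            ((2 * π : ℝ) : ℂ) * starRingEnd ℂ (invDFT 1 (timeWindow t) k) := by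
          rw [g1, ← mul_assoc, ← Complex.ofReal_mul, mul_one_div_cancel (by positivity),
            Complex.ofReal_one, one_mul]
        rw [g2, enorm_mul, mul_pow, enorm_ofReal_of_nonneg (by positivity), RCLike.enorm_conj]
      simp only [f2]
      rw [ENNReal.tsum_mul_left, f1]
      refine ENNReal.mul_lt_top (by finiteness) (ENNReal.mul_lt_top ENNReal.ofReal_lt_top ?_)
      have := (memLp_timeWindow t).eLpNorm_lt_top
      rw [eLpNorm_lt_top_iff_lintegral_rpow_enorm_lt_top (by norm_num) (by norm_num)] at this
      simpa using this
    have hQ2 : ∫⁻ x, ‖Q x‖ₑ ^ 2 ∂(μ.prod Measure.count) < ⊤ := by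
      refine lt_of_le_of_lt (lintegral_mono fun x => ?_) (hQE.trans_lt ENNReal.ofReal_lt_top)
      refine le_mul_of_one_le_left zero_le ?_
      rw [← ENNReal.ofReal_one]
      exact ENNReal.ofReal_le_ofReal (Real.one_le_rpow (one_le_bracket _) (by linarith))
    have hint : Integrable (fun x : ℝ × ℤ => Complex.exp (Complex.I * ((h * n * x.1 : ℝ) : ℂ)) *
        (expPrimitive (-(x.2 : ℝ)) t * Q x)) (μ.prod Measure.count) := by
      have f1 : Integrable (fun x : ℝ × ℤ => expPrimitive (-(x.2 : ℝ)) t * Q x)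
          (μ.prod Measure.count) := by
        refine ⟨hEm.aestronglyMeasurable.mul hQm.aestronglyMeasurable, ?_⟩
        rw [hasFiniteIntegral_iff_enorm]
        simp only [enorm_mul]
        have f2 := (sq_lintegral_mul_le (μ := μ.prod Measure.count) hEm.enorm.aemeasurable
          hQm.measurable.enorm.aemeasurable).trans_lt (ENNReal.mul_lt_top hE2 hQ2)
        by_contra f3
        rw [not_lt, top_le_iff] at f3
        rw [f3] at f2
        simp at f2
      refine f1.bdd_mul (c := 1) (by fun_prop : Measurable _).aestronglyMeasurable
        (Eventually.of_forall fun x => ?_)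
      rw [mul_comm, Complex.norm_exp_ofReal_mul_I]
    have hterm : ∀ k : ℤ, ((1 / (2 * π) : ℝ) : ℂ) *
        ∫ ξ, Complex.exp (Complex.I * ((h * n * ξ : ℝ) : ℂ)) *
          (expPrimitive (-(k : ℝ)) t * C k ξ) ∂μ =
        expPrimitive (-(k : ℝ)) t * invDFT 1 (fun t => (q t n : ℂ)) k := by
      intro k
      have h0 : invDFT 1 (fun t => (q t n : ℂ)) k = invDFT h (C k) n := ((hC k).2 n).symm
      rw [h0, invDFT, mul_left_comm, ← integral_const_mul (expPrimitive (-(k : ℝ)) t)]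
      congr 1
      refine integral_congr_ae (Eventually.of_forall fun ξ => ?_)
      simp only
      ring
    rw [integratedSyn, integral_prod_symm _ hint, integral_countable hint.integral_prod_right,
      ← tsum_mul_left]
    simp only [Measure.real, Measure.count_singleton, ENNReal.toReal_one, one_smul]
    have hpi : (π : ℂ) ≠ 0 := by exact_mod_cast Real.pi_ne_zero
    have h9 := (hsum.mul_left (2 * π : ℂ)).tsum_eq
    have h10 : (2 * π : ℂ) * ((((2 * π * 1)⁻¹ : ℝ) : ℂ) * ∫ x in (0 : ℝ)..t, (q x n : ℂ)) =
        ∫ x in (0 : ℝ)..t, (q x n : ℂ) := by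
      push_cast; field_simp
    rw [h10] at h9
    rw [← h9]
    refine tsum_congr fun k => ?_
    rw [hterm]
    push_cast
    field_simp
/-! ### Densities of forcing terms in the interaction picture -/

/-- The integral in time of waves of phase zero. -/
theorem integral_syn_eq_integratedSyn {h : ℝ} {W : ℝ × ℝ → ℂ} (hW : Integrable W (specMeasure h))
    (t : ℝ) (n : ℤ) :
    ∫ t₁ in (0 : ℝ)..t, syn h (fun _ => 0) W t₁ n =
      integratedSyn h volume (fun τ => τ) W t n := by
  simp only [syn, integratedSyn]
  rw [intervalIntegral.integral_const_mul]
  congr 1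
  have hWae := hW.1
  have hint : Integrable (fun x : ℝ × (ℝ × ℝ) => planeWave h (fun _ => 0) x.1 n x.2 * W x.2)
      ((volume.restrict (uIoc 0 t)).prod (specMeasure h)) := by
    have : IsFiniteMeasure (volume.restrict (uIoc 0 t)) :=
      ⟨by rw [Measure.restrict_apply_univ, uIoc]; simp⟩
    have h1 : Integrable (fun x : ℝ × (ℝ × ℝ) => W x.2)
        ((volume.restrict (uIoc 0 t)).prod (specMeasure h)) := hW.comp_snd _
    refine h1.bdd_mul (c := 1) ?_ (Eventually.of_forall fun x => (norm_planeWave h _ _ n _).le)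
    unfold planeWave
    exact (by fun_prop : Measurable _).aestronglyMeasurable
  rw [intervalIntegral_integral_swap hint]
  refine integral_congr_ae (Eventually.of_forall fun p => ?_)
  simp only
  rw [intervalIntegral.integral_mul_const, expPrimitive, ← mul_assoc,
    ← intervalIntegral.integral_const_mul]
  congr 1
  refine intervalIntegral.integral_congr fun t₁ _ => ?_
  simp only [planeWave, add_zero]
  rw [← Complex.exp_add]
  congr 1; push_cast; ring

theorem isDFT_of_syn {h : ℝ} (hh : 0 < h) {φ : ℝ → ℝ} (hφ : Measurable φ) {W : ℝ × ℝ → ℂ}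
    (hW : Integrable W (specMeasure h)) {t : ℝ} {y : LatticeL2}
    (hy : ∀ n, syn h φ W t n = (y n : ℂ)) :
    IsDFT h (fun n => (y n : ℂ))
      (fun ξ => Complex.exp (Complex.I * ((t * φ ξ : ℝ) : ℂ)) * profile W t ξ) :=
  isDFT_of_integrableOn hh y.memℓp_ofReal (integrableOn_exp_mul_profile hφ hW t) fun n => by
    rw [← syn_eq_invDFT hφ hW, hy]

/-- In the moving frame the flow does nothing: it turns waves of phase zero into waves of
phase `φ`. -/
theorem flow_apply_of_syn {h : ℝ} (hh : 0 < h) {φ : ℝ → ℝ} (hφ : Measurable φ)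
    (hodd : ∀ ξ, φ (-ξ) = -φ ξ) {W : ℝ × ℝ → ℂ}
    (hW : Integrable W (specMeasure h)) {t : ℝ} {y : LatticeL2}
    (hy : ∀ n, syn h (fun _ => 0) W t n = (y n : ℂ)) (n : ℤ) :
    (flow hh hφ hodd t y n : ℂ) = syn h φ W t n := by
  have h1 := isDFT_of_syn hh measurable_const hW hy
  simp only [mul_zero, Complex.ofReal_zero, Complex.exp_zero, one_mul] at h1
  have h0 : _ = (flow hh hφ hodd t y n : ℂ) := (flow_isDFT hh hφ hodd t h1).2 n
  rw [← h0, syn_eq_invDFT hφ hW]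

theorem norm_nablaSymbol_le {h : ℝ} (hh : 0 < h) (ξ : ℝ) : ‖nablaSymbol h ξ‖ ≤ 2 / h := by
  simp only [nablaSymbol]
  rw [norm_mul, Complex.norm_I, one_mul, Complex.norm_real, Real.norm_eq_abs, abs_mul,
    abs_of_pos (by positivity : 0 < 2 / h)]
  exact mul_le_of_le_one_right (by positivity) (Real.abs_sin_le_one _)

theorem integrable_nablaSymbol_mul {h : ℝ} (hh : 0 < h) {Q : ℝ × ℝ → ℂ}
    (hQ : Integrable Q (specMeasure h)) :
    Integrable (fun p => nablaSymbol h p.1 * Q p) (specMeasure h) :=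
  hQ.bdd_mul (c := 2 / h) ((nablaSymbol h).measurable'.comp measurable_fst).aestronglyMeasurable
    (Eventually.of_forall fun p => norm_nablaSymbol_le hh p.1)

theorem flow_neg_nabla_of_syn {h : ℝ} (hh : 0 < h) {φ : ℝ → ℝ} (hφ : Measurable φ)
    (hodd : ∀ ξ, φ (-ξ) = -φ ξ) {Q : ℝ × ℝ → ℂ}
    (hQ : Integrable Q (specMeasure h)) {t : ℝ} {N : LatticeL2}
    (hN : ∀ n, syn h φ Q t n = (N n : ℂ)) (n : ℤ) :
    (flow hh hφ hodd (-t) (mulLin hh (nablaSymbol h) N) n : ℂ) =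
      syn h (fun _ => 0) (fun p => nablaSymbol h p.1 * Q p) t n := by
  have h1 := isDFT_of_syn hh hφ hQ hN
  have h0 : _ = (flow hh hφ hodd (-t) (mulLin hh (nablaSymbol h) N) n : ℂ) :=
    (flow_isDFT hh hφ hodd (-t) (mulLin_isDFT hh (nablaSymbol h) h1)).2 n
  rw [← h0, syn_eq_invDFT measurable_const (integrable_nablaSymbol_mul hh hQ)]
  refine invDFT_congr (Eventually.of_forall fun ξ => ?_) n
  simp only [mul_zero, Complex.ofReal_zero, Complex.exp_zero, one_mul, profile]
  have h2 : ∫ τ : ℝ, Complex.exp (Complex.I * ((t * τ : ℝ) : ℂ)) * (nablaSymbol h ξ * Q (ξ, τ)) =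
      nablaSymbol h ξ * ∫ τ : ℝ, Complex.exp (Complex.I * ((t * τ : ℝ) : ℂ)) * Q (ξ, τ) := by
    rw [← integral_const_mul]
    exact integral_congr_ae (Eventually.of_forall fun τ => by ring)
  have h3 : Complex.exp (Complex.I * ((-t * φ ξ : ℝ) : ℂ)) *
      Complex.exp (Complex.I * ((t * φ ξ : ℝ) : ℂ)) = 1 := by
    rw [← Complex.exp_add, ← Complex.exp_zero]; congr 1; push_cast; ring
  rw [h2]
  linear_combination (nablaSymbol h ξ *
    ∫ τ : ℝ, Complex.exp (Complex.I * ((t * τ : ℝ) : ℂ)) * Q (ξ, τ)) * h3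

/-! ### Products of lattice functions -/

theorem LatticeL2.memℓp_mul (f g : LatticeL2) : Memℓp (fun n => f n * g n) 2 := by
  rw [memℓp_gen_iff (by norm_num)]
  simp only [ENNReal.toReal_ofNat, Real.rpow_ofNat, norm_mul, Real.norm_eq_abs, mul_pow, sq_abs]
  refine Summable.of_nonneg_of_le (fun n => by positivity) (fun n => ?_)
    (g.hasSum_sq.summable.mul_left (‖f‖ ^ 2))
  have := f.abs_apply_le n
  rw [← sq_abs (f n)]
  gcongr

/-- The pointwise product of square summable lattice functions. -/
def latMul (f g : LatticeL2) : LatticeL2 := ⟨fun n => f n * g n, f.memℓp_mul g⟩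

theorem latMul_apply (f g : LatticeL2) (n : ℤ) : latMul f g n = f n * g n := rfl

theorem LatticeL2.norm_le_of_abs_le {f g : LatticeL2} {c : ℝ} (hc : 0 ≤ c)
    (hfg : ∀ n, |f n| ≤ c * |g n|) : ‖f‖ ≤ c * ‖g‖ := by
  refine le_of_sq_le_sq ?_ (by positivity)
  rw [mul_pow]
  refine hasSum_le (fun n => ?_) f.hasSum_sq (g.hasSum_sq.mul_left (c ^ 2))
  rw [← sq_abs (f n), ← sq_abs (g n), ← mul_pow]
  have := hfg n
  gcongr

theorem norm_latMul_le (f g : LatticeL2) : ‖latMul f g‖ ≤ ‖f‖ * ‖g‖ :=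
  LatticeL2.norm_le_of_abs_le (norm_nonneg f) fun n => by
    rw [latMul_apply, abs_mul]
    have := f.abs_apply_le n
    gcongr

/-- The pointwise product as a continuous bilinear map. -/
def latMulCLM : LatticeL2 →L[ℝ] LatticeL2 →L[ℝ] LatticeL2 :=
  LinearMap.mkContinuous₂
    (LinearMap.mk₂ ℝ latMul
      (fun f g k => lp.ext (funext fun n => add_mul (f n) (g n) (k n)))
      (fun c f g => lp.ext (funext fun n => mul_assoc c (f n) (g n)))
      (fun f g k => lp.ext (funext fun n => mul_add (f n) (g n) (k n)))
      (fun c f g => lp.ext (funext fun n => mul_left_comm (f n) c (g n))))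
    1 (fun f g => by simpa using norm_latMul_le f g)

theorem latMulCLM_apply (f g : LatticeL2) : latMulCLM f g = latMul f g := rfl

theorem continuous_latMul {X : Type*} [TopologicalSpace X] {f g : X → LatticeL2}
    (hf : Continuous f) (hg : Continuous g) : Continuous (fun x => latMul (f x) (g x)) := by
  simp only [← latMulCLM_apply]
  fun_prop

/-! ### The Duhamel term of the quadratic interaction -/

/-- The group `e^{t φ(∂_h / i)}` for the phase `φ = phase h σ ε`. For `ε = 1` it is the FPU
propagator with sign `σ`; for `ε = 0` it is `e^{σ t/h² ∂_h}`, and for `ε = -1` the composition of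
`e^{2 σ t/h² ∂_h}` with the propagator of sign `-σ`. -/
def phaseFlow {h : ℝ} (hh : 0 < h) (σ ε t : ℝ) : LatticeL2 →L[ℝ] LatticeL2 :=
  flow hh (measurable_phase h σ ε) (phase_neg h σ ε) t

theorem continuous_phaseFlow_apply {h : ℝ} (hh : 0 < h) (σ ε : ℝ) {t : ℝ → ℝ}
    (ht : Continuous t) {f : ℝ → LatticeL2} (hf : Continuous f) :
    Continuous (fun x => phaseFlow hh σ ε (t x) (f x)) := by
  obtain ⟨c, hc⟩ := phase_bounded h σ ε
  exact continuous_flow_apply hh _ _ hc ht hf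

theorem norm_phaseFlow {h : ℝ} (hh : 0 < h) (σ ε t : ℝ) (f : LatticeL2) :
    ‖phaseFlow hh σ ε t f‖ = ‖f‖ := norm_flow hh _ _ t f

/-- The integrand `S(-t) ∇_h N` of the Duhamel formula in the interaction picture. -/
def pullback {h : ℝ} (hh : 0 < h) (σ t : ℝ) (N : LatticeL2) : LatticeL2 :=
  phaseFlow hh σ 1 (-t) (mulCLM hh (nablaSymbol h) N)

theorem continuous_pullback {h : ℝ} (hh : 0 < h) (σ : ℝ) {N : ℝ → LatticeL2}
    (hN : Continuous N) : Continuous (fun t => pullback hh σ t (N t)) :=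
  continuous_phaseFlow_apply hh σ 1 continuous_neg
    ((mulCLM hh (nablaSymbol h)).continuous.comp hN)

theorem ofReal_integral_apply {q : ℝ → LatticeL2} (hq : Continuous q) (t : ℝ) (n : ℤ) :
    (((∫ t₁ in (0 : ℝ)..t, q t₁) n : ℝ) : ℂ) = ∫ t₁ in (0 : ℝ)..t, ((q t₁ n : ℝ) : ℂ) := by
  have h1 : (∫ t₁ in (0 : ℝ)..t, evalAt n (q t₁)) = evalAt n (∫ t₁ in (0 : ℝ)..t, q t₁) :=
    (evalAt n).intervalIntegral_comp_comm (hq.intervalIntegrable 0 t)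
  simp only [evalAt_apply] at h1
  rw [← h1, intervalIntegral.integral_ofReal]

/-- The Duhamel term of a product of two waves has a density, whose norm is bounded by the norms of
the densities of the factors with a constant that is small for small `T` and does not depend
on `h`. -/
theorem exists_quadratic_density {η : ℝ → ℝ} {ψ : ℝ → ℂ} (hψ : IsCutoffTransform η ψ)
    (hη : ∀ t, |t| ≤ 2 → η t = 1) {b : ℝ} (hb : 1 / 2 < b) (hb' : b < 5 / 8) {s : ℝ}
    (hs : 0 ≤ s) :
    ∃ C : ℝ, 0 ≤ C ∧ ∀ T : ℝ, 0 < T → T ≤ 1 → ∀ (h : ℝ) (hh : 0 < h) (σ ε₁ ε₂ : ℝ),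
      (σ = 1 ∨ σ = -1) → (ε₁ = 1 ∨ ε₁ = -1) → (ε₂ = 1 ∨ ε₂ = -1) → ∀ A B : ℝ × ℝ → ℂ,
      MemLp A 2 (specMeasure h) → MemLp B 2 (specMeasure h) → ∀ y z : ℝ → LatticeL2,
      Continuous y → Continuous z →
      (∀ t, |t| ≤ 2 * T → ∀ n,
        syn h (fun _ => 0) (fun p => invWeight s b p * A p) t n = (y t n : ℂ)) →
      (∀ t, |t| ≤ 2 * T → ∀ n,
        syn h (fun _ => 0) (fun p => invWeight s b p * B p) t n = (z t n : ℂ)) →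
      ∃ D : ℝ × ℝ → ℂ, MemLp D 2 (specMeasure h) ∧
        energy h D ≤ ENNReal.ofReal (C * T ^ (1 / 8 : ℝ)) * (energy h A * energy h B) ∧
        ∀ t, |t| ≤ 2 * T → ∀ n, syn h (fun _ => 0) (fun p => invWeight s b p * D p) t n =
          (((∫ t₁ in (0 : ℝ)..t, pullback hh σ t₁
            (latMul (phaseFlow hh σ ε₁ t₁ (y t₁)) (phaseFlow hh σ ε₂ t₁ (z t₁)))) n : ℝ) : ℂ) := by
  obtain ⟨C, hC, H⟩ := exists_duhamel_density hψ hb hb'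
  refine ⟨C * bracketMass (17 / 16) * bilinearConst s b,
    mul_nonneg (mul_nonneg hC isSpread_volume.nonneg) (bilinearConst_nonneg s b), ?_⟩
  intro T hT hT1 h hh σ ε₁ ε₂ hσ hε₁ hε₂ A B hA hB y z hy hz hyA hzB
  have hiA := integrable_invWeight_mul hs hb hA
  have hiB := integrable_invWeight_mul hs hb hB
  obtain ⟨Q, hQ, hQb, hQs⟩ := exists_product_density hh hs hb hσ hε₁ hε₂ hA hB
  -- a strongly measurable representative of the density of the product
  have hQQ := hQ.1.ae_eq_mk
  set Q' := hQ.1.mk Q with hQ'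
  have hQ'm : StronglyMeasurable Q' := hQ.1.stronglyMeasurable_mk
  have hQ'i : Integrable Q' (specMeasure h) := hQ.congr hQQ
  set P : ℝ × ℝ → ℂ := fun p => nablaSymbol h p.1 * Q' p with hP
  have hPm : StronglyMeasurable P :=
    ((nablaSymbol h).measurable'.comp measurable_fst).stronglyMeasurable.mul hQ'm
  have hPi : Integrable P (specMeasure h) := integrable_nablaSymbol_mul hh hQ'i
  have hPb : ∫⁻ p : ℝ × ℝ, ENNReal.ofReal (bracket p.1 ^ (2 * s) * (√(bracket p.2))⁻¹) * ‖P p‖ₑ ^ 2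
      ∂((volume.restrict (freqDomain h)).prod volume) ≤
      ENNReal.ofReal (bilinearConst s b) * (energy h A * energy h B) := by
    refine le_trans (le_of_eq ?_) hQb
    refine lintegral_congr_ae (hQQ.mono fun p hp => ?_)
    have h1 : ‖nablaSymbol h p.1‖ₑ ^ 2 =
        ENNReal.ofReal ((2 / h * Real.sin (h * p.1 / 2)) ^ 2) := by
      rw [← ofReal_norm, ← ENNReal.ofReal_pow (norm_nonneg _)]
      simp only [nablaSymbol]
      rw [norm_mul, Complex.norm_I, one_mul, Complex.norm_real, Real.norm_eq_abs, sq_abs]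
    simp only [hP, enorm_mul]
    rw [mul_pow, h1, hp, mul_assoc ((2 / h * Real.sin (h * p.1 / 2)) ^ 2),
      ENNReal.ofReal_mul (sq_nonneg (2 / h * Real.sin (h * p.1 / 2)))]
    ring
  obtain ⟨D, hD, hDe, hDs⟩ := H T hT hT1 h s hs volume (fun τ => τ) _ isSpread_volume P hPm _
    (ENNReal.mul_lt_top ENNReal.ofReal_lt_top
      (ENNReal.mul_lt_top (energy_lt_top hA) (energy_lt_top hB))) hPb
  refine ⟨D, hD, hDe.trans (le_of_eq ?_), fun t ht n => ?_⟩
  · rw [← mul_assoc, ← ENNReal.ofReal_mul (by have := isSpread_volume.nonneg; positivity)]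
    congr 2; ring
  have hηt : η (t / T) = 1 := hη _ (by rw [abs_div, abs_of_pos hT]; exact (div_le_iff₀ hT).2 ht)
  rw [hDs t hηt n, ← integral_syn_eq_integratedSyn hPi, ofReal_integral_apply
    (continuous_pullback hh σ (continuous_latMul
      (continuous_phaseFlow_apply hh σ ε₁ continuous_id' hy)
      (continuous_phaseFlow_apply hh σ ε₂ continuous_id' hz)))]
  refine intervalIntegral.integral_congr fun t₁ ht₁ => ?_
  have ht₁' : |t₁| ≤ 2 * T := by
    refine le_trans ?_ ht
    have := abs_sub_left_of_mem_uIcc ht₁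
    simpa using this
  refine (flow_neg_nabla_of_syn hh (measurable_phase h σ 1) (phase_neg h σ 1) hQ'i
    (N := latMul (phaseFlow hh σ ε₁ t₁ (y t₁)) (phaseFlow hh σ ε₂ t₁ (z t₁))) (fun k => ?_) n).symm
  rw [← syn_congr hQQ, ← hQs, latMul_apply, Complex.ofReal_mul]
  congr 1
  · exact (flow_apply_of_syn hh _ (phase_neg h σ ε₁) hiA (hyA t₁ ht₁') k).symm
  · exact (flow_apply_of_syn hh _ (phase_neg h σ ε₂) hiB (hzB t₁ ht₁') k).symm

/-! ### Lattice functions realised by densities -/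

theorem enorm_profile_le {s b : ℝ} (A : ℝ × ℝ → ℂ) (t ξ : ℝ) :
    ‖profile (fun p => invWeight s b p * A p) t ξ‖ₑ ≤
      ENNReal.ofReal (bracket ξ ^ (-s)) *
        ∫⁻ τ, ENNReal.ofReal (bracket τ ^ (-b)) * ‖A (ξ, τ)‖ₑ := by
  rw [← lintegral_const_mul' _ _ ENNReal.ofReal_ne_top]
  refine (enorm_integral_le_lintegral_enorm _).trans (le_of_eq (lintegral_congr fun τ => ?_))
  have h1 : ‖Complex.exp (Complex.I * ((t * τ : ℝ) : ℂ))‖ₑ = 1 := by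
    rw [← ofReal_norm, mul_comm, Complex.norm_exp_ofReal_mul_I, ENNReal.ofReal_one]
  rw [enorm_mul, h1, one_mul, enorm_mul, enorm_ofReal_of_nonneg (invWeight_pos s b _).le,
    invWeight, ENNReal.ofReal_mul (Real.rpow_nonneg (bracket_pos _).le _), mul_assoc]

/-- At each time, the weighted profile is controlled by the density; this is where `b > 1/2`
enters. -/
theorem profile_sq_le {s b : ℝ} (hb : 1 / 2 < b) {A : ℝ × ℝ → ℂ} {ξ : ℝ}
    (hA : AEStronglyMeasurable (fun τ => A (ξ, τ)) volume) (t : ℝ) :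
    ENNReal.ofReal (bracket ξ ^ (2 * s)) * ‖profile (fun p => invWeight s b p * A p) t ξ‖ₑ ^ 2 ≤
      ENNReal.ofReal (bracketMass (2 * b)) * ∫⁻ τ, ‖A (ξ, τ)‖ₑ ^ 2 := by
  have hp : 0 < bracket ξ := bracket_pos ξ
  have h1 : ENNReal.ofReal (bracket ξ ^ (2 * s)) * ENNReal.ofReal (bracket ξ ^ (-s)) ^ 2 = 1 := by
    rw [← ENNReal.ofReal_pow (by positivity), ← ENNReal.ofReal_mul (by positivity), rpow_neg_sq hp,
      ← Real.rpow_add hp, add_neg_cancel, Real.rpow_zero, ENNReal.ofReal_one]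
  calc _ ≤ ENNReal.ofReal (bracket ξ ^ (2 * s)) * (ENNReal.ofReal (bracket ξ ^ (-s)) *
        ∫⁻ τ, ENNReal.ofReal (bracket τ ^ (-b)) * ‖A (ξ, τ)‖ₑ) ^ 2 := by
        gcongr; exact enorm_profile_le A t ξ
    _ = (∫⁻ τ, ENNReal.ofReal (bracket τ ^ (-b)) * ‖A (ξ, τ)‖ₑ) ^ 2 := by
        rw [mul_pow, ← mul_assoc, h1, one_mul]
    _ ≤ (∫⁻ τ, ENNReal.ofReal (bracket τ ^ (-b)) ^ 2) * ∫⁻ τ, ‖A (ξ, τ)‖ₑ ^ 2 :=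
        sq_lintegral_mul_le (by fun_prop) hA.enorm
    _ = _ := by
        rw [← lintegral_bracket_rpow (by linarith)]
        congr 1
        refine lintegral_congr fun τ => ?_
        rw [← ENNReal.ofReal_pow (Real.rpow_nonneg (bracket_pos _).le _),
          rpow_neg_sq (bracket_pos _)]

theorem lintegral_profile_sq_le {h s b : ℝ} (hb : 1 / 2 < b) {A : ℝ × ℝ → ℂ}
    (hA : MemLp A 2 (specMeasure h)) (t : ℝ) :
    ∫⁻ ξ in freqDomain h, ENNReal.ofReal (bracket ξ ^ (2 * s)) *
        ‖profile (fun p => invWeight s b p * A p) t ξ‖ₑ ^ 2 ≤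
      ENNReal.ofReal (bracketMass (2 * b)) * energy h A := by
  have hm : AEStronglyMeasurable A ((volume.restrict (freqDomain h)).prod volume) := hA.1
  rw [energy, specMeasure, lintegral_prod _ (hm.enorm.pow_const 2),
    ← lintegral_const_mul' _ _ ENNReal.ofReal_ne_top]
  exact lintegral_mono_ae (hm.prodMk_left.mono fun ξ hξ => profile_sq_le hb hξ t)

theorem memLp_profile {h s b : ℝ} (hs : 0 ≤ s) (hb : 1 / 2 < b) {A : ℝ × ℝ → ℂ}
    (hA : MemLp A 2 (specMeasure h)) (t : ℝ) :
    MemLp (profile (fun p => invWeight s b p * A p) t) 2 (volume.restrict (freqDomain h)) := by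
  have h1 := integrableOn_exp_mul_profile (φ := fun _ => 0) measurable_const
    (integrable_invWeight_mul hs hb hA) t
  simp only [mul_zero, Complex.ofReal_zero, Complex.exp_zero, one_mul] at h1
  refine ⟨h1.1, ?_⟩
  rw [eLpNorm_lt_top_iff_lintegral_rpow_enorm_lt_top (by norm_num) (by norm_num)]
  simp only [ENNReal.toReal_ofNat, ENNReal.rpow_ofNat]
  refine lt_of_le_of_lt (lintegral_mono fun ξ => ?_)
    ((lintegral_profile_sq_le (s := s) hb hA t).trans_lt
      (ENNReal.mul_lt_top ENNReal.ofReal_lt_top (energy_lt_top hA)))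
  refine le_mul_of_one_le_left' ?_
  rw [← ENNReal.ofReal_one]
  exact ENNReal.ofReal_le_ofReal (Real.one_le_rpow (one_le_bracket ξ) (by positivity))

theorem syn_zero_eq_invDFT {h s b : ℝ} (hs : 0 ≤ s) (hb : 1 / 2 < b) {A : ℝ × ℝ → ℂ}
    (hA : MemLp A 2 (specMeasure h)) (t : ℝ) (n : ℤ) :
    syn h (fun _ => 0) (fun p => invWeight s b p * A p) t n =
      invDFT h (profile (fun p => invWeight s b p * A p) t) n := by
  rw [syn_eq_invDFT measurable_const (integrable_invWeight_mul hs hb hA)]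
  simp only [mul_zero, Complex.ofReal_zero, Complex.exp_zero, one_mul]

/-- The Banach space of densities. -/
abbrev Density (h : ℝ) : Type := Lp ℂ 2 (specMeasure h)

theorem energy_eq {h : ℝ} (A : Density h) : energy h A = ENNReal.ofReal (‖A‖ ^ 2) := by
  rw [ENNReal.ofReal_pow (norm_nonneg _), ofReal_norm, Lp.enorm_def,
    eLpNorm_eq_lintegral_rpow_enorm_toReal (by norm_num) (by norm_num), ← ENNReal.rpow_natCast,
    ← ENNReal.rpow_mul, energy]
  norm_num

theorem norm_toLp_le_of_energy_le {h : ℝ} {A : ℝ × ℝ → ℂ} (hA : MemLp A 2 (specMeasure h)) {c : ℝ}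
    (hc : 0 ≤ c) (hle : energy h A ≤ ENNReal.ofReal (c ^ 2)) : ‖hA.toLp A‖ ≤ c := by
  have h1 : energy h (hA.toLp A) = energy h A :=
    lintegral_congr_ae (hA.coeFn_toLp.mono fun p hp => by simp only [hp])
  rw [← h1, energy_eq, ENNReal.ofReal_le_ofReal_iff (by positivity)] at hle
  exact le_of_sq_le_sq hle hc

theorem syn_toLp {h s b : ℝ} {A : ℝ × ℝ → ℂ} (hA : MemLp A 2 (specMeasure h)) (t : ℝ) (n : ℤ) :
    syn h (fun _ => 0) (fun p => invWeight s b p * hA.toLp A p) t n =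
      syn h (fun _ => 0) (fun p => invWeight s b p * A p) t n :=
  syn_congr (hA.coeFn_toLp.mono fun p hp => by simp only [hp]) t n

section Slice

variable {h s b : ℝ} (hh : 0 < h) (hs : 0 ≤ s) (hb : 1 / 2 < b)

/-- The lattice function at time `t`, in the interaction picture, that is realised by a density
with the weight of the Bourgain space, as an additive function of the density. -/
def realise (t : ℝ) (n : ℤ) : Density h →+ ℂ :=
  AddMonoidHom.mk' (fun A => syn h (fun _ => 0) (fun p => invWeight s b p * A p) t n) fun A B => by
    have h1 : (fun p => (invWeight s b p : ℂ) * (A + B : Density h) p) =ᵐ[specMeasure h]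
        fun p => invWeight s b p * A p + invWeight s b p * B p :=
      (Lp.coeFn_add A B).mono fun p hp => by simp only [hp, Pi.add_apply, mul_add]
    rw [syn_congr h1, syn_add measurable_const (integrable_invWeight_mul hs hb (Lp.memLp A))
      (integrable_invWeight_mul hs hb (Lp.memLp B))]

theorem realise_apply (t : ℝ) (n : ℤ) (A : Density h) :
    realise hs hb t n A = syn h (fun _ => 0) (fun p => invWeight s b p * A p) t n := rfl

theorem continuous_realise (t : ℝ) (n : ℤ) : Continuous (realise (h := h) hs hb t n) := by
  set K := ∫⁻ p, ENNReal.ofReal (invWeight s b p) ^ 2 ∂specMeasure h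
  have hK : K < ⊤ := lintegral_invWeight_sq_lt_top h hs hb
  refine AddMonoidHomClass.continuous_of_bound _ (√K.toReal) fun A => ?_
  have h1 : ‖∫ p, planeWave h (fun _ => 0) t n p * (invWeight s b p * A p) ∂specMeasure h‖ₑ ^ 2 ≤
      K * ENNReal.ofReal (‖A‖ ^ 2) := by
    rw [← energy_eq]
    calc _ ≤ (∫⁻ p, ENNReal.ofReal (invWeight s b p) * ‖A p‖ₑ ∂specMeasure h) ^ 2 := by
          gcongr
          refine (enorm_integral_le_lintegral_enorm _).trans (le_of_eq (lintegral_congr fun p => ?_))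
          rw [enorm_mul, enorm_mul, ← ofReal_norm (planeWave _ _ _ _ _), norm_planeWave,
            ENNReal.ofReal_one, one_mul, enorm_ofReal_of_nonneg (invWeight_pos s b p).le]
      _ ≤ _ := sq_lintegral_mul_le (by fun_prop) (Lp.memLp A).1.enorm
  rw [← ENNReal.ofReal_toReal hK.ne, ← ENNReal.ofReal_mul ENNReal.toReal_nonneg, ← ofReal_norm,
    ← ENNReal.ofReal_pow (norm_nonneg _), ENNReal.ofReal_le_ofReal_iff (by positivity)] at h1
  have h2 : ‖∫ p, planeWave h (fun _ => 0) t n p * (invWeight s b p * A p) ∂specMeasure h‖ ≤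
      √K.toReal * ‖A‖ := by
    refine le_of_sq_le_sq ?_ (by positivity)
    rwa [mul_pow, Real.sq_sqrt ENNReal.toReal_nonneg]
  rw [realise_apply, syn, norm_mul, Complex.norm_real, Real.norm_eq_abs,
    abs_of_pos (by positivity)]
  refine (mul_le_of_le_one_left (norm_nonneg _) ?_).trans h2
  rw [div_le_one (by positivity)]
  linarith [Real.pi_gt_three]

/-- The real part of the lattice function at time `t`, in the interaction picture, realised by a
density. -/
def slice (A : Density h) (t : ℝ) : LatticeL2 :=
  ⟨fun n => (realise hs hb t n A).re, by
    have h1 := memℓp_invDFT hh (memLp_profile hs hb (Lp.memLp A) t)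
    change Memℓp (fun n => (realise hs hb t n A).re) 2
    rw [memℓp_gen_iff (by norm_num)] at h1 ⊢
    refine h1.of_nonneg_of_le (fun n => by positivity) fun n => ?_
    rw [← syn_zero_eq_invDFT hs hb (Lp.memLp A), ← realise_apply hs hb]
    gcongr
    exact Complex.abs_re_le_norm _⟩

theorem slice_apply (A : Density h) (t : ℝ) (n : ℤ) :
    slice hh hs hb A t n = (realise hs hb t n A).re := rfl

theorem slice_sub (A B : Density h) (t : ℝ) :
    slice hh hs hb (A - B) t = slice hh hs hb A t - slice hh hs hb B t :=
  lp.ext (funext fun n => by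
    rw [lp.coeFn_sub, Pi.sub_apply, slice_apply, slice_apply, slice_apply, map_sub, Complex.sub_re])

theorem slice_add (A B : Density h) (t : ℝ) :
    slice hh hs hb (A + B) t = slice hh hs hb A t + slice hh hs hb B t :=
  lp.ext (funext fun n => by
    rw [lp.coeFn_add, Pi.add_apply, slice_apply, slice_apply, slice_apply, map_add, Complex.add_re])

theorem ofReal_slice {A : Density h} {t : ℝ} (hA : ∀ n, (realise hs hb t n A).im = 0) (n : ℤ) :
    realise hs hb t n A = (slice hh hs hb A t n : ℂ) :=
  Complex.ext (by rw [slice_apply, Complex.ofReal_re]) (by rw [hA n, Complex.ofReal_im])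

theorem sobolevNorm_slice_le {A : Density h} {t : ℝ} (hA : ∀ n, (realise hs hb t n A).im = 0) :
    sobolevNorm h s (slice hh hs hb A t) ≤ √(bracketMass (2 * b)) * ‖A‖ := by
  have h0 := isDFT_of_syn hh measurable_const (integrable_invWeight_mul hs hb (Lp.memLp A))
    fun n => (ofReal_slice hh hs hb hA n)
  simp only [mul_zero, Complex.ofReal_zero, Complex.exp_zero, one_mul] at h0
  have h1 := lintegral_profile_sq_le (s := s) hb (Lp.memLp A) t
  have hm := bracketMass_nonneg (2 * b)
  rw [sobolevNorm_sq_eq_lintegral hh s h0, energy_eq, ← ENNReal.ofReal_mul hm,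
    ENNReal.ofReal_le_ofReal_iff (by positivity)] at h1
  refine le_of_sq_le_sq ?_ (by positivity)
  rw [mul_pow, Real.sq_sqrt hm]
  refine le_trans ?_ h1
  refine le_mul_of_one_le_left (sq_nonneg _) ?_
  linarith [Real.pi_gt_three]

theorem continuous_slice (A : Density h) : Continuous (slice hh hs hb A) := by
  set W : ℝ × ℝ → ℂ := fun p => invWeight s b p * A p with hW
  have hWi : Integrable W (specMeasure h) := integrable_invWeight_mul hs hb (Lp.memLp A)
  -- the density with the absolute values gives a bound that is uniform in time
  set B : ℝ → ℝ := fun ξ =>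
    ‖profile (fun p => invWeight s b p * ((fun p => ((‖A p‖ : ℝ) : ℂ)) p)) 0 ξ‖ with hB
  have hBm : MemLp B 2 (volume.restrict (freqDomain h)) :=
    (memLp_profile hs hb (A := fun p => ((‖A p‖ : ℝ) : ℂ)) (Lp.memLp A).norm.ofReal 0).norm
  have hBeq : ∀ ξ, B ξ = ∫ τ, ‖W (ξ, τ)‖ := fun ξ => by
    simp only [hB, profile, zero_mul, Complex.ofReal_zero, mul_zero, Complex.exp_zero, one_mul]
    have : ∀ τ : ℝ, (invWeight s b (ξ, τ) : ℂ) * ((‖A (ξ, τ)‖ : ℝ) : ℂ) =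
        ((‖W (ξ, τ)‖ : ℝ) : ℂ) := fun τ => by
      rw [hW, norm_mul, Complex.norm_real, Real.norm_eq_abs, abs_of_pos (invWeight_pos s b _)]
      push_cast; rfl
    simp only [this]
    rw [integral_complex_ofReal, Complex.norm_real, Real.norm_eq_abs, abs_of_nonneg]
    exact integral_nonneg fun τ => norm_nonneg _
  have hPB : ∀ t ξ, ‖profile W t ξ‖ ≤ B ξ := fun t ξ => by
    rw [hBeq]
    refine (norm_integral_le_integral_norm _).trans (le_of_eq ?_)
    refine integral_congr_ae (Eventually.of_forall fun τ => ?_)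
    simp only
    rw [norm_mul, mul_comm Complex.I, Complex.norm_exp_ofReal_mul_I, one_mul]
  rw [continuous_iff_continuousAt]
  intro t₀
  have hPm : ∀ t, MemLp (profile W t) 2 (volume.restrict (freqDomain h)) :=
    fun t => memLp_profile hs hb (Lp.memLp A) t
  have hlim : Tendsto (fun t => (2 * π * h)⁻¹ *
      ∫ ξ in freqDomain h, ‖profile W t ξ - profile W t₀ ξ‖ ^ 2) (𝓝 t₀) (𝓝 ((2 * π * h)⁻¹ * 0)) := by
    refine Tendsto.const_mul _ ?_
    have h0 : (0 : ℝ) = ∫ _ in freqDomain h, (0 : ℝ) := by simp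
    rw [h0]
    refine tendsto_integral_filter_of_dominated_convergence (fun ξ => 4 * B ξ ^ 2) ?_ ?_
      (hBm.integrable_sq.const_mul 4) ?_
    · exact Eventually.of_forall fun t => ((hPm t).1.sub (hPm t₀).1).norm.pow 2
    · refine Eventually.of_forall fun t => Eventually.of_forall fun ξ => ?_
      rw [norm_pow, norm_norm]
      have h1 := norm_sub_le (profile W t ξ) (profile W t₀ ξ)
      have h2 := hPB t ξ
      have h3 := hPB t₀ ξ
      nlinarith [norm_nonneg (profile W t ξ - profile W t₀ ξ)]
    · have hWi' : Integrable W ((volume.restrict (freqDomain h)).prod volume) := hWi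
      refine hWi'.prod_right_ae.mono fun ξ hξ => ?_
      have hc : Continuous (fun t => profile W t ξ) := by
        refine continuous_of_dominated (bound := fun τ => ‖W (ξ, τ)‖) (fun t => ?_) (fun t => ?_)
          hξ.norm (Eventually.of_forall fun τ => by fun_prop)
        · exact (by fun_prop : Continuous _).aestronglyMeasurable.mul hξ.1
        · refine Eventually.of_forall fun τ => ?_
          rw [norm_mul, mul_comm Complex.I, Complex.norm_exp_ofReal_mul_I, one_mul]
      have := ((hc.tendsto t₀).sub_const (profile W t₀ ξ)).norm.pow 2
      simpa using this
  rw [mul_zero] at hlim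
  rw [ContinuousAt, tendsto_iff_norm_sub_tendsto_zero]
  have hsq : Tendsto (fun t => ‖slice hh hs hb A t - slice hh hs hb A t₀‖ ^ 2) (𝓝 t₀) (𝓝 0) := by
    refine squeeze_zero (fun t => sq_nonneg _) (fun t => ?_) hlim
    refine hasSum_le (fun n => ?_) (LatticeL2.hasSum_sq _)
      (hasSum_norm_sq_invDFT hh ((hPm t).sub (hPm t₀)))
    have h1 : invDFT h (fun ξ => profile W t ξ - profile W t₀ ξ) n =
        realise hs hb t n A - realise hs hb t₀ n A := by
      rw [realise_apply, realise_apply, syn_zero_eq_invDFT hs hb (Lp.memLp A),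
        syn_zero_eq_invDFT hs hb (Lp.memLp A)]
      exact invDFT_sub ((hPm t).integrable (by norm_num)) ((hPm t₀).integrable (by norm_num)) n
    rw [h1, lp.coeFn_sub, Pi.sub_apply, slice_apply, slice_apply, ← Complex.sub_re, ← sq_abs]
    gcongr
    exact Complex.abs_re_le_norm _
  have := hsq.sqrt
  simpa using this

end Slice

/-! ### The higher-order remainder as a function -/

/-- The increment estimate for a function that vanishes to third order, in the form needed for
differences of differences. -/
theorem second_difference_le {G g : ℝ → ℝ} {m L : ℝ} (hm : 0 ≤ m) (hL : 0 ≤ L)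
    (hG : ∀ x, |x| ≤ m → HasDerivAt G (g x) x) (hg : ∀ x, |x| ≤ m → |g x| ≤ L * m ^ 2)
    (hg' : ∀ x y, |x| ≤ m → |y| ≤ m → |g x - g y| ≤ L * m * |x - y|) {a a' b b' : ℝ}
    (ha : |a| ≤ m) (ha' : |a'| ≤ m) (hb : |b| ≤ m) (hb' : |b'| ≤ m) :
    |G a - G a' - (G b - G b')| ≤
      L * m ^ 2 * |(a - a') - (b - b')| + L * m * (|a - b| + |a' - b'|) * |a - a'| := by
  have hseg : ∀ x y θ : ℝ, |x| ≤ m → |y| ≤ m → θ ∈ Icc (0 : ℝ) 1 → |y + θ * (x - y)| ≤ m := by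
    intro x y θ hx hy hθ
    have h1 : y + θ * (x - y) = (1 - θ) * y + θ * x := by ring
    rw [h1]
    refine (abs_add_le _ _).trans ?_
    rw [abs_mul, abs_mul, abs_of_nonneg hθ.1, abs_of_nonneg (by linarith [hθ.2] : 0 ≤ 1 - θ)]
    nlinarith [hθ.1, hθ.2]
  have hder : ∀ x y θ : ℝ, |x| ≤ m → |y| ≤ m → θ ∈ Icc (0 : ℝ) 1 →
      HasDerivAt (fun θ => G (y + θ * (x - y))) (g (y + θ * (x - y)) * (x - y)) θ := by
    intro x y θ hx hy hθ
    have h1 : HasDerivAt (fun θ : ℝ => y + θ * (x - y)) (x - y) θ := by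
      simpa using ((hasDerivAt_id θ).mul_const (x - y)).const_add y
    exact (hG _ (hseg x y θ hx hy hθ)).comp θ h1
  have key := norm_image_sub_le_of_norm_deriv_le_segment_01'
    (f := fun θ => G (a' + θ * (a - a')) - G (b' + θ * (b - b')))
    (f' := fun θ => g (a' + θ * (a - a')) * (a - a') - g (b' + θ * (b - b')) * (b - b'))
    (C := L * m ^ 2 * |(a - a') - (b - b')| + L * m * (|a - b| + |a' - b'|) * |a - a'|)
    (fun θ hθ => ((hder a a' θ ha ha' hθ).sub (hder b b' θ hb hb' hθ)).hasDerivWithinAt)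
    (fun θ hθ => by
      have hθ' : θ ∈ Icc (0 : ℝ) 1 := ⟨hθ.1, hθ.2.le⟩
      have hX := hseg a a' θ ha ha' hθ'
      have hY := hseg b b' θ hb hb' hθ'
      set X := a' + θ * (a - a')
      set Y := b' + θ * (b - b')
      have h1 : g X * (a - a') - g Y * (b - b') =
          g Y * ((a - a') - (b - b')) + (g X - g Y) * (a - a') := by ring
      have h2 : |X - Y| ≤ |a - b| + |a' - b'| := by
        have : X - Y = θ * (a - b) + (1 - θ) * (a' - b') := by simp only [X, Y]; ring
        rw [this]
        refine (abs_add_le _ _).trans ?_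
        rw [abs_mul, abs_mul, abs_of_nonneg hθ'.1, abs_of_nonneg (by linarith [hθ'.2] : 0 ≤ 1 - θ)]
        nlinarith [hθ'.1, hθ'.2, abs_nonneg (a - b), abs_nonneg (a' - b')]
      rw [h1, Real.norm_eq_abs]
      refine (abs_add_le _ _).trans ?_
      rw [abs_mul, abs_mul]
      have h3 := hg Y hY
      have h4 := (hg' X Y hX hY).trans (mul_le_mul_of_nonneg_left h2 (by positivity))
      gcongr)
  simp only [one_mul, zero_mul, add_zero, add_sub_cancel, Real.norm_eq_abs] at key
  rw [show G a - G a' - (G b - G b') = G a - G b - (G a' - G b') by ring]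
  exact key

theorem hasDerivAt_iteratedDeriv {V : ℝ → ℝ} {m : ℕ} (hV : ContDiff ℝ m V) {k : ℕ} (hk : k < m)
    (x : ℝ) : HasDerivAt (iteratedDeriv k V) (iteratedDeriv (k + 1) V x) x := by
  rw [iteratedDeriv_succ]
  exact ((hV.differentiable_iteratedDeriv k (by exact_mod_cast hk)) x).hasDerivAt

/-- The second differences of `F` on `[-M, M]` are bounded, up to the factor `Λ`, as those of a
cubic monomial. -/
def IsCubicOn (F : ℝ → ℝ) (Λ M : ℝ) : Prop :=
  ∀ a a' b b' : ℝ, |a| ≤ M → |a'| ≤ M → |b| ≤ M → |b'| ≤ M →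
    |F a - F a' - (F b - F b')| ≤
      Λ * (M ^ 2 * |(a - a') - (b - b')| + M * (|a - b| + |a' - b'|) * |a - a'|)

theorem IsCubicOn.lipschitz {F : ℝ → ℝ} {Λ M : ℝ} (hF : IsCubicOn F Λ M) (hΛ : 0 ≤ Λ) {a b : ℝ}
    (ha : |a| ≤ M) (hb : |b| ≤ M) : |F a - F b| ≤ 3 * Λ * M ^ 2 * |a - b| := by
  have hM : 0 ≤ M := (abs_nonneg a).trans ha
  have h1 := hF a b 0 0 ha hb (by simpa using hM) (by simpa using hM)
  simp only [sub_zero, sub_self] at h1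
  refine h1.trans ?_
  have h2 : M * (|a| + |b|) * |a - b| ≤ M * (M + M) * |a - b| := by gcongr
  have h3 := mul_le_mul_of_nonneg_left (add_le_add_right h2 (M ^ 2 * |a - b|)) hΛ
  refine h3.trans (le_of_eq (by ring))

/-- The remainder is cubic at the scale of lattice functions, with a gain of `h²`: its third
derivative is the one of `2 h^{-4} V'(h² r)`, which is `2 h²` times a fourth derivative of `V`. -/
theorem exists_remainder_isCubicOn {V : ℝ → ℝ} (hV : ContDiff ℝ 5 V)
    (hV2 : iteratedDeriv 2 V 0 = 1) (hV3 : iteratedDeriv 3 V 0 = 1) (K : ℝ) :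
    ∃ L : ℝ, 0 ≤ L ∧ ∀ h : ℝ, 0 < h → ∀ M : ℝ, 0 ≤ M → h ^ 2 * M ≤ K →
      IsCubicOn (fun r => h ^ 2 * remainder h V r) (L * h ^ 2) M := by
  have hV' : ContDiff ℝ (5 : ℕ) V := hV
  obtain ⟨L, hL⟩ := (isCompact_Icc (a := -K) (b := K)).exists_bound_of_continuousOn
    (f := iteratedDeriv 4 V) (hV.continuous_iteratedDeriv 4 (by norm_num)).continuousOn
  have hd1 : ∀ x, HasDerivAt (deriv V) (iteratedDeriv 2 V x) x := fun x => by
    have := hasDerivAt_iteratedDeriv hV' (k := 1) (by norm_num) x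
    rwa [iteratedDeriv_one] at this
  have hd2 : ∀ x, HasDerivAt (iteratedDeriv 2 V) (iteratedDeriv 3 V x) x :=
    hasDerivAt_iteratedDeriv hV' (by norm_num)
  have hd3 : ∀ x, HasDerivAt (iteratedDeriv 3 V) (iteratedDeriv 4 V x) x :=
    hasDerivAt_iteratedDeriv hV' (by norm_num)
  set L' := max L 0
  have hL0 : 0 ≤ L' := le_max_right _ _
  refine ⟨2 * L', by positivity, fun h hh M hM hMK a a' b b' ha ha' hb hb' => ?_⟩
  set m := h ^ 2 * M
  have hm : 0 ≤ m := by positivity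
  set G : ℝ → ℝ := fun x => deriv V x - x - x ^ 2 / 2 with hG
  set g : ℝ → ℝ := fun x => iteratedDeriv 2 V x - 1 - x with hg
  have hconv : Convex ℝ (Icc (-m) m) := convex_Icc _ _
  have hIcc : ∀ x : ℝ, |x| ≤ m ↔ x ∈ Icc (-m) m := fun x => abs_le
  have h0m : (0 : ℝ) ∈ Icc (-m) m := ⟨by linarith, hm⟩
  have hGd : ∀ x, HasDerivAt G (g x) x := fun x => by
    have := ((hd1 x).sub (hasDerivAt_id x)).sub (((hasDerivAt_id x).pow 2).div_const 2)
    refine this.congr_deriv ?_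
    simp [hg]
  have hgd : ∀ x, HasDerivAt g (iteratedDeriv 3 V x - 1) x := fun x => by
    exact ((hd2 x).sub_const 1).sub (hasDerivAt_id x)
  have h3 : ∀ x ∈ Icc (-m) m, ‖iteratedDeriv 3 V x - 1‖ ≤ L' * m := fun x hx => by
    have h1 := hconv.norm_image_sub_le_of_norm_hasDerivWithin_le (C := L')
      (fun y hy => (hd3 y).hasDerivWithinAt)
      (fun y hy => (hL y ⟨by linarith [hy.1], hy.2.trans hMK⟩).trans (le_max_left _ _)) h0m hx
    rw [hV3, sub_zero] at h1
    refine h1.trans ?_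
    gcongr
    exact (hIcc x).2 hx
  have hgl : ∀ x y, |x| ≤ m → |y| ≤ m → |g x - g y| ≤ L' * m * |x - y| := fun x y hx hy =>
    hconv.norm_image_sub_le_of_norm_hasDerivWithin_le
      (fun z _ => (hgd z).hasDerivWithinAt) h3 ((hIcc y).1 hy) ((hIcc x).1 hx)
  have hgb : ∀ x, |x| ≤ m → |g x| ≤ L' * m ^ 2 := fun x hx => by
    have h1 := hgl x 0 hx (by simpa using hm)
    have h2 : g 0 = 0 := by simp [hg, hV2]
    rw [h2, sub_zero, sub_zero] at h1
    exact h1.trans ((mul_le_mul_of_nonneg_left hx (by positivity)).trans_eq (by ring))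
  have hsc : ∀ x : ℝ, |x| ≤ M → |h ^ 2 * x| ≤ m := fun x hx => by
    rw [abs_mul, abs_of_pos (by positivity)]
    simp only [m]
    gcongr
  have key := second_difference_le hm hL0 (fun x _ => hGd x) hgb hgl (hsc a ha) (hsc a' ha')
    (hsc b hb) (hsc b' hb')
  have hF : ∀ r, h ^ 2 * remainder h V r = 2 / h ^ 4 * G (h ^ 2 * r) := fun r => by
    simp only [remainder, hG]
    field_simp
  have habs : ∀ x y : ℝ, |h ^ 2 * x - h ^ 2 * y| = h ^ 2 * |x - y| := fun x y => by
    rw [← mul_sub, abs_mul, abs_of_pos (by positivity : 0 < h ^ 2)]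
  have e1 : |h ^ 2 * a - h ^ 2 * a' - (h ^ 2 * b - h ^ 2 * b')| =
      h ^ 2 * |(a - a') - (b - b')| := by
    rw [← mul_sub, ← mul_sub, habs]
  rw [e1, habs, habs, habs] at key
  simp only [hF]
  rw [← mul_sub, ← mul_sub, ← mul_sub, abs_mul, abs_of_pos (by positivity)]
  calc _ ≤ 2 / h ^ 4 * _ := mul_le_mul_of_nonneg_left key (by positivity)
    _ = _ := by simp only [m]; field_simp

/-! ### Composition with a function -/

/-- `F` vanishes at the origin and is Lipschitz on bounded sets. -/
def IsLocLip (F : ℝ → ℝ) : Prop :=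
  F 0 = 0 ∧ ∀ M : ℝ, ∃ L : ℝ, 0 ≤ L ∧ ∀ x y : ℝ, |x| ≤ M → |y| ≤ M → |F x - F y| ≤ L * |x - y|

theorem isLocLip_remainder {V : ℝ → ℝ} (hV : ContDiff ℝ 5 V)
    (hV1 : deriv V 0 = 0) (hV2 : iteratedDeriv 2 V 0 = 1) (hV3 : iteratedDeriv 3 V 0 = 1) {h : ℝ}
    (hh : 0 < h) : IsLocLip (fun r => h ^ 2 * remainder h V r) := by
  refine ⟨by simp [remainder, hV1], fun M => ?_⟩
  obtain ⟨L, hL, H⟩ := exists_remainder_isCubicOn hV hV2 hV3 (h ^ 2 * max M 0)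
  have hΛ : 0 ≤ L * h ^ 2 := by positivity
  exact ⟨3 * (L * h ^ 2) * (max M 0) ^ 2, by positivity, fun x y hx hy =>
    (H h hh (max M 0) (le_max_right _ _) le_rfl).lipschitz hΛ (hx.trans (le_max_left _ _))
      (hy.trans (le_max_left _ _))⟩

theorem IsLocLip.memℓp {F : ℝ → ℝ} (hF : IsLocLip F) (r : LatticeL2) :
    Memℓp (fun n => F (r n)) 2 := by
  obtain ⟨L, hL, H⟩ := hF.2 ‖r‖
  rw [memℓp_gen_iff (by norm_num)]
  simp only [ENNReal.toReal_ofNat, Real.rpow_ofNat, Real.norm_eq_abs]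
  refine Summable.of_nonneg_of_le (fun n => by positivity) (fun n => ?_)
    (r.hasSum_sq.summable.mul_left (L ^ 2))
  have h1 := H (r n) 0 (r.abs_apply_le n) (by simp)
  rw [hF.1, sub_zero, sub_zero] at h1
  rw [← sq_abs (r n), ← mul_pow]
  gcongr

/-- The composition of a square summable lattice function with a locally Lipschitz function. -/
def compose {F : ℝ → ℝ} (hF : IsLocLip F) (r : LatticeL2) : LatticeL2 :=
  ⟨fun n => F (r n), hF.memℓp r⟩

theorem compose_apply {F : ℝ → ℝ} (hF : IsLocLip F) (r : LatticeL2) (n : ℤ) :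
    compose hF r n = F (r n) := rfl

theorem exists_norm_compose_sub_le {F : ℝ → ℝ} (hF : IsLocLip F) (M : ℝ) :
    ∃ L : ℝ, 0 ≤ L ∧ ∀ r r' : LatticeL2, ‖r‖ ≤ M → ‖r'‖ ≤ M →
      ‖compose hF r - compose hF r'‖ ≤ L * ‖r - r'‖ := by
  obtain ⟨L, hL, H⟩ := hF.2 M
  refine ⟨L, hL, fun r r' hr hr' => LatticeL2.norm_le_of_abs_le hL fun n => ?_⟩
  rw [lp.coeFn_sub, lp.coeFn_sub, Pi.sub_apply, Pi.sub_apply, compose_apply, compose_apply]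
  exact H _ _ ((r.abs_apply_le n).trans hr) ((r'.abs_apply_le n).trans hr')

theorem continuous_compose {F : ℝ → ℝ} (hF : IsLocLip F) : Continuous (compose hF) := by
  rw [continuous_iff_continuousAt]
  intro r
  obtain ⟨L, hL, H⟩ := exists_norm_compose_sub_le hF (‖r‖ + 1)
  rw [ContinuousAt, tendsto_iff_norm_sub_tendsto_zero]
  have h1 : Tendsto (fun r' => L * ‖r' - r‖) (𝓝 r) (𝓝 0) := by
    have : Continuous (fun r' : LatticeL2 => L * ‖r' - r‖) := by fun_prop
    simpa using this.tendsto r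
  refine squeeze_zero' (Eventually.of_forall fun _ => norm_nonneg _) ?_ h1
  have h2 : ∀ᶠ r' in 𝓝 r, ‖r'‖ ≤ ‖r‖ + 1 :=
    (continuous_norm.tendsto r).eventually_le_const (by linarith)
  filter_upwards [h2] with r' hr'
  exact H r' r hr' (by linarith)

/-! ### Sobolev norms through differences -/

theorem norm_exp_sub_one_sq (x : ℝ) :
    ‖Complex.exp (Complex.I * (x : ℂ)) - 1‖ ^ 2 = 2 - 2 * Real.cos x := by
  rw [mul_comm, Complex.exp_mul_I, ← Complex.ofReal_cos, ← Complex.ofReal_sin,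
    ← Complex.normSq_eq_norm_sq, Complex.normSq_apply]
  simp only [Complex.sub_re, Complex.add_re, Complex.ofReal_re, Complex.mul_re, Complex.I_re,
    mul_zero, Complex.ofReal_im, Complex.I_im, mul_one, sub_self, add_zero, Complex.one_re,
    Complex.sub_im, Complex.add_im, Complex.mul_im, zero_add, Complex.one_im, sub_zero]
  nlinarith [Real.sin_sq_add_cos_sq x]

theorem norm_exp_sub_one_sq_le (x : ℝ) :
    ‖Complex.exp (Complex.I * (x : ℂ)) - 1‖ ^ 2 ≤ x ^ 2 := by
  have h1 := norm_exp_sub_exp_le x 0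
  rw [Complex.ofReal_zero, mul_zero, Complex.exp_zero, sub_zero] at h1
  rw [← sq_abs x]
  gcongr

theorem norm_exp_sub_one_sq_le_four (x : ℝ) :
    ‖Complex.exp (Complex.I * (x : ℂ)) - 1‖ ^ 2 ≤ 4 := by
  rw [norm_exp_sub_one_sq]
  linarith [Real.neg_one_le_cos x]

/-- A geometric sum of the bumps `min (x^a, x^{-a})` over a dyadic grid is bounded independently of
the grid. -/
theorem exists_dyadic_sum_bound {a : ℝ} (ha : 0 < a) :
    ∃ S : ℝ, 0 ≤ S ∧ ∀ x : ℝ, 0 < x →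
      ∑' j : ℕ, ENNReal.ofReal (min ((2 ^ j * x) ^ a) ((2 ^ j * x) ^ (-a))) ≤ ENNReal.ofReal S := by
  set r : ℝ := 2 ^ (-a)
  have hr0 : 0 < r := by positivity
  have hr1 : r < 1 := Real.rpow_lt_one_of_one_lt_of_neg (by norm_num) (by linarith)
  have hsum : Summable (fun k : ℤ => 2 ^ a * r ^ k.natAbs) := by
    refine Summable.mul_left _ (Summable.of_nat_of_neg ?_ ?_) <;>
      simpa using summable_geometric_of_lt_one hr0.le hr1
  refine ⟨∑' k : ℤ, 2 ^ a * r ^ k.natAbs, tsum_nonneg fun k => by positivity, fun x hx => ?_⟩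
  obtain ⟨m, hm1, hm2⟩ := exists_mem_Ico_zpow hx (one_lt_two)
  rw [ENNReal.ofReal_tsum_of_nonneg (fun k => by positivity) hsum]
  have hinj : Function.Injective (fun j : ℕ => (j : ℤ) + m) := fun i j hij => by
    simpa using hij
  refine le_trans (ENNReal.tsum_le_tsum fun j => ?_)
    (ENNReal.tsum_comp_le_tsum_of_injective hinj
      (fun k : ℤ => ENNReal.ofReal (2 ^ a * r ^ k.natAbs)))
  refine ENNReal.ofReal_le_ofReal ?_
  set k : ℤ := (j : ℤ) + m
  have hk1 : (2 : ℝ) ^ k ≤ 2 ^ j * x := by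
    rw [zpow_add₀ (by norm_num), zpow_natCast]; gcongr
  have hk2 : 2 ^ j * x ≤ (2 : ℝ) ^ (k + 1) := by
    rw [show k + 1 = (j : ℤ) + (m + 1) by simp only [k]; ring, zpow_add₀ (by norm_num),
      zpow_natCast]
    gcongr
  have hp : (0 : ℝ) < 2 ^ j * x := by positivity
  have h2a : (1 : ℝ) ≤ 2 ^ a := Real.one_le_rpow (by norm_num) ha.le
  rcases le_or_gt 0 k with hk | hk
  · refine (min_le_right _ _).trans ?_
    have h1 : (2 ^ j * x) ^ (-a) ≤ ((2 : ℝ) ^ k) ^ (-a) :=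
      Real.rpow_le_rpow_of_nonpos (by positivity) hk1 (by linarith)
    obtain ⟨i, hi⟩ := Int.eq_ofNat_of_zero_le hk
    have h3 : ((2 : ℝ) ^ i) ^ (-a) = r ^ i := by
      rw [← Real.rpow_natCast, ← Real.rpow_mul (by norm_num), ← Real.rpow_natCast r i,
        ← Real.rpow_mul (by norm_num)]
      congr 1; ring
    rw [hi, zpow_natCast, h3] at h1
    rw [hi, Int.natAbs_natCast]
    exact h1.trans (le_mul_of_one_le_left (by positivity) h2a)
  · refine (min_le_left _ _).trans ?_
    have h1 : (2 ^ j * x) ^ a ≤ ((2 : ℝ) ^ (k + 1)) ^ a :=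
      Real.rpow_le_rpow hp.le hk2 ha.le
    obtain ⟨i, hi⟩ := Int.eq_ofNat_of_zero_le (by omega : 0 ≤ -k)
    have hki : k = -(i : ℤ) := by omega
    have h3 : ((2 : ℝ) ^ (k + 1)) ^ a = 2 ^ a * r ^ i := by
      rw [← Real.rpow_intCast, ← Real.rpow_mul (by norm_num), ← Real.rpow_natCast r i,
        ← Real.rpow_mul (by norm_num), ← Real.rpow_add (by norm_num), hki]
      congr 1; push_cast; ring
    rw [h3] at h1
    rwa [hki, Int.natAbs_neg, Int.natAbs_natCast]

/-- The weight `⟨ξ⟩^{2s}`, for `0 ≤ s ≤ 1`, is comparable on the frequency domain with the symbol of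
a sum of squares of dyadic differences. -/
theorem exists_difference_weights {s : ℝ} (hs : 0 ≤ s) (hs1 : s ≤ 1) :
    ∃ a A : ℝ, 0 < a ∧ 0 ≤ A ∧ ∀ h : ℝ, 0 < h → ∃ c : ℕ → ℝ, (∀ j, 0 ≤ c j) ∧
      ∀ ξ ∈ freqDomain h,
        ENNReal.ofReal (a * bracket ξ ^ (2 * s)) ≤ 1 + ∑' j, ENNReal.ofReal (c j *
          ‖Complex.exp (Complex.I * ((h * 2 ^ j * ξ : ℝ) : ℂ)) - 1‖ ^ 2) ∧
        1 + ∑' j, ENNReal.ofReal (c j *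
          ‖Complex.exp (Complex.I * ((h * 2 ^ j * ξ : ℝ) : ℂ)) - 1‖ ^ 2) ≤
            ENNReal.ofReal (A * bracket ξ ^ (2 * s)) := by
  have hbr : ∀ ξ : ℝ, (1 : ℝ) ≤ bracket ξ ^ (2 * s) :=
    fun ξ => Real.one_le_rpow (one_le_bracket ξ) (by positivity)
  have hbs : ∀ ξ : ℝ, bracket ξ ^ (2 * s) = (1 + ξ ^ 2) ^ s := fun ξ => by
    rw [bracket, Real.sqrt_eq_rpow, ← Real.rpow_mul (by positivity)]
    congr 1; ring
  rcases hs.eq_or_lt with rfl | hs0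
  · exact ⟨1, 1, one_pos, zero_le_one, fun h hh => ⟨fun _ => 0, fun _ => le_rfl, fun ξ _ => by
      simp⟩⟩
  rcases hs1.eq_or_lt with rfl | hs1
  · -- a single difference quotient
    refine ⟨4 / π ^ 2, 1, by positivity, zero_le_one, fun h hh =>
      ⟨fun j => if j = 0 then (h ^ 2)⁻¹ else 0, fun j => by dsimp only; split_ifs <;> positivity,
        fun ξ hξ => ?_⟩⟩
    have hts : ∑' j : ℕ, ENNReal.ofReal ((if j = 0 then (h ^ 2)⁻¹ else 0) *
        ‖Complex.exp (Complex.I * ((h * 2 ^ j * ξ : ℝ) : ℂ)) - 1‖ ^ 2) =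
        ENNReal.ofReal ((h ^ 2)⁻¹ * ‖Complex.exp (Complex.I * ((h * ξ : ℝ) : ℂ)) - 1‖ ^ 2) := by
      rw [tsum_eq_single 0 (fun j hj => by simp [hj])]
      simp
    rw [hts, ← ENNReal.ofReal_one, ← ENNReal.ofReal_add zero_le_one (by positivity), hbs,
      Real.rpow_one]
    have hpi := Real.pi_gt_three
    constructor
    · refine ENNReal.ofReal_le_ofReal ?_
      have hx : |h * ξ| ≤ π := by
        rw [abs_mul, abs_of_pos hh, mul_comm, ← le_div_iff₀ hh]
        exact abs_le_of_mem_freqDomain hξ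
      have h1 := Real.cos_le_one_sub_mul_cos_sq hx
      have h2 : 4 / π ^ 2 * (h * ξ) ^ 2 ≤ 2 - 2 * Real.cos (h * ξ) := by
        have e : 4 / π ^ 2 * (h * ξ) ^ 2 = 2 * (2 / π ^ 2 * (h * ξ) ^ 2) := by ring
        rw [e]; linarith
      rw [norm_exp_sub_one_sq]
      have h3 : 4 / π ^ 2 ≤ 1 := by
        rw [div_le_one (by positivity)]; nlinarith
      have h4 : 4 / π ^ 2 * ξ ^ 2 = (h ^ 2)⁻¹ * (4 / π ^ 2 * (h * ξ) ^ 2) := by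
        field_simp
      rw [mul_add, mul_one, h4]
      gcongr
    · refine ENNReal.ofReal_le_ofReal ?_
      have h1 := norm_exp_sub_one_sq_le (h * ξ)
      have h2 : ξ ^ 2 = (h ^ 2)⁻¹ * (h * ξ) ^ 2 := by field_simp
      rw [one_mul, h2]
      gcongr
  set a := min (2 - 2 * s) (2 * s)
  have ha : 0 < a := lt_min (by linarith) (by linarith)
  obtain ⟨S, hS, HS⟩ := exists_dyadic_sum_bound ha
  refine ⟨(π ^ 2)⁻¹, 1 + 4 * S, by positivity, by positivity, fun h hh =>
    ⟨fun j => (h * 2 ^ j) ^ (-(2 * s)), fun j => by positivity, fun ξ hξ => ⟨?_, ?_⟩⟩⟩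
  · rcases eq_or_ne ξ 0 with rfl | hξ0
    · refine le_trans ?_ le_self_add
      rw [← ENNReal.ofReal_one]
      refine ENNReal.ofReal_le_ofReal ?_
      rw [hbs]
      have := Real.pi_gt_three
      simp only [ne_eq, OfNat.ofNat_ne_zero, not_false_eq_true, zero_pow, add_zero,
        Real.one_rpow, mul_one]
      exact inv_le_one_of_one_le₀ (by nlinarith)
    -- the scale at which the difference sees half an oscillation
    have hξp : 0 < |ξ| := abs_pos.2 hξ0
    have hx : 1 ≤ π / (h * |ξ|) := by
      rw [one_le_div (by positivity), mul_comm, ← le_div_iff₀ hh]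
      exact abs_le_of_mem_freqDomain hξ
    obtain ⟨j, hj1, hj2⟩ := exists_nat_pow_near hx one_lt_two
    rw [le_div_iff₀ (by positivity)] at hj1
    rw [div_lt_iff₀ (by positivity), pow_succ] at hj2
    set X := h * 2 ^ j * |ξ| with hX
    have hX1 : X ≤ π := by rw [hX]; linarith
    have hX2 : π / 2 ≤ X := by rw [hX]; linarith
    have hXp : 0 < X := by positivity
    have hcos : Real.cos (h * 2 ^ j * ξ) ≤ 0 := by
      rw [← Real.cos_abs, abs_mul, abs_of_pos (by positivity : 0 < h * 2 ^ j)]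
      exact Real.cos_nonpos_of_pi_div_two_le_of_le hX2 (by linarith [Real.pi_pos])
    have hterm : 2 * (π ^ 2)⁻¹ * |ξ| ^ (2 * s) ≤ (h * 2 ^ j) ^ (-(2 * s)) *
        ‖Complex.exp (Complex.I * ((h * 2 ^ j * ξ : ℝ) : ℂ)) - 1‖ ^ 2 := by
      rw [norm_exp_sub_one_sq]
      have e1 : (h * 2 ^ j) ^ (-(2 * s)) = |ξ| ^ (2 * s) * X ^ (-(2 * s)) := by
        rw [hX, Real.mul_rpow (by positivity) hξp.le, mul_left_comm, ← Real.rpow_add hξp,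
          add_neg_cancel, Real.rpow_zero, mul_one]
      have e2 : (π ^ 2)⁻¹ ≤ X ^ (-(2 * s)) := by
        calc (π ^ 2)⁻¹ = π ^ (-2 : ℝ) := by
              rw [Real.rpow_neg Real.pi_pos.le, Real.rpow_ofNat]
          _ ≤ π ^ (-(2 * s)) :=
              Real.rpow_le_rpow_of_exponent_le (by linarith [Real.pi_gt_three]) (by linarith)
          _ ≤ X ^ (-(2 * s)) := Real.rpow_le_rpow_of_nonpos hXp hX1 (by linarith)
      rw [e1]
      calc 2 * (π ^ 2)⁻¹ * |ξ| ^ (2 * s) = |ξ| ^ (2 * s) * (π ^ 2)⁻¹ * 2 := by ring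
        _ ≤ _ := by gcongr; linarith
    have hle : (π ^ 2)⁻¹ * bracket ξ ^ (2 * s) ≤ 1 + 2 * (π ^ 2)⁻¹ * |ξ| ^ (2 * s) := by
      have h1 : bracket ξ ^ (2 * s) ≤ 1 + |ξ| ^ (2 * s) := by
        rw [hbs, Real.rpow_mul hξp.le, Real.rpow_two, sq_abs]
        have := Real.rpow_add_le_add_rpow zero_le_one (sq_nonneg ξ) hs0.le hs1.le
        rwa [Real.one_rpow] at this
      have h2 : (π ^ 2)⁻¹ ≤ 1 := inv_le_one_of_one_le₀ (by nlinarith [Real.pi_gt_three])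
      have h3 : 0 ≤ (π ^ 2)⁻¹ * |ξ| ^ (2 * s) := by positivity
      calc _ ≤ (π ^ 2)⁻¹ * (1 + |ξ| ^ (2 * s)) := by gcongr
        _ ≤ _ := by linarith
    calc _ ≤ ENNReal.ofReal (1 + (h * 2 ^ j) ^ (-(2 * s)) *
          ‖Complex.exp (Complex.I * ((h * 2 ^ j * ξ : ℝ) : ℂ)) - 1‖ ^ 2) :=
          ENNReal.ofReal_le_ofReal (hle.trans (by linarith))
      _ = 1 + ENNReal.ofReal ((h * 2 ^ j) ^ (-(2 * s)) *
          ‖Complex.exp (Complex.I * ((h * 2 ^ j * ξ : ℝ) : ℂ)) - 1‖ ^ 2) := by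
          rw [ENNReal.ofReal_add zero_le_one (by positivity), ENNReal.ofReal_one]
      _ ≤ _ := by
          gcongr
          exact ENNReal.le_tsum (f := fun j : ℕ => ENNReal.ofReal ((h * 2 ^ j) ^ (-(2 * s)) *
            ‖Complex.exp (Complex.I * ((h * 2 ^ j * ξ : ℝ) : ℂ)) - 1‖ ^ 2)) j
  · have hsum : ∑' j : ℕ, ENNReal.ofReal ((h * 2 ^ j) ^ (-(2 * s)) *
        ‖Complex.exp (Complex.I * ((h * 2 ^ j * ξ : ℝ) : ℂ)) - 1‖ ^ 2) ≤
        ENNReal.ofReal (4 * S * bracket ξ ^ (2 * s)) := by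
      rcases eq_or_ne ξ 0 with rfl | hξ0
      · simp
      have hξp : 0 < |ξ| := abs_pos.2 hξ0
      have hxib : |ξ| ^ (2 * s) ≤ bracket ξ ^ (2 * s) := by
        rw [hbs, Real.rpow_mul hξp.le, Real.rpow_two, sq_abs]
        gcongr
        linarith
      calc _ ≤ ∑' j : ℕ, ENNReal.ofReal (4 * |ξ| ^ (2 * s)) *
            ENNReal.ofReal (min ((2 ^ j * (h * |ξ|)) ^ a) ((2 ^ j * (h * |ξ|)) ^ (-a))) := by
            refine ENNReal.tsum_le_tsum fun j => ?_
            rw [← ENNReal.ofReal_mul (by positivity)]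
            refine ENNReal.ofReal_le_ofReal ?_
            set X := 2 ^ j * (h * |ξ|) with hX
            have hXp : 0 < X := by positivity
            have e1 : (h * 2 ^ j) ^ (-(2 * s)) = |ξ| ^ (2 * s) * X ^ (-(2 * s)) := by
              rw [hX, show 2 ^ j * (h * |ξ|) = (h * 2 ^ j) * |ξ| by ring,
                Real.mul_rpow (by positivity) hξp.le, mul_left_comm, ← Real.rpow_add hξp,
                add_neg_cancel, Real.rpow_zero, mul_one]
            rw [e1, show 4 * |ξ| ^ (2 * s) * min (X ^ a) (X ^ (-a)) =
              |ξ| ^ (2 * s) * (4 * min (X ^ a) (X ^ (-a))) by ring, mul_assoc]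
            refine mul_le_mul_of_nonneg_left ?_ (Real.rpow_nonneg hξp.le _)
            have hsqX : (h * 2 ^ j * ξ) ^ 2 = X ^ 2 := by
              rw [hX, mul_pow, mul_pow, mul_pow, mul_pow, sq_abs]; ring
            have haa : a ≤ 2 - 2 * s := min_le_left _ _
            have hab : a ≤ 2 * s := min_le_right _ _
            rcases le_total X 1 with hX1 | hX1
            · have h1 : X ^ (-(2 * s)) * X ^ 2 ≤ X ^ a := by
                rw [← Real.rpow_two, ← Real.rpow_add hXp]
                exact Real.rpow_le_rpow_of_exponent_ge hXp hX1 (by linarith)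
              have h2 : X ^ a ≤ X ^ (-a) :=
                Real.rpow_le_rpow_of_exponent_ge hXp hX1 (by linarith)
              rw [min_eq_left h2]
              have h3 := norm_exp_sub_one_sq_le (h * 2 ^ j * ξ)
              rw [hsqX] at h3
              have h4 : 0 ≤ X ^ a := by positivity
              calc _ ≤ X ^ (-(2 * s)) * X ^ 2 := by gcongr
                _ ≤ 4 * X ^ a := by linarith
            · have h1 : X ^ (-(2 * s)) ≤ X ^ (-a) :=
                Real.rpow_le_rpow_of_exponent_le hX1 (by linarith)
              have h2 : X ^ (-a) ≤ X ^ a :=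
                Real.rpow_le_rpow_of_exponent_le hX1 (by linarith)
              rw [min_eq_right h2]
              have h3 := norm_exp_sub_one_sq_le_four (h * 2 ^ j * ξ)
              calc _ ≤ X ^ (-a) * 4 := by gcongr
                _ = _ := by ring
        _ ≤ ENNReal.ofReal (4 * |ξ| ^ (2 * s)) * ENNReal.ofReal S := by
            rw [ENNReal.tsum_mul_left]
            gcongr
            exact HS _ (by positivity)
        _ ≤ _ := by
            rw [← ENNReal.ofReal_mul (by positivity)]
            refine ENNReal.ofReal_le_ofReal ?_
            calc _ = 4 * S * |ξ| ^ (2 * s) := by ring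
              _ ≤ _ := by gcongr
    have hbp := bracket_pos ξ
    calc _ ≤ 1 + ENNReal.ofReal (4 * S * bracket ξ ^ (2 * s)) := by gcongr
      _ = ENNReal.ofReal (1 + 4 * S * bracket ξ ^ (2 * s)) := by
          rw [ENNReal.ofReal_add zero_le_one (by positivity), ENNReal.ofReal_one]
      _ ≤ _ := by
          refine ENNReal.ofReal_le_ofReal ?_
          rw [add_mul, one_mul]
          linarith [hbr ξ]

/-! ### Composition with the remainder in Sobolev spaces -/

theorem lintegral_enorm_sq_eq {h : ℝ} (hh : 0 < h) {f : LatticeL2} {F : ℝ → ℂ}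
    (hF : IsDFT h (fun n => (f n : ℂ)) F) :
    ∫⁻ ξ in freqDomain h, ‖F ξ‖ₑ ^ 2 = ENNReal.ofReal (2 * π * (h * ‖f‖ ^ 2)) := by
  rw [hF.norm_sq_eq hh, ← mul_assoc, mul_inv_cancel₀ (by positivity), one_mul,
    ofReal_integral_eq_lintegral_ofReal]
  · refine lintegral_congr fun ξ => ?_
    rw [← ofReal_norm, ENNReal.ofReal_pow (norm_nonneg _)]
  · exact hF.1.norm.integrable_sq
  · exact Eventually.of_forall fun ξ => sq_nonneg _

/-- The norm on the left is the one of `ℓ²`, without the factor `√h`; it bounds the supremum norm. -/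
theorem norm_le_sobolevNorm {h : ℝ} (hh : 0 < h) {s : ℝ} (hs : 0 ≤ s) (f : LatticeL2) :
    ‖f‖ ≤ sobolevNorm h s f / √h := by
  have hF := f.isDFT hh
  have h1 : ENNReal.ofReal (2 * π * (h * ‖f‖ ^ 2)) ≤
      ENNReal.ofReal (2 * π * sobolevNorm h s f ^ 2) := by
    rw [← lintegral_enorm_sq_eq hh hF, ← sobolevNorm_sq_eq_lintegral hh s hF]
    refine lintegral_mono fun ξ => le_mul_of_one_le_left' ?_
    rw [← ENNReal.ofReal_one]
    exact ENNReal.ofReal_le_ofReal (Real.one_le_rpow (one_le_bracket ξ) (by positivity))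
  rw [ENNReal.ofReal_le_ofReal_iff (by positivity)] at h1
  have h2 := le_of_mul_le_mul_left h1 (by positivity)
  rw [le_div_iff₀ (Real.sqrt_pos.2 hh)]
  refine le_of_sq_le_sq ?_ (sobolevNorm_nonneg h s f)
  rw [mul_pow, Real.sq_sqrt hh.le]
  linarith

/-- The translation by `k` lattice points. -/
def shift (k : ℤ) (f : LatticeL2) : LatticeL2 :=
  ⟨fun n => f (n + k), by
    change Memℓp (fun n => f (n + k)) 2
    have h1 := lp.memℓp f
    rw [memℓp_gen_iff (by norm_num)] at h1 ⊢
    exact h1.comp_injective (add_left_injective k)⟩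

theorem shift_apply (k : ℤ) (f : LatticeL2) (n : ℤ) : shift k f n = f (n + k) := rfl

theorem isDFT_shift {h : ℝ} (hh : 0 < h) (k : ℤ) {f : LatticeL2} {F : ℝ → ℂ}
    (hF : IsDFT h (fun n => (f n : ℂ)) F) :
    IsDFT h (fun n => (shift k f n : ℂ))
      (fun ξ => Complex.exp (Complex.I * ((h * k * ξ : ℝ) : ℂ)) * F ξ) := by
  refine isDFT_of_integrableOn hh (shift k f).memℓp_ofReal ?_ fun n => ?_
  · refine hF.integrableOn.bdd_mul (c := 1) ?_ (Eventually.of_forall fun ξ => ?_)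
    · exact (by fun_prop : Continuous _).aestronglyMeasurable
    · rw [mul_comm, Complex.norm_exp_ofReal_mul_I]
  · have h1 : _ = (f (n + k) : ℂ) := hF.2 (n + k)
    rw [shift_apply, ← h1, invDFT, invDFT]
    congr 1
    refine integral_congr_ae (Eventually.of_forall fun ξ => ?_)
    simp only
    rw [mul_right_comm, mul_comm, ← Complex.exp_add]
    congr 2; push_cast; ring

/-- The sum of the squared norms of `f` and of its dyadic differences with the weights `c`. -/
def differenceEnergy (h : ℝ) (c : ℕ → ℝ) (f : LatticeL2) : ℝ≥0∞ :=
  ENNReal.ofReal (2 * π * (h * ‖f‖ ^ 2)) +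
    ∑' j, ENNReal.ofReal (c j) * ENNReal.ofReal (2 * π * (h * ‖shift (2 ^ j) f - f‖ ^ 2))

theorem differenceEnergy_eq {h : ℝ} (hh : 0 < h) {c : ℕ → ℝ} (hc : ∀ j, 0 ≤ c j) {f : LatticeL2}
    {F : ℝ → ℂ} (hF : IsDFT h (fun n => (f n : ℂ)) F) :
    differenceEnergy h c f = ∫⁻ ξ in freqDomain h, (1 + ∑' j, ENNReal.ofReal (c j *
      ‖Complex.exp (Complex.I * ((h * 2 ^ j * ξ : ℝ) : ℂ)) - 1‖ ^ 2)) * ‖F ξ‖ₑ ^ 2 := by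
  have hFm : AEMeasurable (fun ξ => ‖F ξ‖ₑ ^ 2) (volume.restrict (freqDomain h)) :=
    hF.1.1.enorm.pow_const 2
  simp only [add_mul, one_mul, ← ENNReal.tsum_mul_right]
  have hm : ∀ j : ℕ, AEMeasurable (fun ξ : ℝ => ENNReal.ofReal (c j *
      ‖Complex.exp (Complex.I * ((h * 2 ^ j * ξ : ℝ) : ℂ)) - 1‖ ^ 2) * ‖F ξ‖ₑ ^ 2)
      (volume.restrict (freqDomain h)) := fun j => by
    refine AEMeasurable.mul (Measurable.aemeasurable ?_) hFm
    fun_prop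
  rw [lintegral_add_left' hFm, lintegral_tsum hm, lintegral_enorm_sq_eq hh hF,
    differenceEnergy]
  congr 1
  refine tsum_congr fun j => ?_
  have h1 : IsDFT h (fun n => ((shift (2 ^ j) f - f : LatticeL2) n : ℂ))
      (fun ξ => Complex.exp (Complex.I * ((h * (2 ^ j : ℤ) * ξ : ℝ) : ℂ)) * F ξ - F ξ) := by
    have := (isDFT_shift hh (2 ^ j) hF).sub hF
    simpa only [lp.coeFn_sub, Pi.sub_apply, Complex.ofReal_sub] using this
  rw [← lintegral_enorm_sq_eq hh h1, ← lintegral_const_mul' _ _ ENNReal.ofReal_ne_top]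
  refine lintegral_congr fun ξ => ?_
  rw [← sub_one_mul, enorm_mul, mul_pow, ENNReal.ofReal_mul (hc j), mul_assoc,
    ENNReal.ofReal_pow (norm_nonneg _), ofReal_norm]
  push_cast
  ring_nf

/-- The Sobolev norm is equivalent to the energy of the dyadic differences. -/
theorem differenceEnergy_bounds {h s a A : ℝ} (hh : 0 < h) {c : ℕ → ℝ} (hc : ∀ j, 0 ≤ c j)
    (ha : 0 ≤ a) (hA : 0 ≤ A)
    (H : ∀ ξ ∈ freqDomain h,
      ENNReal.ofReal (a * bracket ξ ^ (2 * s)) ≤ 1 + ∑' j, ENNReal.ofReal (c j *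
        ‖Complex.exp (Complex.I * ((h * 2 ^ j * ξ : ℝ) : ℂ)) - 1‖ ^ 2) ∧
      1 + ∑' j, ENNReal.ofReal (c j *
        ‖Complex.exp (Complex.I * ((h * 2 ^ j * ξ : ℝ) : ℂ)) - 1‖ ^ 2) ≤
          ENNReal.ofReal (A * bracket ξ ^ (2 * s))) (f : LatticeL2) :
    ENNReal.ofReal (a * (2 * π * sobolevNorm h s f ^ 2)) ≤ differenceEnergy h c f ∧
      differenceEnergy h c f ≤ ENNReal.ofReal (A * (2 * π * sobolevNorm h s f ^ 2)) := by
  have hF := f.isDFT hh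
  rw [differenceEnergy_eq hh hc hF, ENNReal.ofReal_mul ha, ENNReal.ofReal_mul hA,
    ← sobolevNorm_sq_eq_lintegral hh s hF, ← lintegral_const_mul' _ _ ENNReal.ofReal_ne_top,
    ← lintegral_const_mul' _ _ ENNReal.ofReal_ne_top]
  constructor
  · refine lintegral_mono_ae ((ae_mem_freqDomain h).mono fun ξ hξ => ?_)
    rw [← mul_assoc, ← ENNReal.ofReal_mul ha]
    gcongr
    exact (H ξ hξ).1
  · refine lintegral_mono_ae ((ae_mem_freqDomain h).mono fun ξ hξ => ?_)
    rw [← mul_assoc, ← ENNReal.ofReal_mul hA]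
    gcongr
    exact (H ξ hξ).2

theorem add_add_sq_le (x y z : ℝ) : (x + y + z) ^ 2 ≤ 3 * (x ^ 2 + y ^ 2 + z ^ 2) := by
  nlinarith [sq_nonneg (x - y), sq_nonneg (x - z), sq_nonneg (y - z)]

/-- The composition with a cubic function is Lipschitz in `H^s`, for `s ≤ 1`, on balls of lattice
functions; the scale `ρ / √h` is the bound of the supremum norm on the ball of radius `ρ`. -/
theorem exists_sobolevNorm_compose_sub_le {s : ℝ} (hs : 0 ≤ s) (hs1 : s ≤ 1) :
    ∃ C : ℝ, 0 ≤ C ∧ ∀ h : ℝ, 0 < h → ∀ (F : ℝ → ℝ) (hF : IsLocLip F) (Λ ρ : ℝ), 0 ≤ Λ → 0 ≤ ρ →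
      IsCubicOn F Λ (ρ / √h) → ∀ r r' : LatticeL2, sobolevNorm h s r ≤ ρ → sobolevNorm h s r' ≤ ρ →
      sobolevNorm h s (compose hF r - compose hF r' : LatticeL2) ≤
        C * (Λ * ρ ^ 2 / h) * sobolevNorm h s (r - r' : LatticeL2) := by
  obtain ⟨a, A, ha, hA, H⟩ := exists_difference_weights hs hs1
  refine ⟨√(15 * A / a), Real.sqrt_nonneg _, ?_⟩
  intro h hh F hF Λ ρ hΛ hρ hcub r r' hr hr'
  obtain ⟨c, hc, Hc⟩ := H h hh
  have hbd := differenceEnergy_bounds (s := s) hh hc ha.le hA Hc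
  set M := ρ / √h with hM
  have hM0 : 0 ≤ M := by positivity
  have hsh : √h ^ 2 = h := Real.sq_sqrt hh.le
  set e := r - r' with he
  set d := compose hF r - compose hF r' with hd
  set E := sobolevNorm h s e with hE
  have hE0 : 0 ≤ E := sobolevNorm_nonneg h s e
  set ε := E / √h with hε
  have hε0 : 0 ≤ ε := by positivity
  have hrM : ∀ n, |r n| ≤ M := fun n =>
    (r.abs_apply_le n).trans ((norm_le_sobolevNorm hh hs r).trans (by rw [hM]; gcongr))
  have hrM' : ∀ n, |r' n| ≤ M := fun n =>
    (r'.abs_apply_le n).trans ((norm_le_sobolevNorm hh hs r').trans (by rw [hM]; gcongr))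
  have hen : ∀ n, e n = r n - r' n := fun n => by rw [he, lp.coeFn_sub, Pi.sub_apply]
  have hdn : ∀ n, d n = F (r n) - F (r' n) := fun n => by
    rw [hd, lp.coeFn_sub, Pi.sub_apply, compose_apply, compose_apply]
  have heM : ∀ n, |e n| ≤ ε := fun n =>
    (e.abs_apply_le n).trans (norm_le_sobolevNorm hh hs e)
  have hδ : ∀ (k : ℤ) (f : LatticeL2) (n : ℤ), (shift k f - f : LatticeL2) n = f (n + k) - f n :=
    fun k f n => by rw [lp.coeFn_sub, Pi.sub_apply, shift_apply]
  have h0 : ‖d‖ ≤ 3 * Λ * M ^ 2 * ‖e‖ := LatticeL2.norm_le_of_abs_le (by positivity) fun n => by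
    rw [hdn, hen]
    exact hcub.lipschitz hΛ (hrM n) (hrM' n)
  have h0' : h * ‖d‖ ^ 2 ≤ 9 * Λ ^ 2 * M ^ 4 * (h * ‖e‖ ^ 2) := by
    calc h * ‖d‖ ^ 2 ≤ h * (3 * Λ * M ^ 2 * ‖e‖) ^ 2 := by gcongr
      _ = _ := by ring
  -- the differences of `d` are second differences of `F` along `r` and `r'`
  have hk : ∀ k : ℤ, ‖shift k d - d‖ ^ 2 ≤ 9 * Λ ^ 2 * M ^ 4 * ‖shift k e - e‖ ^ 2 +
      3 * Λ ^ 2 * M ^ 2 * ε ^ 2 * (‖shift k r - r‖ ^ 2 + ‖shift k r' - r'‖ ^ 2) := fun k => by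
    refine hasSum_le (fun n => ?_) (LatticeL2.hasSum_sq _)
      (((LatticeL2.hasSum_sq _).mul_left _).add
        (((LatticeL2.hasSum_sq _).add (LatticeL2.hasSum_sq _)).mul_left _))
    simp only [hδ, hdn]
    have h1 := hcub (r (n + k)) (r' (n + k)) (r n) (r' n) (hrM _) (hrM' _) (hrM _) (hrM' _)
    have h2 : |r (n + k) - r' (n + k)| ≤ ε := by rw [← hen]; exact heM _
    rw [hen, hen]
    set x := |r (n + k) - r' (n + k) - (r n - r' n)| with hx
    set y := |r (n + k) - r n|
    set z := |r' (n + k) - r' n|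
    have h3 : |F (r (n + k)) - F (r' (n + k)) - (F (r n) - F (r' n))| ≤
        Λ * (M ^ 2 * x + M * (y + z) * ε) := h1.trans (by gcongr)
    rw [← sq_abs (F (r (n + k)) - F (r' (n + k)) - (F (r n) - F (r' n))),
      ← sq_abs (r (n + k) - r' (n + k) - (r n - r' n)), ← sq_abs (r (n + k) - r n),
      ← sq_abs (r' (n + k) - r' n)]
    calc _ ≤ (Λ * (M ^ 2 * x + M * (y + z) * ε)) ^ 2 := by gcongr
      _ = Λ ^ 2 * (M ^ 2 * x + M * ε * y + M * ε * z) ^ 2 := by ring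
      _ ≤ Λ ^ 2 * (3 * ((M ^ 2 * x) ^ 2 + (M * ε * y) ^ 2 + (M * ε * z) ^ 2)) := by
          gcongr
          exact add_add_sq_le _ _ _
      _ ≤ Λ ^ 2 * (9 * (M ^ 2 * x) ^ 2 + 3 * ((M * ε * y) ^ 2 + (M * ε * z) ^ 2)) := by
          have := sq_nonneg (M ^ 2 * x)
          gcongr
          linarith
      _ = _ := by ring
  have hα : 0 ≤ 9 * Λ ^ 2 * M ^ 4 := by positivity
  have hβ : 0 ≤ 3 * Λ ^ 2 * M ^ 2 * ε ^ 2 := by positivity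
  have hmain : differenceEnergy h c d ≤
      ENNReal.ofReal (9 * Λ ^ 2 * M ^ 4) * differenceEnergy h c e +
      ENNReal.ofReal (3 * Λ ^ 2 * M ^ 2 * ε ^ 2) *
        (differenceEnergy h c r + differenceEnergy h c r') := by
    simp only [differenceEnergy]
    have hA1 : ENNReal.ofReal (2 * π * (h * ‖d‖ ^ 2)) ≤
        ENNReal.ofReal (9 * Λ ^ 2 * M ^ 4) * ENNReal.ofReal (2 * π * (h * ‖e‖ ^ 2)) := by
      rw [← ENNReal.ofReal_mul hα]
      refine ENNReal.ofReal_le_ofReal ?_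
      calc _ ≤ 2 * π * (9 * Λ ^ 2 * M ^ 4 * (h * ‖e‖ ^ 2)) := by gcongr
        _ = _ := by ring
    have hA2 : ∑' j, ENNReal.ofReal (c j) *
          ENNReal.ofReal (2 * π * (h * ‖shift (2 ^ j) d - d‖ ^ 2)) ≤
        ENNReal.ofReal (9 * Λ ^ 2 * M ^ 4) * ∑' j, ENNReal.ofReal (c j) *
          ENNReal.ofReal (2 * π * (h * ‖shift (2 ^ j) e - e‖ ^ 2)) +
        ENNReal.ofReal (3 * Λ ^ 2 * M ^ 2 * ε ^ 2) *
          (∑' j, ENNReal.ofReal (c j) *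
            ENNReal.ofReal (2 * π * (h * ‖shift (2 ^ j) r - r‖ ^ 2)) +
          ∑' j, ENNReal.ofReal (c j) *
            ENNReal.ofReal (2 * π * (h * ‖shift (2 ^ j) r' - r'‖ ^ 2))) := by
      rw [← ENNReal.tsum_add, ← ENNReal.tsum_mul_left, ← ENNReal.tsum_mul_left, ← ENNReal.tsum_add]
      refine ENNReal.tsum_le_tsum fun j => ?_
      rw [← ENNReal.ofReal_mul (hc j), ← ENNReal.ofReal_mul (hc j), ← ENNReal.ofReal_mul (hc j),
        ← ENNReal.ofReal_mul (hc j), ← ENNReal.ofReal_add, ← ENNReal.ofReal_mul hα,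
        ← ENNReal.ofReal_mul hβ, ← ENNReal.ofReal_add]
      · refine ENNReal.ofReal_le_ofReal ?_
        have hcj := hc j
        calc _ ≤ c j * (2 * π * (h * (9 * Λ ^ 2 * M ^ 4 * ‖shift (2 ^ j) e - e‖ ^ 2 +
              3 * Λ ^ 2 * M ^ 2 * ε ^ 2 *
                (‖shift (2 ^ j) r - r‖ ^ 2 + ‖shift (2 ^ j) r' - r'‖ ^ 2)))) := by
              gcongr; exact hk _
          _ = _ := by ring
      all_goals have hcj := hc j; positivity
    calc _ ≤ _ := add_le_add hA1 hA2
      _ ≤ _ := by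
        rw [mul_add (ENNReal.ofReal (9 * Λ ^ 2 * M ^ 4)), add_assoc]
        gcongr
        · exact le_add_self
        · exact le_add_self
  have hfin : ENNReal.ofReal (a * (2 * π * sobolevNorm h s d ^ 2)) ≤
      ENNReal.ofReal (9 * Λ ^ 2 * M ^ 4 * (A * (2 * π * E ^ 2)) +
        3 * Λ ^ 2 * M ^ 2 * ε ^ 2 * (A * (2 * π * ρ ^ 2) + A * (2 * π * ρ ^ 2))) := by
    refine (hbd d).1.trans (hmain.trans ?_)
    rw [ENNReal.ofReal_add (by positivity) (by positivity), ENNReal.ofReal_mul hα,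
      ENNReal.ofReal_mul hβ, ENNReal.ofReal_add (by positivity) (by positivity)]
    have hbr : differenceEnergy h c r ≤ ENNReal.ofReal (A * (2 * π * ρ ^ 2)) :=
      (hbd r).2.trans (ENNReal.ofReal_le_ofReal (by
        have := sobolevNorm_nonneg h s r; gcongr))
    have hbr' : differenceEnergy h c r' ≤ ENNReal.ofReal (A * (2 * π * ρ ^ 2)) :=
      (hbd r').2.trans (ENNReal.ofReal_le_ofReal (by
        have := sobolevNorm_nonneg h s r'; gcongr))
    gcongr
    exact (hbd e).2
  rw [ENNReal.ofReal_le_ofReal_iff (by positivity)] at hfin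
  refine le_of_sq_le_sq ?_ (by positivity)
  have e1 : 9 * Λ ^ 2 * M ^ 4 * (A * (2 * π * E ^ 2)) +
        3 * Λ ^ 2 * M ^ 2 * ε ^ 2 * (A * (2 * π * ρ ^ 2) + A * (2 * π * ρ ^ 2)) =
      2 * π * (15 * A * (Λ * ρ ^ 2 / h) ^ 2 * E ^ 2) := by
    have hM2 : M ^ 2 = ρ ^ 2 / h := by rw [hM, div_pow, hsh]
    have hε2 : ε ^ 2 = E ^ 2 / h := by rw [hε, div_pow, hsh]
    rw [show M ^ 4 = M ^ 2 * M ^ 2 by ring, hM2, hε2]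
    field_simp
    ring
  rw [e1, mul_left_comm] at hfin
  have h5 := le_of_mul_le_mul_left hfin (by positivity)
  rw [mul_pow, mul_pow, Real.sq_sqrt (by positivity), div_mul_eq_mul_div, div_mul_eq_mul_div,
    le_div_iff₀ ha, mul_comm]
  exact h5

/-! ### A fixed point theorem for realised functions -/

/-- A contraction argument in which only the functions realised by the densities are nonlinear: the
differences of the values of the nonlinear map have to be realised by small densities. -/
theorem exists_realised_fixed_point {E ι : Type*} [NormedAddCommGroup E] [CompleteSpace E]
    (S : ι → E →+ ℂ) (hS : ∀ i, Continuous (S i)) (Φ : E → ι → ℝ) {ρ : ℝ}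
    (h0 : ∃ W : E, ‖W‖ ≤ ρ / 2 ∧ ∀ i, S i W = (Φ 0 i : ℂ))
    (hΦ : ∀ W W' : E, ‖W‖ ≤ ρ → ‖W'‖ ≤ ρ → (∀ i, (S i W).im = 0) → (∀ i, (S i W').im = 0) →
      ∃ D : E, ‖D‖ ≤ 1 / 2 * ‖W - W'‖ ∧ ∀ i, S i D = ((Φ W i - Φ W' i : ℝ) : ℂ)) :
    ∃ W : E, ‖W‖ ≤ ρ ∧ ∀ i, S i W = (Φ W i : ℂ) := by
  obtain ⟨W₁, hW₁, hSW₁⟩ := h0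
  have hρ : 0 ≤ ρ := by have := (norm_nonneg W₁).trans hW₁; linarith
  -- pairs of consecutive iterates
  let P : ℕ → E × E → Prop := fun k p => ‖p.1‖ ≤ ρ - ρ * (1 / 2) ^ k ∧
    ‖p.2 - p.1‖ ≤ ρ / 2 * (1 / 2) ^ k ∧ (∀ i, (S i p.1).im = 0) ∧ ∀ i, S i p.2 = (Φ p.1 i : ℂ)
  have step : ∀ k (p : E × E), P k p → ∃ q : E × E, q.1 = p.2 ∧ P (k + 1) q := by
    rintro k ⟨W, W'⟩ ⟨h1, h2, h3, h4⟩
    simp only at h1 h2 h3 h4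
    have hpow : (0 : ℝ) ≤ (1 / 2) ^ k := by positivity
    have h5 : ‖W'‖ ≤ ρ - ρ * (1 / 2) ^ (k + 1) := by
      have := norm_add_le W (W' - W)
      rw [add_sub_cancel] at this
      rw [pow_succ]
      linarith
    have h6 : ∀ i, (S i W').im = 0 := fun i => by rw [h4, Complex.ofReal_im]
    have h7 : 0 ≤ ρ * (1 / 2 : ℝ) ^ (k + 1) := by positivity
    have h8 : 0 ≤ ρ * (1 / 2 : ℝ) ^ k := by positivity
    obtain ⟨D, hD, hSD⟩ := hΦ W' W (by linarith) (by linarith) h6 h3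
    refine ⟨(W', W' + D), rfl, h5, ?_, h6, fun i => ?_⟩
    · simp only [add_sub_cancel_left]
      refine hD.trans ?_
      rw [pow_succ]
      linarith
    · simp only [map_add, hSD, h4]
      push_cast; ring
  have hP0 : P 0 (0, W₁) := by
    refine ⟨by simp, by simpa using hW₁, fun i => by simp, hSW₁⟩
  let seq : (k : ℕ) → {p : E × E // P k p} := fun k => Nat.rec ⟨(0, W₁), hP0⟩
    (fun k p => ⟨(step k p.1 p.2).choose, (step k p.1 p.2).choose_spec.2⟩) k
  have hseq : ∀ k, (seq (k + 1)).1.1 = (seq k).1.2 :=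
    fun k => (step k (seq k).1 (seq k).2).choose_spec.1
  set x : ℕ → E := fun k => (seq k).1.1 with hx
  have hdist : ∀ k, dist (x k) (x (k + 1)) ≤ ρ / 2 * (1 / 2) ^ k := fun k => by
    rw [dist_comm, dist_eq_norm, hx]
    simp only [hseq]
    exact (seq k).2.2.1
  have hcauchy : CauchySeq x := cauchySeq_of_le_geometric (1 / 2) (ρ / 2) (by norm_num) hdist
  obtain ⟨W, hW⟩ := cauchySeq_tendsto_of_complete hcauchy
  have hxρ : ∀ k, ‖x k‖ ≤ ρ := fun k => (seq k).2.1.trans (by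
    have : (0 : ℝ) ≤ ρ * (1 / 2) ^ k := by positivity
    linarith)
  have hWρ : ‖W‖ ≤ ρ := le_of_tendsto hW.norm (Eventually.of_forall hxρ)
  have hxre : ∀ k i, (S i (x k)).im = 0 := fun k => (seq k).2.2.2.1
  have hWre : ∀ i, (S i W).im = 0 := fun i =>
    tendsto_nhds_unique
      ((Complex.continuous_im.comp (hS i)).tendsto W |>.comp hW)
      (by simp [Function.comp_def, hxre])
  refine ⟨W, hWρ, fun i => ?_⟩
  -- the values of the nonlinear map along the iterates converge
  choose D hD hSD using fun k => hΦ (x k) W (hxρ k) hWρ (hxre k) hWre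
  have hD0 : Tendsto D atTop (𝓝 0) := by
    rw [tendsto_zero_iff_norm_tendsto_zero]
    refine squeeze_zero (fun _ => norm_nonneg _) hD ?_
    have := ((hW.sub_const W).norm).const_mul (1 / 2)
    simpa using this
  have h1 : Tendsto (fun k => S i (x (k + 1))) atTop (𝓝 (S i W)) :=
    ((hS i).tendsto W).comp (hW.comp (tendsto_add_atTop_nat 1))
  have h2 : ∀ k, S i (x (k + 1)) = S i (D k) + (Φ W i : ℂ) := fun k => by
    have e1 : S i (x (k + 1)) = (Φ (x k) i : ℂ) := by
      rw [hx]; simp only [hseq]; exact (seq k).2.2.2.2 i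
    rw [e1, hSD]; push_cast; ring
  have h3 : Tendsto (fun k => S i (D k) + (Φ W i : ℂ)) atTop (𝓝 (S i 0 + (Φ W i : ℂ))) :=
    (((hS i).tendsto 0).comp hD0).add_const _
  rw [map_zero, zero_add] at h3
  simp only [h2] at h1
  exact tendsto_nhds_unique h1 h3

/-! ### The Duhamel term of a general forcing -/

theorem sobolevNorm_mulLin_le {h : ℝ} (hh : 0 < h) (s : ℝ) (m : RealSymbol h) {C : ℝ} (hC : 0 ≤ C)
    (hm : ∀ ξ ∈ freqDomain h, ‖m ξ‖ ≤ C) (f : LatticeL2) :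
    sobolevNorm h s (mulLin hh m f) ≤ C * sobolevNorm h s f := by
  rw [sobolevNorm_eq hh, sobolevNorm_eq hh, mulLin_comm, mul_left_comm]
  gcongr
  exact mulLin_norm_le hh m hC hm _

theorem sobolevNorm_phaseFlow {h : ℝ} (hh : 0 < h) (s σ ε t : ℝ) (f : LatticeL2) :
    sobolevNorm h s (phaseFlow hh σ ε t f) = sobolevNorm h s f := by
  rw [sobolevNorm_eq hh, sobolevNorm_eq hh, phaseFlow, ← flow_mulLin, norm_flow]

theorem sobolevNorm_pullback_le {h : ℝ} (hh : 0 < h) (s σ t : ℝ) (f : LatticeL2) :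
    sobolevNorm h s (pullback hh σ t f) ≤ 2 / h * sobolevNorm h s f := by
  rw [pullback, sobolevNorm_phaseFlow, mulCLM_apply]
  exact sobolevNorm_mulLin_le hh s _ (by positivity) (fun ξ _ => norm_nablaSymbol_le hh ξ) f

theorem sobolevNorm_add_le {h : ℝ} (hh : 0 < h) (s : ℝ) (f g : LatticeL2) :
    sobolevNorm h s (f + g : LatticeL2) ≤ sobolevNorm h s f + sobolevNorm h s g := by
  rw [sobolevNorm_eq hh, sobolevNorm_eq hh, sobolevNorm_eq hh, map_add, ← mul_add]
  gcongr
  exact norm_add_le _ _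

/-- The Duhamel estimate for a forcing that is continuous in time with values in `H^s`. -/
theorem exists_forcing_duhamel_density {η : ℝ → ℝ} {ψ : ℝ → ℂ} (hψ : IsCutoffTransform η ψ)
    (hη : ∀ t, |t| ≤ 2 → η t = 1) {b : ℝ} (hb : 1 / 2 < b) (hb' : b < 5 / 8) {s : ℝ}
    (hs : 0 ≤ s) :
    ∃ C : ℝ, 0 ≤ C ∧ ∀ T : ℝ, 0 < T → T ≤ 1 → ∀ h : ℝ, 0 < h → ∀ q : ℝ → LatticeL2,
      Continuous q → ∀ P : ℝ, 0 ≤ P → (∀ t, |t| ≤ 2 * T → sobolevNorm h s (q t) ≤ P) →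
      ∃ D : ℝ × ℝ → ℂ, MemLp D 2 (specMeasure h) ∧
        energy h D ≤ ENNReal.ofReal (C * T ^ (1 / 8 : ℝ) * P ^ 2) ∧
        ∀ t, |t| ≤ 2 * T → ∀ n, syn h (fun _ => 0) (fun p => invWeight s b p * D p) t n =
          (((∫ t₁ in (0 : ℝ)..t, q t₁) n : ℝ) : ℂ) := by
  obtain ⟨C, hC, H⟩ := exists_duhamel_density hψ hb hb'
  set M : ℝ := (2 * √2) ^ (17 / 16 : ℝ) * bracketMass (17 / 16) with hM
  have hM0 : 0 ≤ M := isSpread_int.nonneg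
  refine ⟨C * M * (2 * π), by positivity, fun T hT hT1 h hh q hq P hP hqP => ?_⟩
  -- the values outside `[-2T, 2T]` do not matter
  set c : ℝ → ℝ := fun t => max (-(2 * T)) (min (2 * T) t) with hc
  have hcc : Continuous c := by fun_prop
  have hcb : ∀ t, |c t| ≤ 2 * T := fun t =>
    abs_le.2 ⟨le_max_left _ _, max_le (by linarith) (min_le_left _ _)⟩
  have hcid : ∀ t, |t| ≤ 2 * T → c t = t := fun t ht => by
    rw [abs_le] at ht
    rw [hc]; simp only
    rw [min_eq_right ht.2, max_eq_right ht.1]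
  obtain ⟨Q, hQ, hQb, hQs⟩ := exists_forcing_density hh hs (hq.comp hcc)
    (fun t => hqP _ (hcb t))
  obtain ⟨D, hD, hDe, hDs⟩ := H T hT hT1 h s hs Measure.count (fun k : ℤ => -(k : ℝ)) _
    isSpread_int Q hQ _ ENNReal.ofReal_lt_top hQb
  refine ⟨D, hD, hDe.trans (le_of_eq ?_), fun t ht n => ?_⟩
  · rw [← ENNReal.ofReal_mul (by positivity)]
    congr 1; ring
  have hηt : η (t / T) = 1 := hη _ (by rw [abs_div, abs_of_pos hT]; exact (div_le_iff₀ hT).2 ht)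
  rw [hDs t hηt n, hQs t (by linarith [Real.pi_gt_three]) n]
  have heq : ∫ t₁ in (0 : ℝ)..t, (q ∘ c) t₁ = ∫ t₁ in (0 : ℝ)..t, q t₁ := by
    refine intervalIntegral.integral_congr fun t₁ ht₁ => ?_
    have ht₁' : |t₁| ≤ 2 * T := by
      refine le_trans ?_ ht
      have := abs_sub_left_of_mem_uIcc ht₁
      simpa using this
    simp only [Function.comp_apply, hcid t₁ ht₁']
  rw [← heq]

/-- The remainder is Lipschitz on bounded sets of `H^s`, with a factor `h` that balances the
derivative `∇_h` of size `1/h`. -/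
theorem exists_remainder_lipschitz {V : ℝ → ℝ} (hV : ContDiff ℝ 5 V)
    (hV1 : deriv V 0 = 0) (hV2 : iteratedDeriv 2 V 0 = 1) (hV3 : iteratedDeriv 3 V 0 = 1) {s : ℝ}
    (hs : 0 ≤ s) (hsV : s ≤ 1 ∨ ∀ r, V r = r ^ 2 / 2 + r ^ 3 / 6) {ρ : ℝ} (hρ : 0 ≤ ρ) :
    ∃ C : ℝ, 0 ≤ C ∧ ∀ (h : ℝ) (hh : 0 < h), h ≤ 1 → ∀ r r' : LatticeL2,
      sobolevNorm h s r ≤ ρ → sobolevNorm h s r' ≤ ρ →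
      sobolevNorm h s (compose (isLocLip_remainder hV hV1 hV2 hV3 hh) r -
          compose (isLocLip_remainder hV hV1 hV2 hV3 hh) r' : LatticeL2) ≤
        C * h * sobolevNorm h s (r - r' : LatticeL2) := by
  rcases hsV with hs1 | hVpol
  · obtain ⟨C, hC, H⟩ := exists_sobolevNorm_compose_sub_le hs hs1
    obtain ⟨L, hL, HL⟩ := exists_remainder_isCubicOn hV hV2 hV3 ρ
    refine ⟨C * L * ρ ^ 2, by positivity, fun h hh h1 r r' hr hr' => ?_⟩
    have hK : h ^ 2 * (ρ / √h) ≤ ρ := by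
      rw [mul_div_assoc', div_le_iff₀ (Real.sqrt_pos.2 hh), mul_comm]
      have h2 : h ^ 2 ≤ √h := by
        rw [Real.le_sqrt (by positivity) hh.le, ← pow_mul]
        exact pow_le_of_le_one hh.le h1 (by norm_num)
      gcongr
    have := H h hh _ (isLocLip_remainder hV hV1 hV2 hV3 hh) (L * h ^ 2) ρ (by positivity) hρ
      (HL h hh _ (by positivity) hK) r r' hr hr'
    refine this.trans (le_of_eq ?_)
    field_simp
  · have hd : ∀ x, deriv V x = x + x ^ 2 / 2 := fun x => by
      have h1 : HasDerivAt V (x + x ^ 2 / 2) x := by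
        have e : V = fun r => r ^ 2 / 2 + r ^ 3 / 6 := funext hVpol
        rw [e]
        have := ((hasDerivAt_pow 2 x).div_const 2).add ((hasDerivAt_pow 3 x).div_const 6)
        refine this.congr_deriv ?_
        norm_num; ring
      exact h1.deriv
    refine ⟨0, le_rfl, fun h hh h1 r r' hr hr' => ?_⟩
    have hz : ∀ x, compose (isLocLip_remainder hV hV1 hV2 hV3 hh) x = 0 := fun x =>
      lp.ext (funext fun n => by
        rw [compose_apply, lp.coeFn_zero, Pi.zero_apply, remainder, hd]
        field_simp
        ring)
    rw [hz, hz, sub_zero, sobolevNorm_eq hh, map_zero, norm_zero, mul_zero, zero_mul, zero_mul]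

/-! ### Construction of the solutions -/

theorem phaseFlow_phaseFlow {h : ℝ} (hh : 0 < h) {σ₁ ε₁ t₁ σ₂ ε₂ t₂ σ₃ ε₃ t₃ : ℝ}
    (hφ : ∀ ξ, t₁ * phase h σ₁ ε₁ ξ + t₂ * phase h σ₂ ε₂ ξ = t₃ * phase h σ₃ ε₃ ξ)
    (f : LatticeL2) :
    phaseFlow hh σ₁ ε₁ t₁ (phaseFlow hh σ₂ ε₂ t₂ f) = phaseFlow hh σ₃ ε₃ t₃ f :=
  mulLin_mulLin hh (fun ξ => by
    simp only [waveSymbol_apply]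
    rw [← Complex.exp_add, ← mul_add, ← Complex.ofReal_add, hφ]) f

/-- The nonlinearity of the equation with sign `σ`, with a factor `κ` in front of the terms that
couple the two equations and of the remainder: `κ = 1` gives the coupled and `κ = 0` the decoupled
system. Here `F` stands for `h² 𝓡`. -/
def nonlin {h : ℝ} (hh : 0 < h) {F : ℝ → ℝ} (hF : IsLocLip F) (κ σ t : ℝ) (u w : LatticeL2) :
    LatticeL2 :=
  latMul (u + κ • phaseFlow hh σ 0 (2 * t) w) (u + κ • phaseFlow hh σ 0 (2 * t) w) +
    κ • phaseFlow hh σ 0 t (compose hF (phaseFlow hh σ 0 (-t) u + phaseFlow hh σ 0 t w))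

/-- The nonlinearity in terms of the interaction pictures of the two unknowns. -/
def interNonlin {h : ℝ} (hh : 0 < h) {F : ℝ → ℝ} (hF : IsLocLip F) (κ σ t : ℝ) (y z : LatticeL2) :
    LatticeL2 :=
  nonlin hh hF κ σ t (phaseFlow hh σ 1 t y) (phaseFlow hh (-σ) 1 t z)

theorem continuous_nonlin {h : ℝ} (hh : 0 < h) {F : ℝ → ℝ} (hF : IsLocLip F) (κ σ : ℝ)
    {u w : ℝ → LatticeL2} (hu : Continuous u) (hw : Continuous w) :
    Continuous (fun t => nonlin hh hF κ σ t (u t) (w t)) := by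
  have h1 : Continuous (fun t => u t + κ • phaseFlow hh σ 0 (2 * t) (w t)) :=
    hu.add ((continuous_phaseFlow_apply hh σ 0 (by fun_prop : Continuous fun t : ℝ => 2 * t)
      hw).const_smul κ)
  have h2 : Continuous (fun t => phaseFlow hh σ 0 (-t) (u t) + phaseFlow hh σ 0 t (w t)) :=
    (continuous_phaseFlow_apply hh σ 0 continuous_neg hu).add
      (continuous_phaseFlow_apply hh σ 0 continuous_id' hw)
  exact (continuous_latMul h1 h1).add
    ((continuous_phaseFlow_apply hh σ 0 continuous_id'
      ((continuous_compose hF).comp h2)).const_smul κ)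

theorem latMul_self_sub (a b a' b' : LatticeL2) (κ : ℝ) :
    latMul (a + κ • b) (a + κ • b) - latMul (a' + κ • b') (a' + κ • b') =
      latMul (a - a') (a + a') + κ • latMul (a - a') (b + b') + κ • latMul (b - b') (a + a') +
        κ ^ 2 • latMul (b - b') (b + b') :=
  lp.ext (funext fun n => by
    simp only [lp.coeFn_sub, lp.coeFn_add, lp.coeFn_smul, Pi.sub_apply, Pi.add_apply,
      Pi.smul_apply, latMul_apply, smul_eq_mul]
    ring)

theorem compose_zero {F : ℝ → ℝ} (hF : IsLocLip F) : compose hF 0 = 0 :=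
  lp.ext (funext fun n => by
    rw [compose_apply, lp.coeFn_zero, Pi.zero_apply]; exact hF.1)

theorem nonlin_zero {h : ℝ} (hh : 0 < h) {F : ℝ → ℝ} (hF : IsLocLip F) (κ σ t : ℝ) :
    nonlin hh hF κ σ t 0 0 = 0 := by
  simp only [nonlin, map_zero, smul_zero, add_zero, compose_zero, ← latMulCLM_apply]

theorem pullback_add {h : ℝ} (hh : 0 < h) (σ t : ℝ) (f g : LatticeL2) :
    pullback hh σ t (f + g) = pullback hh σ t f + pullback hh σ t g := by
  simp only [pullback, map_add]

theorem pullback_sub {h : ℝ} (hh : 0 < h) (σ t : ℝ) (f g : LatticeL2) :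
    pullback hh σ t (f - g) = pullback hh σ t f - pullback hh σ t g := by
  simp only [pullback, map_sub]

theorem pullback_smul {h : ℝ} (hh : 0 < h) (σ t c : ℝ) (f : LatticeL2) :
    pullback hh σ t (c • f) = c • pullback hh σ t f := by
  simp only [pullback, map_smul]

section Solve

variable {h s b : ℝ} (hh : 0 < h) (hs : 0 ≤ s) (hb : 1 / 2 < b)

/-- The functions realised by the density are real-valued for `|t| ≤ 2T`. -/
def IsRealOn (T : ℝ) (A : Density h) : Prop :=
  ∀ t, |t| ≤ 2 * T → ∀ n, (realise hs hb t n A).im = 0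

variable {hs hb} in
theorem IsRealOn.add {T : ℝ} {A B : Density h} (hA : IsRealOn hs hb T A) (hB : IsRealOn hs hb T B) :
    IsRealOn hs hb T (A + B) := fun t ht n => by
  rw [map_add, Complex.add_im, hA t ht, hB t ht, add_zero]

variable {hs hb} in
theorem IsRealOn.sub {T : ℝ} {A B : Density h} (hA : IsRealOn hs hb T A) (hB : IsRealOn hs hb T B) :
    IsRealOn hs hb T (A - B) := fun t ht n => by
  rw [map_sub, Complex.sub_im, hA t ht, hB t ht, sub_zero]

/-- The density `D` realises the primitive `∫_0^t q` for `|t| ≤ 2T`. -/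
structure RealisesPrimitive (T : ℝ) (q : ℝ → LatticeL2) (D : Density h) : Prop where
  continuous : Continuous q
  realise_eq : ∀ t, |t| ≤ 2 * T → ∀ n,
    realise hs hb t n D = (((∫ t₁ in (0 : ℝ)..t, q t₁) n : ℝ) : ℂ)

variable {hs hb} in
theorem RealisesPrimitive.add {T : ℝ} {q q' : ℝ → LatticeL2} {D D' : Density h}
    (hD : RealisesPrimitive hs hb T q D) (hD' : RealisesPrimitive hs hb T q' D') :
    RealisesPrimitive hs hb T (fun t => q t + q' t) (D + D') where
  continuous := hD.continuous.add hD'.continuous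
  realise_eq t ht n := by
    rw [map_add, hD.realise_eq t ht, hD'.realise_eq t ht,
      intervalIntegral.integral_add (hD.continuous.intervalIntegrable _ _)
        (hD'.continuous.intervalIntegrable _ _), lp.coeFn_add, Pi.add_apply, Complex.ofReal_add]

variable {hs hb} in
theorem RealisesPrimitive.smul {T : ℝ} {q : ℝ → LatticeL2} {D : Density h}
    (hD : RealisesPrimitive hs hb T q D) (c : ℝ) :
    RealisesPrimitive hs hb T (fun t => c • q t) (c • D) where
  continuous := hD.continuous.const_smul c
  realise_eq t ht n := by
    rw [map_real_smul _ (continuous_realise hs hb t n), hD.realise_eq t ht,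
      intervalIntegral.integral_smul, lp.coeFn_smul, Pi.smul_apply, smul_eq_mul,
      Complex.ofReal_mul, Complex.real_smul]

end Solve

/-- The estimate `exists_quadratic_density` in terms of norms. -/
theorem exists_quadratic_realisation {η : ℝ → ℝ} {ψ : ℝ → ℂ} (hψ : IsCutoffTransform η ψ)
    (hη : ∀ t, |t| ≤ 2 → η t = 1) {b : ℝ} (hb : 1 / 2 < b) (hb' : b < 5 / 8) {s : ℝ}
    (hs : 0 ≤ s) :
    ∃ C : ℝ, 0 ≤ C ∧ ∀ T : ℝ, 0 < T → T ≤ 1 → ∀ (h : ℝ) (hh : 0 < h) (σ ε₁ ε₂ : ℝ),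
      (σ = 1 ∨ σ = -1) → (ε₁ = 1 ∨ ε₁ = -1) → (ε₂ = 1 ∨ ε₂ = -1) → ∀ A B : Density h,
      IsRealOn hs hb T A → IsRealOn hs hb T B →
      ∃ D : Density h, ‖D‖ ≤ C * T ^ (1 / 16 : ℝ) * (‖A‖ * ‖B‖) ∧
        RealisesPrimitive hs hb T (fun t => pullback hh σ t
          (latMul (phaseFlow hh σ ε₁ t (slice hh hs hb A t))
            (phaseFlow hh σ ε₂ t (slice hh hs hb B t)))) D := by
  obtain ⟨C, hC, H⟩ := exists_quadratic_density hψ hη hb hb' hs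
  refine ⟨√C, Real.sqrt_nonneg _, ?_⟩
  intro T hT hT1 h hh σ ε₁ ε₂ hσ hε₁ hε₂ A B hA hB
  have hcA := continuous_slice hh hs hb A
  have hcB := continuous_slice hh hs hb B
  obtain ⟨D, hD, hDe, hDs⟩ := H T hT hT1 h hh σ ε₁ ε₂ hσ hε₁ hε₂ A B (Lp.memLp A) (Lp.memLp B)
    (slice hh hs hb A) (slice hh hs hb B) hcA hcB
    (fun t ht n => ofReal_slice hh hs hb (hA t ht) n)
    (fun t ht n => ofReal_slice hh hs hb (hB t ht) n)
  refine ⟨hD.toLp D, norm_toLp_le_of_energy_le hD (by positivity) (hDe.trans (le_of_eq ?_)),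
    ⟨?_, fun t ht n => ?_⟩⟩
  · rw [energy_eq, energy_eq, ← ENNReal.ofReal_mul (by positivity),
      ← ENNReal.ofReal_mul (by positivity)]
    congr 1
    rw [mul_pow, mul_pow, Real.sq_sqrt hC, ← Real.rpow_natCast (T ^ (1 / 16 : ℝ)),
      ← Real.rpow_mul hT.le, show (1 / 16 : ℝ) * ((2 : ℕ) : ℝ) = 1 / 8 by norm_num]
    ring
  · exact continuous_pullback hh σ (continuous_latMul
      (continuous_phaseFlow_apply hh σ ε₁ continuous_id' hcA)
      (continuous_phaseFlow_apply hh σ ε₂ continuous_id' hcB))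
  · rw [realise_apply, syn_toLp, hDs t ht n]

/-- The estimate `exists_forcing_duhamel_density` in terms of norms. -/
theorem exists_forcing_realisation {η : ℝ → ℝ} {ψ : ℝ → ℂ} (hψ : IsCutoffTransform η ψ)
    (hη : ∀ t, |t| ≤ 2 → η t = 1) {b : ℝ} (hb : 1 / 2 < b) (hb' : b < 5 / 8) {s : ℝ}
    (hs : 0 ≤ s) :
    ∃ C : ℝ, 0 ≤ C ∧ ∀ T : ℝ, 0 < T → T ≤ 1 → ∀ h : ℝ, 0 < h → ∀ q : ℝ → LatticeL2,
      Continuous q → ∀ P : ℝ, 0 ≤ P → (∀ t, |t| ≤ 2 * T → sobolevNorm h s (q t) ≤ P) →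
      ∃ D : Density h, ‖D‖ ≤ C * T ^ (1 / 16 : ℝ) * P ∧ RealisesPrimitive hs hb T q D := by
  obtain ⟨C, hC, H⟩ := exists_forcing_duhamel_density hψ hη hb hb' hs
  refine ⟨√C, Real.sqrt_nonneg _, ?_⟩
  intro T hT hT1 h hh q hq P hP hqP
  obtain ⟨D, hD, hDe, hDs⟩ := H T hT hT1 h hh q hq P hP hqP
  refine ⟨hD.toLp D, norm_toLp_le_of_energy_le hD (by positivity) (hDe.trans (le_of_eq ?_)),
    ⟨hq, fun t ht n => ?_⟩⟩
  · congr 1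
    rw [mul_pow, mul_pow, Real.sq_sqrt hC, ← Real.rpow_natCast (T ^ (1 / 16 : ℝ)),
      ← Real.rpow_mul hT.le, show (1 / 16 : ℝ) * ((2 : ℕ) : ℝ) = 1 / 8 by norm_num]
  · rw [realise_apply, syn_toLp, hDs t ht n]

/-- The sign `1` or `-1` of one of the two equations. -/
def sgn (j : Bool) : ℝ := if j then 1 else -1

theorem sgn_eq (j : Bool) : sgn j = 1 ∨ sgn j = -1 := by cases j <;> simp [sgn]

theorem sgn_not (j : Bool) : sgn (!j) = -sgn j := by cases j <;> simp [sgn]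

theorem abs_sgn (j : Bool) : |sgn j| = 1 := by cases j <;> simp [sgn]

theorem phase_comp_two_mul (h σ t ξ : ℝ) :
    2 * t * phase h σ 0 ξ + t * phase h (-σ) 1 ξ = t * phase h σ (-1) ξ := by
  simp only [phase]; ring

/-- The difference of two values of the nonlinearity, as a combination of products of waves. -/
theorem interNonlin_sub {h : ℝ} (hh : 0 < h) {F : ℝ → ℝ} (hF : IsLocLip F) (κ σ t : ℝ)
    (y z y' z' : LatticeL2) :
    interNonlin hh hF κ σ t y z - interNonlin hh hF κ σ t y' z' =
      latMul (phaseFlow hh σ 1 t (y - y')) (phaseFlow hh σ 1 t (y + y')) +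
      κ • latMul (phaseFlow hh σ 1 t (y - y')) (phaseFlow hh σ (-1) t (z + z')) +
      κ • latMul (phaseFlow hh σ (-1) t (z - z')) (phaseFlow hh σ 1 t (y + y')) +
      κ ^ 2 • latMul (phaseFlow hh σ (-1) t (z - z')) (phaseFlow hh σ (-1) t (z + z')) +
      κ • phaseFlow hh σ 0 t
        (compose hF (phaseFlow hh σ 0 (-t) (phaseFlow hh σ 1 t y) +
            phaseFlow hh σ 0 t (phaseFlow hh (-σ) 1 t z)) -
          compose hF (phaseFlow hh σ 0 (-t) (phaseFlow hh σ 1 t y') +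
            phaseFlow hh σ 0 t (phaseFlow hh (-σ) 1 t z'))) := by
  have e : ∀ z, phaseFlow hh σ 0 (2 * t) (phaseFlow hh (-σ) 1 t z) = phaseFlow hh σ (-1) t z :=
    phaseFlow_phaseFlow hh (phase_comp_two_mul h σ t)
  simp only [interNonlin, nonlin, e]
  rw [map_sub, map_sub, map_sub, map_add, map_add, smul_sub, ← latMul_self_sub]
  abel

/-- For a short time that does not depend on `h`, the integral equations in the interaction picture
are solved by functions that are realised by small densities. -/
theorem exists_density_solution {η : ℝ → ℝ} {ψ : ℝ → ℂ} (hψ : IsCutoffTransform η ψ)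
    (hη : ∀ t, |t| ≤ 2 → η t = 1) {b : ℝ} (hb : 1 / 2 < b) (hb' : b < 5 / 8) {s : ℝ}
    (hs : 0 ≤ s) {V : ℝ → ℝ} (hV : ContDiff ℝ 5 V)
    (hV1 : deriv V 0 = 0) (hV2 : iteratedDeriv 2 V 0 = 1) (hV3 : iteratedDeriv 3 V 0 = 1)
    (hsV : s ≤ 1 ∨ ∀ r, V r = r ^ 2 / 2 + r ^ 3 / 6) :
    ∃ C₀ : ℝ, 0 ≤ C₀ ∧ ∀ ρm : ℝ, 0 ≤ ρm → ∃ T : ℝ, 0 < T ∧ T ≤ 1 ∧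
      ∀ (h : ℝ) (hh : 0 < h), h ≤ 1 → ∀ κ : ℝ, |κ| ≤ 1 → ∀ (f : Bool → LatticeL2) (ρ : ℝ),
      ρ ≤ ρm → (∀ j, C₀ * sobolevNorm h s (f j) ≤ ρ) →
      ∃ W : Bool → Density h, ‖W‖ ≤ ρ ∧ ∀ (j : Bool) (t : ℝ), |t| ≤ 2 * T → ∀ n,
        realise hs hb t n (W j) = ((f j n - sgn j / 4 *
          (∫ t₁ in (0 : ℝ)..t, pullback hh (sgn j) t₁
            (interNonlin hh (isLocLip_remainder hV hV1 hV2 hV3 hh) κ (sgn j) t₁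
              (slice hh hs hb (W j) t₁) (slice hh hs hb (W (!j)) t₁))) n : ℝ) : ℂ) := by
  obtain ⟨C, hC, HC⟩ := exists_const_density hψ (b := b) hb'
  obtain ⟨Cq, hCq, HCq⟩ := exists_quadratic_realisation hψ hη hb hb' hs
  obtain ⟨Cf, hCf, HCf⟩ := exists_forcing_realisation hψ hη hb hb' hs
  refine ⟨2 * √C, by positivity, fun ρm hρm => ?_⟩
  set c := √(bracketMass (2 * b)) with hc
  have hc0 : 0 ≤ c := Real.sqrt_nonneg _
  obtain ⟨Cr, hCr, HCr⟩ := exists_remainder_lipschitz hV hV1 hV2 hV3 hs hsV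
    (by positivity : 0 ≤ 2 * (c * ρm))
  -- the time that makes the map a contraction
  set B := 2 * Cq * ρm + Cf * Cr * c with hB
  have hB0 : 0 ≤ B := by positivity
  set τ : ℝ := 1 / (2 * (B + 1)) with hτ
  have hτ0 : 0 < τ := by positivity
  have hτ1 : τ ≤ 1 := by rw [hτ, div_le_one (by positivity)]; linarith
  have hBτ : τ * B ≤ 1 / 2 := by
    rw [hτ, div_mul_eq_mul_div, div_le_div_iff₀ (by positivity) (by norm_num)]; linarith
  refine ⟨τ ^ 16, by positivity, pow_le_one₀ hτ0.le hτ1, ?_⟩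
  have hT16 : (τ ^ 16 : ℝ) ^ (1 / 16 : ℝ) = τ := by
    rw [← Real.rpow_natCast, ← Real.rpow_mul hτ0.le]; norm_num
  set T := τ ^ 16 with hT
  have hT0 : 0 < T := by positivity
  have hT1 : T ≤ 1 := pow_le_one₀ hτ0.le hτ1
  intro h hh h1 κ hκ f ρ hρρm hf
  have hρ : 0 ≤ ρ := le_trans (mul_nonneg (by positivity) (sobolevNorm_nonneg h s _)) (hf true)
  set hF := isLocLip_remainder hV hV1 hV2 hV3 hh
  have hcs : ∀ A, Continuous (slice hh hs hb A) := continuous_slice hh hs hb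
  have hNc : ∀ (W : Bool → Density h) (j : Bool), Continuous (fun t => pullback hh (sgn j) t
      (interNonlin hh hF κ (sgn j) t (slice hh hs hb (W j) t) (slice hh hs hb (W (!j)) t))) :=
    fun W j => continuous_pullback hh _ (continuous_nonlin hh hF κ _
      (continuous_phaseFlow_apply hh _ _ continuous_id' (hcs _))
      (continuous_phaseFlow_apply hh _ _ continuous_id' (hcs _)))
  let ι := Bool × {t : ℝ // |t| ≤ 2 * T} × ℤ
  let S : ι → (Bool → Density h) →+ ℂ := fun i =>
    (realise hs hb i.2.1.1 i.2.2).comp (Pi.evalAddMonoidHom (fun _ => Density h) i.1)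
  let Φ : (Bool → Density h) → ι → ℝ := fun W i => f i.1 i.2.2 - sgn i.1 / 4 *
    (∫ t₁ in (0 : ℝ)..i.2.1.1, pullback hh (sgn i.1) t₁ (interNonlin hh hF κ (sgn i.1) t₁
      (slice hh hs hb (W i.1) t₁) (slice hh hs hb (W (!i.1)) t₁))) i.2.2
  have hfix := exists_realised_fixed_point S
    (fun i => (continuous_realise hs hb _ _).comp (continuous_apply i.1)) Φ (ρ := ρ) ?_ ?_
  · obtain ⟨W, hW, HW⟩ := hfix
    exact ⟨W, hW, fun j t ht n => HW (j, ⟨t, ht⟩, n)⟩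
  · -- the free evolution
    choose A hA hAe hAs using fun j => HC h s hh (f j)
    have hsl0 : ∀ t, slice hh hs hb (0 : Density h) t = 0 := fun t => lp.ext (funext fun n => by
      rw [slice_apply, map_zero]; rfl)
    refine ⟨fun j => (hA j).toLp (A j), ?_, fun i => ?_⟩
    · rw [pi_norm_le_iff_of_nonneg (by positivity)]
      intro j
      have h2 := norm_toLp_le_of_energy_le (hA j) (c := √C * sobolevNorm h s (f j))
        (mul_nonneg (Real.sqrt_nonneg _) (sobolevNorm_nonneg h s _))
        (by rw [mul_pow, Real.sq_sqrt hC]; exact hAe j)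
      refine h2.trans ?_
      have := hf j
      linarith
    · have hηi : η i.2.1.1 = 1 := hη _ (by linarith [i.2.1.2])
      have e1 : S i (fun j => (hA j).toLp (A j)) =
          realise hs hb i.2.1.1 i.2.2 ((hA i.1).toLp (A i.1)) := rfl
      rw [e1, realise_apply, syn_toLp, hAs i.1 _ hηi]
      simp only [Φ, Pi.zero_apply, hsl0, interNonlin, map_zero, nonlin_zero, pullback,
        intervalIntegral.integral_zero, lp.coeFn_zero, mul_zero, sub_zero]
  · -- the contraction
    intro W W' hW hW' hWr hWr'
    have hWj : ∀ j, IsRealOn hs hb T (W j) := fun j t ht n => hWr (j, ⟨t, ht⟩, n)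
    have hWj' : ∀ j, IsRealOn hs hb T (W' j) := fun j t ht n => hWr' (j, ⟨t, ht⟩, n)
    set δ := ‖W - W'‖ with hδ
    have hδ0 : 0 ≤ δ := norm_nonneg _
    have hd : ∀ j, ‖W j - W' j‖ ≤ δ := fun j => norm_le_pi_norm (W - W') j
    have hsum : ∀ j, ‖W j + W' j‖ ≤ 2 * ρm := fun j => by
      have h2 := norm_add_le (W j) (W' j)
      have h3 := norm_le_pi_norm W j
      have h4 := norm_le_pi_norm W' j
      linarith
    have hy : ∀ j t, |t| ≤ 2 * T → sobolevNorm h s (slice hh hs hb (W j) t) ≤ c * ρm :=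
      fun j t ht => (sobolevNorm_slice_le hh hs hb (hWj j t ht)).trans (by
        gcongr; exact (norm_le_pi_norm W j).trans (hW.trans hρρm))
    have hy' : ∀ j t, |t| ≤ 2 * T → sobolevNorm h s (slice hh hs hb (W' j) t) ≤ c * ρm :=
      fun j t ht => (sobolevNorm_slice_le hh hs hb (hWj' j t ht)).trans (by
        gcongr; exact (norm_le_pi_norm W' j).trans (hW'.trans hρρm))
    have hyd : ∀ j t, |t| ≤ 2 * T →
        sobolevNorm h s (slice hh hs hb (W j) t - slice hh hs hb (W' j) t : LatticeL2) ≤ c * δ :=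
      fun j t ht => by
        rw [← slice_sub]
        exact (sobolevNorm_slice_le hh hs hb (((hWj j).sub (hWj' j)) t ht)).trans (by
          gcongr; exact hd j)
    have key : ∀ j, ∃ D : Density h, ‖D‖ ≤ 1 / 2 * δ ∧
        RealisesPrimitive hs hb T (fun t => (-(sgn j / 4)) • (pullback hh (sgn j) t
          (interNonlin hh hF κ (sgn j) t (slice hh hs hb (W j) t) (slice hh hs hb (W (!j)) t)) -
          pullback hh (sgn j) t
          (interNonlin hh hF κ (sgn j) t (slice hh hs hb (W' j) t)
            (slice hh hs hb (W' (!j)) t)))) D := by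
      intro j
      have hj := sgn_eq j
      have one : (1 : ℝ) = 1 ∨ (1 : ℝ) = -1 := Or.inl rfl
      have neg : (-1 : ℝ) = 1 ∨ (-1 : ℝ) = -1 := Or.inr rfl
      -- densities for the five terms in `interNonlin_sub`
      obtain ⟨D₁, hD₁, hR₁⟩ := HCq T hT0 hT1 h hh (sgn j) 1 1 hj one one _ _
        ((hWj j).sub (hWj' j)) ((hWj j).add (hWj' j))
      obtain ⟨D₂, hD₂, hR₂⟩ := HCq T hT0 hT1 h hh (sgn j) 1 (-1) hj one neg _ _
        ((hWj j).sub (hWj' j)) ((hWj (!j)).add (hWj' (!j)))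
      obtain ⟨D₃, hD₃, hR₃⟩ := HCq T hT0 hT1 h hh (sgn j) (-1) 1 hj neg one _ _
        ((hWj (!j)).sub (hWj' (!j))) ((hWj j).add (hWj' j))
      obtain ⟨D₄, hD₄, hR₄⟩ := HCq T hT0 hT1 h hh (sgn j) (-1) (-1) hj neg neg _ _
        ((hWj (!j)).sub (hWj' (!j))) ((hWj (!j)).add (hWj' (!j)))
      have hrc : ∀ U : Bool → Density h, Continuous (fun t =>
          phaseFlow hh (sgn j) 0 (-t) (phaseFlow hh (sgn j) 1 t (slice hh hs hb (U j) t)) +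
            phaseFlow hh (sgn j) 0 t
              (phaseFlow hh (-sgn j) 1 t (slice hh hs hb (U (!j)) t))) := fun U =>
        (continuous_phaseFlow_apply hh _ _ continuous_neg
          (continuous_phaseFlow_apply hh _ _ continuous_id' (hcs _))).add
        (continuous_phaseFlow_apply hh _ _ continuous_id'
          (continuous_phaseFlow_apply hh _ _ continuous_id' (hcs _)))
      obtain ⟨D₅, hD₅, hR₅⟩ := HCf T hT0 hT1 h hh (fun t => pullback hh (sgn j) t
        (phaseFlow hh (sgn j) 0 t
        (compose hF (phaseFlow hh (sgn j) 0 (-t)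
              (phaseFlow hh (sgn j) 1 t (slice hh hs hb (W j) t)) +
            phaseFlow hh (sgn j) 0 t (phaseFlow hh (-sgn j) 1 t (slice hh hs hb (W (!j)) t))) -
          compose hF (phaseFlow hh (sgn j) 0 (-t)
              (phaseFlow hh (sgn j) 1 t (slice hh hs hb (W' j) t)) +
            phaseFlow hh (sgn j) 0 t
              (phaseFlow hh (-sgn j) 1 t (slice hh hs hb (W' (!j)) t))))))
        (continuous_pullback hh _ (continuous_phaseFlow_apply hh _ _ continuous_id'
          (((continuous_compose hF).comp (hrc W)).sub ((continuous_compose hF).comp (hrc W')))))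
        (4 * Cr * c * δ) (by positivity) (fun t ht => by
          refine (sobolevNorm_pullback_le hh s _ t _).trans ?_
          rw [sobolevNorm_phaseFlow]
          have hb1 : ∀ y z : LatticeL2, sobolevNorm h s
              (phaseFlow hh (sgn j) 0 (-t) (phaseFlow hh (sgn j) 1 t y) +
                phaseFlow hh (sgn j) 0 t (phaseFlow hh (-sgn j) 1 t z) : LatticeL2) ≤
              sobolevNorm h s y + sobolevNorm h s z := fun y z => by
            refine (sobolevNorm_add_le hh s _ _).trans (le_of_eq ?_)
            simp only [sobolevNorm_phaseFlow]
          have h2 := HCr h hh h1 _ _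
            ((hb1 (slice hh hs hb (W j) t) (slice hh hs hb (W (!j)) t)).trans
              (by linarith [hy j t ht, hy (!j) t ht]))
            ((hb1 (slice hh hs hb (W' j) t) (slice hh hs hb (W' (!j)) t)).trans
              (by linarith [hy' j t ht, hy' (!j) t ht]))
          rw [add_sub_add_comm, ← map_sub, ← map_sub, ← map_sub, ← map_sub] at h2
          have h3 := hb1 (slice hh hs hb (W j) t - slice hh hs hb (W' j) t)
            (slice hh hs hb (W (!j)) t - slice hh hs hb (W' (!j)) t)
          have h4 := hyd j t ht
          have h5 := hyd (!j) t ht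
          calc _ ≤ 2 / h * (Cr * h * (c * δ + c * δ)) := by
                refine mul_le_mul_of_nonneg_left (h2.trans ?_) (by positivity)
                refine mul_le_mul_of_nonneg_left (h3.trans ?_) (by positivity)
                exact add_le_add h4 h5
            _ = _ := by field_simp; ring)
      refine ⟨(-(sgn j / 4)) • (D₁ + κ • D₂ + κ • D₃ + κ ^ 2 • D₄ + κ • D₅), ?_, ?_⟩
      · have hq : ∀ {X : Density h} (i i' : Bool),
            ‖X‖ ≤ Cq * T ^ (1 / 16 : ℝ) * (‖W i - W' i‖ * ‖W i' + W' i'‖) →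
            ‖X‖ ≤ Cq * τ * (δ * (2 * ρm)) := fun i i' hX => by
          rw [hT16] at hX
          refine hX.trans ?_
          have := hd i
          have := hsum i'
          gcongr
        have h5 := hD₅
        rw [hT16] at h5
        have hκs : ∀ X : Density h, ‖κ • X‖ ≤ ‖X‖ := fun X => by
          rw [norm_smul, Real.norm_eq_abs]
          exact mul_le_of_le_one_left (norm_nonneg _) hκ
        have hκs2 : ∀ X : Density h, ‖κ ^ 2 • X‖ ≤ ‖X‖ := fun X => by
          rw [pow_two, mul_smul]
          exact (hκs _).trans (hκs _)
        have htri : ‖D₁ + κ • D₂ + κ • D₃ + κ ^ 2 • D₄ + κ • D₅‖ ≤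
            ‖D₁‖ + ‖D₂‖ + ‖D₃‖ + ‖D₄‖ + ‖D₅‖ := by
          refine (norm_add_le _ _).trans (add_le_add ?_ (hκs _))
          refine (norm_add_le _ _).trans (add_le_add ?_ (hκs2 _))
          refine (norm_add_le _ _).trans (add_le_add ?_ (hκs _))
          exact (norm_add_le _ _).trans (add_le_add le_rfl (hκs _))
        rw [norm_smul, norm_neg, Real.norm_eq_abs, abs_div, abs_sgn,
          abs_of_pos (by norm_num : (0 : ℝ) < 4)]
        have hall := add_le_add (add_le_add (add_le_add (add_le_add (hq j j hD₁) (hq j (!j) hD₂))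
          (hq (!j) j hD₃)) (hq (!j) (!j) hD₄)) h5
        calc _ ≤ 1 / 4 * (Cq * τ * (δ * (2 * ρm)) + Cq * τ * (δ * (2 * ρm)) +
              Cq * τ * (δ * (2 * ρm)) + Cq * τ * (δ * (2 * ρm)) + Cf * τ * (4 * Cr * c * δ)) := by
              gcongr; exact htri.trans hall
          _ = τ * B * δ := by rw [hB]; ring
          _ ≤ _ := by gcongr
      · have hR := (((((hR₁.add (hR₂.smul κ)).add (hR₃.smul κ)).add (hR₄.smul (κ ^ 2))).add
          (hR₅.smul κ)).smul (-(sgn j / 4)))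
        convert hR using 3 with t
        rw [← pullback_sub, interNonlin_sub]
        simp only [pullback_add, pullback_smul, slice_sub, slice_add]
    choose D hD hR using key
    refine ⟨D, ?_, fun i => ?_⟩
    · rw [pi_norm_le_iff_of_nonneg (by positivity)]
      exact hD
    · have e1 : S i D = realise hs hb i.2.1.1 i.2.2 (D i.1) := rfl
      rw [e1, (hR i.1).realise_eq _ i.2.1.2, intervalIntegral.integral_smul,
        intervalIntegral.integral_sub ((hNc W i.1).intervalIntegrable _ _)
          ((hNc W' i.1).intervalIntegrable _ _), lp.coeFn_smul, lp.coeFn_sub, Pi.smul_apply,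
        Pi.sub_apply, smul_eq_mul]
      congr 1
      simp only [Φ]
      ring

/-! ### The Duhamel formula in the interaction picture -/

theorem propagator_eq {h : ℝ} (hh : 0 < h) (σ t : ℝ) (f : LatticeL2) :
    propagator h σ t f = phaseFlow hh σ 1 t f := by
  change multiplier h _ _ = multiplier h _ _
  congr 1
  funext ξ
  rw [waveSymbol_apply, phase]
  congr 1
  have : (h : ℂ) ≠ 0 := by exact_mod_cast hh.ne'
  push_cast
  field_simp
  ring

theorem expPartial_eq {h : ℝ} (hh : 0 < h) {a σ t : ℝ} (ha : a = σ * t / h ^ 2) (f : LatticeL2) :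
    expPartial h a f = phaseFlow hh σ 0 t f := by
  change multiplier h _ _ = multiplier h _ _
  congr 1
  funext ξ
  rw [waveSymbol_apply, phase, ha]
  congr 3
  ring

theorem nabla_eq {h : ℝ} (hh : 0 < h) (f : LatticeL2) :
    nabla h f = mulCLM hh (nablaSymbol h) f := rfl

theorem coupledNonlinearity_eq {h : ℝ} (hh : 0 < h) {V : ℝ → ℝ}
    (hF : IsLocLip (fun r => h ^ 2 * remainder h V r)) (σ t : ℝ) (u w : LatticeL2) :
    coupledNonlinearity h V σ t u w = nonlin hh hF 1 σ t u w := by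
  funext n
  have e1 : expPartial h (2 * σ * t / h ^ 2) w = phaseFlow hh σ 0 (2 * t) w :=
    expPartial_eq hh (by ring) w
  have e2 : expPartial h (σ * t / h ^ 2) w = phaseFlow hh σ 0 t w := expPartial_eq hh rfl w
  have e3 : expPartial h (-(σ * t / h ^ 2)) u = phaseFlow hh σ 0 (-t) u :=
    expPartial_eq hh (by ring) u
  set r := phaseFlow hh σ 0 (-t) u + phaseFlow hh σ 0 t w with hr
  have e4 : (fun k => remainder h V
      (expPartial h (-(σ * t / h ^ 2)) u k + expPartial h (σ * t / h ^ 2) w k)) =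
      ((h ^ 2)⁻¹ • compose hF r : LatticeL2) := by
    funext k
    rw [lp.coeFn_smul, Pi.smul_apply, compose_apply, smul_eq_mul, e2, e3, hr, lp.coeFn_add,
      Pi.add_apply]
    field_simp
  rw [coupledNonlinearity, e1, e4, expPartial_eq hh rfl, map_smul, nonlin, one_smul, one_smul]
  rw [lp.coeFn_add, Pi.add_apply, latMul_apply, lp.coeFn_add, Pi.add_apply, lp.coeFn_smul,
    Pi.smul_apply, smul_eq_mul, ← hr]
  field_simp

theorem phaseFlow_neg_cancel {h : ℝ} (hh : 0 < h) (σ ε t : ℝ) (f : LatticeL2) :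
    phaseFlow hh σ ε (-t) (phaseFlow hh σ ε t f) = f := by
  rw [phaseFlow, phaseFlow, flow_flow, neg_add_cancel, flow_zero]

theorem phaseFlow_cancel_neg {h : ℝ} (hh : 0 < h) (σ ε t : ℝ) (f : LatticeL2) :
    phaseFlow hh σ ε t (phaseFlow hh σ ε (-t) f) = f := by
  rw [phaseFlow, phaseFlow, flow_flow, add_neg_cancel, flow_zero]

/-- The Duhamel formula, evaluated at each lattice point, as an equation in `L²`. -/
theorem duhamel_iff {h : ℝ} (hh : 0 < h) {σ τ : ℝ} {f : LatticeL2} {N : ℝ → LatticeL2}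
    (hN : Continuous N) {N' : ℝ → ℤ → ℝ} (hNN : ∀ t ∈ Icc (-τ) τ, N' t = N t)
    {u : ℝ → LatticeL2} :
    Duhamel h σ τ f N' u ↔ ∀ t ∈ Icc (-τ) τ,
      u t = phaseFlow hh σ 1 t (f - (σ / 4) • ∫ t₁ in (0 : ℝ)..t, pullback hh σ t₁ (N t₁)) := by
  refine forall₂_congr fun t ht => ?_
  have key : ∀ n, ∫ t₁ in (0 : ℝ)..t, propagator h σ (t - t₁) (nabla h (N' t₁)) n =
      phaseFlow hh σ 1 t (∫ t₁ in (0 : ℝ)..t, pullback hh σ t₁ (N t₁)) n := fun n => by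
    have hc := (continuous_pullback hh σ hN).intervalIntegrable (μ := volume) 0 t
    have h1 := (evalAt n ∘L phaseFlow hh σ 1 t).intervalIntegral_comp_comm hc
    simp only [ContinuousLinearMap.comp_apply, evalAt_apply] at h1
    rw [← h1]
    refine intervalIntegral.integral_congr fun t₁ ht₁ => ?_
    have ht₁' : t₁ ∈ Icc (-τ) τ := by
      have h2 := abs_sub_left_of_mem_uIcc ht₁
      simp only [sub_zero] at h2
      exact abs_le.1 (h2.trans (abs_le.2 ht))
    rw [hNN t₁ ht₁', nabla_eq hh, propagator_eq hh, pullback, phaseFlow, phaseFlow, phaseFlow,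
      flow_flow, sub_eq_add_neg]
  constructor
  · intro H
    refine lp.ext (funext fun n => ?_)
    rw [H n, key, propagator_eq hh, map_sub, map_smul, lp.coeFn_sub, Pi.sub_apply, lp.coeFn_smul,
      Pi.smul_apply, smul_eq_mul]
  · intro H n
    rw [H, key, propagator_eq hh, map_sub, map_smul, lp.coeFn_sub, Pi.sub_apply, lp.coeFn_smul,
      Pi.smul_apply, smul_eq_mul]

/-- The pair `u` of functions, indexed by the sign, solves the system with the coupling constant
`κ`. -/
def IsPairSolution {h : ℝ} (hh : 0 < h) {F : ℝ → ℝ} (hF : IsLocLip F) (κ τ : ℝ)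
    (f : Bool → LatticeL2) (u : Bool → ℝ → LatticeL2) : Prop :=
  ∀ j, ContinuousOn (u j) (Icc (-τ) τ) ∧
    Duhamel h (sgn j) τ (f j) (fun t => nonlin hh hF κ (sgn j) t (u j t) (u (!j) t)) (u j)

theorem isCoupledSolution_iff {h : ℝ} (hh : 0 < h) {V : ℝ → ℝ}
    (hF : IsLocLip (fun r => h ^ 2 * remainder h V r)) {τ : ℝ} {f : Bool → LatticeL2}
    {u : Bool → ℝ → LatticeL2} :
    IsCoupledSolution h V τ (f true) (f false) (u true) (u false) ↔
      IsPairSolution hh hF 1 τ f u := by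
  simp only [IsPairSolution, Bool.forall_bool, IsCoupledSolution, coupledNonlinearity_eq hh hF, sgn,
    Bool.not_true, Bool.not_false, if_true, Bool.false_eq_true, if_false]
  tauto

theorem isDecoupledSolution_iff {h : ℝ} (hh : 0 < h) {F : ℝ → ℝ} (hF : IsLocLip F) {τ : ℝ}
    {f : Bool → LatticeL2} {u : Bool → ℝ → LatticeL2} :
    (∀ j, IsDecoupledSolution h (sgn j) τ (f j) (u j)) ↔ IsPairSolution hh hF 0 τ f u := by
  refine forall_congr' fun j => and_congr_right fun _ => ?_
  have e : (fun t => ((nonlin hh hF 0 (sgn j) t (u j t) (u (!j) t) : LatticeL2) : ℤ → ℝ)) =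
      fun t n => u j t n ^ 2 := by
    funext t n
    rw [nonlin, zero_smul, zero_smul, add_zero, add_zero, latMul_apply, pow_two]
  rw [e]

/-! ### Uniqueness -/

theorem norm_pullback_sub_le {h : ℝ} (hh : 0 < h) (σ t : ℝ) (f g : LatticeL2) :
    ‖pullback hh σ t f - pullback hh σ t g‖ ≤ 2 / h * ‖f - g‖ := by
  rw [← pullback_sub, pullback, norm_phaseFlow, mulCLM_apply]
  exact mulLin_norm_le hh _ (by positivity) (fun ξ _ => norm_nablaSymbol_le hh ξ) _

theorem exists_norm_interNonlin_sub_le {h : ℝ} (hh : 0 < h) {F : ℝ → ℝ} (hF : IsLocLip F)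
    {κ : ℝ} (hκ : |κ| ≤ 1) (M : ℝ) :
    ∃ L : ℝ, 0 ≤ L ∧ ∀ (σ t δ : ℝ) (y z y' z' : LatticeL2), ‖y‖ ≤ M → ‖z‖ ≤ M → ‖y'‖ ≤ M →
      ‖z'‖ ≤ M → ‖y - y'‖ ≤ δ → ‖z - z'‖ ≤ δ →
      ‖interNonlin hh hF κ σ t y z - interNonlin hh hF κ σ t y' z'‖ ≤ L * δ := by
  obtain ⟨L, hL, H⟩ := exists_norm_compose_sub_le hF (M + M)
  refine ⟨8 * |M| + 2 * L, by positivity, ?_⟩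
  intro σ t δ y z y' z' hy hz hy' hz' hyd hzd
  have hδ : 0 ≤ δ := (norm_nonneg _).trans hyd
  have hM : 0 ≤ M := (norm_nonneg _).trans hy
  have hκs : ∀ X : LatticeL2, ‖κ • X‖ ≤ ‖X‖ := fun X => by
    rw [norm_smul, Real.norm_eq_abs]
    exact mul_le_of_le_one_left (norm_nonneg _) hκ
  have hκs2 : ∀ X : LatticeL2, ‖κ ^ 2 • X‖ ≤ ‖X‖ := fun X => by
    rw [pow_two, mul_smul]
    exact (hκs _).trans (hκs _)
  have hq : ∀ (ε ε' : ℝ) (a b : LatticeL2), ‖a‖ ≤ δ → ‖b‖ ≤ M + M →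
      ‖latMul (phaseFlow hh σ ε t a) (phaseFlow hh σ ε' t b)‖ ≤ δ * (M + M) :=
    fun ε ε' a b ha hb => by
      refine (norm_latMul_le _ _).trans ?_
      rw [norm_phaseFlow, norm_phaseFlow]
      gcongr
  have hys : ‖y + y'‖ ≤ M + M := (norm_add_le _ _).trans (add_le_add hy hy')
  have hzs : ‖z + z'‖ ≤ M + M := (norm_add_le _ _).trans (add_le_add hz hz')
  have hr : ∀ a b : LatticeL2, ‖phaseFlow hh σ 0 (-t) (phaseFlow hh σ 1 t a) +
      phaseFlow hh σ 0 t (phaseFlow hh (-σ) 1 t b)‖ ≤ ‖a‖ + ‖b‖ := fun a b => by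
    refine (norm_add_le _ _).trans (le_of_eq ?_)
    simp only [norm_phaseFlow]
  have hR := H _ _ ((hr y z).trans (add_le_add hy hz)) ((hr y' z').trans (add_le_add hy' hz'))
  rw [add_sub_add_comm, ← map_sub, ← map_sub, ← map_sub, ← map_sub] at hR
  have hR' := hR.trans (mul_le_mul_of_nonneg_left
    ((hr (y - y') (z - z')).trans (add_le_add hyd hzd)) hL)
  rw [interNonlin_sub]
  calc _ ≤ δ * (M + M) + δ * (M + M) + δ * (M + M) + δ * (M + M) + L * (δ + δ) := by
        refine (norm_add_le _ _).trans (add_le_add ?_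
          ((hκs _).trans ((norm_phaseFlow hh _ _ _ _).le.trans hR')))
        refine (norm_add_le _ _).trans (add_le_add ?_ ((hκs2 _).trans (hq _ _ _ _ hzd hzs)))
        refine (norm_add_le _ _).trans (add_le_add ?_ ((hκs _).trans (hq _ _ _ _ hzd hys)))
        exact (norm_add_le _ _).trans (add_le_add (hq _ _ _ _ hyd hys)
          ((hκs _).trans (hq _ _ _ _ hyd hzs)))
    _ = _ := by rw [abs_of_nonneg hM]; ring

/-- Solutions of the integral equations in the interaction picture are unique: for fixed `h` the
equations are ordinary differential equations in `L²` with a locally Lipschitz vector field. -/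
theorem interaction_unique {h : ℝ} (hh : 0 < h) {F : ℝ → ℝ} (hF : IsLocLip F)
    {κ : ℝ} (hκ : |κ| ≤ 1) {τ : ℝ} (hτ : 0 < τ) {f : Bool → LatticeL2}
    {y y' : ℝ → Bool → LatticeL2} (hy : Continuous y) (hy' : Continuous y')
    (H : ∀ t ∈ Icc (-τ) τ, ∀ j, y t j = f j - (sgn j / 4) • ∫ t₁ in (0 : ℝ)..t,
      pullback hh (sgn j) t₁ (interNonlin hh hF κ (sgn j) t₁ (y t₁ j) (y t₁ (!j))))
    (H' : ∀ t ∈ Icc (-τ) τ, ∀ j, y' t j = f j - (sgn j / 4) • ∫ t₁ in (0 : ℝ)..t,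
      pullback hh (sgn j) t₁ (interNonlin hh hF κ (sgn j) t₁ (y' t₁ j) (y' t₁ (!j)))) :
    EqOn y y' (Icc (-τ) τ) := by
  obtain ⟨M₁, hM₁⟩ := (isCompact_Icc (a := -τ) (b := τ)).exists_bound_of_continuousOn
    hy.continuousOn
  obtain ⟨M₂, hM₂⟩ := (isCompact_Icc (a := -τ) (b := τ)).exists_bound_of_continuousOn
    hy'.continuousOn
  set M := max M₁ M₂
  obtain ⟨L, hL, HL⟩ := exists_norm_interNonlin_sub_le hh hF hκ M
  let v : ℝ → (Bool → LatticeL2) → Bool → LatticeL2 := fun t x j =>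
    -((sgn j / 4) • pullback hh (sgn j) t (interNonlin hh hF κ (sgn j) t (x j) (x (!j))))
  have hv : ∀ t, LipschitzOnWith (Real.toNNReal (1 / 4 * (2 / h * L))) (v t)
      (Metric.closedBall 0 M) := fun t => by
    refine LipschitzOnWith.of_dist_le_mul fun x hx x' hx' => ?_
    rw [mem_closedBall_zero_iff] at hx hx'
    rw [Real.coe_toNNReal _ (by positivity), dist_eq_norm, dist_eq_norm,
      pi_norm_le_iff_of_nonneg (by positivity)]
    intro j
    rw [Pi.sub_apply]
    simp only [v]
    rw [← neg_sub_neg, neg_neg, neg_neg, ← smul_sub, norm_smul, Real.norm_eq_abs, abs_div, abs_sgn,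
      abs_of_pos (by norm_num : (0 : ℝ) < 4), mul_assoc, mul_assoc]
    refine mul_le_mul_of_nonneg_left ?_ (by norm_num)
    refine (norm_pullback_sub_le hh _ _ _ _).trans (mul_le_mul_of_nonneg_left ?_ (by positivity))
    rw [norm_sub_rev x x']
    exact HL _ _ _ _ _ _ _ ((norm_le_pi_norm x' _).trans hx') ((norm_le_pi_norm x' _).trans hx')
      ((norm_le_pi_norm x _).trans hx) ((norm_le_pi_norm x _).trans hx)
      (norm_le_pi_norm (x' - x) j) (norm_le_pi_norm (x' - x) (!j))
  have hder : ∀ {x : ℝ → Bool → LatticeL2}, Continuous x →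
      (∀ t ∈ Icc (-τ) τ, ∀ j, x t j = f j - (sgn j / 4) • ∫ t₁ in (0 : ℝ)..t,
        pullback hh (sgn j) t₁ (interNonlin hh hF κ (sgn j) t₁ (x t₁ j) (x t₁ (!j)))) →
      ∀ t ∈ Ioo (-τ) τ, HasDerivAt x (v t (x t)) t := by
    intro x hx Hx t ht
    rw [hasDerivAt_pi]
    intro j
    have hxj : ∀ j, Continuous fun t => x t j := fun j => (continuous_apply j).comp hx
    have hc : Continuous (fun t₁ => pullback hh (sgn j) t₁
        (interNonlin hh hF κ (sgn j) t₁ (x t₁ j) (x t₁ (!j)))) :=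
      continuous_pullback hh _ (continuous_nonlin hh hF κ _
        (continuous_phaseFlow_apply hh _ _ continuous_id' (hxj j))
        (continuous_phaseFlow_apply hh _ _ continuous_id' (hxj (!j))))
    have h1 := ((hc.integral_hasStrictDerivAt 0 t).hasDerivAt.const_smul (sgn j / 4)).const_sub
      (f j)
    refine h1.congr_of_eventuallyEq ?_
    filter_upwards [Ioo_mem_nhds ht.1 ht.2] with t' ht'
    exact Hx t' (Ioo_subset_Icc_self ht') j
  have h0 : (0 : ℝ) ∈ Ioo (-τ) τ := ⟨by linarith, hτ⟩
  refine ODE_solution_unique_of_mem_Icc (fun t _ => hv t) h0 hy.continuousOn (hder hy H) ?_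
    hy'.continuousOn (hder hy' H') ?_ ?_
  · exact fun t ht => mem_closedBall_zero_iff.2
      ((hM₁ t (Ioo_subset_Icc_self ht)).trans (le_max_left _ _))
  · exact fun t ht => mem_closedBall_zero_iff.2
      ((hM₂ t (Ioo_subset_Icc_self ht)).trans (le_max_right _ _))
  · funext j
    rw [H 0 (Ioo_subset_Icc_self h0), H' 0 (Ioo_subset_Icc_self h0), intervalIntegral.integral_same,
      intervalIntegral.integral_same]

/-- A function on an interval, extended by its boundary values. -/
def extend {E : Type*} (τ : ℝ) (u : ℝ → E) (t : ℝ) : E := u (max (-τ) (min τ t))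

theorem extend_eq {E : Type*} {τ t : ℝ} (u : ℝ → E) (ht : t ∈ Icc (-τ) τ) : extend τ u t = u t := by
  rw [extend, min_eq_right ht.2, max_eq_right ht.1]

theorem continuous_extend {E : Type*} [TopologicalSpace E] {τ : ℝ} (hτ : 0 ≤ τ) {u : ℝ → E}
    (hu : ContinuousOn u (Icc (-τ) τ)) : Continuous (extend τ u) :=
  hu.comp_continuous (by fun_prop) fun t =>
    ⟨le_max_left _ _, max_le (by linarith) (min_le_left _ _)⟩

/-- A solution is given only for `|t| ≤ τ`; it is extended by constants in order to have continuous
functions on the line. -/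
theorem IsPairSolution.unique {h : ℝ} {hh : 0 < h} {F : ℝ → ℝ} {hF : IsLocLip F}
    {κ : ℝ} (hκ : |κ| ≤ 1) {τ : ℝ} (hτ : 0 < τ) {f : Bool → LatticeL2}
    {u w : Bool → ℝ → LatticeL2} (hu : IsPairSolution hh hF κ τ f u)
    (hw : IsPairSolution hh hF κ τ f w) {t : ℝ} (ht : t ∈ Icc (-τ) τ) (j : Bool) : u j t = w j t := by
  have hinter : ∀ {x : Bool → ℝ → LatticeL2}, IsPairSolution hh hF κ τ f x →
      Continuous (fun t j => phaseFlow hh (sgn j) 1 (-t) (extend τ (x j) t)) ∧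
      ∀ t ∈ Icc (-τ) τ, ∀ j, phaseFlow hh (sgn j) 1 (-t) (extend τ (x j) t) =
        f j - (sgn j / 4) • ∫ t₁ in (0 : ℝ)..t, pullback hh (sgn j) t₁
          (interNonlin hh hF κ (sgn j) t₁ (phaseFlow hh (sgn j) 1 (-t₁) (extend τ (x j) t₁))
            (phaseFlow hh (sgn (!j)) 1 (-t₁) (extend τ (x (!j)) t₁))) := by
    intro x hx
    have hc : ∀ j, Continuous (extend τ (x j)) := fun j => continuous_extend hτ.le (hx j).1
    refine ⟨continuous_pi fun j => continuous_phaseFlow_apply hh _ _ continuous_neg (hc j),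
      fun t ht j => ?_⟩
    have h1 := (duhamel_iff hh (N := fun t => nonlin hh hF κ (sgn j) t (extend τ (x j) t)
      (extend τ (x (!j)) t)) (continuous_nonlin hh hF κ _ (hc j) (hc (!j)))
      (fun t ht => by rw [extend_eq _ ht, extend_eq _ ht])).1 (hx j).2 t ht
    rw [extend_eq _ ht, h1, phaseFlow_neg_cancel]
    simp only [interNonlin, sgn_not, phaseFlow_cancel_neg]
  have h1 := interaction_unique hh hF hκ hτ (hinter hu).1 (hinter hw).1 (hinter hu).2 (hinter hw).2
    ht
  have h2 := congrArg (phaseFlow hh (sgn j) 1 t) (congrFun h1 j)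
  simp only [phaseFlow_cancel_neg, extend_eq _ ht] at h2
  exact h2

/-- A solution of the integral equation for the densities gives a solution of the system. -/
theorem isPairSolution_of_realise {h s b : ℝ} {hh : 0 < h} {hs : 0 ≤ s} {hb : 1 / 2 < b}
    {F : ℝ → ℝ} {hF : IsLocLip F} {κ T : ℝ} {f : Bool → LatticeL2} {W : Bool → Density h}
    (HW : ∀ (j : Bool) (t : ℝ), |t| ≤ 2 * T → ∀ n,
      realise hs hb t n (W j) = ((f j n - sgn j / 4 *
        (∫ t₁ in (0 : ℝ)..t, pullback hh (sgn j) t₁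
          (interNonlin hh hF κ (sgn j) t₁
            (slice hh hs hb (W j) t₁) (slice hh hs hb (W (!j)) t₁))) n : ℝ) : ℂ)) :
    IsPairSolution hh hF κ (2 * T) f
      (fun j t => phaseFlow hh (sgn j) 1 t (slice hh hs hb (W j) t)) := by
  intro j
  have hc : ∀ j, Continuous (fun t => phaseFlow hh (sgn j) 1 t (slice hh hs hb (W j) t)) :=
    fun j => continuous_phaseFlow_apply hh _ _ continuous_id' (continuous_slice hh hs hb _)
  refine ⟨(hc j).continuousOn, ?_⟩
  refine (duhamel_iff hh (N := fun t => nonlin hh hF κ (sgn j) t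
    (phaseFlow hh (sgn j) 1 t (slice hh hs hb (W j) t))
    (phaseFlow hh (sgn (!j)) 1 t (slice hh hs hb (W (!j)) t)))
    (continuous_nonlin hh hF κ (sgn j) (hc j) (hc (!j))) (fun _ _ => rfl)).2 fun t ht => ?_
  refine congrArg (phaseFlow hh (sgn j) 1 t) (lp.ext (funext fun n => ?_))
  have h1 := congrArg Complex.re (HW j t (abs_le.2 ht) n)
  rw [Complex.ofReal_re] at h1
  simp only [interNonlin, ← sgn_not] at h1
  rw [slice_apply, h1, lp.coeFn_sub, Pi.sub_apply, lp.coeFn_smul, Pi.smul_apply, smul_eq_mul]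

/-! ### The norms of the solutions in the Bourgain spaces -/

theorem IsCutoffTransform.integral_comp_div {η : ℝ → ℝ} {ψ : ℝ → ℂ} (hψ : IsCutoffTransform η ψ)
    {T : ℝ} (hT : 0 < T) (x : ℝ) :
    ∫ t : ℝ, Complex.exp (-Complex.I * ((t * x : ℝ) : ℂ)) * (η (t / T) : ℂ) =
      2 * π * T * ψ (T * x) := by
  have h1 := Measure.integral_comp_div
    (fun t : ℝ => Complex.exp (-Complex.I * ((t * (T * x) : ℝ) : ℂ)) * (η t : ℂ)) T
  rw [hψ.analysis, abs_of_pos hT, Complex.real_smul] at h1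
  calc _ = ∫ t : ℝ, Complex.exp (-Complex.I * ((t / T * (T * x) : ℝ) : ℂ)) * (η (t / T) : ℂ) := by
        refine integral_congr_ae (Eventually.of_forall fun t => ?_)
        have : t / T * (T * x) = t * x := by field_simp
        simp only [this]
    _ = _ := by rw [h1]; ring

/-- The density of a function cut off in time, at the frequency `τ₀` of the cutoff function. -/
def cutDensity (ψ : ℝ → ℂ) (T : ℝ) (φ : ℝ → ℝ) (A : ℝ × ℝ → ℂ) (τ₀ : ℝ) (p : ℝ × ℝ) : ℂ :=
  2 * π * T * ψ (T * (τ₀ - φ p.1 - p.2)) * A p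

theorem memLp_cutDensity {η : ℝ → ℝ} {ψ : ℝ → ℂ} (hψ : IsCutoffTransform η ψ) {h T : ℝ}
    {φ : ℝ → ℝ} (hφ : Measurable φ) {A : ℝ × ℝ → ℂ} (hA : MemLp A 2 (specMeasure h)) (τ₀ : ℝ) :
    MemLp (cutDensity ψ T φ A τ₀) 2 (specMeasure h) := by
  obtain ⟨C, hC, HC⟩ := hψ.decay
  have hψm : Measurable ψ := hψ.contDiff.continuous.measurable
  refine hA.of_le_mul (c := ‖(2 * π * T : ℂ)‖ * C) ?_ (Eventually.of_forall fun p => ?_)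
  · exact (by fun_prop : Measurable fun p : ℝ × ℝ =>
      2 * π * T * ψ (T * (τ₀ - φ p.1 - p.2))).aestronglyMeasurable.mul hA.1
  · rw [cutDensity, norm_mul, norm_mul]
    gcongr
    refine (HC _).1.trans (mul_le_of_le_one_right hC ?_)
    exact Real.rpow_le_one_of_one_le_of_nonpos (one_le_bracket _) (by norm_num)

/-- The time transform at `τ₀` of a realised function with a cutoff, as a superposition of waves in
space. -/
theorem integral_cutoff_mul_syn {η : ℝ → ℝ} {ψ : ℝ → ℂ} (hψ : IsCutoffTransform η ψ)
    (hη : Integrable η) {h s b T : ℝ} (hs : 0 ≤ s) (hb : 1 / 2 < b) (hT : 0 < T) {φ : ℝ → ℝ}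
    (hφ : Measurable φ) {A : ℝ × ℝ → ℂ} (hA : MemLp A 2 (specMeasure h)) (τ₀ : ℝ) (n : ℤ) :
    ∫ t : ℝ, Complex.exp (-Complex.I * ((t * τ₀ : ℝ) : ℂ)) *
        ((η (t / T) : ℂ) * syn h φ (fun p => invWeight s b p * A p) t n) =
      syn h (fun _ => 0) (fun p => invWeight s b p * cutDensity ψ T φ A τ₀ p) 0 n := by
  set W : ℝ × ℝ → ℂ := fun p => invWeight s b p * A p with hW
  have hWi : Integrable W (specMeasure h) := integrable_invWeight_mul hs hb hA
  have hηT : Integrable (fun t => (η (t / T) : ℂ)) := (hη.comp_div hT.ne').ofReal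
  have hint : Integrable (fun q : ℝ × (ℝ × ℝ) =>
      (Complex.exp (-Complex.I * ((q.1 * τ₀ : ℝ) : ℂ)) * planeWave h φ q.1 n q.2) *
        ((η (q.1 / T) : ℂ) * W q.2)) (volume.prod (specMeasure h)) := by
    refine (hηT.mul_prod hWi).bdd_mul (c := 1) ?_ (Eventually.of_forall fun q => ?_)
    · unfold planeWave
      exact (by fun_prop : Measurable _).aestronglyMeasurable
    · rw [norm_mul, norm_planeWave, mul_one, neg_mul, ← mul_neg, ← Complex.ofReal_neg, mul_comm,
        Complex.norm_exp_ofReal_mul_I]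
  calc _ = ∫ t : ℝ, ((1 / (2 * π) : ℝ) : ℂ) * ∫ p,
        (Complex.exp (-Complex.I * ((t * τ₀ : ℝ) : ℂ)) * planeWave h φ t n p) *
        ((η (t / T) : ℂ) * W p) ∂specMeasure h := by
        refine integral_congr_ae (Eventually.of_forall fun t => ?_)
        simp only [syn]
        rw [← mul_assoc, mul_left_comm, ← integral_const_mul]
        congr 1
        refine integral_congr_ae (Eventually.of_forall fun p => ?_)
        simp only
        ring
    _ = _ := by
        rw [integral_const_mul, integral_integral_swap hint, syn]
        congr 1
        refine integral_congr_ae (Eventually.of_forall fun p => ?_)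
        simp only
        have h1 := hψ.integral_comp_div hT (τ₀ - φ p.1 - p.2)
        calc _ = ∫ t : ℝ, (planeWave h (fun _ => 0) 0 n p * W p) *
              (Complex.exp (-Complex.I * ((t * (τ₀ - φ p.1 - p.2) : ℝ) : ℂ)) * (η (t / T) : ℂ)) := by
              refine integral_congr_ae (Eventually.of_forall fun t => ?_)
              simp only [planeWave]
              have e : Complex.exp (-Complex.I * ((t * τ₀ : ℝ) : ℂ)) *
                  Complex.exp (Complex.I * ((t * (p.2 + φ p.1) + h * n * p.1 : ℝ) : ℂ)) =
                  Complex.exp (Complex.I * ((0 * (p.2 + 0) + h * n * p.1 : ℝ) : ℂ)) *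
                  Complex.exp (-Complex.I * ((t * (τ₀ - φ p.1 - p.2) : ℝ) : ℂ)) := by
                rw [← Complex.exp_add, ← Complex.exp_add]
                congr 1; push_cast; ring
              rw [e]; ring
          _ = _ := by
              rw [integral_const_mul, h1, cutDensity, hW]
              ring

/-- The kernel `⟨y⟩^b T |ψ(T y)|` of the cutoff is integrable. -/
theorem exists_cutoff_kernel_bound {η : ℝ → ℝ} {ψ : ℝ → ℂ} (hψ : IsCutoffTransform η ψ) {b T : ℝ}
    (hb : b ≤ 1) (hT : 0 < T) (hT1 : T ≤ 1) :
    ∃ c : ℝ, 0 ≤ c ∧ ∀ y : ℝ,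
      bracket y ^ b * ‖2 * π * T * ψ (T * y)‖ ≤ c * bracket y ^ (-2 : ℝ) := by
  obtain ⟨C, hC, HC⟩ := hψ.decay
  refine ⟨2 * π * T * (C * T ^ (-4 : ℝ)), by positivity, fun y => ?_⟩
  have hy := bracket_pos y
  have h1 : T * bracket y ≤ bracket (T * y) := by
    refine le_of_sq_le_sq ?_ (bracket_pos _).le
    rw [mul_pow, bracket_sq, bracket_sq]
    nlinarith
  have h2 : bracket (T * y) ^ (-4 : ℝ) ≤ T ^ (-4 : ℝ) * bracket y ^ (-4 : ℝ) := by
    rw [← Real.mul_rpow hT.le hy.le]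
    exact Real.rpow_le_rpow_of_nonpos (by positivity) h1 (by norm_num)
  have h3 : ‖(2 * π * T * ψ (T * y) : ℂ)‖ ≤
      2 * π * T * (C * (T ^ (-4 : ℝ) * bracket y ^ (-4 : ℝ))) := by
    rw [norm_mul, norm_mul, norm_mul, Complex.norm_real, Complex.norm_real, Complex.norm_two,
      Real.norm_eq_abs, Real.norm_eq_abs, abs_of_pos Real.pi_pos, abs_of_pos hT]
    have := (HC (T * y)).1
    gcongr
    exact this.trans (by gcongr)
  calc _ ≤ bracket y ^ b * (2 * π * T * (C * (T ^ (-4 : ℝ) * bracket y ^ (-4 : ℝ)))) := by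
        gcongr
    _ = 2 * π * T * (C * T ^ (-4 : ℝ)) * bracket y ^ (b + -4) := by
        rw [Real.rpow_add hy]; ring
    _ ≤ _ := by
        gcongr
        · exact one_le_bracket y
        · linarith

/-- The norm in the Bourgain space of a realised function with a cutoff is bounded by the norm of
the density. -/
theorem exists_bourgainNorm_le {η : ℝ → ℝ} {ψ : ℝ → ℂ} (hψ : IsCutoffTransform η ψ)
    (hη : Integrable η) (hη2 : ∀ t, 2 < |t| → η t = 0) {b : ℝ} (hb : 1 / 2 < b) (hb' : b < 5 / 8)
    {T : ℝ} (hT : 0 < T) (hT1 : T ≤ 1) :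
    ∃ C : ℝ, 0 ≤ C ∧ ∀ (h : ℝ) (hh : 0 < h) (s : ℝ) (hs : 0 ≤ s) (σ : ℝ) (A : Density h),
      IsRealOn hs hb T A →
      bourgainNorm h σ s b
        (fun t n => η (t / T) * phaseFlow hh σ 1 t (slice hh hs hb A t) n) ≤
          ENNReal.ofReal (C * ‖A‖) := by
  obtain ⟨c, hc, Hc⟩ := exists_cutoff_kernel_bound hψ (by linarith : b ≤ 1) hT hT1
  set K := 2 ^ b * c * bracketMass 2 with hK
  have hK0 : 0 ≤ K := by have := bracketMass_nonneg 2; positivity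
  refine ⟨K, hK0, fun h hh s hs σ A hA => ?_⟩
  set φ := phase h σ 1 with hφ
  have hφm : Measurable φ := measurable_phase h σ 1
  have hWi := integrable_invWeight_mul (s := s) (b := b) hs hb (Lp.memLp A)
  have hAm : Measurable (A : ℝ × ℝ → ℂ) := (Lp.stronglyMeasurable A).measurable
  -- the space-time transform
  have hFT : ∀ τ₀ : ℝ, spaceTimeFT h
      (fun t n => η (t / T) * phaseFlow hh σ 1 t (slice hh hs hb A t) n) τ₀
        =ᵐ[volume.restrict (freqDomain h)]
      profile (fun p => invWeight s b p * cutDensity ψ T φ A τ₀ p) 0 := fun τ₀ => by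
    have hD := memLp_cutDensity hψ (T := T) hφm (Lp.memLp A) τ₀
    refine IsDFT.dft_ae_eq hh ⟨memLp_profile hs hb hD 0, fun n => ?_⟩
    rw [← syn_zero_eq_invDFT hs hb hD, ← integral_cutoff_mul_syn hψ hη hs hb hT hφm (Lp.memLp A)]
    refine integral_congr_ae (Eventually.of_forall fun t => ?_)
    simp only
    rcases le_or_gt |t| (2 * T) with ht | ht
    · have e := flow_apply_of_syn (t := t) hh hφm (phase_neg h σ 1) hWi
        (fun n => ofReal_slice hh hs hb (hA t ht) n) n
      rw [← e, ← Complex.ofReal_mul]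
      rfl
    · have : η (t / T) = 0 := hη2 _ (by
        rw [abs_div, abs_of_pos hT]; exact (lt_div_iff₀ hT).2 ht)
      simp only [this, Complex.ofReal_zero, zero_mul]
  set k : ℝ → ℝ≥0∞ := fun y => ENNReal.ofReal (2 ^ b * c * bracket y ^ (-2 : ℝ)) with hk
  have hkm : Measurable k := by fun_prop
  have hkK : ∫⁻ y, k y = ENNReal.ofReal K := by
    simp only [hk]
    rw [hK, ENNReal.ofReal_mul (by positivity), ← lintegral_bracket_rpow (by norm_num : (1 : ℝ) < 2),
      ← lintegral_const_mul' _ _ ENNReal.ofReal_ne_top]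
    refine lintegral_congr fun y => ?_
    rw [← ENNReal.ofReal_mul (by positivity)]
  have hpt : ∀ τ₀ ξ : ℝ, ENNReal.ofReal (bracket ξ ^ (2 * s) *
      bracket (τ₀ - σ * dispersion h ξ) ^ (2 * b) *
      ‖profile (fun p => invWeight s b p * cutDensity ψ T φ A τ₀ p) 0 ξ‖ ^ 2) ≤
      ENNReal.ofReal K * ∫⁻ τ, ‖A (ξ, τ)‖ₑ ^ 2 * k (τ₀ - φ ξ - τ) := fun τ₀ ξ => by
    rw [← phase_one hh, ← hφ]
    set x := τ₀ - φ ξ with hx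
    have hξ := bracket_pos ξ
    have hxp := bracket_pos x
    have hle := enorm_profile_le (s := s) (b := b) (cutDensity ψ T φ A τ₀) 0 ξ
    have e1 : ENNReal.ofReal (bracket ξ ^ (2 * s) * bracket x ^ (2 * b) *
        ‖profile (fun p => invWeight s b p * cutDensity ψ T φ A τ₀ p) 0 ξ‖ ^ 2) =
        (ENNReal.ofReal (bracket ξ ^ s) * ENNReal.ofReal (bracket x ^ b) *
          ‖profile (fun p => invWeight s b p * cutDensity ψ T φ A τ₀ p) 0 ξ‖ₑ) ^ 2 := by
      rw [← ofReal_norm, ← ENNReal.ofReal_mul (by positivity), ← ENNReal.ofReal_mul (by positivity),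
        ← ENNReal.ofReal_pow (by positivity), bracket_rpow_two_mul, bracket_rpow_two_mul]
      congr 1; ring
    have e2 : ENNReal.ofReal (bracket ξ ^ s) * ENNReal.ofReal (bracket ξ ^ (-s)) = 1 := by
      rw [← ENNReal.ofReal_mul (by positivity), ← Real.rpow_add hξ, add_neg_cancel, Real.rpow_zero,
        ENNReal.ofReal_one]
    have e3 : ENNReal.ofReal (bracket ξ ^ s) * ENNReal.ofReal (bracket x ^ b) *
          ‖profile (fun p => invWeight s b p * cutDensity ψ T φ A τ₀ p) 0 ξ‖ₑ ≤
        ∫⁻ τ, ‖A (ξ, τ)‖ₑ * k (x - τ) := by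
      calc _ ≤ ENNReal.ofReal (bracket ξ ^ s) * ENNReal.ofReal (bracket x ^ b) *
            (ENNReal.ofReal (bracket ξ ^ (-s)) * ∫⁻ τ, ENNReal.ofReal (bracket τ ^ (-b)) *
              ‖cutDensity ψ T φ A τ₀ (ξ, τ)‖ₑ) := by gcongr
        _ = (ENNReal.ofReal (bracket ξ ^ s) * ENNReal.ofReal (bracket ξ ^ (-s))) *
            (ENNReal.ofReal (bracket x ^ b) * ∫⁻ τ, ENNReal.ofReal (bracket τ ^ (-b)) *
              ‖cutDensity ψ T φ A τ₀ (ξ, τ)‖ₑ) := by ring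
        _ = ∫⁻ τ, ENNReal.ofReal (bracket x ^ b) * (ENNReal.ofReal (bracket τ ^ (-b)) *
              ‖cutDensity ψ T φ A τ₀ (ξ, τ)‖ₑ) := by
            rw [e2, one_mul, lintegral_const_mul' _ _ ENNReal.ofReal_ne_top]
        _ ≤ _ := by
            refine lintegral_mono fun τ => ?_
            have hτ := bracket_pos τ
            have hz : |x| ≤ |x - τ| + |τ| := by
              have := abs_add_le (x - τ) τ
              rwa [sub_add_cancel] at this
            have h1 := bracket_rpow_le_mul (by linarith : 0 ≤ b) hz
            have h2 := Hc (x - τ)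
            rw [cutDensity, enorm_mul, ← ofReal_norm (2 * π * T * ψ _ : ℂ), ← mul_assoc, ← mul_assoc,
              ← ENNReal.ofReal_mul (by positivity), ← ENNReal.ofReal_mul (by positivity), mul_comm]
            gcongr
            refine ENNReal.ofReal_le_ofReal ?_
            rw [show T * (τ₀ - φ (ξ, τ).1 - (ξ, τ).2) = T * (x - τ) from rfl]
            calc bracket x ^ b * bracket τ ^ (-b) * ‖2 * π * T * ψ (T * (x - τ))‖
                ≤ 2 ^ b * (bracket (x - τ) ^ b * bracket τ ^ b) * bracket τ ^ (-b) *
                  ‖2 * π * T * ψ (T * (x - τ))‖ := by gcongr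
              _ = 2 ^ b * (bracket (x - τ) ^ b * ‖2 * π * T * ψ (T * (x - τ))‖) *
                  (bracket τ ^ b * bracket τ ^ (-b)) := by ring
              _ = 2 ^ b * (bracket (x - τ) ^ b * ‖2 * π * T * ψ (T * (x - τ))‖) := by
                  rw [← Real.rpow_add hτ, add_neg_cancel, Real.rpow_zero, mul_one]
              _ ≤ 2 ^ b * (c * bracket (x - τ) ^ (-2 : ℝ)) := by gcongr
              _ = _ := by ring
    have hk' : ∫⁻ τ, k (x - τ) = ENNReal.ofReal K := by
      rw [← hkK]; exact lintegral_sub_left_eq_self k x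
    rw [e1]
    calc _ ≤ (∫⁻ τ, ‖A (ξ, τ)‖ₑ * k (x - τ)) ^ 2 := by gcongr
      _ ≤ (∫⁻ τ, ‖A (ξ, τ)‖ₑ ^ 2 * k (x - τ)) * ∫⁻ τ, k (x - τ) :=
          sq_lintegral_mul_le_weighted (by fun_prop) (by fun_prop)
      _ = _ := by rw [hk', mul_comm]
  have hmeas : Measurable (fun q : ℝ × (ℝ × ℝ) => ‖A q.2‖ₑ ^ 2 * k (q.1 - φ q.2.1 - q.2.2)) := by
    fun_prop
  have hsq : ∫⁻ τ₀ : ℝ, ∫⁻ ξ in freqDomain h,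
      ENNReal.ofReal (bracket ξ ^ (2 * s) * bracket (τ₀ - σ * dispersion h ξ) ^ (2 * b) *
        ‖spaceTimeFT h (fun t n => η (t / T) * phaseFlow hh σ 1 t (slice hh hs hb A t) n) τ₀ ξ‖ ^ 2)
      ≤ ENNReal.ofReal ((K * ‖A‖) ^ 2) := by
    calc _ ≤ ∫⁻ τ₀ : ℝ, ∫⁻ ξ in freqDomain h, ENNReal.ofReal K *
          ∫⁻ τ, ‖A (ξ, τ)‖ₑ ^ 2 * k (τ₀ - φ ξ - τ) := by
          refine lintegral_mono fun τ₀ => lintegral_mono_ae ((hFT τ₀).mono fun ξ hξ => ?_)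
          rw [hξ]
          exact hpt τ₀ ξ
      _ = ∫⁻ τ₀ : ℝ, ENNReal.ofReal K *
          (∫⁻ p, ‖A p‖ₑ ^ 2 * k (τ₀ - φ p.1 - p.2) ∂specMeasure h) := by
          refine lintegral_congr fun τ₀ => ?_
          rw [lintegral_const_mul' _ _ ENNReal.ofReal_ne_top]
          exact congrArg _ (lintegral_prod _
            (hmeas.comp (measurable_const.prodMk measurable_id)).aemeasurable).symm
      _ = ENNReal.ofReal K * (∫⁻ p, (∫⁻ τ₀ : ℝ, ‖A p‖ₑ ^ 2 * k (τ₀ - φ p.1 - p.2))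
          ∂specMeasure h) := by
          rw [lintegral_const_mul' _ _ ENNReal.ofReal_ne_top,
            lintegral_lintegral_swap hmeas.aemeasurable]
      _ = ENNReal.ofReal K * (energy h A * ENNReal.ofReal K) := by
          congr 1
          rw [energy, ← lintegral_mul_const' _ _ ENNReal.ofReal_ne_top]
          refine lintegral_congr fun p => ?_
          rw [lintegral_const_mul _ (by fun_prop), ← hkK]
          congr 1
          simp only [sub_sub]
          exact lintegral_sub_right_eq_self k _
      _ = _ := by
          rw [energy_eq, ← ENNReal.ofReal_mul (by positivity), ← ENNReal.ofReal_mul hK0]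
          congr 1; ring
  calc _ ≤ (ENNReal.ofReal ((K * ‖A‖) ^ 2)) ^ (1 / 2 : ℝ) := by
        rw [bourgainNorm]; gcongr
    _ = _ := by
        rw [ENNReal.ofReal_rpow_of_nonneg (by positivity) (by norm_num), ← Real.sqrt_eq_rpow,
          Real.sqrt_sq (by positivity)]

/-! ### Solutions with a bound in the Bourgain norm -/

/-- A smooth function of compact support which is `1` on `[-2, 2]`. -/
theorem exists_cutoff :
    ∃ η : ℝ → ℝ, ContDiff ℝ ∞ η ∧ HasCompactSupport η ∧ ∀ t, |t| ≤ 2 → η t = 1 := by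
  let β : ContDiffBump (0 : ℝ) := ⟨2, 3, by norm_num, by norm_num⟩
  refine ⟨β, β.contDiff, β.hasCompactSupport, fun t ht => β.one_of_mem_closedBall ?_⟩
  rwa [mem_closedBall_zero_iff, Real.norm_eq_abs]

theorem sobolevNorm_zero {h : ℝ} (hh : 0 < h) (s : ℝ) : sobolevNorm h s (0 : LatticeL2) = 0 := by
  rw [sobolevNorm_eq hh, map_zero, norm_zero, mul_zero]

/-- Solutions of the pair of equations exist up to a time that depends only on the size of the
data, and their norms in the Bourgain space, after localisation in time, are bounded linearly by
the size of the data. -/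
theorem exists_pairSolution {b : ℝ} (hb : 1 / 2 < b) (hb' : b < 5 / 8) {s : ℝ}
    (hs : 0 ≤ s) {V : ℝ → ℝ} (hV : ContDiff ℝ 5 V)
    (hV1 : deriv V 0 = 0) (hV2 : iteratedDeriv 2 V 0 = 1) (hV3 : iteratedDeriv 3 V 0 = 1)
    (hsV : s ≤ 1 ∨ ∀ r, V r = r ^ 2 / 2 + r ^ 3 / 6) {R : ℝ} (hR : 0 ≤ R) :
    ∃ T : ℝ, 0 < T ∧
      ∀ θ : ℝ → ℝ, ContDiff ℝ ∞ θ → (∀ t, 2 < |t| → θ t = 0) →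
      ∃ C : ℝ, 0 < C ∧
      ∀ (h : ℝ) (hh : 0 < h), h ≤ 1 → ∀ κ : ℝ, |κ| ≤ 1 → ∀ (f : Bool → LatticeL2) (ρ : ℝ),
      ρ ≤ R → (∀ j, sobolevNorm h s (f j) ≤ ρ) →
      ∃ u : Bool → ℝ → LatticeL2,
        IsPairSolution hh (isLocLip_remainder hV hV1 hV2 hV3 hh) κ (2 * T) f u ∧
        ∀ j, bourgainNorm h (sgn j) s b (fun t n => θ (t / T) * u j t n) ≤
          ENNReal.ofReal (C * ρ) := by
  obtain ⟨η, hη, hc, hη1⟩ := exists_cutoff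
  obtain ⟨ψ, hψ⟩ := exists_isCutoffTransform hη hc
  obtain ⟨C₀, hC₀, H⟩ := exists_density_solution hψ hη1 hb hb' hs hV hV1 hV2 hV3 hsV
  obtain ⟨T, hT, hT1, HT⟩ := H (C₀ * R) (by positivity)
  refine ⟨T, hT, fun θ hθ hθ2 => ?_⟩
  have hθc : HasCompactSupport θ :=
    HasCompactSupport.intro (isCompact_closedBall (0 : ℝ) 2) fun t ht => hθ2 t (by
      rwa [mem_closedBall_zero_iff, Real.norm_eq_abs, not_le] at ht)
  obtain ⟨χ, hχ⟩ := exists_isCutoffTransform hθ hθc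
  obtain ⟨C, hC, HC⟩ := exists_bourgainNorm_le hχ
    (hθ.continuous.integrable_of_hasCompactSupport hθc) hθ2 hb hb' hT hT1
  refine ⟨C * C₀ + 1, by positivity, fun h hh h1 κ hκ f ρ hρ hf => ?_⟩
  have hρ0 : 0 ≤ ρ := (sobolevNorm_nonneg h s (f true)).trans (hf true)
  obtain ⟨W, hW, HW⟩ := HT h hh h1 κ hκ f (C₀ * ρ) (by gcongr) fun j => by
    gcongr; exact hf j
  refine ⟨_, isPairSolution_of_realise HW, fun j => ?_⟩
  refine (HC h hh s hs (sgn j) (W j) fun t ht n => ?_).trans (ENNReal.ofReal_le_ofReal ?_)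
  · rw [HW j t ht n, Complex.ofReal_im]
  · have := (norm_le_pi_norm W j).trans hW
    nlinarith [mul_le_mul_of_nonneg_left this hC]

end FPU

end

theorem proposition6p3 (s : ℝ) (hs : 0 ≤ s) (b : ℝ) (hb : 1 / 2 < b) (hb' : b < 5 / 8)
    (V : ℝ → ℝ) (hV : ContDiff ℝ 5 V) (hV0 : V 0 = 0) (hV1 : deriv V 0 = 0)
    (hV2 : iteratedDeriv 2 V 0 = 1) (hV3 : iteratedDeriv 3 V 0 = 1)
    (hsV : s ≤ 1 ∨ ∀ r, V r = r ^ 2 / 2 + r ^ 3 / 6)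
    (R : ℝ) (hR : 0 < R) :
    ∃ T : ℝ, 0 < T ∧
      ∀ θ : ℝ → ℝ, ContDiff ℝ ∞ θ → (∀ t, 0 ≤ θ t) → (∀ t, 2 < |t| → θ t = 0) →
      ∃ C : ℝ, 0 < C ∧
      ∀ h : ℝ, 0 < h → h ≤ 1 → ∀ f₁ f₂ : FPU.LatticeL2,
        FPU.sobolevNorm h s f₁ + FPU.sobolevNorm h s f₂ ≤ R →
        -- the coupled system
        (∃ u₁ u₂ : ℝ → FPU.LatticeL2,
          FPU.IsCoupledSolution h V (2 * T) f₁ f₂ u₁ u₂ ∧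
          (∀ w₁ w₂ : ℝ → FPU.LatticeL2, FPU.IsCoupledSolution h V (2 * T) f₁ f₂ w₁ w₂ →
            ∀ t ∈ Icc (-(2 * T)) (2 * T), w₁ t = u₁ t ∧ w₂ t = u₂ t) ∧
          FPU.bourgainNorm h 1 s b (fun t n => θ (t / T) * u₁ t n) ≤
            ENNReal.ofReal (C * (FPU.sobolevNorm h s f₁ + FPU.sobolevNorm h s f₂)) ∧
          FPU.bourgainNorm h (-1) s b (fun t n => θ (t / T) * u₂ t n) ≤
            ENNReal.ofReal (C * (FPU.sobolevNorm h s f₁ + FPU.sobolevNorm h s f₂))) ∧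
        -- the decoupled system
        (∃ v₁ v₂ : ℝ → FPU.LatticeL2,
          FPU.IsDecoupledSolution h 1 (2 * T) f₁ v₁ ∧
          FPU.IsDecoupledSolution h (-1) (2 * T) f₂ v₂ ∧
          (∀ w₁ w₂ : ℝ → FPU.LatticeL2, FPU.IsDecoupledSolution h 1 (2 * T) f₁ w₁ →
            FPU.IsDecoupledSolution h (-1) (2 * T) f₂ w₂ →
            ∀ t ∈ Icc (-(2 * T)) (2 * T), w₁ t = v₁ t ∧ w₂ t = v₂ t) ∧
          FPU.bourgainNorm h 1 s b (fun t n => θ (t / T) * v₁ t n) ≤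
            ENNReal.ofReal (C * FPU.sobolevNorm h s f₁) ∧
          FPU.bourgainNorm h (-1) s b (fun t n => θ (t / T) * v₂ t n) ≤
            ENNReal.ofReal (C * FPU.sobolevNorm h s f₂)) := by
  obtain ⟨T, hT, H⟩ := FPU.exists_pairSolution hb hb' hs hV hV1 hV2 hV3 hsV hR.le
  refine ⟨T, hT, fun θ hθ _ hθ2 => ?_⟩
  obtain ⟨C, hC, HC⟩ := H θ hθ hθ2
  refine ⟨C, hC, fun h hh h1 f₁ f₂ hf => ?_⟩
  have n₁ := FPU.sobolevNorm_nonneg h s f₁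
  have n₂ := FPU.sobolevNorm_nonneg h s f₂
  have hF := FPU.isLocLip_remainder hV hV1 hV2 hV3 hh
  have hτ : 0 < 2 * T := by positivity
  have k1 : |(1 : ℝ)| ≤ 1 := by norm_num
  have k0 : |(0 : ℝ)| ≤ 1 := by norm_num
  let pair : ∀ {α : Type}, α → α → Bool → α := fun x y j => cond j x y
  constructor
  · obtain ⟨u, hu, hub⟩ := HC h hh h1 1 k1 (pair f₁ f₂) _ hf (Bool.forall_bool.2
      ⟨by simpa [pair] using n₁, by simpa [pair] using n₂⟩)
    refine ⟨u true, u false, (FPU.isCoupledSolution_iff hh hF (f := pair f₁ f₂) (u := u)).2 hu, fun w₁ w₂ hw t ht => ?_,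
      ?_, ?_⟩
    rotate_left
    · simpa [FPU.sgn] using hub true
    · simpa [FPU.sgn] using hub false
    have hw' : FPU.IsPairSolution hh hF 1 (2 * T) (pair f₁ f₂) (pair w₁ w₂) :=
      (FPU.isCoupledSolution_iff hh hF (f := pair f₁ f₂) (u := pair w₁ w₂)).1 hw
    exact ⟨hw'.unique k1 hτ hu ht true, hw'.unique k1 hτ hu ht false⟩
  · -- For `κ = 0` the two equations do not interact: each is solved with zero as the other datum.
    have z := FPU.sobolevNorm_zero hh s
    obtain ⟨u, hu, hub⟩ := HC h hh h1 0 k0 (pair f₁ 0) (FPU.sobolevNorm h s f₁) (by linarith)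
      (Bool.forall_bool.2 ⟨z.trans_le n₁, le_rfl⟩)
    obtain ⟨v, hv, hvb⟩ := HC h hh h1 0 k0 (pair 0 f₂) (FPU.sobolevNorm h s f₂) (by linarith)
      (Bool.forall_bool.2 ⟨le_rfl, z.trans_le n₂⟩)
    have hu₁ : FPU.IsDecoupledSolution h 1 (2 * T) f₁ (u true) :=
      by
      simpa [FPU.sgn, pair] using (FPU.isDecoupledSolution_iff hh hF).2 hu true
    have hv₂ : FPU.IsDecoupledSolution h (-1) (2 * T) f₂ (v false) :=
      by
      simpa [FPU.sgn, pair] using (FPU.isDecoupledSolution_iff hh hF).2 hv false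
    have hsol : ∀ w₁ w₂ : ℝ → FPU.LatticeL2, FPU.IsDecoupledSolution h 1 (2 * T) f₁ w₁ →
        FPU.IsDecoupledSolution h (-1) (2 * T) f₂ w₂ →
        FPU.IsPairSolution hh hF 0 (2 * T) (pair f₁ f₂) (pair w₁ w₂) := fun w₁ w₂ hw₁ hw₂ =>
      (FPU.isDecoupledSolution_iff hh hF).1 (Bool.forall_bool.2 ⟨by
        simpa [FPU.sgn, pair] using hw₂, by simpa [FPU.sgn, pair] using hw₁⟩)
    refine ⟨u true, v false, hu₁, hv₂, fun w₁ w₂ hw₁ hw₂ t ht => ?_, ?_, ?_⟩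
    rotate_left
    · simpa [FPU.sgn] using hub true
    · simpa [FPU.sgn] using hvb false
    exact ⟨(hsol _ _ hw₁ hw₂).unique k0 hτ (hsol _ _ hu₁ hv₂) ht true,
      (hsol _ _ hw₁ hw₂).unique k0 hτ (hsol _ _ hu₁ hv₂) ht false⟩
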